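/- Let $n\ge 0$, let $V$ be a complex vector space of dimension $2n$ with a symplectic (alternating, nondegenerate bilinear) form, and let $\mathbb{LG}_n$ be the Lagrangian Grassmannian of maximal isotropic (i.e. isotropic $n$-dimensional) subspaces $W\subset V$, a closed subvariety of the Grassmannian of $n$-dimensional subspaces of $V$ (a point if $n=0$). Let $Q_n$ be the tautological quotient bundle of rank $n$ on $\mathbb{LG}_n$, with fibre $V/W$ at $W$, and let $\mathcal O(-1)$ be the dual of the line bundle $\mathcal O(1)=\det Q_n$. For integers $1\le j\le n$ and $i\ge 0$ put $$\mathcal L^{n,j}_i=\begin{cases}\wedge^i Q_n^* & \text{if } i<j,\\ \mathcal O(-1) & \text{if } i=j,\\ 0 & \text{if } i>j.\end{cases}$$ Let $\mathcal F$ be a coherent sheaf on $\mathbb{LG}_n$. Suppose that for all integers $i_1,\dots,i_n\ge 0$ and $q\ge 0$ such that either $q\ge i_1+\cdots+i_n>0$ or $q>i_1+\cdots+i_n=0$ one has $$H^q(\mathbb{LG}_n,\mathcal L^{n,1}_{i_1}\otimes\cdots\otimes\mathcal L^{n,n}_{i_n}\otimes\mathcal F)=0.$$ Then $\mathcal F$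 is generated by its global sections. -/

import Mathlib

open CategoryTheory TopologicalSpace Opposite
open scoped ZeroObject

universe u

noncomputable section

/-- The Lagrangian Grassmannian `LG_n` of a symplectic form `ω` on a vector space `V` of dimension
`2n`: its points are the maximal isotropic subspaces of `V`, i.e. the isotropic subspaces of
dimension `n`. -/
def LagGrass {V : Type u} [AddCommGroup V] [Module ℂ V] (ω : LinearMap.BilinForm ℂ V) (n : ℕ) :
    Type u :=
  {W : Submodule ℂ V // (∀ v ∈ W, ∀ w ∈ W, ω v w = 0) ∧ Module.finrank ℂ W = n}

namespace LagGrass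

variable {V : Type u} [AddCommGroup V] [Module ℂ V] {ω : LinearMap.BilinForm ℂ V} {n : ℕ}

/-- Homogeneous coordinates on `ℙ(⋀ⁿ V)` are the linear forms on `⋀ⁿ V`; a polynomial `P` in them
is evaluated at the Plücker vector `b₁ ∧ ⋯ ∧ bₙ` of a basis `b` of the subspace `W`. -/
def pluckerEval (W : LagGrass ω n) (b : Module.Basis (Fin n) ℂ W.1)
    (P : MvPolynomial (Module.Dual ℂ (⋀[ℂ]^n V)) ℂ) : ℂ :=
  MvPolynomial.eval (fun l => l (exteriorPower.ιMulti ℂ n (fun k => (b k : V)))) P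

/-- The locus in `LG_n` where a homogeneous polynomial `P` in the Plücker coordinates does not
vanish. -/
def nonvanishing (P : MvPolynomial (Module.Dual ℂ (⋀[ℂ]^n V)) ℂ) : Set (LagGrass ω n) :=
  {W | ∀ b : Module.Basis (Fin n) ℂ W.1, pluckerEval W b P ≠ 0}

/-- The Zariski topology on `LG_n`, embedded in `ℙ(⋀ⁿ V)` by the Plücker embedding. -/
instance zariski : TopologicalSpace (LagGrass ω n) :=
  TopologicalSpace.generateFrom
    {S | ∃ (d : ℕ) (P : MvPolynomial (Module.Dual ℂ (⋀[ℂ]^n V)) ℂ),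
      P.IsHomogeneous d ∧ S = nonvanishing P}

variable (ω n) in
/-- `LG_n` as a topological space, with the Zariski topology. -/
abbrev space : TopCat.{u} := TopCat.of (LagGrass ω n)

variable (ω n) in
/-- Functions that are a quotient of two homogeneous polynomials of the same degree in the Plücker
coordinates, with nowhere vanishing denominator. -/
def fractionPrelocal : TopCat.PrelocalPredicate (fun _ : space ω n => ℂ) where
  pred {U} f := ∃ (d : ℕ) (P Q : MvPolynomial (Module.Dual ℂ (⋀[ℂ]^n V)) ℂ),
    P.IsHomogeneous d ∧ Q.IsHomogeneous d ∧
      ∀ (x : U) (b : Module.Basis (Fin n) ℂ (x : LagGrass ω n).1),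
        pluckerEval (x : LagGrass ω n) b Q ≠ 0 ∧
          f x = pluckerEval (x : LagGrass ω n) b P / pluckerEval (x : LagGrass ω n) b Q
  res := by
    rintro U V i f ⟨d, P, Q, hP, hQ, h⟩
    exact ⟨d, P, Q, hP, hQ, fun x b => h ⟨x.1, i.le x.2⟩ b⟩

variable (ω n) in
/-- Regular functions: those that are locally such quotients. -/
def regular : TopCat.LocalPredicate (fun _ : space ω n => ℂ) := (fractionPrelocal ω n).sheafify

lemma regular_const (U : Opens (space ω n)) (c : ℂ) :
    (regular ω n).pred (fun _ : U => c) :=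
  TopCat.PrelocalPredicate.sheafifyOf
    ⟨0, MvPolynomial.C c, 1, MvPolynomial.isHomogeneous_C _ _, MvPolynomial.isHomogeneous_one _ _,
      fun x b => by simp [pluckerEval]⟩

lemma regular_add {U : Opens (space ω n)} {f g : U → ℂ}
    (hf : (regular ω n).pred f) (hg : (regular ω n).pred g) :
    (regular ω n).pred (fun x => f x + g x) := by
  refine TopCat.PrelocalPredicate.sheafify_inductionOn₂' _ _ (fractionPrelocal ω n)
    (fun {_} a b => a + b) ?_ hf hg
  rintro U V a b ⟨d, P, Q, hP, hQ, h⟩ ⟨e, R, S, hR, hS, k⟩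
  refine ⟨d + e, P * S + Q * R, Q * S, (hP.mul hS).add (hQ.mul hR), hQ.mul hS, fun x c => ?_⟩
  obtain ⟨h1, h2⟩ := h ⟨x, x.2.1⟩ c
  obtain ⟨k1, k2⟩ := k ⟨x, x.2.2⟩ c
  simp only [pluckerEval, map_mul, map_add] at *
  exact ⟨mul_ne_zero h1 k1, by rw [h2, k2, div_add_div _ _ h1 k1]⟩

lemma regular_mul {U : Opens (space ω n)} {f g : U → ℂ}
    (hf : (regular ω n).pred f) (hg : (regular ω n).pred g) :
    (regular ω n).pred (fun x => f x * g x) := by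
  refine TopCat.PrelocalPredicate.sheafify_inductionOn₂' _ _ (fractionPrelocal ω n)
    (fun {_} a b => a * b) ?_ hf hg
  rintro U V a b ⟨d, P, Q, hP, hQ, h⟩ ⟨e, R, S, hR, hS, k⟩
  refine ⟨d + e, P * R, Q * S, hP.mul hR, hQ.mul hS, fun x c => ?_⟩
  obtain ⟨h1, h2⟩ := h ⟨x, x.2.1⟩ c
  obtain ⟨k1, k2⟩ := k ⟨x, x.2.2⟩ c
  simp only [pluckerEval, map_mul] at *
  exact ⟨mul_ne_zero h1 k1, by rw [h2, k2, div_mul_div_comm]⟩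

lemma regular_neg {U : Opens (space ω n)} {f : U → ℂ} (hf : (regular ω n).pred f) :
    (regular ω n).pred (fun x => -f x) := by
  simpa using regular_mul (regular_const U (-1)) hf

/-- The ring of regular functions on an open subset `U` of `LG_n`. -/
def regularFunctions (U : Opens (space ω n)) : Subring (U → ℂ) where
  carrier := {f | (regular ω n).pred f}
  zero_mem' := regular_const U 0
  one_mem' := regular_const U 1
  add_mem' := regular_add
  mul_mem' := regular_mul
  neg_mem' := regular_neg

variable (ω n) in
/-- The presheaf of rings of regular functions. -/
def structurePresheaf : TopCat.Presheaf CommRingCat.{u} (space ω n) where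
  obj U := CommRingCat.of (regularFunctions U.unop)
  map {U V} i := CommRingCat.ofHom
    { toFun := fun f => ⟨fun x => f.1 ⟨x.1, i.unop.le x.2⟩, (regular ω n).res i.unop f.1 f.2⟩
      map_zero' := rfl
      map_one' := rfl
      map_add' := fun _ _ => rfl
      map_mul' := fun _ _ => rfl }

variable (ω n) in
/-- The structure sheaf of `LG_n`: the sheaf of regular functions. -/
def structureSheaf : TopCat.Sheaf CommRingCat.{u} (space ω n) :=
  ⟨structurePresheaf ω n, (TopCat.Presheaf.isSheaf_iff_isSheaf_comp (forget CommRingCat) _).mpr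
    (TopCat.Presheaf.isSheaf_of_iso
      (show (TopCat.subsheafToTypes (regular ω n)).1 ≅ structurePresheaf ω n ⋙ forget CommRingCat from
        NatIso.ofComponents (fun _ => Iso.refl _) (by intros; rfl))
      (TopCat.subsheafToTypes (regular ω n)).property)⟩

variable (ω n) in
/-- The structure sheaf, as a sheaf of rings. -/
def ringSheaf : Sheaf (Opens.grothendieckTopology (space ω n)) RingCat.{u} :=
  (sheafCompose _ (forget₂ CommRingCat.{u} RingCat.{u})).obj (structureSheaf ω n)

variable (ω n) in
/-- Sheaves of `𝒪`-modules on `LG_n`. -/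
abbrev Mod := SheafOfModules.{u} (ringSheaf ω n)

variable (ω n) in
/-- The fibre of the tautological quotient bundle `Q_n` at `W` is `V ⧸ W`. This is the local
predicate that defines regular sections of the vector bundle `⋀^p Q_n^*`, whose fibre at `W` is the
space of alternating `p`-forms on `V ⧸ W`: a family of forms is regular if its values on the
constant sections of `Q_n` (the classes of vectors of `V`, which generate `Q_n`) are regular
functions. -/
def formPred (p : ℕ) :
    TopCat.LocalPredicate (fun W : space ω n => (V ⧸ W.1) [⋀^Fin p]→ₗ[ℂ] ℂ) where
  pred {U} η := ∀ v : Fin p → V, (regular ω n).pred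
    (fun x : U => η x (fun k => (Submodule.Quotient.mk (v k) : V ⧸ (x : LagGrass ω n).1)))
  res {U U'} i η h v := (regular ω n).res i _ (h v)
  locality {U} η h v := (regular ω n).locality _ fun x => by
    obtain ⟨U', hx, i, h'⟩ := h x
    exact ⟨U', hx, i, h' v⟩

lemma formPred_zero (p : ℕ) (U : Opens (space ω n)) :
    (formPred ω n p).pred (fun _ : U => 0) := fun _ => regular_const U 0

/-- Regular `p`-forms on an open subset `U`, as a module over the regular functions on `U`. -/
def forms (p : ℕ) (U : Opens (space ω n)) :
    Submodule (regularFunctions U) (∀ x : U, (V ⧸ (x : LagGrass ω n).1) [⋀^Fin p]→ₗ[ℂ] ℂ) where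
  carrier := {η | (formPred ω n p).pred η}
  zero_mem' := formPred_zero p U
  add_mem' := fun h k v => regular_add (h v) (k v)
  smul_mem' := fun c _ h v => regular_mul c.2 (h v)

variable (ω n) in
/-- The abelian presheaf of regular `p`-forms. -/
def formPresheafAb (p : ℕ) : TopCat.Presheaf Ab.{u} (space ω n) where
  obj U := AddCommGrpCat.of (forms (ω := ω) (n := n) p U.unop)
  map {U U'} i := AddCommGrpCat.ofHom
    { toFun := fun η => ⟨fun x => η.1 ⟨x.1, i.unop.le x.2⟩, (formPred ω n p).res i.unop η.1 η.2⟩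
      map_zero' := rfl
      map_add' := fun _ _ => rfl }

instance formPresheafAbModule (p : ℕ) (U : (Opens (space ω n))ᵒᵖ) :
    Module ((ringSheaf ω n).obj.obj U) ((formPresheafAb ω n p).obj U) :=
  inferInstanceAs (Module (regularFunctions U.unop) (forms (ω := ω) (n := n) p U.unop))

variable (ω n) in
/-- The sheaf of `𝒪`-modules `⋀^p Q_n^*`. -/
def formSheaf (p : ℕ) : Mod ω n where
  val := PresheafOfModules.ofPresheaf (formPresheafAb ω n p) (fun _ _ _ _ _ => rfl)
  isSheaf := (TopCat.Presheaf.isSheaf_iff_isSheaf_comp (forget Ab) _).mpr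
    (TopCat.Presheaf.isSheaf_of_iso
      (show (TopCat.subsheafToTypes (formPred ω n p)).1 ≅ formPresheafAb ω n p ⋙ forget Ab from
        NatIso.ofComponents (fun _ => Iso.refl _) (by intros; rfl))
      (TopCat.subsheafToTypes (formPred ω n p)).property)

/-- The tensor product of two sheaves of `𝒪`-modules: the sheaf associated with the presheaf
`U ↦ M(U) ⊗ N(U)` over `𝒪(U)`. -/
def tensor (M N : Mod ω n) : Mod ω n :=
  (PresheafOfModules.sheafification (𝟙 (ringSheaf ω n).obj)).obj
    (PresheafOfModules.Monoidal.tensorObj (R := structurePresheaf ω n) M.val N.val)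

variable (ω n) in
/-- The line bundle `𝒪(-1)`, dual to `𝒪(1) = det Q_n`; that is, `𝒪(-1) = det Q_n^* = ⋀^n Q_n^*`. -/
def negOne : Mod ω n := formSheaf ω n n

variable (ω n) in
/-- The sheaves `ℒ_i^{n,j}`: `⋀^i Q_n^*` if `i < j`, `𝒪(-1)` if `i = j`, and `0` if `i > j`. -/
def calL (j i : ℕ) : Mod ω n :=
  if i < j then formSheaf ω n i else if i = j then negOne ω n else 0

/-- `ℒ_{i_1}^{n,1} ⊗ ⋯ ⊗ ℒ_{i_n}^{n,n} ⊗ F`; the index `k : Fin n` stands for `j = k + 1`. -/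
def twist (i : Fin n → ℕ) (F : Mod ω n) : Mod ω n :=
  (List.ofFn fun k : Fin n => calL ω n (k + 1) (i k)).foldr tensor F

/-- Sheaf cohomology `H^q(LG_n, F)`. -/
abbrev H (q : ℕ) (F : Mod ω n) : Type u :=
  Sheaf.H.{u} ((SheafOfModules.toSheaf (ringSheaf ω n)).obj F) q

/-- A sheaf of `𝒪`-modules is coherent if it is of finite type and, over every open subset `U`, the
kernel of every morphism `𝒪^m → F` is of finite type. -/
def IsCoherent (F : Mod ω n) : Prop :=
  F.IsFiniteType ∧ ∀ (U : Opens (space ω n)) (m : ℕ)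
    (φ : SheafOfModules.free (R := (ringSheaf ω n).over U) (ULift.{u} (Fin m)) ⟶ F.over U),
    (Limits.kernel φ).IsFiniteType

/-- A sheaf of `𝒪`-modules is generated by its global sections if some family of global sections
defines an epimorphism from a direct sum of copies of `𝒪`. -/
def IsGloballyGenerated (F : Mod ω n) : Prop := Nonempty F.GeneratingSections

end LagGrass

end

/-! Generation by global sections can be tested near one point at a time. Fix W in LG_n and a basis
w_1, …, w_n of W. The classes of the constant vectors w_i form a section of Q^n (`tautSec`) whose
zero set is the single point W (`tautSec_eq_zero_iff`). Contraction with it gives a Koszul complex ⋯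
→ ⋀²(Q^n)* ⊗ F → (Q^n)* ⊗ F → F that is exact off W. Its homology lives at a closed point and has no
higher cohomology. Hence, if H^q(⋀^p(Q^n)* ⊗ F) = 0 for q ≥ p ≥ 1, dimension shifting
(`subsingleton_H_of_exact_off`) kills H^1 of the image of the last map, and the global sections of F
map onto those of the cokernel, which is concentrated at W. The last map vanishes at W, so each
local generator agrees with a global section modulo functions vanishing at W, and Nakayama's lemma
concludes (`exists_generates_global`).

It remains to deduce these vanishings (`hcoh_qPow`) from the hypothesis. Let S be the tautological
subbundle. The sequence 0 → S^n → V^n → Q^n → 0 gives a resolution of ⋀^p(Q^n)* by the sheaves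
⋀^{p-m}(V^n)* ⊗ Sym^m(S^n)*. As V is trivial, two facts suffice: H^q(Sym^m(S^n)* ⊗ F) = 0 for q ≥ 1
(`hcoh_power`), and surjectivity on H^0 of the last map (V^n)* ⊗ Sym^m(S^n)* ⊗ F → Sym^{m+1}(S^n)* ⊗
F (`yS_surjective`).

The copies of S are removed one at a time. With k copies left one allows N = n - k additional
factors ⋀^b Q*: the j-th has either b < j, at cost b, or b = n, i.e. it is 𝒪(-1), at cost j; the
claim is vanishing of H^q for q ≥ max(1, total cost). For k = 0 this is the hypothesis. For the
step, the sequence 0 → S^{k+1} → S^k ⊕ V → Q → 0 resolves Sym^m(S^{k+1})* by ⋀^c Q* ⊗ Sym^{m-c}(S^k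
⊕ V)*. The trivial summand V can be dropped (`hcoh_of_decomposition`), and for c ≤ N or c = n the
sheaf ⋀^c Q* ⊗ Sym(S^k)* is covered by the induction with one more factor.

The degrees N < c < n are the heart of the proof (`pieri_vanishing`). The form ω identifies S* with
Q, so there are contractions X_i and multiplications Y_i on ⋀^• Q* ⊗ Sym^•(S^k)*, for 0 ≤ i < k,
lowering and raising both degrees by one, with X_i Y_j + Y_j X_i = δ_ij (n - c) + E_ij, where the
E_ij give an action of gl_k. All of them act on cohomology. If degree c + 1 has no cohomology, a
highest weight class u in degree c is killed by all Y_i. Its image under X_{k-1} ⋯ X_0 lies in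
degree c - k < n - k, where cohomology vanishes. Climbing back with the Y_j only multiplies by the
operators n - c + j + E_jj, which are invertible because E_jj has nonnegative eigenvalues; hence u =
0.

The bundles are handled as homogeneous ones. For a representation M of the stabilizer of W, a
section of the twist of F by M is a rule that assigns a vector of sections of F to each local
symplectic frame, i.e. to each regular family g with gW = x. Frames exist locally (`hasFrames`), so
exactness and tensor products (`tensor_tw`) reduce to linear algebra on the fibre at W. -/

noncomputable section
namespace LagGrass
variable {V : Type u} [AddCommGroup V] [Module ℂ V] {ω : LinearMap.BilinForm ℂ V} {n : ℕ}

/-! ### Sections and gluing for sheaves of modules -/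

/-- Sections of a sheaf of modules over an open subset. -/
def Sec (F : Mod ω n) (U : Opens (space ω n)) : Type u := F.val.obj (op U)

instance (F : Mod ω n) (U : Opens (space ω n)) : AddCommGroup (Sec F U) :=
  inferInstanceAs (AddCommGroup (F.val.obj (op U)))

instance (F : Mod ω n) (U : Opens (space ω n)) : Module (regularFunctions U) (Sec F U) :=
  inferInstanceAs (Module ((ringSheaf ω n).obj.obj (op U)) (F.val.obj (op U)))

/-- Restriction of regular functions. -/
def rres {U U' : Opens (space ω n)} (h : U' ≤ U) : regularFunctions U →+* regularFunctions U' :=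
  ((structurePresheaf ω n).map (homOfLE h).op).hom

namespace Sec
variable {F : Mod ω n}

/-- Restriction of sections. -/
def res {U U' : Opens (space ω n)} (h : U' ≤ U) : Sec F U →+ Sec F U' :=
  (((SheafOfModules.toSheaf (ringSheaf ω n)).obj F).obj.map (homOfLE h).op).hom

lemma res_smul {U U' : Opens (space ω n)} (h : U' ≤ U) (f : regularFunctions U) (s : Sec F U) :
    res h (f • s) = rres h f • res h s :=
  PresheafOfModules.map_smul F.val (homOfLE h).op f s

@[simp] lemma res_refl {U : Opens (space ω n)} (s : Sec F U) : res le_rfl s = s := by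
  have := ConcreteCategory.congr_hom
    (((SheafOfModules.toSheaf (ringSheaf ω n)).obj F).obj.map_id (op U)) s
  exact this

lemma res_res {U U' U'' : Opens (space ω n)} (h : U' ≤ U) (h' : U'' ≤ U') (s : Sec F U) :
    res h' (res h s) = res (h'.trans h) s := by
  have := ConcreteCategory.congr_hom
    (((SheafOfModules.toSheaf (ringSheaf ω n)).obj F).obj.map_comp (homOfLE h).op
      (homOfLE h').op) s
  exact this.symm

end Sec

/-- Sheaves of abelian groups on a topological space. -/
abbrev AbSheaf (X : TopCat.{u}) := Sheaf (Opens.grothendieckTopology X) AddCommGrpCat.{u}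

/-- The sheaf of abelian groups underlying a sheaf of modules. -/
abbrev ab (F : Mod ω n) : AbSheaf (space ω n) :=
  (SheafOfModules.toSheaf (ringSheaf ω n)).obj F

/-- A morphism of abelian sheaves from additive maps on sections. -/
def abHom {F G : Mod ω n} (f : ∀ U, Sec F U →+ Sec G U)
    (h : ∀ U U' (l : U' ≤ U) (s : Sec F U), f _ (Sec.res l s) = Sec.res l (f _ s)) : ab F ⟶ ab G :=
  ⟨{ app := fun U => AddCommGrpCat.ofHom (f U.unop)
     naturality := by
      intro U U' i
      ext s
      exact h U.unop U'.unop i.unop.le s }⟩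

namespace Sec
variable {F : Mod ω n}

lemma eq_of_cover {ι : Type*} {U : Opens (space ω n)} {W : ι → Opens (space ω n)}
    (hW : ∀ i, W i ≤ U) (hU : U ≤ iSup W) {s t : Sec F U}
    (h : ∀ i, res (hW i) s = res (hW i) t) : s = t :=
  TopCat.Sheaf.eq_of_locally_eq' (ab F) W U (fun i => homOfLE (hW i)) hU s t h

lemma exists_glue {ι : Type*} {U : Opens (space ω n)} {W : ι → Opens (space ω n)}
    (hW : ∀ i, W i ≤ U) (hU : U ≤ iSup W) (s : ∀ i, Sec F (W i))
    (h : ∀ i j, res (inf_le_left : W i ⊓ W j ≤ W i) (s i) =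
      res (inf_le_right : W i ⊓ W j ≤ W j) (s j)) : ∃ t : Sec F U, ∀ i, res (hW i) t = s i := by
  obtain ⟨t, ht, -⟩ := TopCat.Sheaf.existsUnique_gluing' (C := AddCommGrpCat.{u}) (ab F) W U
    (fun i => homOfLE (hW i)) hU s (fun i j => h i j)
  exact ⟨t, ht⟩

end Sec

/-! ### Exact sequences of abelian sheaves and their cohomology -/

section Exact
variable {X : TopCat.{u}}

lemma Sheaf.hom_ext_apply {A B : AbSheaf X} {f g : A ⟶ B}
    (h : ∀ (U : Opens X) (s : A.obj.obj (op U)), f.hom.app (op U) s = g.hom.app (op U) s) :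
    f = g := by
  apply Sheaf.hom_ext
  ext U s
  exact h U.unop s

/-- Injectivity over every open set makes the chosen preimages unique, hence additive and compatible
with restriction. -/
lemma Sheaf.exists_lift {A B Z : AbSheaf X} (f : A ⟶ B) (t : Z ⟶ B)
    (hf : ∀ U : Opens X, Function.Injective (f.hom.app (op U)))
    (h : ∀ (U : Opens X) (z : Z.obj.obj (op U)), ∃ a, f.hom.app (op U) a = t.hom.app (op U) z) :
    ∃ l : Z ⟶ A, l ≫ f = t := by
  choose l hl using h
  refine ⟨⟨{ app := fun U => AddCommGrpCat.ofHom
                { toFun := l U.unop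
                  map_zero' := hf _ (by rw [hl]; simp)
                  map_add' := fun a b => hf _ (by rw [hl, map_add, map_add, hl, hl]) }
             naturality := ?_ }⟩, Sheaf.hom_ext_apply fun U s => hl U s⟩
  intro U U' i
  ext z
  apply hf U'.unop
  refine (hl U'.unop (Z.obj.map i z)).trans ?_
  have h1 := ConcreteCategory.congr_hom (t.hom.naturality i) z
  have h2 := ConcreteCategory.congr_hom (f.hom.naturality i) (l U.unop z)
  refine h1.trans ?_
  refine Eq.trans ?_ h2.symm
  exact congrArg (fun y => B.obj.map i y) (hl U.unop z).symm

lemma Sheaf.epi_of_locally {A B : AbSheaf X} (g : A ⟶ B)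
    (hg : ∀ (U : Opens X) (t : B.obj.obj (op U)) (x : X), x ∈ U → ∃ (W : Opens X) (h : W ≤ U),
      x ∈ W ∧ ∃ s, g.hom.app (op W) s = B.obj.map (homOfLE h).op t) : Epi g := by
  refine (TopCat.Sheaf.isLocallySurjective_iff_epi (X := X) g).1 ?_
  rw [TopCat.Presheaf.isLocallySurjective_iff]
  intro U t x hx
  obtain ⟨W, h, hxW, s, hs⟩ := hg U t x hx
  exact ⟨W, h, ⟨s, hs⟩, hxW⟩

lemma Sheaf.locally_of_epi {A B : AbSheaf X} (g : A ⟶ B) [hg : Epi g]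
    (U : Opens X) (t : B.obj.obj (op U)) (x : X) (hx : x ∈ U) : ∃ (W : Opens X) (h : W ≤ U),
      x ∈ W ∧ ∃ s, g.hom.app (op W) s = B.obj.map (homOfLE h).op t := by
  have h' := (TopCat.Sheaf.isLocallySurjective_iff_epi (X := X) g).2 hg
  rw [TopCat.Presheaf.isLocallySurjective_iff] at h'
  obtain ⟨W, h, ⟨s, hs⟩, hxW⟩ := h' U t x hx
  exact ⟨W, h, hxW, s, hs⟩

lemma Sheaf.mono_of_sections {A B : AbSheaf X} (f : A ⟶ B)
    (hf : ∀ U : Opens X, Function.Injective (f.hom.app (op U))) : Mono f := by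
  constructor
  intro Z a b hab
  refine Sheaf.hom_ext_apply fun U z => hf U ?_
  exact congrArg (fun c : Z ⟶ B => c.hom.app (op U) z) hab

/-- Taking sections is left exact; apply this to 0 → A → B. -/
lemma Sheaf.injective_of_mono {A B : AbSheaf X} (f : A ⟶ B) [hm : Mono f]
    (U : Opens X) : Function.Injective (f.hom.app (op U)) := by
  rw [injective_iff_map_eq_zero]
  intro s hs
  let S : ShortComplex (AbSheaf X) :=
    ⟨(0 : (0 : AbSheaf X) ⟶ A), f, by simp⟩
  have hS : S.Exact := by
    rw [ShortComplex.exact_iff_mono _ rfl]; exact hm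
  obtain ⟨t, ht⟩ := TopCat.Sheaf.sections_exact_of_left_exact (U := U) hS
    (inferInstanceAs (Mono (0 : (0 : AbSheaf X) ⟶ A))) s hs
  rw [← ht]
  rfl

/-- Exactness on the left is asked over every open set, surjectivity only locally. Twists satisfy
both conditions as soon as local frames exist. -/
lemma shortExact_of_sections (S : ShortComplex (AbSheaf X))
    (hf : ∀ U : Opens X, Function.Injective (S.f.hom.app (op U)))
    (hfg : ∀ (U : Opens X) (s : S.X₂.obj.obj (op U)), S.g.hom.app (op U) s = 0 →
      ∃ t, S.f.hom.app (op U) t = s)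
    (hg : ∀ (U : Opens X) (t : S.X₃.obj.obj (op U)) (x : X), x ∈ U → ∃ (W : Opens X) (h : W ≤ U),
      x ∈ W ∧ ∃ s, S.g.hom.app (op W) s = S.X₃.obj.map (homOfLE h).op t) : S.ShortExact := by
  have : Epi S.g := Sheaf.epi_of_locally _ hg
  have : Mono S.f := Sheaf.mono_of_sections _ hf
  refine { exact := S.exact_of_f_is_kernel (Limits.KernelFork.IsLimit.ofι' _ _ fun {Z} t ht => ?_) }
  have := Sheaf.exists_lift S.f t hf fun U z =>
    hfg U _ (congrArg (fun c : Z ⟶ S.X₃ => c.hom.app (op U) z) ht)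
  exact ⟨this.choose, this.choose_spec⟩

variable {S : ShortComplex (AbSheaf X)}

open Abelian

lemma H_middle (hS : S.ShortExact) (q : ℕ) (h₁ : Subsingleton (Sheaf.H.{u} S.X₁ q))
    (h₃ : Subsingleton (Sheaf.H.{u} S.X₃ q)) : Subsingleton (Sheaf.H.{u} S.X₂ q) := by
  refine subsingleton_of_forall_eq 0 fun x => ?_
  obtain ⟨y, rfl⟩ := Ext.covariant_sequence_exact₂ _ hS x (Subsingleton.elim _ _)
  rw [Subsingleton.elim y 0, Ext.zero_comp]

/-- If every class of the quotient lifts in degree q, the connecting map into degree q + 1 is zero.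
This form is needed when H^0 of the quotient does not vanish. -/
lemma H_left_of_surjective (hS : S.ShortExact) (q : ℕ)
    (hg : Function.Surjective (Sheaf.H.map.{u} S.g q))
    (h₂ : Subsingleton (Sheaf.H.{u} S.X₂ (q + 1))) : Subsingleton (Sheaf.H.{u} S.X₁ (q + 1)) := by
  refine subsingleton_of_forall_eq 0 fun x => ?_
  obtain ⟨y, rfl⟩ := Ext.covariant_sequence_exact₁ _ hS x (Subsingleton.elim _ _) rfl
  obtain ⟨z, rfl⟩ := hg y
  rw [Sheaf.H.map_apply, Ext.comp_assoc_of_second_deg_zero, hS.comp_extClass, Ext.comp_zero]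

lemma H_left (hS : S.ShortExact) (q : ℕ) (h₃ : Subsingleton (Sheaf.H.{u} S.X₃ q))
    (h₂ : Subsingleton (Sheaf.H.{u} S.X₂ (q + 1))) : Subsingleton (Sheaf.H.{u} S.X₁ (q + 1)) :=
  H_left_of_surjective hS q (fun _ => ⟨0, Subsingleton.elim _ _⟩) h₂

lemma H_surjective (hS : S.ShortExact) (q : ℕ) (h₁ : Subsingleton (Sheaf.H.{u} S.X₁ (q + 1))) :
    Function.Surjective (Sheaf.H.map.{u} S.g q) := fun x =>
  Ext.covariant_sequence_exact₃ _ hS x rfl (Subsingleton.elim _ _)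

lemma H_right (hS : S.ShortExact) (q : ℕ) (h₂ : Subsingleton (Sheaf.H.{u} S.X₂ q))
    (h₁ : Subsingleton (Sheaf.H.{u} S.X₁ (q + 1))) : Subsingleton (Sheaf.H.{u} S.X₃ q) :=
  (H_surjective hS q h₁).subsingleton

lemma sections_top_surjective {A B : AbSheaf X} (f : A ⟶ B)
    (hf : Function.Surjective (Sheaf.H.map.{u} f 0)) :
    Function.Surjective (f.hom.app (op ⊤)) := by
  intro t
  obtain ⟨y, hy⟩ := hf ((Sheaf.H.equiv₀ B Limits.isTerminalTop).symm t)
  refine ⟨Sheaf.H.equiv₀ A Limits.isTerminalTop y, ?_⟩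
  rw [Sheaf.H.equiv₀_naturality, hy, AddEquiv.apply_symm_apply]

end Exact
end LagGrass

end

/-! ### Regular families of linear maps, frames, and representations of the stabilizer -/

noncomputable section
namespace LagGrass
variable {V : Type u} [AddCommGroup V] [Module ℂ V] {ω : LinearMap.BilinForm ℂ V} {n : ℕ}

/-- A family of vectors is regular if its coordinates are regular functions. -/
def RegVec {U : Opens (space ω n)} {M : Type*} [AddCommGroup M] [Module ℂ M] (f : U → M) : Prop :=
  ∀ l : Module.Dual ℂ M, (regular ω n).pred (fun x => l (f x))

section RegVec
variable {U : Opens (space ω n)} {M M' M'' : Type*} [AddCommGroup M] [Module ℂ M]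
  [AddCommGroup M'] [Module ℂ M'] [AddCommGroup M''] [Module ℂ M'']

lemma regular_sum {ι : Type*} (s : Finset ι) {f : ι → U → ℂ}
    (h : ∀ i ∈ s, (regular ω n).pred (f i)) : (regular ω n).pred (fun x => ∑ i ∈ s, f i x) := by
  classical
  induction s using Finset.induction_on with
  | empty => simpa using regular_const U 0
  | insert a s ha ih =>
    simp only [Finset.sum_insert ha]
    exact regular_add (h a (by simp)) (ih fun i hi => h i (by simp [hi]))

lemma regular_prod {ι : Type*} (s : Finset ι) {f : ι → U → ℂ}
    (h : ∀ i ∈ s, (regular ω n).pred (f i)) : (regular ω n).pred (fun x => ∏ i ∈ s, f i x) := by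
  classical
  induction s using Finset.induction_on with
  | empty => simpa using regular_const U 1
  | insert a s ha ih =>
    simp only [Finset.prod_insert ha]
    exact regular_mul (h a (by simp)) (ih fun i hi => h i (by simp [hi]))

lemma regular_res {U' : Opens (space ω n)} (h : U' ≤ U) {f : U → ℂ}
    (hf : (regular ω n).pred f) : (regular ω n).pred (fun x : U' => f ⟨x.1, h x.2⟩) :=
  (regular ω n).res (homOfLE h) f hf

lemma RegVec.const (m : M) : RegVec (fun _ : U => m) := fun _ => regular_const U _

lemma RegVec.add {f g : U → M} (hf : RegVec f) (hg : RegVec g) : RegVec (fun x => f x + g x) :=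
  fun l => by simpa using regular_add (hf l) (hg l)

lemma RegVec.smul {a : U → ℂ} {f : U → M} (ha : (regular ω n).pred a) (hf : RegVec f) :
    RegVec (fun x => a x • f x) :=
  fun l => by simpa using regular_mul ha (hf l)

lemma RegVec.sum {ι : Type*} (s : Finset ι) {f : ι → U → M} (h : ∀ i ∈ s, RegVec (f i)) :
    RegVec (fun x => ∑ i ∈ s, f i x) :=
  fun l => by simpa using regular_sum s fun i hi => h i hi l

lemma RegVec.map {f : U → M} (hf : RegVec f) (c : M →ₗ[ℂ] M') : RegVec (fun x => c (f x)) :=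
  fun l => hf (l ∘ₗ c)

lemma RegVec.res {U' : Opens (space ω n)} (h : U' ≤ U) {f : U → M} (hf : RegVec f) :
    RegVec (fun x : U' => f ⟨x.1, h x.2⟩) := fun l => regular_res h (hf l)

/-- A family of linear maps is regular if its values on constant vectors are. -/
def RegHom (c : U → M →ₗ[ℂ] M') : Prop := ∀ m, RegVec (fun x => c x m)

lemma RegHom.const (c : M →ₗ[ℂ] M') : RegHom (fun _ : U => c) := fun _ => RegVec.const _

lemma RegHom.apply [FiniteDimensional ℂ M] {c : U → M →ₗ[ℂ] M'} {f : U → M} (hc : RegHom c)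
    (hf : RegVec f) : RegVec (fun x => c x (f x)) := by
  let b := Module.finBasis ℂ M
  have e : (fun x => c x (f x)) = fun x => ∑ i, b.coord i (f x) • c x (b i) := by
    funext x
    conv_lhs => rw [← b.sum_repr (f x)]
    simp only [map_sum, map_smul, Module.Basis.coord_apply, smul_eq_mul]
  rw [e]
  exact RegVec.sum _ fun i _ => RegVec.smul (hf _) (hc _)

lemma RegHom.comp [FiniteDimensional ℂ M'] {c' : U → M' →ₗ[ℂ] M''} {c : U → M →ₗ[ℂ] M'}
    (hc' : RegHom c') (hc : RegHom c) : RegHom (fun x => c' x ∘ₗ c x) :=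
  fun m => hc'.apply (hc m)

lemma RegHom.res {U' : Opens (space ω n)} (h : U' ≤ U) {c : U → M →ₗ[ℂ] M'} (hc : RegHom c) :
    RegHom (fun x : U' => c ⟨x.1, h x.2⟩) := fun m => (hc m).res h

end RegVec

/-- Regular families of linear maps, as a subspace. -/
def regHom (U : Opens (space ω n)) (M M' : Type*) [AddCommGroup M] [Module ℂ M]
    [AddCommGroup M'] [Module ℂ M'] : Submodule ℂ (U → M →ₗ[ℂ] M') where
  carrier := {c | RegHom c}
  zero_mem' := RegHom.const 0
  add_mem' := fun h k m => (h m).add (k m)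
  smul_mem' := fun a _ h m => RegVec.smul (regular_const U a) (h m)

/-- Regular families of linear maps. -/
abbrev RHom (U : Opens (space ω n)) (M M' : Type*) [AddCommGroup M] [Module ℂ M]
    [AddCommGroup M'] [Module ℂ M'] : Type _ := regHom U M M'

namespace RHom
variable {U : Opens (space ω n)} {M M' M'' : Type*} [AddCommGroup M] [Module ℂ M]
  [AddCommGroup M'] [Module ℂ M'] [AddCommGroup M''] [Module ℂ M'']

/-- Constant families. -/
def const (U : Opens (space ω n)) (c : M →ₗ[ℂ] M') : RHom U M M' :=
  ⟨fun _ => c, RegHom.const c⟩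

/-- Composition of regular families. -/
def comp [FiniteDimensional ℂ M'] (c' : RHom U M' M'') (c : RHom U M M') : RHom U M M'' :=
  ⟨fun x => c'.1 x ∘ₗ c.1 x, RegHom.comp c'.2 c.2⟩

/-- Restriction of regular families. -/
def res {U' : Opens (space ω n)} (h : U' ≤ U) (c : RHom U M M') : RHom U' M M' :=
  ⟨fun x => c.1 ⟨x.1, h x.2⟩, RegHom.res h c.2⟩

/-- Multiplication by a regular function. -/
def fsmul (f : regularFunctions U) (c : RHom U M M') : RHom U M M' :=
  ⟨fun x => f.1 x • c.1 x, fun m => RegVec.smul f.2 (c.2 m)⟩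

variable [FiniteDimensional ℂ M] [FiniteDimensional ℂ M'] [FiniteDimensional ℂ M'']
variable {F : Mod ω n}

/-- The matrix of a regular family. -/
def mat (c : RHom U M M') (i : Fin (Module.finrank ℂ M')) (j : Fin (Module.finrank ℂ M)) :
    regularFunctions U :=
  ⟨fun x => (Module.finBasis ℂ M').coord i (c.1 x (Module.finBasis ℂ M j)), c.2 _ _⟩

/-- The action of a regular family on vectors of sections. -/
def act (c : RHom U M M') :
    (Fin (Module.finrank ℂ M) → Sec F U) →+ (Fin (Module.finrank ℂ M') → Sec F U) where
  toFun s i := ∑ j, c.mat i j • s j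
  map_zero' := by ext; simp
  map_add' s t := by ext; simp [Finset.sum_add_distrib]

lemma act_apply (c : RHom U M M') (s : Fin (Module.finrank ℂ M) → Sec F U) (i) :
    c.act s i = ∑ j, c.mat i j • s j := rfl

lemma mat_comp (c' : RHom U M' M'') (c : RHom U M M') (i j) :
    (c'.comp c).mat i j = ∑ k, c'.mat i k * c.mat k j := by
  ext x
  simp only [mat, comp, LinearMap.comp_apply, AddSubmonoidClass.coe_finsetSum, Finset.sum_apply,
    Subring.coe_mul, Pi.mul_apply]
  conv_lhs => rw [← (Module.finBasis ℂ M').sum_repr (c.1 x _)]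
  simp only [map_sum, map_smul, Module.Basis.coord_apply, smul_eq_mul, mul_comm]

lemma act_act (c' : RHom U M' M'') (c : RHom U M M')
    (s : Fin (Module.finrank ℂ M) → Sec F U) : c'.act (c.act s) = (c'.comp c).act s := by
  ext i
  simp only [act_apply, mat_comp, Finset.smul_sum, Finset.sum_smul, mul_smul]
  exact Finset.sum_comm

lemma act_const_id (s : Fin (Module.finrank ℂ M) → Sec F U) :
    (const U (LinearMap.id : M →ₗ[ℂ] M)).act s = s := by
  ext i
  rw [act_apply, Finset.sum_eq_single i]
  · have : (const U (LinearMap.id : M →ₗ[ℂ] M)).mat i i = 1 := by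
      ext x; simp [mat, const]
    rw [this, one_smul]
  · intro j _ hj
    have : (const U (LinearMap.id : M →ₗ[ℂ] M)).mat i j = 0 := by
      ext x; simp [mat, const, hj]
    rw [this, zero_smul]
  · intro h
    exact absurd (Finset.mem_univ i) h

lemma act_add_left (c c' : RHom U M M') (s : Fin (Module.finrank ℂ M) → Sec F U) :
    (c + c').act s = c.act s + c'.act s := by
  ext i
  simp only [act_apply, Pi.add_apply, ← Finset.sum_add_distrib, ← add_smul]
  refine Finset.sum_congr rfl fun j _ => ?_
  congr 1
  ext x
  simp [mat]

lemma act_zero_left (s : Fin (Module.finrank ℂ M) → Sec F U) :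
    (0 : RHom U M M').act s = 0 := by
  have := act_add_left (0 : RHom U M M') 0 s
  simpa using this

lemma act_fsmul_left (f : regularFunctions U) (c : RHom U M M')
    (s : Fin (Module.finrank ℂ M) → Sec F U) : (fsmul f c).act s = f • c.act s := by
  ext i
  simp only [act_apply, Pi.smul_apply, Finset.smul_sum, smul_smul]
  refine Finset.sum_congr rfl fun j _ => ?_
  congr 1
  ext x
  simp [mat, fsmul]

lemma act_smul (f : regularFunctions U) (c : RHom U M M')
    (s : Fin (Module.finrank ℂ M) → Sec F U) : c.act (f • s) = f • c.act s := by
  ext i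
  simp only [act_apply, Pi.smul_apply, Finset.smul_sum, smul_smul, mul_comm]

lemma res_act {U' : Opens (space ω n)} (h : U' ≤ U) (c : RHom U M M')
    (s : Fin (Module.finrank ℂ M) → Sec F U) (i) :
    Sec.res h (c.act s i) = (c.res h).act (fun j => Sec.res h (s j)) i := by
  simp only [act_apply, map_sum]
  refine Finset.sum_congr rfl fun j _ => ?_
  exact Sec.res_smul h _ _

end RHom

variable (ω) in
/-- The symplectic group. -/
def symp : Subgroup (V ≃ₗ[ℂ] V) where
  carrier := {g | ∀ v w, ω (g v) (g w) = ω v w}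
  one_mem' := fun _ _ => rfl
  mul_mem' := fun {g h} hg hh v w => by rw [LinearEquiv.mul_apply, LinearEquiv.mul_apply, hg, hh]
  inv_mem' := fun {g} hg v w => by
    rw [← hg]; exact congrArg₂ (fun a b => ω a b) (g.apply_symm_apply v) (g.apply_symm_apply w)

/-- The stabilizer of a point of the Lagrangian Grassmannian in the symplectic group. -/
def stab (W : LagGrass ω n) : Subgroup (V ≃ₗ[ℂ] V) where
  carrier := {g | g ∈ symp ω ∧ W.1.map (g : V →ₗ[ℂ] V) = W.1}
  one_mem' := ⟨one_mem _, by ext; simp⟩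
  mul_mem' := fun {g h} hg hh => ⟨mul_mem hg.1 hh.1, by
    have : ((g * h : V ≃ₗ[ℂ] V) : V →ₗ[ℂ] V) = (g : V →ₗ[ℂ] V) ∘ₗ (h : V →ₗ[ℂ] V) := rfl
    rw [this, Submodule.map_comp, hh.2, hg.2]⟩
  inv_mem' := fun {g} hg => ⟨inv_mem hg.1, by
    conv_lhs => rw [← hg.2]
    rw [← Submodule.map_comp]
    have : ((g⁻¹ : V ≃ₗ[ℂ] V) : V →ₗ[ℂ] V) ∘ₗ (g : V →ₗ[ℂ] V) = LinearMap.id := by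
      ext v; exact g.symm_apply_apply v
    rw [this, Submodule.map_id]⟩

/-- A symplectic frame relative to the base point `W`: a regular family of symplectic
transformations that takes `W` to the points of `U`. -/
structure Frame (W : LagGrass ω n) (U : Opens (space ω n)) where
  /-- the transformations -/
  g : U → V ≃ₗ[ℂ] V
  mem : ∀ x, g x ∈ symp ω
  map : ∀ x, W.1.map (g x : V →ₗ[ℂ] V) = (x : LagGrass ω n).1
  reg : RegHom (fun x => (g x : V →ₗ[ℂ] V))
  reg_inv : RegHom (fun x => ((g x)⁻¹ : V ≃ₗ[ℂ] V).toLinearMap)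

/-- Regular families of elements of the stabilizer. -/
structure StabFam (W : LagGrass ω n) (U : Opens (space ω n)) where
  /-- the elements -/
  p : U → stab W
  reg : RegHom (fun x => ((p x : V ≃ₗ[ℂ] V) : V →ₗ[ℂ] V))
  reg_inv : RegHom (fun x => (((p x)⁻¹ : stab W) : V ≃ₗ[ℂ] V).toLinearMap)

/-- The restriction of a frame. -/
def Frame.res {W : LagGrass ω n} {U U' : Opens (space ω n)} (h : U' ≤ U) (φ : Frame W U) :
    Frame W U' :=
  ⟨fun x => φ.g ⟨x.1, h x.2⟩, fun _ => φ.mem _, fun _ => φ.map _, φ.reg.res h, φ.reg_inv.res h⟩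

/-- The transition between two frames. -/
def Frame.trans [FiniteDimensional ℂ V] {W : LagGrass ω n} {U : Opens (space ω n)}
    (φ' φ : Frame W U) : StabFam W U where
  p x := ⟨(φ'.g x)⁻¹ * φ.g x, mul_mem (inv_mem (φ'.mem x)) (φ.mem x), by
    have : ((φ'.g x)⁻¹ * φ.g x : V ≃ₗ[ℂ] V).toLinearMap =
      ((φ'.g x)⁻¹ : V ≃ₗ[ℂ] V).toLinearMap ∘ₗ (φ.g x : V →ₗ[ℂ] V) := rfl
    rw [this, Submodule.map_comp, φ.map, ← φ'.map, ← Submodule.map_comp]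
    have : ((φ'.g x)⁻¹ : V ≃ₗ[ℂ] V).toLinearMap ∘ₗ (φ'.g x : V →ₗ[ℂ] V) = LinearMap.id := by
      ext v; exact (φ'.g x).symm_apply_apply v
    rw [this, Submodule.map_id]⟩
  reg := φ'.reg_inv.comp φ.reg
  reg_inv := by
    have := φ.reg_inv.comp φ'.reg
    convert this using 2 with x
    ext v
    simp

/-- A finite-dimensional representation of the stabilizer that takes regular families to regular
families. -/
structure RRep (W : LagGrass ω n) where
  /-- the underlying space -/
  carrier : Type u
  [acg : AddCommGroup carrier]
  [mod : Module ℂ carrier]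
  [fd : FiniteDimensional ℂ carrier]
  /-- the action -/
  ρ : stab W →* Module.End ℂ carrier
  reg : ∀ (U : Opens (space ω n)) (p : StabFam W U), RegHom (fun x => ρ (p.p x))

instance (W : LagGrass ω n) : CoeSort (RRep W) (Type u) := ⟨RRep.carrier⟩
instance {W : LagGrass ω n} (M : RRep W) : AddCommGroup M := M.acg
instance {W : LagGrass ω n} (M : RRep W) : Module ℂ M := M.mod
instance {W : LagGrass ω n} (M : RRep W) : FiniteDimensional ℂ M := M.fd

/-- The action of a regular family on a representation. -/
def RRep.fam {W : LagGrass ω n} (M : RRep W) {U : Opens (space ω n)} (p : StabFam W U) :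
    RHom U M M := ⟨fun x => M.ρ (p.p x), M.reg U p⟩

/-- Maps between representations that may depend on a group element, compatibly with the action, as a subspace. -/
def bMap {W : LagGrass ω n} (M M' : RRep W) : Submodule ℂ ((V ≃ₗ[ℂ] V) → M →ₗ[ℂ] M') where
  -- The first condition makes τ descend to the bundles associated with M and M'; the second makes
  -- the result regular. Constant τ are the equivariant maps. Nonconstant ones are needed for the
  -- triviality of V and for the tautological section.
  carrier := {τ | (∀ (g : V ≃ₗ[ℂ] V) (p : stab W), M'.ρ p ∘ₗ τ (g * p) = τ g ∘ₗ M.ρ p) ∧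
    ∀ (U : Opens (space ω n)) (φ : Frame W U), RegHom (fun x => τ (φ.g x))}
  zero_mem' := ⟨fun g p => by simp, fun U φ => RegHom.const 0⟩
  add_mem' := fun {a b} ha hb => ⟨fun g p => by
    simp only [Pi.add_apply, LinearMap.comp_add, LinearMap.add_comp, ha.1, hb.1],
    fun U φ m => (ha.2 U φ m).add (hb.2 U φ m)⟩
  smul_mem' := fun c {a} ha => ⟨fun g p => by
    simp only [Pi.smul_apply, LinearMap.comp_smul, LinearMap.smul_comp, ha.1],
    fun U φ m => RegVec.smul (regular_const U c) (ha.2 U φ m)⟩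

/-- Maps between representations that may depend on a group element, compatibly with the
action. -/
abbrev BMap {W : LagGrass ω n} (M M' : RRep W) : Type u := bMap M M'

namespace BMap
variable {W : LagGrass ω n} {M M' M'' : RRep W}

@[ext] lemma ext {a b : BMap M M'} (h : ∀ g m, a.1 g m = b.1 g m) : a = b :=
  Subtype.ext (funext fun g => LinearMap.ext (h g))

/-- The map defined by an equivariant linear map. -/
def const (f : M →ₗ[ℂ] M') (hf : ∀ (p : stab W) m, f (M.ρ p m) = M'.ρ p (f m)) : BMap M M' :=
  ⟨fun _ => f, fun g p => LinearMap.ext fun m => (hf p m).symm, fun _ _ => RegHom.const f⟩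

/-- The identity. -/
def id (M : RRep W) : BMap M M := const LinearMap.id fun _ _ => rfl

/-- Composition. -/
def comp (b : BMap M' M'') (a : BMap M M') : BMap M M'' :=
  ⟨fun g => b.1 g ∘ₗ a.1 g, fun g p => by
    rw [← LinearMap.comp_assoc, b.2.1, LinearMap.comp_assoc, a.2.1, LinearMap.comp_assoc],
    fun U φ => (b.2.2 U φ).comp (a.2.2 U φ)⟩

/-- The regular family of maps associated with a frame. -/
def fam (a : BMap M M') {U : Opens (space ω n)} (φ : Frame W U) : RHom U M M' :=
  ⟨fun x => a.1 (φ.g x), a.2.2 U φ⟩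

end BMap

end LagGrass

end

/-! ### The twist of a sheaf by a homogeneous bundle -/

noncomputable section
namespace LagGrass
variable {V : Type u} [AddCommGroup V] [Module ℂ V] {ω : LinearMap.BilinForm ℂ V} {n : ℕ}
variable [FiniteDimensional ℂ V] {W : LagGrass ω n} 

/-- Vectors of sections indexed by a basis of `M`. -/
abbrev VSec (F : Mod ω n) (M : RRep W) (U : Opens (space ω n)) : Type u :=
  Fin (Module.finrank ℂ M) → Sec F U

/-- Restriction of vectors of sections. -/
def VSec.res {F : Mod ω n} {M : RRep W} {U U' : Opens (space ω n)} (h : U' ≤ U) (s : VSec F M U) :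
    VSec F M U' := fun i => Sec.res h (s i)

namespace VSec
variable {F : Mod ω n} {M : RRep W} {U U' U'' : Opens (space ω n)}

@[simp] lemma res_zero (h : U' ≤ U) : res h (0 : VSec F M U) = 0 := funext fun _ => map_zero _
@[simp] lemma res_add (h : U' ≤ U) (s t : VSec F M U) : res h (s + t) = res h s + res h t :=
  funext fun _ => map_add _ _ _
@[simp] lemma res_neg (h : U' ≤ U) (s : VSec F M U) : res h (-s) = -res h s :=
  funext fun _ => map_neg _ _
lemma res_smul (h : U' ≤ U) (f : regularFunctions U) (s : VSec F M U) :
    res h (f • s) = rres h f • res h s := funext fun _ => Sec.res_smul _ _ _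
lemma res_res (h : U' ≤ U) (h' : U'' ≤ U') (s : VSec F M U) :
    res h' (res h s) = res (h'.trans h) s := funext fun _ => Sec.res_res _ _ _
lemma res_refl (s : VSec F M U) : res le_rfl s = s := funext fun _ => Sec.res_refl _
lemma res_act {M' : RRep W} (h : U' ≤ U) (c : RHom U M M') (s : VSec F M U) :
    res h (c.act s : VSec F M' U) = (c.res h).act (res h s) := funext fun _ => RHom.res_act _ _ _ _

end VSec

/-- The families that define `secF` depend on a proof of U' ≤ U, so a product indexed by a
proposition occurs. -/
instance addCommGroupPropPi {p : Prop} {A : p → Type*} [∀ h, AddCommGroup (A h)] :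
    AddCommGroup (∀ h : p, A h) where
  add f g h := f h + g h
  zero := fun h => (0 : A h)
  neg f h := -f h
  nsmul k f h := k • f h
  zsmul k f h := k • f h
  nsmul_zero f := funext fun _ => zero_nsmul _
  nsmul_succ k f := funext fun _ => succ_nsmul _ _
  zsmul_zero' f := funext fun _ => zero_zsmul _
  zsmul_succ' k f := funext fun h => SubNegMonoid.zsmul_succ' k (f h)
  zsmul_neg' k f := funext fun h => SubNegMonoid.zsmul_neg' k (f h)
  add_assoc _ _ _ := funext fun _ => add_assoc _ _ _
  zero_add _ := funext fun _ => zero_add _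
  add_zero _ := funext fun _ => add_zero _
  add_comm _ _ := funext fun _ => add_comm _ _
  neg_add_cancel _ := funext fun _ => neg_add_cancel _

section
variable {U : Opens (space ω n)} {M M' : RRep W}

/-- The cocycle identity (φ''⁻¹φ')(φ'⁻¹φ) = φ''⁻¹φ. -/
lemma RRep.fam_trans_comp (φ'' φ' φ : Frame W U) :
    (M.fam (φ''.trans φ')).comp (M.fam (φ'.trans φ)) = M.fam (φ''.trans φ) := by
  apply Subtype.ext
  funext x
  have : (φ''.trans φ').p x * (φ'.trans φ).p x = (φ''.trans φ).p x := by
    apply Subtype.ext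
    simp [Frame.trans]
  change M.ρ _ * M.ρ _ = M.ρ _
  rw [← map_mul, this]

lemma RRep.fam_trans_self (φ : Frame W U) :
    M.fam (φ.trans φ) = RHom.const U LinearMap.id := by
  apply Subtype.ext
  funext x
  have : (φ.trans φ).p x = 1 := by
    apply Subtype.ext
    simp [Frame.trans]
  change M.ρ _ = 1
  rw [this, map_one]

lemma RRep.fam_trans_res {U' : Opens (space ω n)} (h : U' ≤ U) (φ' φ : Frame W U) :
    (M.fam (φ'.trans φ)).res h = M.fam ((φ'.res h).trans (φ.res h)) := rfl

/-- This is the equivariance of a at g = φ' and p = φ'⁻¹φ, for which gp = φ. -/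
lemma BMap.fam_trans (a : BMap M M') (φ' φ : Frame W U) :
    (M'.fam (φ'.trans φ)).comp (a.fam φ) = (a.fam φ').comp (M.fam (φ'.trans φ)) := by
  apply Subtype.ext
  funext x
  have := a.2.1 (φ'.g x) ((φ'.trans φ).p x)
  refine Eq.trans ?_ this
  have h : φ'.g x * ((φ'.trans φ).p x : V ≃ₗ[ℂ] V) = φ.g x := by simp [Frame.trans]
  rw [h]
  rfl

end

/-- Sections of the twist of a sheaf by the vector bundle associated with a representation. -/
def secF (F : Mod ω n) (M : RRep W) (U : Opens (space ω n)) :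
    AddSubgroup (∀ U' : Opens (space ω n), U' ≤ U → Frame W U' → VSec F M U') where
  -- The coordinates of a section of the twist in all frames: they commute with restriction and
  -- change by the action of φ'⁻¹φ when φ is replaced by φ'.
  carrier := {s | (∀ U' h φ U'' (h' : U'' ≤ U'),
      s U'' (h'.trans h) (φ.res h') = VSec.res h' (s U' h φ)) ∧
    ∀ U' h φ φ', s U' h φ' = (M.fam (Frame.trans φ' φ)).act (s U' h φ)}
  zero_mem' := ⟨fun _ _ _ _ h' => (VSec.res_zero h').symm, fun _ _ _ _ => (map_zero _).symm⟩
  add_mem' := fun {s t} hs ht => ⟨fun U' h φ U'' h' =>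
      (congrArg₂ (· + ·) (hs.1 U' h φ U'' h') (ht.1 U' h φ U'' h')).trans
        (VSec.res_add h' _ _).symm,
    fun U' h φ φ' => (congrArg₂ (· + ·) (hs.2 U' h φ φ') (ht.2 U' h φ φ')).trans
      (map_add _ _ _).symm⟩
  neg_mem' := fun {s} hs => ⟨fun U' h φ U'' h' =>
      (congrArg (- ·) (hs.1 U' h φ U'' h')).trans (VSec.res_neg h' _).symm,
    fun U' h φ φ' => (congrArg (- ·) (hs.2 U' h φ φ')).trans (map_neg _ _).symm⟩

namespace secF
variable {F : Mod ω n} {M : RRep W} {U U' : Opens (space ω n)}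

lemma ext_frame {s t : secF F M U} (h : ∀ U' (h : U' ≤ U) φ, s.1 U' h φ = t.1 U' h φ) : s = t :=
  Subtype.ext (funext fun U' => funext fun h' => funext fun φ => h U' h' φ)

instance : SMul (regularFunctions U) (secF F M U) where
  smul f s := ⟨fun U' h φ => rres h f • s.1 U' h φ,
    fun U' h φ U'' h' => by
      rw [VSec.res_smul, ← s.2.1]; rfl,
    fun U' h φ φ' => by
      rw [RHom.act_smul, ← s.2.2]⟩

lemma smul_val (f : regularFunctions U) (s : secF F M U) (U') (h : U' ≤ U) (φ) :
    (f • s).1 U' h φ = rres h f • s.1 U' h φ := rfl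

instance : Module (regularFunctions U) (secF F M U) where
  one_smul s := ext_frame fun U' h φ => by rw [smul_val, map_one, one_smul]
  mul_smul f g s := ext_frame fun U' h φ => by rw [smul_val, map_mul, mul_smul]; rfl
  smul_zero f := ext_frame fun U' h φ => by rw [smul_val]; exact smul_zero _
  smul_add f s t := ext_frame fun U' h φ => by rw [smul_val]; exact smul_add _ _ _
  add_smul f g s := ext_frame fun U' h φ => by rw [smul_val, map_add, add_smul]; rfl
  zero_smul s := ext_frame fun U' h φ => by rw [smul_val, map_zero, zero_smul]; rfl

/-- Restriction. -/
def res (h : U' ≤ U) : secF F M U →+ secF F M U' where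
  toFun s := ⟨fun U'' h' φ => s.1 U'' (h'.trans h) φ, fun _ _ _ _ _ => s.2.1 _ _ _ _ _,
    fun _ _ _ _ => s.2.2 _ _ _ _⟩
  map_zero' := rfl
  map_add' _ _ := rfl

/-- The section that has a given vector in a given frame. -/
def ofFrame (φ : Frame W U) (v : VSec F M U) : secF F M U :=
  ⟨fun U' h φ' => (M.fam (Frame.trans φ' (φ.res h))).act (VSec.res h v),
    fun U' h φ' U'' h' => by
      rw [VSec.res_act, VSec.res_res]; rfl,
    fun U' h φ' φ'' => by
      rw [RHom.act_act, RRep.fam_trans_comp]⟩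

lemma ofFrame_val (φ : Frame W U) (v : VSec F M U) : (ofFrame φ v).1 U le_rfl φ = v := by
  change (M.fam (Frame.trans φ φ)).act (VSec.res le_rfl v) = v
  rw [RRep.fam_trans_self, RHom.act_const_id, VSec.res_refl]

/-- The transition rule recovers the coordinates in every other frame over a smaller open set from
those in one frame. -/
lemma eq_of_frame (φ : Frame W U) {s t : secF F M U} (h : s.1 U le_rfl φ = t.1 U le_rfl φ) :
    s = t := ext_frame fun U' h' φ' => by
  rw [s.2.2 U' h' (φ.res h') φ', t.2.2 U' h' (φ.res h') φ']
  have h1 := s.2.1 U le_rfl φ U' h'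
  have h2 := t.2.1 U le_rfl φ U' h'
  rw [h1, h2, h]

/-- Over an open subset with a frame the twist is a power of the sheaf. -/
def frameEquiv (φ : Frame W U) : secF F M U ≃+ VSec F M U where
  toFun s := s.1 U le_rfl φ
  invFun := ofFrame φ
  left_inv s := eq_of_frame φ (ofFrame_val φ _)
  right_inv v := ofFrame_val φ v
  map_add' _ _ := rfl

lemma eq_of_cover {ι : Type*} {O : ι → Opens (space ω n)}
    (hO : ∀ i, O i ≤ U) (hU : U ≤ iSup O) {s t : secF F M U}
    (h : ∀ i, res (hO i) s = res (hO i) t) : s = t := by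
  refine ext_frame fun U' h' φ => funext fun k => ?_
  refine Sec.eq_of_cover (W := fun i => U' ⊓ O i) (fun i => inf_le_left) ?_ fun i => ?_
  · rw [← inf_iSup_eq]; exact le_inf le_rfl (h'.trans hU)
  · have h1 := congrFun (s.2.1 U' h' φ (U' ⊓ O i) inf_le_left) k
    have h2 := congrFun (t.2.1 U' h' φ (U' ⊓ O i) inf_le_left) k
    refine h1.symm.trans (Eq.trans ?_ h2)
    exact congrArg (fun z : secF F M (O i) => z.1 (U' ⊓ O i) inf_le_right (φ.res inf_le_left) k) (h i)

/-- In each frame over U' the coordinates are glued along the cover of U' by the U' ⊓ O i; both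
defining conditions are then checked on this cover. -/
lemma exists_glue {ι : Type*} {O : ι → Opens (space ω n)}
    (hO : ∀ i, O i ≤ U) (hU : U ≤ iSup O) (s : ∀ i, secF F M (O i))
    (h : ∀ i j, res (inf_le_left : O i ⊓ O j ≤ O i) (s i) =
      res (inf_le_right : O i ⊓ O j ≤ O j) (s j)) : ∃ t : secF F M U, ∀ i, res (hO i) t = s i := by
  have hcov : ∀ U' ≤ U, U' ≤ ⨆ i, U' ⊓ O i := fun U' h' => by
    rw [← inf_iSup_eq]; exact le_inf le_rfl (h'.trans hU)
  have key : ∀ (U') (h' : U' ≤ U) (φ : Frame W U') (k), ∃ t : Sec F U', ∀ i,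
      Sec.res (inf_le_left : U' ⊓ O i ≤ U') t =
        (s i).1 (U' ⊓ O i) inf_le_right (φ.res inf_le_left) k := by
    intro U' h' φ k
    refine Sec.exists_glue _ (hcov U' h') _ fun i j => ?_
    have h1 := congrFun ((s i).2.1 (U' ⊓ O i) inf_le_right (φ.res inf_le_left)
      ((U' ⊓ O i) ⊓ (U' ⊓ O j)) inf_le_left) k
    refine h1.symm.trans ?_
    have h2 := congrFun ((s j).2.1 (U' ⊓ O j) inf_le_right (φ.res inf_le_left)
      ((U' ⊓ O i) ⊓ (U' ⊓ O j)) inf_le_right) k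
    refine Eq.trans ?_ h2
    exact congrArg (fun z : secF F M (O i ⊓ O j) => z.1 ((U' ⊓ O i) ⊓ (U' ⊓ O j))
      (inf_le_inf inf_le_right inf_le_right) (φ.res (inf_le_left.trans inf_le_left)) k) (h i j)
  choose t ht using key
  have htV : ∀ (U') (h' : U' ≤ U) (φ : Frame W U') i,
    VSec.res (inf_le_left : U' ⊓ O i ≤ U') (t U' h' φ : VSec F M U') =
      (s i).1 (U' ⊓ O i) inf_le_right (φ.res inf_le_left) :=
    fun U' h' φ i => funext fun k => ht U' h' φ k i
  refine ⟨⟨fun U' h' φ => t U' h' φ, fun U' h' φ U'' h'' => ?_, fun U' h' φ φ' => ?_⟩, fun i => ?_⟩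
  · ext k
    refine Sec.eq_of_cover (W := fun i => U'' ⊓ O i) (fun i => inf_le_left)
      (hcov U'' (h''.trans h')) fun i => ?_
    refine (ht _ _ _ _ i).trans ?_
    have h1 := congrFun ((s i).2.1 (U' ⊓ O i) inf_le_right (φ.res inf_le_left) (U'' ⊓ O i)
      (inf_le_inf_right _ h'')) k
    refine h1.trans ?_
    rw [← htV _ h']
    exact (Sec.res_res _ _ _).trans (Sec.res_res _ _ _).symm
  · ext k
    refine Sec.eq_of_cover (W := fun i => U' ⊓ O i) (fun i => inf_le_left) (hcov U' h') fun i => ?_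
    refine (ht _ _ _ _ i).trans ?_
    have h1 := congrFun ((s i).2.2 (U' ⊓ O i) inf_le_right (φ.res inf_le_left)
      (φ'.res inf_le_left)) k
    refine h1.trans ?_
    rw [← htV, ← RRep.fam_trans_res, ← VSec.res_act]
    rfl
  · refine ext_frame fun U' h' φ => funext fun k => ?_
    refine Sec.eq_of_cover (W := fun _ : Unit => U' ⊓ O i) (fun _ => inf_le_left)
      (le_iSup_of_le () (le_inf le_rfl h')) fun _ => ?_
    exact (ht U' _ φ k i).trans (congrFun ((s i).2.1 U' h' φ _ inf_le_left) k)

end secF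

/-- The abelian presheaf of sections of the twist by a representation. -/
def twAb (F : Mod ω n) (M : RRep W) : TopCat.Presheaf Ab.{u} (space ω n) where
  obj U := AddCommGrpCat.of (secF F M U.unop)
  map {U U'} i := AddCommGrpCat.ofHom (secF.res i.unop.le)

instance twAbModule (F : Mod ω n) (M : RRep W) (U : (Opens (space ω n))ᵒᵖ) :
    Module ((ringSheaf ω n).obj.obj U) ((twAb F M).obj U) :=
  inferInstanceAs (Module (regularFunctions U.unop) (secF F M U.unop))

/-- The twist of a sheaf of modules by the vector bundle associated with a representation. -/
def tw (F : Mod ω n) (M : RRep W) : Mod ω n where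
  val := PresheafOfModules.ofPresheaf (twAb F M) (fun _ _ _ _ _ => rfl)
  isSheaf := (TopCat.Presheaf.isSheaf_iff_isSheaf_comp (forget Ab) _).mpr (by
    refine TopCat.Presheaf.isSheaf_of_isSheafUniqueGluing_types _ fun ι O s h => ?_
    obtain ⟨t, ht⟩ := secF.exists_glue (F := F) (M := M) (U := iSup O) (fun i => le_iSup O i) le_rfl s h
    exact ⟨t, ht, fun t' ht' => secF.eq_of_cover (F := F) (M := M) (fun i => le_iSup O i) le_rfl
      fun i => (ht' i).trans (ht i).symm⟩)

namespace tw
variable {F : Mod ω n} {M M' M'' : RRep W}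

/-- The map of sections defined by a map of representations. -/
def mapSec (a : BMap M M') (U : Opens (space ω n)) : secF F M U →+ secF F M' U where
  toFun s := ⟨fun U' h φ => (a.fam φ).act (s.1 U' h φ),
    fun U' h φ U'' h' => by
      refine (congrArg _ (s.2.1 U' h φ U'' h')).trans ?_
      exact (VSec.res_act h' (a.fam φ) _).symm,
    fun U' h φ φ' => by
      refine (congrArg _ (s.2.2 U' h φ φ')).trans ?_
      beta_reduce
      rw [RHom.act_act, RHom.act_act, BMap.fam_trans]⟩
  map_zero' := secF.ext_frame fun U' h φ => map_zero _
  map_add' s t := secF.ext_frame fun U' h φ => map_add _ _ _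

lemma mapSec_val (a : BMap M M') {U : Opens (space ω n)} (s : secF F M U) (U' h φ) :
    (mapSec a U s).1 U' h φ = (a.fam φ).act (s.1 U' h φ) := rfl

variable (F) in
/-- The map of abelian sheaves defined by a map of representations. -/
def map (a : BMap M M') : ab (tw F M) ⟶ ab (tw F M') :=
  abHom (F := tw F M) (G := tw F M') (fun U => mapSec a U) (fun _ _ _ _ => rfl)

lemma mapSec_comp (b : BMap M' M'') (a : BMap M M') (U : Opens (space ω n)) (s : secF F M U) :
    mapSec (b.comp a) U s = mapSec b U (mapSec a U s) :=
  secF.ext_frame fun U' h φ => by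
    rw [mapSec_val, mapSec_val, mapSec_val, RHom.act_act]
    rfl

lemma mapSec_id (U : Opens (space ω n)) (s : secF F M U) : mapSec (BMap.id M) U s = s :=
  secF.ext_frame fun U' h φ => by
    have : (BMap.id M).fam φ = RHom.const U' LinearMap.id := rfl
    rw [mapSec_val, this, RHom.act_const_id]

lemma mapSec_add (a b : BMap M M') (U : Opens (space ω n)) (s : secF F M U) :
    mapSec (a + b) U s = mapSec a U s + mapSec b U s :=
  secF.ext_frame fun U' h φ => by
    have : (a + b).fam φ = a.fam φ + b.fam φ := rfl
    rw [mapSec_val, this, RHom.act_add_left]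
    rfl

lemma map_comp (b : BMap M' M'') (a : BMap M M') : map F (b.comp a) = map F a ≫ map F b :=
  Sheaf.hom_ext_apply fun U s => mapSec_comp b a U s

lemma map_id : map F (BMap.id M) = 𝟙 _ :=
  Sheaf.hom_ext_apply fun U s => mapSec_id U s

lemma map_add (a b : BMap M M') : map F (a + b) = map F a + map F b :=
  Sheaf.hom_ext_apply fun U s => mapSec_add a b U s

end tw
end LagGrass

end

/-! ### Multilinear algebra: forms alternating in one list of variables and symmetric in another -/

noncomputable section
namespace LagGrass

/-- Functions of two lists of vectors, the domain of definition of the operators of exterior and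
symmetric multilinear algebra. -/
abbrev Raw (A B M : Type*) := List A → List B → M

namespace Raw
variable {A B M : Type*} [AddCommGroup A] [Module ℂ A] [AddCommGroup B] [Module ℂ B]
  [AddCommGroup M] [Module ℂ M]

/-- Contraction with a vector in the alternating variables. -/
def ia (a : A) : Raw A B M →ₗ[ℂ] Raw A B M where
  toFun f l s := f (a :: l) s
  map_add' _ _ := rfl
  map_smul' _ _ := rfl

/-- Contraction with a vector in the symmetric variables. -/
def db (b : B) : Raw A B M →ₗ[ℂ] Raw A B M where
  toFun f l s := f l (b :: s)
  map_add' _ _ := rfl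
  map_smul' _ _ := rfl

lemma ia_db (a : A) (b : B) (f : Raw A B M) : ia a (db b f) = db b (ia a f) := rfl

/-- Symmetrization of a family of functions. -/
def delta (g : B → Raw A B M) : Raw A B M := fun l s =>
  match s with
  | [] => 0
  | w :: s => g w l s + delta (fun b => db w (g b)) l s
termination_by _ s => s.length

/-- Alternation of a family of functions. -/
def eps (g : A → Raw A B M) : Raw A B M := fun l s =>
  match l with
  | [] => 0
  | a :: l => g a l s - eps (fun a' => ia a (g a')) l s
termination_by l _ => l.length

lemma delta_nil (g : B → Raw A B M) (l : List A) : delta g l [] = 0 := by rw [delta]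

lemma eps_nil (g : A → Raw A B M) (s : List B) : eps g [] s = 0 := by rw [eps]

lemma delta_cons (g : B → Raw A B M) (l : List A) (w : B) (s : List B) :
    delta g l (w :: s) = g w l s + delta (fun b => db w (g b)) l s := by rw [delta]

lemma eps_cons (g : A → Raw A B M) (a : A) (l : List A) (s : List B) :
    eps g (a :: l) s = g a l s - eps (fun a' => ia a (g a')) l s := by rw [eps]

lemma db_delta (w : B) (g : B → Raw A B M) :
    db w (delta g) = g w + delta (fun b => db w (g b)) := by
  funext l s; exact delta_cons g l w s

lemma ia_eps (a : A) (g : A → Raw A B M) :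
    ia a (eps g) = g a - eps (fun a' => ia a (g a')) := by
  funext l s; exact eps_cons g a l s

lemma ia_delta (a : A) (g : B → Raw A B M) :
    ia a (delta g) = delta (fun b => ia a (g b)) := by
  funext l s
  induction s generalizing g with
  | nil => rw [delta_nil]; exact delta_nil _ _
  | cons w s ih =>
    refine (delta_cons _ _ _ _).trans ((delta_cons _ _ _ _).trans ?_).symm
    exact congrArg (_ + ·) (ih fun b => db w (g b)).symm

lemma db_eps (w : B) (g : A → Raw A B M) :
    db w (eps g) = eps (fun a => db w (g a)) := by
  funext l s
  induction l generalizing g with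
  | nil => rw [eps_nil]; exact eps_nil _ _
  | cons a l ih =>
    refine (eps_cons _ _ _ _).trans ((eps_cons _ _ _ _).trans ?_).symm
    exact congrArg (_ - ·) (ih fun b => ia a (g b)).symm

lemma delta_add (g h : B → Raw A B M) : delta (fun b => g b + h b) = delta g + delta h := by
  funext l s
  induction s generalizing g h with
  | nil => simp [delta_nil]
  | cons w s ih =>
    simp only [Pi.add_apply, delta_cons, map_add] at ih ⊢
    rw [ih]; abel

lemma delta_smul (c : ℂ) (g : B → Raw A B M) : delta (fun b => c • g b) = c • delta g := by
  funext l s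
  induction s generalizing g with
  | nil => simp [delta_nil]
  | cons w s ih =>
    simp only [Pi.smul_apply, delta_cons, map_smul, smul_add] at ih ⊢
    rw [ih]

lemma eps_add (g h : A → Raw A B M) : eps (fun b => g b + h b) = eps g + eps h := by
  funext l s
  induction l generalizing g h with
  | nil => simp [eps_nil]
  | cons w s ih =>
    simp only [Pi.add_apply, eps_cons, map_add] at ih ⊢
    rw [ih]; abel

lemma eps_smul (c : ℂ) (g : A → Raw A B M) : eps (fun b => c • g b) = c • eps g := by
  funext l s
  induction l generalizing g with
  | nil => simp [eps_nil]
  | cons w s ih =>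
    simp only [Pi.smul_apply, eps_cons, map_smul, smul_sub] at ih ⊢
    rw [ih]

/-- Symmetrization as a linear map. -/
def deltaL : (B → Raw A B M) →ₗ[ℂ] Raw A B M where
  toFun := delta
  map_add' := delta_add
  map_smul' := delta_smul

/-- Alternation as a linear map. -/
def epsL : (A → Raw A B M) →ₗ[ℂ] Raw A B M where
  toFun := eps
  map_add' := eps_add
  map_smul' := eps_smul

lemma delta_zero : delta (fun _ => 0 : B → Raw A B M) = 0 := map_zero deltaL
lemma eps_zero : eps (fun _ => 0 : A → Raw A B M) = 0 := map_zero epsL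
lemma delta_neg (g : B → Raw A B M) : delta (fun b => -g b) = -delta g := map_neg deltaL g
lemma eps_neg (g : A → Raw A B M) : eps (fun b => -g b) = -eps g := map_neg epsL g
lemma delta_sub (g h : B → Raw A B M) : delta (fun b => g b - h b) = delta g - delta h :=
  map_sub deltaL g h
lemma delta_sum {ι : Type*} (t : Finset ι) (g : ι → B → Raw A B M) :
    delta (fun b => ∑ i ∈ t, g i b) = ∑ i ∈ t, delta (g i) := by
  have := map_sum (deltaL (A := A) (B := B) (M := M)) g t
  refine Eq.trans ?_ this
  exact congrArg delta (funext fun b => (Finset.sum_apply b t g).symm)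
lemma eps_sum {ι : Type*} (t : Finset ι) (g : ι → A → Raw A B M) :
    eps (fun b => ∑ i ∈ t, g i b) = ∑ i ∈ t, eps (g i) := by
  have := map_sum (epsL (A := A) (B := B) (M := M)) g t
  refine Eq.trans ?_ this
  exact congrArg eps (funext fun b => (Finset.sum_apply b t g).symm)

/-- The local conditions for a function to be alternating multilinear in the first list and
symmetric multilinear in the second. -/
structure Loc (f : Raw A B M) : Prop where
  ia_add : ∀ a a', ia (a + a') f = ia a f + ia a' f
  ia_smul : ∀ (c : ℂ) a, ia (c • a) f = c • ia a f
  ia_self : ∀ a, ia a (ia a f) = 0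
  db_add : ∀ b b', db (b + b') f = db b f + db b' f
  db_smul : ∀ (c : ℂ) b, db (c • b) f = c • db b f
  db_comm : ∀ b b', db b (db b' f) = db b' (db b f)

lemma Loc.zero : Loc (0 : Raw A B M) := ⟨by simp, by simp, by simp, by simp, by simp, by simp⟩

lemma Loc.add {f g : Raw A B M} (hf : Loc f) (hg : Loc g) : Loc (f + g) where
  ia_add a a' := by simp only [map_add, hf.ia_add, hg.ia_add]; abel
  ia_smul c a := by simp only [map_add, hf.ia_smul, hg.ia_smul, smul_add]
  ia_self a := by simp only [map_add, hf.ia_self, hg.ia_self, add_zero]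
  db_add a a' := by simp only [map_add, hf.db_add, hg.db_add]; abel
  db_smul c a := by simp only [map_add, hf.db_smul, hg.db_smul, smul_add]
  db_comm a a' := by simp only [map_add]; rw [hf.db_comm, hg.db_comm]

lemma Loc.smul {f : Raw A B M} (c : ℂ) (hf : Loc f) : Loc (c • f) where
  ia_add a a' := by simp only [map_smul, hf.ia_add, smul_add]
  ia_smul c' a := by simp only [map_smul, hf.ia_smul, smul_smul, mul_comm]
  ia_self a := by simp only [map_smul, hf.ia_self, smul_zero]
  db_add a a' := by simp only [map_smul, hf.db_add, smul_add]
  db_smul c' a := by simp only [map_smul, hf.db_smul, smul_smul, mul_comm]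
  db_comm a a' := by simp only [map_smul]; rw [hf.db_comm]

/-- Partial evaluation. -/
def shift (l₁ : List A) (s₁ : List B) : Raw A B M →ₗ[ℂ] Raw A B M where
  toFun f l s := f (l₁ ++ l) (s₁ ++ s)
  map_add' _ _ := rfl
  map_smul' _ _ := rfl

variable (A B M) in
/-- Functions that are alternating multilinear in the first list and symmetric multilinear in the
second. -/
def AM : Submodule ℂ (Raw A B M) where
  carrier := {f | ∀ l s, Loc (shift l s f)}
  zero_mem' l s := by rw [map_zero]; exact Loc.zero
  add_mem' hf hg l s := by rw [map_add]; exact (hf l s).add (hg l s)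
  smul_mem' c f hf l s := by rw [map_smul]; exact (hf l s).smul c

lemma AM.loc {f : Raw A B M} (hf : f ∈ AM A B M) : Loc f := hf [] []

lemma AM.ia {f : Raw A B M} (hf : f ∈ AM A B M) (a : A) : ia a f ∈ AM A B M :=
  fun l s => hf (a :: l) s

lemma AM.db {f : Raw A B M} (hf : f ∈ AM A B M) (b : B) : db b f ∈ AM A B M :=
  fun l s => hf l (b :: s)

/-- Multilinearity and symmetry at all positions follow from the conditions at the head of the
lists, provided that the class considered is stable under contraction. It replaces explicit
permutations. -/
lemma AM.of_stable (C : Raw A B M → Prop) (hloc : ∀ f, C f → Loc f)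
    (hia : ∀ f a, C f → C (Raw.ia a f)) (hdb : ∀ f b, C f → C (Raw.db b f)) {f : Raw A B M}
    (hf : C f) : f ∈ AM A B M := by
  intro l s
  apply hloc
  induction l generalizing f with
  | nil =>
    induction s generalizing f with
    | nil => exact hf
    | cons b s ih => exact ih (hdb f b hf)
  | cons a l ih => exact ih (hia f a hf)

lemma AM.db_zero {f : Raw A B M} (hf : f ∈ AM A B M) : Raw.db 0 f = 0 := by
  have := (AM.loc hf).db_smul 0 0
  rwa [zero_smul, zero_smul] at this

lemma AM.ia_zero {f : Raw A B M} (hf : f ∈ AM A B M) : Raw.ia 0 f = 0 := by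
  have := (AM.loc hf).ia_smul 0 0
  rwa [zero_smul, zero_smul] at this

lemma AM.ia_anticomm {f : Raw A B M} (hf : f ∈ AM A B M) (a a' : A) :
    Raw.ia a (Raw.ia a' f) = -Raw.ia a' (Raw.ia a f) := by
  have h := (AM.loc hf).ia_self (a + a')
  have h1 := (AM.loc hf).ia_self a
  have h2 := (AM.loc hf).ia_self a'
  rw [(AM.loc hf).ia_add, map_add, (AM.loc (AM.ia hf a)).ia_add, (AM.loc (AM.ia hf a')).ia_add,
    h1, h2, zero_add, add_zero, add_comm] at h
  exact eq_neg_of_add_eq_zero_left h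

/-- Contraction as a linear function of the vector. -/
def iaL {f : Raw A B M} (hf : f ∈ AM A B M) : A →ₗ[ℂ] Raw A B M where
  toFun a := ia a f
  map_add' := (AM.loc hf).ia_add
  map_smul' := (AM.loc hf).ia_smul

/-- Contraction as a linear function of the vector. -/
def dbL {f : Raw A B M} (hf : f ∈ AM A B M) : B →ₗ[ℂ] Raw A B M where
  toFun a := db a f
  map_add' := (AM.loc hf).db_add
  map_smul' := (AM.loc hf).db_smul

lemma iaL_apply {f : Raw A B M} (hf : f ∈ AM A B M) (a : A) : iaL hf a = ia a f := rfl
lemma dbL_apply {f : Raw A B M} (hf : f ∈ AM A B M) (a : B) : dbL hf a = db a f := rfl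

lemma AM.delta {g : B →ₗ[ℂ] Raw A B M} (hg : ∀ b, g b ∈ AM A B M) : delta g ∈ AM A B M := by
  -- Symmetrizations alone are not stable: contraction with w produces the extra summand g w, so the
  -- class must consist of sums h + `delta` g.
  refine AM.of_stable (fun f => ∃ h ∈ AM A B M, ∃ g : B →ₗ[ℂ] Raw A B M, (∀ b, g b ∈ AM A B M) ∧
    f = h + Raw.delta g) ?_ ?_ ?_ ⟨0, zero_mem _, g, hg, (zero_add _).symm⟩
  · rintro f ⟨h, hh, g, hg, rfl⟩
    refine (AM.loc hh).add ?_
    refine ⟨fun a a' => ?_, fun c a => ?_, fun a => ?_, fun b b' => ?_, fun c b => ?_, fun b b' => ?_⟩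
    · simp only [ia_delta, (AM.loc (hg _)).ia_add, delta_add]
    · simp only [ia_delta, (AM.loc (hg _)).ia_smul, delta_smul]
    · simp only [ia_delta, (AM.loc (hg _)).ia_self, delta_zero]
    · simp only [db_delta, (AM.loc (hg _)).db_add, delta_add, map_add]; abel
    · simp only [db_delta, (AM.loc (hg _)).db_smul, delta_smul, map_smul, smul_add]
    · simp only [db_delta, map_add]
      have : (fun x => Raw.db b (Raw.db b' (g x))) = fun x => Raw.db b' (Raw.db b (g x)) :=
        funext fun x => (AM.loc (hg x)).db_comm b b'
      rw [this]
      abel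
  · rintro f a ⟨h, hh, g, hg, rfl⟩
    refine ⟨Raw.ia a h, AM.ia hh a, Raw.ia a ∘ₗ g, fun b => AM.ia (hg b) a, ?_⟩
    rw [map_add, ia_delta]
    rfl
  · rintro f b ⟨h, hh, g, hg, rfl⟩
    refine ⟨Raw.db b h + g b, add_mem (AM.db hh b) (hg b), Raw.db b ∘ₗ g, fun b' => AM.db (hg b') b, ?_⟩
    rw [map_add, db_delta, add_assoc]
    rfl

lemma AM.eps {g : A →ₗ[ℂ] Raw A B M} (hg : ∀ b, g b ∈ AM A B M) : eps g ∈ AM A B M := by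
  refine AM.of_stable (fun f => ∃ h ∈ AM A B M, ∃ g : A →ₗ[ℂ] Raw A B M, (∀ b, g b ∈ AM A B M) ∧
    f = h + Raw.eps g) ?_ ?_ ?_ ⟨0, zero_mem _, g, hg, (zero_add _).symm⟩
  · rintro f ⟨h, hh, g, hg, rfl⟩
    refine (AM.loc hh).add ?_
    refine ⟨fun a a' => ?_, fun c a => ?_, fun a => ?_, fun b b' => ?_, fun c b => ?_, fun b b' => ?_⟩
    · simp only [ia_eps, (AM.loc (hg _)).ia_add, eps_add, map_add]; abel
    · simp only [ia_eps, (AM.loc (hg _)).ia_smul, eps_smul, map_smul, smul_sub]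
    · simp only [ia_eps, map_sub, (AM.loc (hg _)).ia_self, eps_zero]
      simp
    · simp only [db_eps, (AM.loc (hg _)).db_add, eps_add]
    · simp only [db_eps, (AM.loc (hg _)).db_smul, eps_smul]
    · simp only [db_eps]
      congr 1
      exact funext fun x => (AM.loc (hg x)).db_comm b b'
  · rintro f a ⟨h, hh, g, hg, rfl⟩
    refine ⟨Raw.ia a h + g a, add_mem (AM.ia hh a) (hg a), -(Raw.ia a ∘ₗ g),
      fun b' => neg_mem (AM.ia (hg b') a), ?_⟩
    have : Raw.eps (-(Raw.ia a ∘ₗ g) : A →ₗ[ℂ] Raw A B M) = -Raw.eps (fun a' => Raw.ia a (g a')) :=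
      eps_neg _
    rw [map_add, ia_eps, this]
    abel
  · rintro f b ⟨h, hh, g, hg, rfl⟩
    refine ⟨Raw.db b h, AM.db hh b, Raw.db b ∘ₗ g, fun b' => AM.db (hg b') b, ?_⟩
    rw [map_add, db_eps]
    rfl

/-- The method for all operator identities below: if the difference of the two sides, for f ranging
over all forms, is stable under contraction and vanishes on empty lists, it is zero. Only
commutators with contractions have to be computed. -/
lemma eq_zero_of_stable (C : Raw A B M → Prop) (h0 : ∀ f, C f → f [] [] = 0)
    (hia : ∀ f a, C f → C (Raw.ia a f)) (hdb : ∀ f b, C f → C (Raw.db b f)) {f : Raw A B M}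
    (hf : C f) : f = 0 := by
  funext l s
  induction l generalizing f with
  | nil =>
    induction s generalizing f with
    | nil => exact h0 f hf
    | cons b s ih => exact ih (hdb f b hf)
  | cons a l ih => exact ih (hia f a hf)

/-- `y f = δ(b ↦ i_{π b} f)`, the differential of Koszul complexes. -/
def yop (π : B →ₗ[ℂ] A) : Raw A B M →ₗ[ℂ] Raw A B M where
  toFun f := delta (fun b => ia (π b) f)
  map_add' f g := by simp only [map_add, delta_add]
  map_smul' c f := by simp only [map_smul, delta_smul, RingHom.id_apply]

/-- `x f = ε(a ↦ ∂_{σ a} f)`. -/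
def xop (σ : A →ₗ[ℂ] B) : Raw A B M →ₗ[ℂ] Raw A B M where
  toFun f := eps (fun a => db (σ a) f)
  map_add' f g := by simp only [map_add, eps_add]
  map_smul' c f := by simp only [map_smul, eps_smul, RingHom.id_apply]

/-- The derivation defined by an endomorphism of `A`. -/
def DA (τ : A →ₗ[ℂ] A) : Raw A B M →ₗ[ℂ] Raw A B M where
  toFun f := eps (fun a => ia (τ a) f)
  map_add' f g := by simp only [map_add, eps_add]
  map_smul' c f := by simp only [map_smul, eps_smul, RingHom.id_apply]

/-- The derivation defined by an endomorphism of `B`. -/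
def DB (τ : B →ₗ[ℂ] B) : Raw A B M →ₗ[ℂ] Raw A B M where
  toFun f := delta (fun b => db (τ b) f)
  map_add' f g := by simp only [map_add, delta_add]
  map_smul' c f := by simp only [map_smul, delta_smul, RingHom.id_apply]

/-- Exterior multiplication by a form that is linear in the symmetric variable. -/
def Yop (β : B →ₗ[ℂ] A →ₗ[ℂ] ℂ) : Raw A B M →ₗ[ℂ] Raw A B M where
  toFun f := delta (fun b => eps (fun a => β b a • f))
  map_add' f g := by simp only [smul_add, eps_add, delta_add]
  map_smul' c f := by
    simp only [smul_comm _ c f, eps_smul, delta_smul, RingHom.id_apply]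

section mem
variable {f : Raw A B M} (hf : f ∈ AM A B M)

lemma AM.yop (π : B →ₗ[ℂ] A) (hf : f ∈ AM A B M) : yop π f ∈ AM A B M :=
  AM.delta (g := iaL hf ∘ₗ π) fun b => AM.ia hf (π b)

lemma AM.xop (σ : A →ₗ[ℂ] B) (hf : f ∈ AM A B M) : xop σ f ∈ AM A B M :=
  AM.eps (g := dbL hf ∘ₗ σ) fun b => AM.db hf (σ b)

lemma AM.DB (τ : B →ₗ[ℂ] B) (hf : f ∈ AM A B M) : DB τ f ∈ AM A B M :=
  AM.delta (g := dbL hf ∘ₗ τ) fun b => AM.db hf (τ b)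

lemma AM.Yop (β : B →ₗ[ℂ] A →ₗ[ℂ] ℂ) (hf : f ∈ AM A B M) : Yop β f ∈ AM A B M :=
  AM.delta (g := { toFun := fun b => Raw.eps (fun a => β b a • f)
                   map_add' := fun b b' => by simp only [map_add, LinearMap.add_apply, add_smul, eps_add]
                   map_smul' := fun c b => by
                    simp only [map_smul, LinearMap.smul_apply, smul_eq_mul, mul_smul, eps_smul,
                      RingHom.id_apply] })
    fun b => AM.eps (g := (β b).smulRight f) fun a => Submodule.smul_mem _ _ hf

end mem

section commutators
variable (f : Raw A B M)

lemma db_yop (π : B →ₗ[ℂ] A) (w : B) : db w (yop π f) = ia (π w) f + yop π (db w f) := db_delta w _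

lemma ia_yop (π : B →ₗ[ℂ] A) (hf : f ∈ AM A B M) (a : A) : ia a (yop π f) = -yop π (ia a f) := by
  refine (ia_delta a _).trans ?_
  simp only [AM.ia_anticomm hf a]
  exact delta_neg _

lemma ia_xop (σ : A →ₗ[ℂ] B) (a : A) : ia a (xop σ f) = db (σ a) f - xop σ (ia a f) := ia_eps a _

lemma db_xop (σ : A →ₗ[ℂ] B) (hf : f ∈ AM A B M) (w : B) : db w (xop σ f) = xop σ (db w f) := by
  refine (db_eps w _).trans ?_
  simp only [(AM.loc hf).db_comm w]
  rfl

lemma ia_DA (τ : A →ₗ[ℂ] A) (hf : f ∈ AM A B M) (a : A) :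
    ia a (DA τ f) = ia (τ a) f + DA τ (ia a f) := by
  refine (ia_eps a _).trans ?_
  simp only [AM.ia_anticomm hf a, eps_neg, sub_neg_eq_add]
  rfl

lemma db_DA (τ : A →ₗ[ℂ] A) (w : B) : db w (DA τ f) = DA τ (db w f) := db_eps w _

lemma db_DB (τ : B →ₗ[ℂ] B) (hf : f ∈ AM A B M) (w : B) :
    db w (DB τ f) = db (τ w) f + DB τ (db w f) := by
  refine (db_delta w _).trans ?_
  simp only [(AM.loc hf).db_comm w]
  rfl

lemma ia_DB (τ : B →ₗ[ℂ] B) (a : A) : ia a (DB τ f) = DB τ (ia a f) := ia_delta a _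

lemma db_Yop (β : B →ₗ[ℂ] A →ₗ[ℂ] ℂ) (w : B) :
    db w (Yop β f) = eps (fun a => β w a • f) + Yop β (db w f) := by
  refine (db_delta w _).trans ?_
  simp only [db_eps, map_smul]
  rfl

lemma ia_Yop (β : B →ₗ[ℂ] A →ₗ[ℂ] ℂ) (a : A) :
    ia a (Yop β f) = delta (fun b => β b a • f) - Yop β (ia a f) := by
  refine (ia_delta a _).trans ?_
  simp only [ia_eps, map_smul, delta_sub]
  rfl

lemma DA_nil (τ : A →ₗ[ℂ] A) (s) : DA τ f [] s = 0 := eps_nil _ _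
lemma DB_nil (τ : B →ₗ[ℂ] B) (l) : DB τ f l [] = 0 := delta_nil _ _
lemma yop_nil (π : B →ₗ[ℂ] A) (l) : yop π f l [] = 0 := delta_nil _ _
lemma xop_nil (σ : A →ₗ[ℂ] B) (s) : xop σ f [] s = 0 := eps_nil _ _

variable {f}

/-- The Koszul homotopy formula. The anticommutator of the two opposite differentials is a sum of
derivations, whose eigenvalues control the exactness of every Koszul complex used here. -/
lemma xop_yop (π : B →ₗ[ℂ] A) (σ : A →ₗ[ℂ] B) (hf : f ∈ AM A B M) :
    xop σ (yop π f) + yop π (xop σ f) = DA (π ∘ₗ σ) f + DB (σ ∘ₗ π) f := by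
  rw [← sub_eq_zero]
  refine eq_zero_of_stable (fun z => ∃ f ∈ AM A B M, z = xop σ (yop π f) + yop π (xop σ f) -
    (DA (π ∘ₗ σ) f + DB (σ ∘ₗ π) f)) ?_ ?_ ?_ ⟨f, hf, rfl⟩
  · rintro _ ⟨f, hf, rfl⟩
    simp [DA_nil, DB_nil, yop_nil, xop_nil]
  · rintro _ a ⟨f, hf, rfl⟩
    refine ⟨ia a f, AM.ia hf a, ?_⟩
    simp only [map_sub, map_add, ia_xop, ia_yop _ _ (AM.xop σ hf), ia_yop _ _ hf, map_neg,
      ia_DA _ _ hf, ia_DB, db_yop, LinearMap.comp_apply]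
    abel
  · rintro _ w ⟨f, hf, rfl⟩
    refine ⟨db w f, AM.db hf w, ?_⟩
    simp only [map_sub, map_add, db_xop _ _ (AM.yop π hf), db_yop, db_DA, db_DB _ _ hf,
      ia_xop, db_xop _ _ hf, LinearMap.comp_apply]
    abel

lemma yop_yop (π : B →ₗ[ℂ] A) (hf : f ∈ AM A B M) : yop π (yop π f) = 0 := by
  refine eq_zero_of_stable (fun z => ∃ f ∈ AM A B M, z = yop π (yop π f)) ?_ ?_ ?_ ⟨f, hf, rfl⟩
  · rintro _ ⟨f, hf, rfl⟩
    simp [yop_nil]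
  · rintro _ a ⟨f, hf, rfl⟩
    refine ⟨ia a f, AM.ia hf a, ?_⟩
    rw [ia_yop _ _ (AM.yop π hf), ia_yop _ _ hf, map_neg, neg_neg]
  · rintro _ w ⟨f, hf, rfl⟩
    refine ⟨db w f, AM.db hf w, ?_⟩
    rw [db_yop, db_yop, ia_yop _ _ hf, map_add]
    abel

/-- An endomorphism acts on forms contragrediently, so the commutator is the derivation of the
opposite commutator. -/
lemma DB_comm (τ τ' : B →ₗ[ℂ] B) (hf : f ∈ AM A B M) :
    DB τ (DB τ' f) - DB τ' (DB τ f) = DB (τ' ∘ₗ τ) f - DB (τ ∘ₗ τ') f := by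
  rw [← sub_eq_zero]
  refine eq_zero_of_stable (fun z => ∃ f ∈ AM A B M, z = DB τ (DB τ' f) - DB τ' (DB τ f) -
    (DB (τ' ∘ₗ τ) f - DB (τ ∘ₗ τ') f)) ?_ ?_ ?_ ⟨f, hf, rfl⟩
  · rintro _ ⟨f, hf, rfl⟩
    simp [DB_nil]
  · rintro _ a ⟨f, hf, rfl⟩
    refine ⟨ia a f, AM.ia hf a, ?_⟩
    simp only [map_sub, ia_DB]
  · rintro _ w ⟨f, hf, rfl⟩
    refine ⟨db w f, AM.db hf w, ?_⟩
    simp only [map_sub, map_add, db_DB _ _ hf, db_DB _ _ (AM.DB τ hf), db_DB _ _ (AM.DB τ' hf),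
      LinearMap.comp_apply]
    abel

lemma DA_id (hf : f ∈ AM A B M) (l s) : DA LinearMap.id f l s = (l.length : ℂ) • f l s := by
  induction l generalizing f with
  | nil => simp [DA_nil]
  | cons a l ih =>
    have h1 := congrFun (congrFun (ia_DA f LinearMap.id hf a) l) s
    refine h1.trans ?_
    rw [Pi.add_apply, Pi.add_apply, ih (AM.ia hf a)]
    simp only [LinearMap.id_apply, List.length_cons, Nat.cast_add, Nat.cast_one, add_smul, one_smul]
    exact add_comm _ _

lemma DB_id (hf : f ∈ AM A B M) (l s) : DB LinearMap.id f l s = (s.length : ℂ) • f l s := by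
  induction s generalizing f with
  | nil => simp [DB_nil]
  | cons a s ih =>
    have h1 := congrFun (congrFun (db_DB f LinearMap.id hf a) l) s
    refine h1.trans ?_
    rw [Pi.add_apply, Pi.add_apply, ih (AM.db hf a)]
    simp only [LinearMap.id_apply, List.length_cons, Nat.cast_add, Nat.cast_one, add_smul, one_smul]
    exact add_comm _ _

end commutators

section pieri
variable {ι : Type*} [Fintype ι]

/-- Contraction with a tensor in `A ⊗ B`. -/
def Xop (q : ι → A) (s : ι → B) : Raw A B M →ₗ[ℂ] Raw A B M := ∑ t, ia (q t) ∘ₗ db (s t)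

lemma Xop_apply (q : ι → A) (s : ι → B) (f : Raw A B M) :
    Xop q s f = ∑ t, ia (q t) (db (s t) f) := by simp [Xop]

/-- Moving the contraction past the multiplication leaves three terms: both contracted variables
fall on β (the trace), or only the symmetric one does (a derivation of A, with a sign from
alternation), or only the alternating one does (a derivation of B). -/
lemma Xop_Yop (q : ι → A) (s : ι → B) (β : B →ₗ[ℂ] A →ₗ[ℂ] ℂ) {f : Raw A B M}
    (hf : f ∈ AM A B M) (τA : A →ₗ[ℂ] A) (τB : B →ₗ[ℂ] B)
    (hA : ∀ a, τA a = ∑ t, β (s t) a • q t) (hB : ∀ b, τB b = ∑ t, β b (q t) • s t) :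
    Xop q s (Yop β f) + Yop β (Xop q s f) = (∑ t, β (s t) (q t)) • f - DA τA f + DB τB f := by
  have e1 : DA τA f = ∑ t, eps (fun a => β (s t) a • ia (q t) f) := by
    rw [← eps_sum]
    change eps _ = _
    congr 1
    funext a
    rw [hA, ← iaL_apply hf, map_sum]
    simp only [map_smul, iaL_apply]
  have e2 : DB τB f = ∑ t, delta (fun b => β b (q t) • db (s t) f) := by
    rw [← delta_sum]
    change delta _ = _
    congr 1
    funext a
    rw [hB, ← dbL_apply hf, map_sum]
    simp only [map_smul, dbL_apply]
  simp only [Xop_apply, db_Yop, map_add, ia_Yop, ia_eps, map_smul, map_sum, e1, e2,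
    Finset.sum_add_distrib, Finset.sum_sub_distrib, Finset.sum_smul]
  abel

lemma Xop_DB (q : ι → A) (s : ι → B) (τ : B →ₗ[ℂ] B) {f : Raw A B M} (hf : f ∈ AM A B M) :
    Xop q s (DB τ f) = DB τ (Xop q s f) + Xop q (fun t => τ (s t)) f := by
  simp only [Xop_apply, db_DB _ _ hf, map_add, ia_DB, map_sum, Finset.sum_add_distrib]
  exact add_comm _ _

end pieri

section pull
variable {A' B' M' : Type*} [AddCommGroup A'] [Module ℂ A'] [AddCommGroup B'] [Module ℂ B']
  [AddCommGroup M'] [Module ℂ M']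

/-- Pullback along linear maps. -/
def pull (α : A' →ₗ[ℂ] A) (β : B' →ₗ[ℂ] B) (γ : M →ₗ[ℂ] M') : Raw A B M →ₗ[ℂ] Raw A' B' M' where
  toFun f l s := γ (f (l.map α) (s.map β))
  map_add' f g := by funext l s; simp
  map_smul' c f := by funext l s; simp

variable (α : A' →ₗ[ℂ] A) (β : B' →ₗ[ℂ] B) (γ : M →ₗ[ℂ] M') (f : Raw A B M)

lemma ia_pull (a : A') : ia a (pull α β γ f) = pull α β γ (ia (α a) f) := rfl
lemma db_pull (b : B') : db b (pull α β γ f) = pull α β γ (db (β b) f) := rfl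

variable {f} in
lemma AM.pull (hf : f ∈ AM A B M) : pull α β γ f ∈ AM A' B' M' := by
  refine AM.of_stable (fun z => ∃ f ∈ AM A B M, z = Raw.pull α β γ f) ?_ ?_ ?_ ⟨f, hf, rfl⟩
  · rintro _ ⟨f, hf, rfl⟩
    have h := AM.loc hf
    refine ⟨fun a a' => ?_, fun c a => ?_, fun a => ?_, fun b b' => ?_, fun c b => ?_, fun b b' => ?_⟩
    · simp only [ia_pull, map_add, h.ia_add]
    · simp only [ia_pull, map_smul, h.ia_smul]
    · simp only [ia_pull, h.ia_self, map_zero]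
    · simp only [db_pull, map_add, h.db_add]
    · simp only [db_pull, map_smul, h.db_smul]
    · simp only [db_pull]; rw [h.db_comm]
  · rintro _ a ⟨f, hf, rfl⟩
    exact ⟨_, AM.ia hf _, ia_pull _ _ _ _ _⟩
  · rintro _ a ⟨f, hf, rfl⟩
    exact ⟨_, AM.db hf _, db_pull _ _ _ _ _⟩

lemma pull_delta (g : B → Raw A B M) (g' : B' → Raw A' B' M')
    (h : ∀ b, g' b = pull α β γ (g (β b))) : pull α β γ (delta g) = delta g' := by
  funext l s
  induction s generalizing g g' with
  | nil =>
    rw [delta_nil]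
    change γ (delta g _ []) = 0
    rw [delta_nil, map_zero]
  | cons w s ih =>
    have h1 : ∀ b, db w (g' b) = pull α β γ ((fun b => db (β w) (g b)) (β b)) := fun b => by
      rw [h, db_pull]
    have := ih (fun b => db (β w) (g b)) (fun b => db w (g' b)) h1
    rw [delta_cons, ← this, h]
    change γ (delta g _ (_ :: _)) = _
    rw [delta_cons, map_add]
    rfl

lemma pull_eps (g : A → Raw A B M) (g' : A' → Raw A' B' M')
    (h : ∀ b, g' b = pull α β γ (g (α b))) : pull α β γ (eps g) = eps g' := by
  funext l s
  induction l generalizing g g' with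
  | nil =>
    rw [eps_nil]
    change γ (eps g [] _) = 0
    rw [eps_nil, map_zero]
  | cons w l ih =>
    have h1 : ∀ b, ia w (g' b) = pull α β γ ((fun b => ia (α w) (g b)) (α b)) := fun b => by
      rw [h, ia_pull]
    have := ih (fun b => ia (α w) (g b)) (fun b => ia w (g' b)) h1
    rw [eps_cons, ← this, h]
    change γ (eps g (_ :: _) _) = _
    rw [eps_cons, map_sub]
    rfl

lemma pull_yop (π : B →ₗ[ℂ] A) (π' : B' →ₗ[ℂ] A') (h : π ∘ₗ β = α ∘ₗ π') :
    pull α β γ (yop π f) = yop π' (pull α β γ f) :=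
  pull_delta _ _ _ _ _ fun b => by
    rw [ia_pull]
    exact congrArg (fun z => Raw.pull α β γ (ia z f)) (LinearMap.congr_fun h b).symm

lemma pull_xop (σ : A →ₗ[ℂ] B) (σ' : A' →ₗ[ℂ] B') (h : σ ∘ₗ α = β ∘ₗ σ') :
    pull α β γ (xop σ f) = xop σ' (pull α β γ f) :=
  pull_eps _ _ _ _ _ fun b => by
    rw [db_pull]
    exact congrArg (fun z => Raw.pull α β γ (db z f)) (LinearMap.congr_fun h b).symm

lemma pull_DB (τ : B →ₗ[ℂ] B) (τ' : B' →ₗ[ℂ] B') (h : τ ∘ₗ β = β ∘ₗ τ') :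
    pull α β γ (DB τ f) = DB τ' (pull α β γ f) :=
  pull_delta _ _ _ _ _ fun b => by
    rw [db_pull]
    exact congrArg (fun z => Raw.pull α β γ (db z f)) (LinearMap.congr_fun h b).symm

lemma pull_Yop (b : B →ₗ[ℂ] A →ₗ[ℂ] ℂ) (b' : B' →ₗ[ℂ] A' →ₗ[ℂ] ℂ)
    (h : ∀ x y, b (β x) (α y) = b' x y) : pull α β γ (Yop b f) = Yop b' (pull α β γ f) :=
  pull_delta _ _ _ _ _ fun x => (pull_eps _ _ _ _ _ fun y => by rw [map_smul, h]).symm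

end pull

section degree
variable {f : Raw A B M}

variable (A B M) in
/-- Functions that vanish on lists of other lengths. -/
def Deg (c m : ℕ) : Submodule ℂ (Raw A B M) where
  carrier := {f | ∀ l s, ¬ (l.length = c ∧ s.length = m) → f l s = 0}
  zero_mem' _ _ _ := rfl
  add_mem' hf hg l s h := by rw [Pi.add_apply, Pi.add_apply, hf l s h, hg l s h, add_zero]
  smul_mem' c f hf l s h := by rw [Pi.smul_apply, Pi.smul_apply, hf l s h, smul_zero]

lemma Deg.ia {c m : ℕ} (hf : f ∈ Deg A B M (c + 1) m) (a : A) : ia a f ∈ Deg A B M c m :=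
  fun l s h => hf (a :: l) s (by simpa using h)

lemma Deg.ia_zero {m : ℕ} (hf : f ∈ Deg A B M 0 m) (a : A) : Raw.ia a f = 0 :=
  funext fun l => funext fun s => hf (a :: l) s (by simp)

lemma Deg.db {c m : ℕ} (hf : f ∈ Deg A B M c (m + 1)) (b : B) : db b f ∈ Deg A B M c m :=
  fun l s h => hf l (b :: s) (by simpa using h)

lemma Deg.db_zero {c : ℕ} (hf : f ∈ Deg A B M c 0) (b : B) : Raw.db b f = 0 :=
  funext fun l => funext fun s => hf l (b :: s) (by simp)

lemma Deg.delta {c m : ℕ} {g : B → Raw A B M} (hg : ∀ b, g b ∈ Deg A B M c m) :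
    delta g ∈ Deg A B M c (m + 1) := by
  intro l s h
  induction s generalizing g m with
  | nil => exact delta_nil _ _
  | cons w s ih =>
    rw [delta_cons, hg w l s (by simpa using h), zero_add]
    cases m with
    | zero => simp only [Deg.db_zero (hg _)]; rw [delta_zero]; rfl
    | succ m => exact ih (fun b => Deg.db (hg b) w) (by simpa using h)

lemma Deg.eps {c m : ℕ} {g : A → Raw A B M} (hg : ∀ b, g b ∈ Deg A B M c m) :
    eps g ∈ Deg A B M (c + 1) m := by
  intro l s h
  induction l generalizing g c with
  | nil => exact eps_nil _ _
  | cons w l ih =>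
    rw [eps_cons, hg w l s (by simpa using h), zero_sub, neg_eq_zero]
    cases c with
    | zero => simp only [Deg.ia_zero (hg _)]; rw [eps_zero]; rfl
    | succ m => exact ih (fun b => Deg.ia (hg b) w) (by simpa using h)

end degree

variable (A B M) in
/-- Alternating `c`-forms on `A` and symmetric `m`-forms on `B`, with values in `M`. -/
def Phi (c m : ℕ) : Submodule ℂ (Raw A B M) := AM A B M ⊓ Deg A B M c m

namespace Phi
variable {c m : ℕ} {f : Raw A B M}

lemma ia (hf : f ∈ Phi A B M (c + 1) m) (a : A) : ia a f ∈ Phi A B M c m :=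
  ⟨AM.ia hf.1 a, Deg.ia hf.2 a⟩
lemma db (hf : f ∈ Phi A B M c (m + 1)) (b : B) : db b f ∈ Phi A B M c m :=
  ⟨AM.db hf.1 b, Deg.db hf.2 b⟩
lemma yop (hf : f ∈ Phi A B M (c + 1) m) (π : B →ₗ[ℂ] A) : yop π f ∈ Phi A B M c (m + 1) :=
  ⟨AM.yop π hf.1, Deg.delta fun _ => Deg.ia hf.2 _⟩
lemma yop_zero (hf : f ∈ Phi A B M 0 m) (π : B →ₗ[ℂ] A) : Raw.yop π f = 0 := by
  change delta _ = 0
  simp only [Deg.ia_zero hf.2]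
  exact delta_zero
lemma xop (hf : f ∈ Phi A B M c (m + 1)) (σ : A →ₗ[ℂ] B) : xop σ f ∈ Phi A B M (c + 1) m :=
  ⟨AM.xop σ hf.1, Deg.eps fun _ => Deg.db hf.2 _⟩
lemma DB_zero (hf : f ∈ Phi A B M c 0) (τ : B →ₗ[ℂ] B) : Raw.DB τ f = 0 := by
  change delta _ = 0
  simp only [Deg.db_zero hf.2]
  exact delta_zero
lemma DA_zero (hf : f ∈ Phi A B M 0 m) (τ : A →ₗ[ℂ] A) : Raw.DA τ f = 0 := by
  change eps _ = 0
  simp only [Deg.ia_zero hf.2]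
  exact eps_zero
lemma DB (hf : f ∈ Phi A B M c m) (τ : B →ₗ[ℂ] B) : DB τ f ∈ Phi A B M c m := by
  refine ⟨AM.DB τ hf.1, ?_⟩
  cases m with
  | zero => rw [DB_zero hf]; exact zero_mem _
  | succ c => exact Deg.delta fun _ => Deg.db hf.2 _
lemma Yop (hf : f ∈ Phi A B M c m) (β : B →ₗ[ℂ] A →ₗ[ℂ] ℂ) : Yop β f ∈ Phi A B M (c + 1) (m + 1) :=
  ⟨AM.Yop β hf.1, Deg.delta fun _ => Deg.eps fun _ => Submodule.smul_mem _ _ hf.2⟩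
lemma Xop {ι : Type*} [Fintype ι] (hf : f ∈ Phi A B M (c + 1) (m + 1)) (q : ι → A) (s : ι → B) :
    Xop q s f ∈ Phi A B M c m := by
  rw [Xop_apply]
  exact sum_mem fun t _ => Phi.ia (Phi.db hf _) _
lemma Xop_zero_left {ι : Type*} [Fintype ι] (hf : f ∈ Phi A B M 0 m) (q : ι → A) (s : ι → B) :
    Raw.Xop q s f = 0 := by
  rw [Xop_apply]
  exact Finset.sum_eq_zero fun t _ => by rw [ia_db, Deg.ia_zero hf.2, map_zero]
lemma Xop_zero_right {ι : Type*} [Fintype ι] (hf : f ∈ Phi A B M c 0) (q : ι → A) (s : ι → B) :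
    Raw.Xop q s f = 0 := by
  rw [Xop_apply]
  exact Finset.sum_eq_zero fun t _ => by rw [Deg.db_zero hf.2, map_zero]
lemma pull {A' B' M' : Type*} [AddCommGroup A'] [Module ℂ A'] [AddCommGroup B'] [Module ℂ B']
    [AddCommGroup M'] [Module ℂ M'] (hf : f ∈ Phi A B M c m) (α : A' →ₗ[ℂ] A) (β : B' →ₗ[ℂ] B)
    (γ : M →ₗ[ℂ] M') : pull α β γ f ∈ Phi A' B' M' c m :=
  ⟨AM.pull α β γ hf.1, fun l s h => by
    change γ (f _ _) = 0
    rw [hf.2 _ _ (by simpa using h), map_zero]⟩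

lemma DA_id (hf : f ∈ Phi A B M c m) : Raw.DA LinearMap.id f = (c : ℂ) • f := by
  funext l s
  rw [Raw.DA_id hf.1]
  by_cases h : l.length = c ∧ s.length = m
  · rw [h.1]; rfl
  · simp [hf.2 _ _ h]

lemma DB_id (hf : f ∈ Phi A B M c m) : Raw.DB LinearMap.id f = (m : ℂ) • f := by
  funext l s
  rw [Raw.DB_id hf.1]
  by_cases h : l.length = c ∧ s.length = m
  · rw [h.2]; rfl
  · simp [hf.2 _ _ h]

lemma eq_zero_of_db (hf : f ∈ Phi A B M c (m + 1)) (h : ∀ b, Raw.db b f = 0) : f = 0 := by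
  funext l s
  cases s with
  | nil => exact hf.2 _ _ (by simp)
  | cons b s => exact congrFun (congrFun (h b) l) s

lemma eq_zero_of_ia (hf : f ∈ Phi A B M (c + 1) m) (h : ∀ b, Raw.ia b f = 0) : f = 0 := by
  funext l s
  cases l with
  | nil => exact hf.2 _ _ (by simp)
  | cons b l => exact congrFun (congrFun (h b) l) s

lemma eq_zero_of_idempotent (hf : f ∈ AM A B M) {e : B →ₗ[ℂ] B} (he : ∀ b, e (e b) = e b)
    (h0 : ∀ w, e w = 0 → Raw.db w f = 0) (h1 : ∀ w, e w = w → Raw.db w f = 0) (b : B) :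
    Raw.db b f = 0 := by
  have : b = (b - e b) + e b := by abel
  rw [this, (AM.loc hf).db_add, h0 _ (by rw [map_sub, he, sub_self]), h1 _ (he b), add_zero]

lemma eq_zero_of_idempotent' (hf : f ∈ AM A B M) {e : A →ₗ[ℂ] A} (he : ∀ b, e (e b) = e b)
    (h0 : ∀ w, e w = 0 → Raw.ia w f = 0) (h1 : ∀ w, e w = w → Raw.ia w f = 0) (b : A) :
    Raw.ia b f = 0 := by
  have : b = (b - e b) + e b := by abel
  rw [this, (AM.loc hf).ia_add, h0 _ (by rw [map_sub, he, sub_self]), h1 _ (he b), add_zero]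

/-- For an idempotent e the derivation counts the variables in the image of e, so its eigenvalues
are nonnegative integers and -r is not one of them. Contraction with a vector of the image increases
r by one, contraction with a vector of the kernel keeps it; this is the induction. -/
lemma eq_zero_of_smul_add_DB {e : B →ₗ[ℂ] B} (he : ∀ b, e (e b) = e b) (r : ℕ) (hr : 0 < r)
    (hf : f ∈ Phi A B M c m) (h : (r : ℂ) • f + Raw.DB e f = 0) : f = 0 := by
  induction m generalizing f r with
  | zero =>
    rw [DB_zero hf, add_zero] at h
    exact (smul_eq_zero.1 h).resolve_left (by exact_mod_cast hr.ne')
  | succ m ih =>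
    have key : ∀ w, (r : ℂ) • Raw.db w f + (Raw.db (e w) f + Raw.DB e (Raw.db w f)) = 0 := fun w => by
      rw [← db_DB _ _ hf.1, ← map_smul, ← map_add, h, map_zero]
    refine eq_zero_of_db hf (eq_zero_of_idempotent hf.1 he (fun w hw => ?_) fun w hw => ?_)
    · refine ih r hr (Phi.db hf w) ?_
      have := key w
      rw [hw, AM.db_zero hf.1, zero_add] at this
      exact this
    · refine ih (r + 1) (by omega) (Phi.db hf w) ?_
      have := key w
      rw [hw, ← add_assoc] at this
      rw [Nat.cast_add, Nat.cast_one, add_smul, one_smul]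
      exact this

lemma eq_zero_of_smul_add_DA {e : A →ₗ[ℂ] A} (he : ∀ b, e (e b) = e b) (r : ℕ) (hr : 0 < r)
    (hf : f ∈ Phi A B M c m) (h : (r : ℂ) • f + Raw.DA e f = 0) : f = 0 := by
  induction c generalizing f r with
  | zero =>
    rw [DA_zero hf, add_zero] at h
    exact (smul_eq_zero.1 h).resolve_left (by exact_mod_cast hr.ne')
  | succ m ih =>
    have key : ∀ w, (r : ℂ) • Raw.ia w f + (Raw.ia (e w) f + Raw.DA e (Raw.ia w f)) = 0 := fun w => by
      rw [← ia_DA _ _ hf.1, ← map_smul, ← map_add, h, map_zero]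
    refine eq_zero_of_ia hf (eq_zero_of_idempotent' hf.1 he (fun w hw => ?_) fun w hw => ?_)
    · refine ih r hr (Phi.ia hf w) ?_
      have := key w
      rw [hw, AM.ia_zero hf.1, zero_add] at this
      exact this
    · refine ih (r + 1) (by omega) (Phi.ia hf w) ?_
      have := key w
      rw [hw, ← add_assoc] at this
      rw [Nat.cast_add, Nat.cast_one, add_smul, one_smul]
      exact this

/-- On forms with j variables in the image of e the derivation is multiplication by j, while the
pullback along 1 - e is the identity for j = 0 and zero for j > 0. The sum has eigenvalues max(j,
1), hence is injective. -/
lemma eq_zero_of_DB_add_pull {e : B →ₗ[ℂ] B} (he : ∀ b, e (e b) = e b)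
    (hf : f ∈ Phi A B M c m)
    (h : Raw.DB e f + Raw.pull LinearMap.id (LinearMap.id - e) LinearMap.id f = 0) : f = 0 := by
  induction m generalizing f with
  | zero =>
    rw [DB_zero hf, zero_add] at h
    funext l s
    cases s with
    | nil =>
      have := congrFun (congrFun h l) []
      simpa [Raw.pull] using this
    | cons b s => exact hf.2 _ _ (by simp)
  | succ m ih =>
    have key : ∀ w, Raw.db (e w) f + Raw.DB e (Raw.db w f) +
        Raw.pull LinearMap.id (LinearMap.id - e) LinearMap.id (Raw.db (w - e w) f) = 0 := fun w => by
      rw [← db_DB _ _ hf.1]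
      have h2 := db_pull LinearMap.id (LinearMap.id - e) LinearMap.id f w
      have h3 : ((LinearMap.id : B →ₗ[ℂ] B) - e) w = w - e w := rfl
      rw [h3] at h2
      rw [← h2, ← map_add, h, map_zero]
    refine eq_zero_of_db hf (eq_zero_of_idempotent hf.1 he (fun w hw => ?_) fun w hw => ?_)
    · refine ih (Phi.db hf w) ?_
      have := key w
      rw [hw, AM.db_zero hf.1, zero_add, sub_zero] at this
      exact this
    · refine eq_zero_of_smul_add_DB he 1 one_pos (Phi.db hf w) ?_
      have := key w
      rw [hw, sub_self, AM.db_zero hf.1, map_zero, add_zero] at this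
      rw [Nat.cast_one, one_smul]
      exact this

end Phi
end Raw
end LagGrass

end

/-! ### Regular representations of the stabilizer -/

noncomputable section
namespace LagGrass
variable {V : Type u} [AddCommGroup V] [Module ℂ V] {ω : LinearMap.BilinForm ℂ V} {n : ℕ}
variable {W : LagGrass ω n}

section reg
variable {U : Opens (space ω n)} {M M' N N' : Type*} [AddCommGroup M] [Module ℂ M]
  [AddCommGroup M'] [Module ℂ M'] [AddCommGroup N] [Module ℂ N] [AddCommGroup N'] [Module ℂ N']

/-- A linear retraction, which need not be equivariant, expresses the coordinates on the subspace
through those on the larger space. -/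
lemma RegHom.of_injective {f : N →ₗ[ℂ] M} (hf : Function.Injective f) {c : U → N →ₗ[ℂ] N}
    {c' : U → M →ₗ[ℂ] M} (h : ∀ x m, f (c x m) = c' x (f m)) (hc : RegHom c') : RegHom c := by
  intro m l
  obtain ⟨r, hr⟩ := f.exists_leftInverse_of_injective (LinearMap.ker_eq_bot.2 hf)
  have e : (fun x => l (c x m)) = fun x => (l ∘ₗ r) (c' x (f m)) := by
    funext x
    rw [← h, LinearMap.comp_apply]
    exact congrArg l (LinearMap.congr_fun hr (c x m)).symm
  rw [e]
  exact hc _ _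

lemma RegHom.of_surjective {f : M →ₗ[ℂ] N} (hf : Function.Surjective f) {c : U → N →ₗ[ℂ] N}
    {c' : U → M →ₗ[ℂ] M} (h : ∀ x m, c x (f m) = f (c' x m)) (hc : RegHom c') : RegHom c := by
  intro m l
  obtain ⟨m, rfl⟩ := hf m
  simp only [h]
  exact hc m (l ∘ₗ f)

lemma RegHom.regVec [FiniteDimensional ℂ M] {c : U → M →ₗ[ℂ] M'} (hc : RegHom c) : RegVec c := by
  let b := Module.finBasis ℂ M
  have e : c = fun x => ∑ i, LinearMap.smulRightₗ (b.coord i) (c x (b i)) := by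
    funext x
    refine b.ext fun j => ?_
    simp [Finsupp.single_apply]
  rw [e]
  exact RegVec.sum _ fun i _ => (hc (b i)).map _

end reg

/-- The inverse of a regular family. -/
def StabFam.inv {U : Opens (space ω n)} (p : StabFam W U) : StabFam W U where
  p x := (p.p x)⁻¹
  reg := p.reg_inv
  reg_inv := by
    simp only [inv_inv]
    exact p.reg

namespace RRep

/-- The tautological representation. -/
def vRep [FiniteDimensional ℂ V] (W : LagGrass ω n) : RRep W where
  carrier := V
  ρ := { toFun := fun p => ((p : V ≃ₗ[ℂ] V) : V →ₗ[ℂ] V)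
         map_one' := rfl
         map_mul' := fun _ _ => rfl }
  reg _ p := p.reg

lemma stab_mem (p : stab W) {v : V} (hv : v ∈ W.1) : (p : V ≃ₗ[ℂ] V) v ∈ W.1 := by
  have := p.2.2
  rw [← this]
  exact Submodule.mem_map_of_mem hv

/-- The fibre of the tautological subbundle. -/
def sRep [FiniteDimensional ℂ V] (W : LagGrass ω n) : RRep W where
  carrier := W.1
  ρ := { toFun := fun p => ((p : V ≃ₗ[ℂ] V) : V →ₗ[ℂ] V).restrict fun _ hv => stab_mem p hv
         map_one' := rfl
         map_mul' := fun _ _ => rfl }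
  reg _ p := RegHom.of_injective (f := W.1.subtype) W.1.injective_subtype (fun _ _ => rfl) p.reg

/-- The fibre of the tautological quotient bundle. -/
def qRep [FiniteDimensional ℂ V] (W : LagGrass ω n) : RRep W where
  carrier := V ⧸ W.1
  ρ := { toFun := fun p => W.1.mapQ W.1 ((p : V ≃ₗ[ℂ] V) : V →ₗ[ℂ] V) fun _ hv => stab_mem p hv
         map_one' := by ext; rfl
         map_mul' := fun _ _ => by ext; rfl }
  reg _ p := RegHom.of_surjective (f := W.1.mkQ) W.1.mkQ_surjective (fun _ _ => rfl) p.reg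

/-- The trivial representation. -/
def triv (W : LagGrass ω n) : RRep W where
  carrier := ULift.{u} ℂ
  ρ := 1
  reg _ _ := RegHom.const _

lemma ρ_inv_apply (M : RRep W) (p : stab W) (m : M) : M.ρ p (M.ρ p⁻¹ m) = m := by
  rw [← Module.End.mul_apply, ← map_mul, mul_inv_cancel, map_one, Module.End.one_apply]

lemma ρ_apply_inv (M : RRep W) (p : stab W) (m : M) : M.ρ p⁻¹ (M.ρ p m) = m := by
  rw [← Module.End.mul_apply, ← map_mul, inv_mul_cancel, map_one, Module.End.one_apply]

/-- Linear maps between two representations. -/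
def homRep (M M' : RRep W) : RRep W where
  carrier := M →ₗ[ℂ] M'
  ρ := { toFun := fun p =>
          { toFun := fun f => M'.ρ p ∘ₗ f ∘ₗ M.ρ p⁻¹
            map_add' := fun f g => by ext; simp
            map_smul' := fun c f => by ext; simp }
         map_one' := by ext; simp
         map_mul' := fun p p' => by ext; simp }
  reg U p f := RegHom.regVec ((M'.reg U p).comp ((RegHom.const f).comp (M.reg U p.inv)))

/-- Powers of a representation. -/
def piRep (r : ℕ) (M : RRep W) : RRep W where
  carrier := Fin r → M
  ρ := { toFun := fun p => LinearMap.pi fun i => M.ρ p ∘ₗ LinearMap.proj i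
         map_one' := by ext; simp
         map_mul' := fun p p' => by ext; simp }
  reg U p f := by
    have e : (fun x => (LinearMap.pi fun i => M.ρ (p.p x) ∘ₗ LinearMap.proj i) f) =
        fun x => ∑ i, LinearMap.single ℂ (fun _ : Fin r => M.carrier) i (M.ρ (p.p x) (f i)) := by
      funext x j
      simp [Finset.sum_apply, Pi.single_apply]
    exact e ▸ RegVec.sum _ fun i _ => (M.reg U p (f i)).map _

/-- The sum of two representations. -/
def prodRep (M M' : RRep W) : RRep W where
  carrier := M × M'
  ρ := { toFun := fun p => (M.ρ p).prodMap (M'.ρ p)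
         map_one' := by ext <;> simp
         map_mul' := fun p p' => by ext <;> simp }
  reg U p f := by
    have e : (fun x => ((M.ρ (p.p x)).prodMap (M'.ρ (p.p x))) f) =
        fun x => LinearMap.inl ℂ M M' (M.ρ (p.p x) f.1) + LinearMap.inr ℂ M M' (M'.ρ (p.p x) f.2) := by
      funext x
      ext <;> simp
    exact e ▸ ((M.reg U p f.1).map _).add ((M'.reg U p f.2).map _)

/-- The kernel of an equivariant map. -/
def kerRep {M M' : RRep W} (f : M →ₗ[ℂ] M') (hf : ∀ (p : stab W) m, f (M.ρ p m) = M'.ρ p (f m)) :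
    RRep W where
  carrier := LinearMap.ker f
  ρ := { toFun := fun p => (M.ρ p).restrict fun m hm => by
          rw [LinearMap.mem_ker] at hm ⊢
          rw [hf, hm, map_zero]
         map_one' := by ext; simp
         map_mul' := fun p p' => by ext; simp }
  reg U p := RegHom.of_injective (f := (LinearMap.ker f).subtype) (Submodule.injective_subtype _)
    (fun _ _ => rfl) (M.reg U p)

end RRep

section phi
open Raw

variable (A B M : RRep W)

/-- The action of the stabilizer on functions of lists. -/
def rawAct (p : stab W) : Raw A B M →ₗ[ℂ] Raw A B M := pull (A.ρ p⁻¹) (B.ρ p⁻¹) (M.ρ p)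

lemma rawAct_apply (p : stab W) (f : Raw A B M) (l : List A) (s : List B) :
    rawAct A B M p f l s = M.ρ p (f (l.map (A.ρ p⁻¹)) (s.map (B.ρ p⁻¹))) := rfl

lemma rawAct_one (f : Raw A B M) : rawAct A B M 1 f = f := by
  funext l s
  have h (N : RRep W) : (N.ρ (1 : stab W)⁻¹ : N → N) = id := by
    funext x; rw [inv_one, map_one]; rfl
  rw [rawAct_apply, h, h, List.map_id, List.map_id, map_one]
  rfl

lemma rawAct_mul (p p' : stab W) (f : Raw A B M) :
    rawAct A B M (p * p') f = rawAct A B M p (rawAct A B M p' f) := by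
  funext l s
  have h (N : RRep W) : (N.ρ (p * p')⁻¹ : N → N) = N.ρ p'⁻¹ ∘ N.ρ p⁻¹ := by
    funext x; rw [mul_inv_rev, map_mul]; rfl
  rw [rawAct_apply, rawAct_apply, rawAct_apply, h, h, ← List.map_map, ← List.map_map, map_mul]
  rfl

/-- The action of the stabilizer on alternating and symmetric forms. -/
def phiAct (c m : ℕ) : stab W →* Module.End ℂ (Phi A B M c m) where
  toFun p := (rawAct A B M p).restrict fun _ hf => Phi.pull hf _ _ _
  map_one' := by
    ext f : 2
    exact rawAct_one A B M f.1
  map_mul' p p' := by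
    ext f : 2
    exact rawAct_mul A B M p p' f.1

/-- Contraction in the first alternating variable. -/
def curryA (A B M : Type*) [AddCommGroup A] [Module ℂ A] [AddCommGroup B] [Module ℂ B]
    [AddCommGroup M] [Module ℂ M] (c m : ℕ) :
    Phi A B M (c + 1) m →ₗ[ℂ] A →ₗ[ℂ] Phi A B M c m where
  toFun f :=
    { toFun := fun a => ⟨ia a f.1, Phi.ia f.2 a⟩
      map_add' := fun a a' => Subtype.ext ((AM.loc f.2.1).ia_add a a')
      map_smul' := fun c a => Subtype.ext ((AM.loc f.2.1).ia_smul c a) }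
  map_add' _ _ := rfl
  map_smul' _ _ := rfl

/-- Contraction in the first symmetric variable. -/
def curryB (A B M : Type*) [AddCommGroup A] [Module ℂ A] [AddCommGroup B] [Module ℂ B]
    [AddCommGroup M] [Module ℂ M] (c m : ℕ) :
    Phi A B M c (m + 1) →ₗ[ℂ] B →ₗ[ℂ] Phi A B M c m where
  toFun f :=
    { toFun := fun a => ⟨db a f.1, Phi.db f.2 a⟩
      map_add' := fun a a' => Subtype.ext ((AM.loc f.2.1).db_add a a')
      map_smul' := fun c a => Subtype.ext ((AM.loc f.2.1).db_smul c a) }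
  map_add' _ _ := rfl
  map_smul' _ _ := rfl

/-- Evaluation on empty lists. -/
def evalNil (A B M : Type*) [AddCommGroup A] [Module ℂ A] [AddCommGroup B] [Module ℂ B]
    [AddCommGroup M] [Module ℂ M] : Phi A B M 0 0 →ₗ[ℂ] M where
  toFun f := f.1 [] []
  map_add' _ _ := rfl
  map_smul' _ _ := rfl

section inj
variable (A B M : Type*) [AddCommGroup A] [Module ℂ A] [AddCommGroup B] [Module ℂ B]
    [AddCommGroup M] [Module ℂ M] (c m : ℕ)

lemma curryA_injective : Function.Injective (curryA A B M c m) := by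
  rw [injective_iff_map_eq_zero]
  intro f hf
  exact Subtype.ext (Phi.eq_zero_of_ia f.2 fun a =>
    congrArg Subtype.val (LinearMap.congr_fun hf a))

lemma curryB_injective : Function.Injective (curryB A B M c m) := by
  rw [injective_iff_map_eq_zero]
  intro f hf
  exact Subtype.ext (Phi.eq_zero_of_db f.2 fun a =>
    congrArg Subtype.val (LinearMap.congr_fun hf a))

lemma evalNil_injective : Function.Injective (evalNil A B M) := by
  rw [injective_iff_map_eq_zero]
  intro f hf
  refine Subtype.ext (funext fun l => funext fun s => ?_)
  by_cases h : l.length = 0 ∧ s.length = 0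
  · rw [List.length_eq_zero_iff.1 h.1, List.length_eq_zero_iff.1 h.2]
    exact hf
  · exact f.2.2 l s h

instance Phi.finiteDimensional [FiniteDimensional ℂ A] [FiniteDimensional ℂ B]
    [FiniteDimensional ℂ M] : FiniteDimensional ℂ (Phi A B M c m) := by
  induction c with
  | zero =>
    induction m with
    | zero => exact Module.Finite.of_injective _ (evalNil_injective A B M)
    | succ m ih => exact Module.Finite.of_injective _ (curryB_injective A B M 0 m)
  | succ c ih => exact Module.Finite.of_injective _ (curryA_injective A B M c m)

end inj

/-- Contraction in one variable embeds forms into linear maps to forms of lower degree, where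
regularity is known by induction; at degree zero one is left with the values in M. -/
lemma phiAct_reg (c m : ℕ) (U : Opens (space ω n)) (p : StabFam W U) :
    RegHom (fun x => phiAct A B M c m (p.p x)) := by
  induction c with
  | zero =>
    induction m with
    | zero => exact RegHom.of_injective (evalNil_injective A B M) (fun _ _ => rfl) (M.reg U p)
    | succ m ih =>
      let c' : U → (B →ₗ[ℂ] Phi A B M 0 m) →ₗ[ℂ] (B →ₗ[ℂ] Phi A B M 0 m) := fun x =>
        { toFun := fun f => phiAct A B M 0 m (p.p x) ∘ₗ f ∘ₗ B.ρ (p.p x)⁻¹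
          map_add' := fun f g => by ext; simp
          map_smul' := fun c f => by ext; simp }
      have h : ∀ x f, curryB A B M 0 m (phiAct A B M 0 (m + 1) (p.p x) f) =
          c' x (curryB A B M 0 m f) := fun x f => LinearMap.ext fun b => Subtype.ext rfl
      refine RegHom.of_injective (M := B →ₗ[ℂ] Phi A B M 0 m) (f := curryB A B M 0 m)
        (curryB_injective A B M 0 m) h ?_
      exact fun f => RegHom.regVec (ih.comp ((RegHom.const f).comp (B.reg U p.inv)))
  | succ c ih =>
    let c' : U → (A →ₗ[ℂ] Phi A B M c m) →ₗ[ℂ] (A →ₗ[ℂ] Phi A B M c m) := fun x =>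
      { toFun := fun f => phiAct A B M c m (p.p x) ∘ₗ f ∘ₗ A.ρ (p.p x)⁻¹
        map_add' := fun f g => by ext; simp
        map_smul' := fun c f => by ext; simp }
    have h : ∀ x f, curryA A B M c m (phiAct A B M (c + 1) m (p.p x) f) =
        c' x (curryA A B M c m f) := fun x f => LinearMap.ext fun b => Subtype.ext rfl
    refine RegHom.of_injective (M := A →ₗ[ℂ] Phi A B M c m) (f := curryA A B M c m)
      (curryA_injective A B M c m) h ?_
    exact fun f => RegHom.regVec (ih.comp ((RegHom.const f).comp (A.reg U p.inv)))

/-- The representation of alternating `c`-forms on `A` and symmetric `m`-forms on `B` with values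
in `M`. -/
def RRep.phi (c m : ℕ) : RRep W where
  carrier := Phi A B M c m
  ρ := phiAct A B M c m
  reg := phiAct_reg A B M c m

variable {A B M} {A' B' M' : RRep W}

/-- Equivariant operators on forms. -/
def BMap.phi (T : Raw A B M →ₗ[ℂ] Raw A' B' M') (c m c' m' : ℕ)
    (h : ∀ f ∈ Phi A B M c m, T f ∈ Phi A' B' M' c' m')
    (hT : ∀ (p : stab W), ∀ f ∈ Phi A B M c m, T (rawAct A B M p f) = rawAct A' B' M' p (T f)) :
    BMap (RRep.phi A B M c m) (RRep.phi A' B' M' c' m') :=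
  BMap.const (T.restrict h) fun p f => Subtype.ext (hT p f.1 f.2)

end phi

/-- Alternating `c`-forms on the fibre of the quotient bundle. -/
def RRep.alt [FiniteDimensional ℂ V] (c : ℕ) (M : RRep W) : RRep W :=
  RRep.phi (RRep.qRep W) (RRep.qRep W) M c 0

section
variable [FiniteDimensional ℂ V] {M M' M'' : RRep W}
open Raw

lemma RegVec.of_injective {U : Opens (space ω n)} {N N' : Type*} [AddCommGroup N] [Module ℂ N]
    [AddCommGroup N'] [Module ℂ N'] {f : N →ₗ[ℂ] N'} (hf : Function.Injective f) {v : U → N}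
    (h : RegVec fun x => f (v x)) : RegVec v := by
  intro l
  obtain ⟨r, hr⟩ := f.exists_leftInverse_of_injective (LinearMap.ker_eq_bot.2 hf)
  have e : (fun x => l (v x)) = fun x => (l ∘ₗ r) (f (v x)) := by
    funext x
    rw [LinearMap.comp_apply]
    exact congrArg l (LinearMap.congr_fun hr (v x)).symm
  rw [e]
  exact h _

/-- Composition with a linear map of the values. -/
def Phi.mapVal {A B M M' : Type*} [AddCommGroup A] [Module ℂ A] [AddCommGroup B] [Module ℂ B]
    [AddCommGroup M] [Module ℂ M] [AddCommGroup M'] [Module ℂ M'] (c m : ℕ) (γ : M →ₗ[ℂ] M') :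
    Phi A B M c m →ₗ[ℂ] Phi A B M' c m :=
  (pull LinearMap.id LinearMap.id γ).restrict fun _ hf => Phi.pull hf _ _ _

lemma Phi.mapVal_apply {A B M M' : Type*} [AddCommGroup A] [Module ℂ A] [AddCommGroup B]
    [Module ℂ B] [AddCommGroup M] [Module ℂ M] [AddCommGroup M'] [Module ℂ M'] (c m : ℕ)
    (γ : M →ₗ[ℂ] M') (f : Phi A B M c m) (l s) : (Phi.mapVal c m γ f).1 l s = γ (f.1 l s) := by
  change γ (f.1 (l.map _) (s.map _)) = _
  simp

lemma Phi.mapVal_regHom {U : Opens (space ω n)} {A B M M' : Type*} [AddCommGroup A] [Module ℂ A]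
    [AddCommGroup B] [Module ℂ B] [AddCommGroup M] [Module ℂ M] [AddCommGroup M'] [Module ℂ M']
    [FiniteDimensional ℂ A] [FiniteDimensional ℂ B] (c m : ℕ) {γ : U → M →ₗ[ℂ] M'}
    (hγ : RegHom γ) : RegHom (fun x => Phi.mapVal (A := A) (B := B) c m (γ x)) := by
  induction c with
  | zero =>
    induction m with
    | zero => 
      intro f
      refine RegVec.of_injective (evalNil_injective A B M') ?_
      exact hγ (f.1 [] [])
    | succ m ih =>
      intro f
      refine RegVec.of_injective (curryB_injective A B M' 0 m) (RegHom.regVec fun b => ?_)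
      exact ih (curryB A B M 0 m f b)
  | succ c ih =>
    intro f
    refine RegVec.of_injective (curryA_injective A B M' c m) (RegHom.regVec fun b => ?_)
    exact ih (curryA A B M c m f b)

/-- Functoriality of alternating forms in the values. -/
def BMap.alt (c : ℕ) (a : BMap M M') : BMap (RRep.alt c M) (RRep.alt c M') :=
  ⟨fun g => Phi.mapVal c 0 (a.1 g), fun g p => by
    ext f : 1
    refine Subtype.ext (funext fun l => funext fun s => ?_)
    refine (congrArg (M'.ρ p) (Phi.mapVal_apply c 0 _ f _ _)).trans
      (Eq.trans ?_ (Phi.mapVal_apply c 0 _ _ _ _).symm)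
    exact LinearMap.congr_fun (a.2.1 g p) _,
    fun U φ => Phi.mapVal_regHom c 0 (a.2.2 U φ)⟩

end
end LagGrass

end

/-! ### Cohomology of twists: functoriality, exactness, iterated forms -/

noncomputable section
namespace LagGrass
variable {V : Type u} [AddCommGroup V] [Module ℂ V] {ω : LinearMap.BilinForm ℂ V} {n : ℕ}
variable [FiniteDimensional ℂ V] {W : LagGrass ω n}

/-- Cohomology of the twist of a sheaf by a representation. -/
def coh (F : Mod ω n) (M : RRep W) (q : ℕ) : Type u := Sheaf.H.{u} (ab (tw F M)) q

instance (F : Mod ω n) (M : RRep W) (q : ℕ) : AddCommGroup (coh F M q) :=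
  inferInstanceAs (AddCommGroup (Sheaf.H.{u} (ab (tw F M)) q))

namespace BMap
variable {M M' M'' M₃ : RRep W}

lemma comp_id (a : BMap M M') : a.comp (BMap.id M) = a := BMap.ext fun _ _ => rfl
lemma id_comp (a : BMap M M') : (BMap.id M').comp a = a := BMap.ext fun _ _ => rfl
lemma comp_smul (b : BMap M' M'') (c : ℂ) (a : BMap M M') : b.comp (c • a) = c • b.comp a :=
  BMap.ext fun g m => map_smul (b.1 g) c (a.1 g m)
lemma smul_comp (b : BMap M' M'') (c : ℂ) (a : BMap M M') : (c • b).comp a = c • b.comp a := rfl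

end BMap

namespace coh
variable {F : Mod ω n} {M M' M'' : RRep W} {q : ℕ}

/-- The additive map induced on cohomology. -/
def mapAdd (a : BMap M M') : coh F M q →+ coh F M' q := Sheaf.H.map.{u} (tw.map F a) q

lemma mapAdd_comp (b : BMap M' M'') (a : BMap M M') (x : coh F M q) :
    mapAdd (b.comp a) x = mapAdd b (mapAdd a x) := by
  change Sheaf.H.map (tw.map F (b.comp a)) q x = _
  rw [tw.map_comp]
  exact Sheaf.H.map_comp_apply _ _ _

lemma mapAdd_id (x : coh F M q) : mapAdd (BMap.id M) x = x := by
  change Sheaf.H.map (tw.map F (BMap.id M)) q x = _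
  rw [tw.map_id]
  exact Sheaf.H.map_id_apply _

lemma mapAdd_add (a b : BMap M M') (x : coh F M q) :
    mapAdd (a + b) x = mapAdd a x + mapAdd b x := by
  change Sheaf.H.map (tw.map F (a + b)) q x = _
  rw [tw.map_add]
  exact Sheaf.H.map_add_apply _ _ _

/-- The action of scalars on cohomology. -/
def scalar (F : Mod ω n) (M : RRep W) (q : ℕ) : ℂ →+* AddMonoid.End (coh F M q) where
  toFun c := mapAdd (c • BMap.id M)
  map_one' := by
    ext x
    rw [one_smul]
    exact mapAdd_id x
  map_mul' c d := by
    ext x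
    refine Eq.trans ?_ (mapAdd_comp (c • BMap.id M) (d • BMap.id M) x)
    rw [mul_smul]
    rfl
  map_zero' := by
    ext x
    rw [zero_smul]
    have := mapAdd_add (0 : BMap M M) 0 x
    rw [add_zero] at this
    exact left_eq_add.1 this
  map_add' c d := by
    ext x
    rw [add_smul]
    exact mapAdd_add _ _ x

/-- Scalars act through endomorphisms of the representation. Cohomology becomes a complex vector
space on which maps of representations act linearly, as eigenvalue arguments require. -/
instance : Module ℂ (coh F M q) := Module.compHom _ (scalar F M q)

lemma smul_def (c : ℂ) (x : coh F M q) : c • x = mapAdd (c • BMap.id M) x := rfl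

variable (F q) in
/-- The map induced on cohomology. -/
def map (a : BMap M M') : coh F M q →ₗ[ℂ] coh F M' q :=
  { mapAdd a with
    map_smul' := fun c x => by
      change mapAdd a (c • x) = c • mapAdd a x
      rw [smul_def, smul_def, ← mapAdd_comp, ← mapAdd_comp, BMap.comp_smul, BMap.smul_comp,
        BMap.comp_id, BMap.id_comp] }

lemma map_comp (b : BMap M' M'') (a : BMap M M') : map F q (b.comp a) = map F q b ∘ₗ map F q a :=
  LinearMap.ext fun x => mapAdd_comp b a x

lemma map_id : map F q (BMap.id M) = LinearMap.id := LinearMap.ext fun x => mapAdd_id x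

lemma map_add (a b : BMap M M') : map F q (a + b) = map F q a + map F q b :=
  LinearMap.ext fun x => mapAdd_add a b x

lemma map_smul (c : ℂ) (a : BMap M M') : map F q (c • a) = c • map F q a :=
  LinearMap.ext fun x => by
    change mapAdd (c • a) x = c • mapAdd a x
    rw [smul_def, ← mapAdd_comp, BMap.smul_comp, BMap.id_comp]

variable (F q M M') in
/-- The map induced on cohomology, as a linear function. -/
def mapL : BMap M M' →ₗ[ℂ] coh F M q →ₗ[ℂ] coh F M' q where
  toFun := map F q
  map_add' := map_add
  map_smul' := map_smul

lemma subsingleton_of_retract (a : BMap M M') (b : BMap M' M) (h : b.comp a = BMap.id M)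
    (hM : Subsingleton (coh F M' q)) : Subsingleton (coh F M q) := by
  refine subsingleton_of_forall_eq 0 fun x => ?_
  have : map F q (BMap.id M) x = x := by rw [map_id]; rfl
  rw [← this, ← h, map_comp, LinearMap.comp_apply, Subsingleton.elim (map F q a x) 0, _root_.map_zero]

end coh

/-- Equivariance of a linear map. -/
def Eqv {M M' : RRep W} (f : M →ₗ[ℂ] M') : Prop :=
  ∀ (p : stab W) m, f (M.ρ p m) = M'.ρ p (f m)

/-- Short exact sequences of representations. -/
def SES {M M' M'' : RRep W} (a : BMap M M') (b : BMap M' M'') : Prop :=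
  ∃ (f : M →ₗ[ℂ] M') (hf : Eqv f) (g : M' →ₗ[ℂ] M'') (hg : Eqv g), a = BMap.const f hf ∧
    b = BMap.const g hg ∧ Function.Injective f ∧ Function.Surjective g ∧ Function.Exact f g

/-- The splitting is only linear. This is enough, since in a frame the twist is a power of F. -/
lemma exists_splitting {M M' M'' : Type*} [AddCommGroup M] [Module ℂ M] [AddCommGroup M']
    [Module ℂ M'] [AddCommGroup M''] [Module ℂ M''] {f : M →ₗ[ℂ] M'} {g : M' →ₗ[ℂ] M''}
    (hf : Function.Injective f) (hg : Function.Surjective g) (h : Function.Exact f g) :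
    ∃ (r : M' →ₗ[ℂ] M) (σ : M'' →ₗ[ℂ] M'), r ∘ₗ f = LinearMap.id ∧ g ∘ₗ σ = LinearMap.id ∧
      f ∘ₗ r + σ ∘ₗ g = LinearMap.id := by
  obtain ⟨r, hr⟩ := f.exists_leftInverse_of_injective (LinearMap.ker_eq_bot.2 hf)
  obtain ⟨σ, hσ⟩ := g.exists_rightInverse_of_surjective (LinearMap.range_eq_top.2 hg)
  have hgf : ∀ m, g (f m) = 0 := fun m => (h _).2 ⟨m, rfl⟩
  have hr' : ∀ m, r (f m) = m := fun m => LinearMap.congr_fun hr m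
  have hσ' : ∀ m, g (σ m) = m := fun m => LinearMap.congr_fun hσ m
  refine ⟨r, σ - f ∘ₗ r ∘ₗ σ, hr, ?_, ?_⟩
  · ext m
    simp [hgf, hσ']
  · ext m
    obtain ⟨y, hy⟩ := (h (m - σ (g m))).1 (by rw [map_sub, hσ', sub_self])
    have h1 : r m - r (σ (g m)) = y := by rw [← map_sub, ← hy, hr']
    have h2 : f (r m) - f (r (σ (g m))) = m - σ (g m) := by rw [← map_sub, h1, hy]
    simp only [LinearMap.add_apply, LinearMap.comp_apply, LinearMap.sub_apply, LinearMap.id_apply]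
    rw [show f (r m) + (σ (g m) - f (r (σ (g m)))) = (f (r m) - f (r (σ (g m)))) + σ (g m) by abel, h2,
      sub_add_cancel]

variable (W) in
/-- Local existence of frames. -/
def HasFrames : Prop := ∀ x : space ω n, ∃ U : Opens (space ω n), x ∈ U ∧ Nonempty (Frame W U)

section ses
variable {F : Mod ω n} {M M' M'' : RRep W}

lemma RHom.const_act_const {U : Opens (space ω n)} (f : M →ₗ[ℂ] M') (g : M' →ₗ[ℂ] M'')
    (s : VSec F M U) : (RHom.const U g).act ((RHom.const U f).act s) =
      (RHom.const U (g ∘ₗ f)).act s := RHom.act_act _ _ _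

lemma tw.map_zero_of_comp (a : BMap M M') (b : BMap M' M'') (h : b.comp a = 0) :
    tw.map F a ≫ tw.map F b = 0 := by
  rw [← tw.map_comp, h]
  have := tw.map_add (F := F) (0 : BMap M M'') 0
  rw [add_zero] at this
  exact left_eq_add.1 this

lemma SES.comp_eq_zero {a : BMap M M'} {b : BMap M' M''} (h : SES a b) : b.comp a = 0 := by
  obtain ⟨f, hf, g, hg, rfl, rfl, -, -, hfg⟩ := h
  exact BMap.ext fun _ m => (hfg _).2 ⟨m, rfl⟩

/-- In each frame the three twists are powers of F, and the maps are constant matrices split by r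
and σ. Surjectivity is local and uses a frame near the given point. -/
lemma SES.shortExact (hfr : HasFrames W) {a : BMap M M'} {b : BMap M' M''} (h : SES a b) :
    (ShortComplex.mk (tw.map F a) (tw.map F b)
      (tw.map_zero_of_comp a b h.comp_eq_zero)).ShortExact := by
  obtain ⟨f, hf, g, hg, rfl, rfl, hfi, hgs, hfg⟩ := h
  obtain ⟨r, σ, hr, hσ, hrσ⟩ := exists_splitting hfi hgs hfg
  have key : ∀ {U : Opens (space ω n)} (v : VSec F M U),
      (RHom.const U r).act ((RHom.const U f).act v) = v := fun v => by
    rw [RHom.const_act_const, hr, RHom.act_const_id]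
  have inj : ∀ {U : Opens (space ω n)} {v w : VSec F M U},
      (RHom.const U f).act v = (RHom.const U f).act w → v = w := fun {U v w} hvw => by
    rw [← key v, hvw, key w]
  apply shortExact_of_sections
  · intro U
    rw [injective_iff_map_eq_zero]
    intro s hs
    refine secF.ext_frame fun U' h φ => inj ?_
    have h1 := congrArg (fun z : secF F M' U => z.1 U' h φ) hs
    refine Eq.trans ?_ (_root_.map_zero (RHom.const U' f).act).symm
    exact h1
  · intro U s hs
    have hs' : ∀ U' h φ, (RHom.const U' g).act ((s : secF F M' U).1 U' h φ) = 0 := fun U' h φ =>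
      congrArg (fun z : secF F M'' U => z.1 U' h φ) hs
    have lift : ∀ U' h φ, (RHom.const U' f).act ((RHom.const U' r).act
        ((s : secF F M' U).1 U' h φ)) = (s : secF F M' U).1 U' h φ := by
      intro U' h φ
      have h1 : (RHom.const U' f).comp (RHom.const U' r) + (RHom.const U' σ).comp (RHom.const U' g) =
          RHom.const U' LinearMap.id := by
        rw [← hrσ]; rfl
      have h2 := RHom.act_add_left ((RHom.const U' f).comp (RHom.const U' r))
        ((RHom.const U' σ).comp (RHom.const U' g)) ((s : secF F M' U).1 U' h φ)
      rw [h1, RHom.act_const_id, ← RHom.act_act, ← RHom.act_act, hs', _root_.map_zero, add_zero] at h2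
      exact h2.symm
    refine ⟨(⟨fun U' h φ => (RHom.const U' r).act ((s : secF F M' U).1 U' h φ),
      fun U' h φ U'' h' => ?_, fun U' h φ φ' => ?_⟩ : secF F M U), ?_⟩
    · beta_reduce
      refine (congrArg _ ((s : secF F M' U).2.1 U' h φ U'' h')).trans ?_
      exact (VSec.res_act h' (RHom.const U' r) _).symm
    -- r is not equivariant, but the transition rule for the lift can be checked after applying f,
    -- which is equivariant and injective on vectors of sections.
    · apply inj
      beta_reduce
      rw [lift, (s : secF F M' U).2.2 U' h φ φ', RHom.act_act]
      have := BMap.fam_trans (BMap.const f hf) φ' φ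
      have h2 : (BMap.const f hf).fam φ' = RHom.const U' f := rfl
      have h3 : (BMap.const f hf).fam φ = RHom.const U' f := rfl
      rw [h2, h3] at this
      rw [← this, ← RHom.act_act, lift]
    · exact secF.ext_frame fun U' h φ => lift U' h φ
  · intro U t x hx
    obtain ⟨U₀, hx₀, ⟨φ⟩⟩ := hfr x
    refine ⟨U ⊓ U₀, inf_le_left, ⟨hx, hx₀⟩, secF.ofFrame (φ.res inf_le_right)
      ((RHom.const _ σ).act ((t : secF F M'' U).1 _ inf_le_left (φ.res inf_le_right))), ?_⟩
    refine secF.eq_of_frame (F := F) (M := M'') (φ.res inf_le_right) ?_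
    refine (congrArg (RHom.act (RHom.const (U ⊓ U₀) g)) (secF.ofFrame_val (M := M') _ _)).trans ?_
    rw [RHom.const_act_const, hσ, RHom.act_const_id]
    rfl

variable {q : ℕ}

lemma SES.coh_left_of_surjective (hfr : HasFrames W) {a : BMap M M'} {b : BMap M' M''}
    (h : SES a b) (h₃ : Function.Surjective (coh.map F q b))
    (h₂ : Subsingleton (coh F M' (q + 1))) : Subsingleton (coh F M (q + 1)) :=
  H_left_of_surjective (h.shortExact hfr) q h₃ h₂

lemma SES.coh_left (hfr : HasFrames W) {a : BMap M M'} {b : BMap M' M''} (h : SES a b)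
    (h₃ : Subsingleton (coh F M'' q)) (h₂ : Subsingleton (coh F M' (q + 1))) :
    Subsingleton (coh F M (q + 1)) := H_left (h.shortExact hfr) q h₃ h₂

lemma SES.coh_surjective (hfr : HasFrames W) {a : BMap M M'} {b : BMap M' M''} (h : SES a b)
    (h₁ : Subsingleton (coh F M (q + 1))) : Function.Surjective (coh.map F q b) :=
  H_surjective (h.shortExact hfr) q h₁

lemma SES.coh_right (hfr : HasFrames W) {a : BMap M M'} {b : BMap M' M''} (h : SES a b)
    (h₂ : Subsingleton (coh F M' q)) (h₁ : Subsingleton (coh F M (q + 1))) :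
    Subsingleton (coh F M'' q) := H_right (h.shortExact hfr) q h₂ h₁

end ses

section alt
open Raw
variable {M M' M'' : RRep W}

lemma BMap.alt_comp (c : ℕ) (b : BMap M' M'') (a : BMap M M') :
    (b.comp a).alt c = (b.alt c).comp (a.alt c) :=
  BMap.ext fun g f => Subtype.ext (funext fun l => funext fun s => by
    refine (Phi.mapVal_apply c 0 _ f l s).trans ((Phi.mapVal_apply c 0 _ _ l s).trans ?_).symm
    exact congrArg (b.1 g) (Phi.mapVal_apply c 0 _ f l s))

lemma BMap.alt_id (c : ℕ) : (BMap.id M).alt c = BMap.id (RRep.alt c M) :=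
  BMap.ext fun g f => Subtype.ext (funext fun l => funext fun s => Phi.mapVal_apply c 0 _ f l s)

lemma BMap.alt_add (c : ℕ) (a b : BMap M M') : (a + b).alt c = a.alt c + b.alt c :=
  BMap.ext fun g f => Subtype.ext (funext fun l => funext fun s => rfl)

lemma BMap.alt_smul (c : ℕ) (r : ℂ) (a : BMap M M') : (r • a).alt c = r • a.alt c :=
  BMap.ext fun g f => Subtype.ext (funext fun l => funext fun s => rfl)

lemma Phi.mapVal_exact {A B M M' M'' : Type*} [AddCommGroup A] [Module ℂ A] [AddCommGroup B]
    [Module ℂ B] [AddCommGroup M] [Module ℂ M] [AddCommGroup M'] [Module ℂ M'] [AddCommGroup M'']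
    [Module ℂ M''] (c m : ℕ) {f : M →ₗ[ℂ] M'} {g : M' →ₗ[ℂ] M''}
    (hfi : Function.Injective f) (hgs : Function.Surjective g) (hfg : Function.Exact f g) :
    Function.Injective (Phi.mapVal (A := A) (B := B) c m f) ∧
      Function.Surjective (Phi.mapVal (A := A) (B := B) c m g) ∧
      Function.Exact (Phi.mapVal (A := A) (B := B) c m f) (Phi.mapVal (A := A) (B := B) c m g) := by
  obtain ⟨r, σ, hr, hσ, hrσ⟩ := exists_splitting hfi hgs hfg
  refine ⟨?_, ?_, ?_⟩
  · intro x y hxy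
    refine Subtype.ext (funext fun l => funext fun s => hfi ?_)
    rw [← Phi.mapVal_apply c m f, ← Phi.mapVal_apply c m f, hxy]
  · intro y
    refine ⟨Phi.mapVal c m σ y, Subtype.ext (funext fun l => funext fun s => ?_)⟩
    rw [Phi.mapVal_apply, Phi.mapVal_apply]
    exact LinearMap.congr_fun hσ _
  · intro y
    constructor
    · intro hy
      refine ⟨Phi.mapVal c m r y, Subtype.ext (funext fun l => funext fun s => ?_)⟩
      rw [Phi.mapVal_apply, Phi.mapVal_apply]
      have h1 := LinearMap.congr_fun hrσ (y.1 l s)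
      have h2 : g (y.1 l s) = 0 := by
        rw [← Phi.mapVal_apply c m g y, hy]; rfl
      rw [LinearMap.add_apply, LinearMap.comp_apply, LinearMap.comp_apply, h2, _root_.map_zero,
        add_zero] at h1
      exact h1
    · rintro ⟨x, rfl⟩
      refine Subtype.ext (funext fun l => funext fun s => ?_)
      rw [Phi.mapVal_apply, Phi.mapVal_apply]
      exact (hfg _).2 ⟨_, rfl⟩

lemma SES.alt (c : ℕ) {a : BMap M M'} {b : BMap M' M''} (h : SES a b) :
    SES (a.alt c) (b.alt c) := by
  obtain ⟨f, hf, g, hg, rfl, rfl, hfi, hgs, hfg⟩ := h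
  obtain ⟨h1, h2, h3⟩ := Phi.mapVal_exact (A := RRep.qRep W) (B := RRep.qRep W) c 0 hfi hgs hfg
  exact ⟨Phi.mapVal c 0 f, fun p m => (LinearMap.congr_fun (((BMap.const f hf).alt c).2.1 1 p) m).symm,
    Phi.mapVal c 0 g, fun p m => (LinearMap.congr_fun (((BMap.const g hg).alt c).2.1 1 p) m).symm,
    rfl, rfl, h1, h2, h3⟩

/-- Iterated forms on the fibre of the quotient bundle. -/
def RRep.iter (l : List ℕ) (M : RRep W) : RRep W := l.foldr RRep.alt M

/-- Functoriality of iterated forms. -/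
def BMap.iter : (l : List ℕ) → BMap M M' → BMap (RRep.iter l M) (RRep.iter l M')
  | [], a => a
  | c :: l, a => (BMap.iter l a).alt c

lemma BMap.iter_comp (l : List ℕ) (b : BMap M' M'') (a : BMap M M') :
    (b.comp a).iter l = (b.iter l).comp (a.iter l) := by
  induction l with
  | nil => rfl
  | cons c l ih => exact (congrArg (BMap.alt c) ih).trans (BMap.alt_comp c _ _)

lemma BMap.iter_id (l : List ℕ) : (BMap.id M).iter l = BMap.id (RRep.iter l M) := by
  induction l with
  | nil => rfl
  | cons c l ih => exact (congrArg (BMap.alt c) ih).trans (BMap.alt_id c)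

lemma BMap.iter_add (l : List ℕ) (a b : BMap M M') : (a + b).iter l = a.iter l + b.iter l := by
  induction l with
  | nil => rfl
  | cons c l ih => exact (congrArg (BMap.alt c) ih).trans (BMap.alt_add c _ _)

lemma BMap.iter_smul (l : List ℕ) (r : ℂ) (a : BMap M M') : (r • a).iter l = r • a.iter l := by
  induction l with
  | nil => rfl
  | cons c l ih => exact (congrArg (BMap.alt c) ih).trans (BMap.alt_smul c _ _)

variable (M M') in
/-- Functoriality of iterated forms, as a linear map. -/
def BMap.iterL (l : List ℕ) : BMap M M' →ₗ[ℂ] BMap (RRep.iter l M) (RRep.iter l M') where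
  toFun a := a.iter l
  map_add' := BMap.iter_add l
  map_smul' := BMap.iter_smul l

lemma SES.iter (l : List ℕ) {a : BMap M M'} {b : BMap M' M''} (h : SES a b) :
    SES (a.iter l) (b.iter l) := by
  induction l with
  | nil => exact h
  | cons c l ih => exact ih.alt c

end alt
end LagGrass

end

/-! ### Forms as alternating maps, and equivariant operators on forms -/

noncomputable section
namespace LagGrass
open Raw

section toAlt
variable {A B M : Type*} [AddCommGroup A] [Module ℂ A] [AddCommGroup B] [Module ℂ B]
  [AddCommGroup M] [Module ℂ M]

lemma ofFn_update_zero {α : Type*} {c : ℕ} (v : Fin (c + 1) → α) (x : α) :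
    List.ofFn (Function.update v 0 x) = x :: List.ofFn (fun i => v (Fin.succ i)) := by
  rw [List.ofFn_succ, Function.update_self]
  congr 2

lemma ofFn_update_succ {α : Type*} {c : ℕ} (v : Fin (c + 1) → α) (i : Fin c) (x : α) :
    List.ofFn (Function.update v i.succ x) =
      v 0 :: List.ofFn (Function.update (fun i => v (Fin.succ i)) i x) := by
  rw [List.ofFn_succ, Function.update_of_ne (Fin.succ_ne_zero i).symm]
  congr 2
  funext j
  by_cases h : j = i
  · subst h; simp
  · rw [Function.update_of_ne h, Function.update_of_ne (fun h' => h (Fin.succ_injective _ h'))]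

lemma AM.eq_zero_of_mem {f : Raw A B M} (hf : f ∈ AM A B M) {a : A} {l : List A} (h : a ∈ l)
    (s : List B) : f (a :: l) s = 0 := by
  induction l generalizing f with
  | nil => simp at h
  | cons b l ih =>
    rcases List.mem_cons.1 h with rfl | h
    · exact congrFun (congrFun ((AM.loc hf).ia_self a) l) s
    · have h1 := congrFun (congrFun (AM.ia_anticomm hf b a) l) s
      refine h1.trans ?_
      rw [Pi.neg_apply, Pi.neg_apply, neg_eq_zero]
      exact ih (AM.ia hf b) h

lemma AM.eq_zero_of_not_nodup {f : Raw A B M} (hf : f ∈ AM A B M) {l : List A} (h : ¬ l.Nodup)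
    (s : List B) : f l s = 0 := by
  induction l generalizing f with
  | nil => simp at h
  | cons b l ih =>
    by_cases hb : b ∈ l
    · exact AM.eq_zero_of_mem hf hb s
    · exact ih (AM.ia hf b) (fun hl => h (List.nodup_cons.2 ⟨hb, hl⟩))

/-- Evaluation of an alternating function on tuples. -/
def AM.toAlt {f : Raw A B M} (hf : f ∈ AM A B M) (c : ℕ) (s : List B) : A [⋀^Fin c]→ₗ[ℂ] M where
  toFun v := f (List.ofFn v) s
  map_update_add' := by
    intro inst v i x y
    have : inst = instDecidableEqFin c := Subsingleton.elim _ _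
    subst this
    induction c generalizing f with
    | zero => exact i.elim0
    | succ c ih =>
      induction i using Fin.cases with
      | zero =>
        simp only [ofFn_update_zero]
        exact congrFun (congrFun ((AM.loc hf).ia_add x y) _) s
      | succ i =>
        simp only [ofFn_update_succ]
        exact ih (AM.ia hf (v 0)) _ i
  map_update_smul' := by
    intro inst v i r x
    have : inst = instDecidableEqFin c := Subsingleton.elim _ _
    subst this
    induction c generalizing f with
    | zero => exact i.elim0
    | succ c ih =>
      induction i using Fin.cases with
      | zero =>
        simp only [ofFn_update_zero]
        exact congrFun (congrFun ((AM.loc hf).ia_smul r x) _) s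
      | succ i =>
        simp only [ofFn_update_succ]
        exact ih (AM.ia hf (v 0)) _ i
  map_eq_zero_of_eq' := by
    intro v i j hij hne
    refine AM.eq_zero_of_not_nodup hf (fun h => hne ?_) s
    exact List.nodup_ofFn.1 h hij

lemma AM.toAlt_apply {f : Raw A B M} (hf : f ∈ AM A B M) (c : ℕ) (s : List B) (v : Fin c → A) :
    AM.toAlt hf c s v = f (List.ofFn v) s := rfl

lemma Phi.eq_zero_of_lt [FiniteDimensional ℂ A] {c m : ℕ} (hc : Module.finrank ℂ A < c)
    {f : Raw A B M} (hf : f ∈ Phi A B M c m) : f = 0 := by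
  funext l s
  by_cases h : l.length = c ∧ s.length = m
  · have h1 : ¬ LinearIndependent ℂ (l.get) := fun hli => by
      have := hli.fintype_card_le_finrank
      simp only [Fintype.card_fin] at this
      omega
    have := (AM.toAlt hf.1 l.length s).map_linearDependent l.get h1
    rw [AM.toAlt_apply, List.ofFn_get] at this
    exact this
  · exact hf.2 _ _ h

end toAlt

variable {V : Type u} [AddCommGroup V] [Module ℂ V] {ω : LinearMap.BilinForm ℂ V} {n : ℕ}
variable {W : LagGrass ω n}

section ops
variable {A B M A' B' : RRep W}

lemma Eqv.symm_apply {f : A →ₗ[ℂ] B} (hf : Eqv f) (p : stab W) : f ∘ₗ A.ρ p = B.ρ p ∘ₗ f :=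
  LinearMap.ext fun m => hf p m

/-- The opposite Koszul differential. -/
def BMap.x (M : RRep W) (σ : A →ₗ[ℂ] B) (hσ : Eqv σ) (c m : ℕ) :
    BMap (RRep.phi A B M c (m + 1)) (RRep.phi A B M (c + 1) m) :=
  BMap.phi (xop σ) _ _ _ _ (fun _ hf => Phi.xop hf σ)
    fun p f _ => (pull_xop _ _ _ f σ σ (hσ.symm_apply p⁻¹)).symm

/-- The derivation defined by an equivariant endomorphism. -/
def BMap.der (A M : RRep W) (τ : B →ₗ[ℂ] B) (hτ : Eqv τ) (c m : ℕ) :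
    BMap (RRep.phi A B M c m) (RRep.phi A B M c m) :=
  BMap.phi (DB τ) _ _ _ _ (fun _ hf => Phi.DB hf τ)
    fun p f _ => (pull_DB _ _ _ f τ τ (hτ.symm_apply p⁻¹)).symm

lemma pull_pull {A B M A' B' M' A'' B'' M'' : Type*} [AddCommGroup A] [Module ℂ A]
    [AddCommGroup B] [Module ℂ B] [AddCommGroup M] [Module ℂ M] [AddCommGroup A'] [Module ℂ A']
    [AddCommGroup B'] [Module ℂ B'] [AddCommGroup M'] [Module ℂ M'] [AddCommGroup A'']
    [Module ℂ A''] [AddCommGroup B''] [Module ℂ B''] [AddCommGroup M''] [Module ℂ M'']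
    (α : A' →ₗ[ℂ] A) (β : B' →ₗ[ℂ] B) (γ : M →ₗ[ℂ] M') (α' : A'' →ₗ[ℂ] A') (β' : B'' →ₗ[ℂ] B')
    (γ' : M' →ₗ[ℂ] M'') (f : Raw A B M) :
    pull α' β' γ' (pull α β γ f) = pull (α ∘ₗ α') (β ∘ₗ β') (γ' ∘ₗ γ) f := by
  funext l s
  change γ' (γ (f ((l.map α').map α) ((s.map β').map β))) = _
  rw [List.map_map, List.map_map]
  rfl

/-- Pullback of forms along equivariant maps. -/
def BMap.pull (M : RRep W) (α : A' →ₗ[ℂ] A) (hα : Eqv α) (β : B' →ₗ[ℂ] B) (hβ : Eqv β) (c m : ℕ) :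
    BMap (RRep.phi A B M c m) (RRep.phi A' B' M c m) :=
  BMap.phi (Raw.pull α β LinearMap.id) _ _ _ _ (fun _ hf => Phi.pull hf _ _ _)
    fun p f _ => by
      rw [rawAct, rawAct, pull_pull, pull_pull, hα.symm_apply, hβ.symm_apply]
      rfl

end ops

end LagGrass

end

/-! ### The Pieri operators of an invariant dual pair -/

noncomputable section
namespace LagGrass
open Raw

section pieri
variable {A B M A' B' M' S : Type*} [AddCommGroup A] [Module ℂ A] [AddCommGroup B] [Module ℂ B]
  [AddCommGroup M] [Module ℂ M] [AddCommGroup M'] [Module ℂ M'] [AddCommGroup S] [Module ℂ S]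
  {ι : Type*} [Fintype ι]

/-- `Xop` depends only on the tensor ∑ q_t ⊗ s_t. The two conditions on c say that α ⊗ β fixes this
tensor. -/
lemma Raw.Xop_pull (q : ι → A) (s : ι → B) {f : Raw A B M} (hf : f ∈ AM A B M) (α : A →ₗ[ℂ] A)
    (β : B →ₗ[ℂ] B) (γ : M →ₗ[ℂ] M') (c : ι → ι → ℂ) (hq : ∀ t, α (q t) = ∑ u, c u t • q u)
    (hs : ∀ u, ∑ t, c u t • β (s t) = s u) :
    Xop q s (pull α β γ f) = pull α β γ (Xop q s f) := by
  simp only [Xop_apply, map_sum, db_pull, ia_pull]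
  rw [← map_sum, ← map_sum]
  congr 1
  have h1 : ∀ t, ia (α (q t)) (db (β (s t)) f) = ∑ u, ia (q u) (c u t • db (β (s t)) f) := by
    intro t
    rw [← iaL_apply (AM.db hf _), hq, map_sum]
    simp only [map_smul, iaL_apply]
  simp only [h1]
  rw [Finset.sum_comm]
  refine Finset.sum_congr rfl fun u _ => ?_
  rw [← map_sum]
  congr 1
  conv_rhs => rw [← hs u, ← dbL_apply hf, map_sum]
  simp only [map_smul, dbL_apply]

/-- For dual families the trace is n and the derivation of A is that of the identity when i = j, so
it contributes the degree c; for i ≠ j both terms vanish because the copies of S are different. The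
derivation of B is the polarization from copy j to copy i. -/
lemma Raw.Xop_Yop_single {k : ℕ} (σ : S →ₗ[ℂ] A →ₗ[ℂ] ℂ) (q : ι → A) (s : ι → S)
    (hA : ∀ a, ∑ t, σ (s t) a • q t = a) (hS : ∀ b, ∑ t, σ b (q t) • s t = b) {n : ℕ}
    (hn : ∑ t, σ (s t) (q t) = (n : ℂ)) {c m : ℕ} (i j : Fin k) {f : Raw A (Fin k → S) M}
    (hf : f ∈ Phi A (Fin k → S) M c m) :
    Xop q (fun t => LinearMap.single ℂ (fun _ => S) i (s t)) (Yop (σ ∘ₗ LinearMap.proj j) f) +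
      Yop (σ ∘ₗ LinearMap.proj j) (Xop q (fun t => LinearMap.single ℂ (fun _ => S) i (s t)) f) =
      (if i = j then ((n : ℂ) - c) • f else 0) +
        DB (LinearMap.single ℂ (fun _ => S) i ∘ₗ LinearMap.proj j) f := by
  rw [Xop_Yop q (fun t => LinearMap.single ℂ (fun _ => S) i (s t)) (σ ∘ₗ LinearMap.proj j) hf.1
    (if i = j then LinearMap.id else 0) (LinearMap.single ℂ (fun _ => S) i ∘ₗ LinearMap.proj j)]
  · congr 1
    split_ifs with h
    · subst h
      rw [Phi.DA_id hf]
      simp [hn, sub_smul]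
    · have : DA (0 : A →ₗ[ℂ] A) f = 0 := by
        have h0 : (fun a : A => ia ((0 : A →ₗ[ℂ] A) a) f) = fun _ => 0 := by
          funext a
          rw [LinearMap.zero_apply, ← iaL_apply hf.1, map_zero]
        change eps _ = 0
        rw [h0, eps_zero]
      rw [this]
      simp [Pi.single_apply, Ne.symm h]
  · intro a
    split_ifs with h
    · subst h; simp [hA]
    · simp [Pi.single_apply, Ne.symm h]
  · intro b
    simp only [LinearMap.comp_apply, LinearMap.proj_apply]
    conv_lhs => rw [← hS (b j), map_sum]
    simp only [map_smul]

lemma Raw.Xop_Yop_single_of_eq_zero {k : ℕ} (σ : S →ₗ[ℂ] A →ₗ[ℂ] ℂ) (q : ι → A) (s : ι → S)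
    (hA : ∀ a, ∑ t, σ (s t) a • q t = a) (hS : ∀ b, ∑ t, σ b (q t) • s t = b) {n : ℕ}
    (hn : ∑ t, σ (s t) (q t) = (n : ℂ)) {c m : ℕ} (i j : Fin k) {f : Raw A (Fin k → S) M}
    (hf : f ∈ Phi A (Fin k → S) M c m) (h : c = 0 ∨ m = 0) :
    Xop q (fun t => LinearMap.single ℂ (fun _ => S) i (s t)) (Yop (σ ∘ₗ LinearMap.proj j) f) =
      (if i = j then ((n : ℂ) - c) • f else 0) +
        DB (LinearMap.single ℂ (fun _ => S) i ∘ₗ LinearMap.proj j) f := by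
  rw [← Raw.Xop_Yop_single σ q s hA hS hn i j hf]
  have : Xop q (fun t => LinearMap.single ℂ (fun _ => S) i (s t)) f = 0 := by
    rcases h with rfl | rfl
    · exact Phi.Xop_zero_left hf _ _
    · exact Phi.Xop_zero_right hf _ _
  rw [this, map_zero, add_zero]

end pieri

variable {V : Type u} [AddCommGroup V] [Module ℂ V] {ω : LinearMap.BilinForm ℂ V} {n : ℕ}
variable {W : LagGrass ω n}

/-- Dual families for an invariant pairing. -/
structure DualPair (A S : RRep W) (r : ℕ) where
  /-- the pairing -/
  pair : S →ₗ[ℂ] A →ₗ[ℂ] ℂ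
  inv : ∀ (p : stab W) s a, pair (S.ρ p s) (A.ρ p a) = pair s a
  /-- the vectors of the first factor -/
  s : Fin r → S
  /-- the vectors of the second factor -/
  q : Fin r → A
  hA : ∀ a, ∑ t, pair (s t) a • q t = a
  hS : ∀ b, ∑ t, pair b (q t) • s t = b
  trace : ∑ t, pair (s t) (q t) = (r : ℂ)

variable {A S M : RRep W} {r : ℕ}

lemma DualPair.finrank_le (P : DualPair A S r) : Module.finrank ℂ A ≤ r := by
  have : Submodule.span ℂ (Set.range P.q) = ⊤ := by
    refine eq_top_iff.2 fun a _ => ?_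
    rw [← P.hA a]
    exact Submodule.sum_mem _ fun t _ => Submodule.smul_mem _ _ (Submodule.subset_span ⟨t, rfl⟩)
  have h := finrank_range_le_card (R := ℂ) P.q
  rw [Set.finrank, this, finrank_top, Fintype.card_fin] at h
  exact h

namespace RRep

/-- The inclusion of a summand. -/
def single (k : ℕ) (S : RRep W) (i : Fin k) : S →ₗ[ℂ] piRep k S :=
  LinearMap.single ℂ (fun _ : Fin k => S.carrier) i

/-- The projection to a summand. -/
def proj (k : ℕ) (S : RRep W) (i : Fin k) : piRep k S →ₗ[ℂ] S :=
  LinearMap.proj (R := ℂ) (φ := fun _ : Fin k => S.carrier) i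

lemma single_eqv (k : ℕ) (S : RRep W) (i : Fin k) : Eqv (single k S i) := fun p s => by
  refine funext fun j => ?_
  change Pi.single (M := fun _ : Fin k => S.carrier) i (S.ρ p s) j =
    S.ρ p (Pi.single (M := fun _ : Fin k => S.carrier) i s j)
  by_cases h : j = i
  · subst h; simp
  · simp [h]

lemma proj_eqv (k : ℕ) (S : RRep W) (i : Fin k) : Eqv (proj k S i) := fun _ _ => rfl

lemma Eqv.comp {M M' M'' : RRep W} {g : M' →ₗ[ℂ] M''} {f : M →ₗ[ℂ] M'} (hg : Eqv g) (hf : Eqv f) :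
    Eqv (g ∘ₗ f) := fun p m => by rw [LinearMap.comp_apply, hf, hg]; rfl

end RRep

namespace DualPair
variable (P : DualPair A S r) (M) {k : ℕ}

/-- The tensor ∑ q_t ⊗ s_t is the canonical element of a perfect invariant pairing, hence fixed by
the stabilizer; the coefficients c express the action on the q_t in terms of the q_u. -/
lemma Xop_act (i : Fin k) {c m : ℕ} (p : stab W) (f : Raw A (RRep.piRep k S) M)
    (hf : f ∈ Phi A (RRep.piRep k S) M c m) :
    Xop P.q (fun t => RRep.single k S i (P.s t)) (rawAct A (RRep.piRep k S) M p f) =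
      rawAct A (RRep.piRep k S) M p (Xop P.q (fun t => RRep.single k S i (P.s t)) f) := by
  refine Raw.Xop_pull _ _ hf.1 _ _ _ (fun u t => P.pair (P.s u) (A.ρ p⁻¹ (P.q t))) (fun t => ?_)
    (fun u => ?_)
  · exact (P.hA _).symm
  · simp only [← RRep.single_eqv k S i p⁻¹, ← map_smul, ← map_sum]
    congr 2
    have h1 : ∀ t, P.pair (P.s u) (A.ρ p⁻¹ (P.q t)) = P.pair (S.ρ p (P.s u)) (P.q t) := fun t => by
      rw [← P.inv p, RRep.ρ_inv_apply]
    simp only [h1]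
    rw [P.hS, RRep.ρ_apply_inv]

/-- The lowering operators of the Pieri system. -/
def X (i : Fin k) (c m : ℕ) : BMap (RRep.phi A (RRep.piRep k S) M (c + 1) (m + 1))
    (RRep.phi A (RRep.piRep k S) M c m) :=
  BMap.phi (Xop P.q (fun t => RRep.single k S i (P.s t))) _ _ _ _ (fun _ hf => Phi.Xop hf _ _)
    fun p f hf => P.Xop_act M i p f hf

/-- The raising operators of the Pieri system. -/
def Y (i : Fin k) (c m : ℕ) : BMap (RRep.phi A (RRep.piRep k S) M c m)
    (RRep.phi A (RRep.piRep k S) M (c + 1) (m + 1)) :=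
  BMap.phi (Yop (P.pair ∘ₗ RRep.proj k S i)) _ _ _ _ (fun _ hf => Phi.Yop hf _)
    fun p f _ => (pull_Yop _ _ _ f _ _ fun b a => P.inv p⁻¹ (RRep.proj k S i b) a).symm

end DualPair

/-- The diagonal endomorphism with given eigenvalues. -/
def RRep.diag (k : ℕ) (S : RRep W) (a : Fin k → ℂ) : RRep.piRep k S →ₗ[ℂ] RRep.piRep k S :=
  LinearMap.pi fun i => a i • RRep.proj k S i

lemma RRep.diag_eqv (k : ℕ) (S : RRep W) (a : Fin k → ℂ) : Eqv (RRep.diag k S a) := fun p s =>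
  funext fun i => (map_smul (S.ρ p) (a i) _).symm

variable (A S M)
/-- The derivations of the Pieri system. -/
def BMap.E {k : ℕ} (i j : Fin k) (c m : ℕ) : BMap (RRep.phi A (RRep.piRep k S) M c m)
    (RRep.phi A (RRep.piRep k S) M c m) :=
  BMap.der A M (RRep.single k S i ∘ₗ RRep.proj k S j)
    (RRep.Eqv.comp (RRep.single_eqv k S i) (RRep.proj_eqv k S j)) c m

/-- The weight operator of the Pieri system. -/
def BMap.D (k : ℕ) (c m : ℕ) : BMap (RRep.phi A (RRep.piRep k S) M c m)
    (RRep.phi A (RRep.piRep k S) M c m) :=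
  BMap.der A M (RRep.diag k S fun i => (i : ℂ)) (RRep.diag_eqv k S _) c m

variable {A S M}

lemma BMap.phi_ext {A' B' M' B : RRep W} {c m c' m' : ℕ}
    {a b : BMap (RRep.phi A B M c m) (RRep.phi A' B' M' c' m')}
    (h : ∀ g (f : Phi A B M c m), Subtype.val (p := fun x => x ∈ Phi A' B' M' c' m') (a.1 g f) =
      Subtype.val (p := fun x => x ∈ Phi A' B' M' c' m') (b.1 g f)) : a = b := BMap.ext fun g f => Subtype.ext (h g f)

namespace DualPair
variable (P : DualPair A S r) {k : ℕ} (i j : Fin k) (c m : ℕ)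

/-- Degrees are natural numbers, so this covers positive degrees only. When c = 0 or m = 0 there is
no term Y X, and the next two lemmas give the same relation without it. -/
lemma X_Y : (P.X M i (c + 1) (m + 1)).comp (P.Y M j (c + 1) (m + 1)) +
    (P.Y M j c m).comp (P.X M i c m) =
      (if i = j then ((r : ℂ) - (c + 1 : ℕ)) else 0) • BMap.id _ + BMap.E A S M i j (c + 1) (m + 1) := by
  refine BMap.phi_ext fun g f => ?_
  refine (Raw.Xop_Yop_single P.pair P.q P.s P.hA P.hS P.trace i j f.2).trans ?_
  congr 1
  split_ifs
  · rfl
  · exact (zero_smul ℂ _).symm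

lemma X_Y_zero_left : (P.X M i 0 m).comp (P.Y M j 0 m) =
      (if i = j then ((r : ℂ) - (0 : ℕ)) else 0) • BMap.id _ + BMap.E A S M i j 0 m := by
  refine BMap.phi_ext fun g f => ?_
  refine (Raw.Xop_Yop_single_of_eq_zero P.pair P.q P.s P.hA P.hS P.trace i j f.2 (.inl rfl)).trans ?_
  congr 1
  split_ifs
  · rfl
  · exact (zero_smul ℂ _).symm

lemma X_Y_zero_right : (P.X M i c 0).comp (P.Y M j c 0) =
      (if i = j then ((r : ℂ) - (c : ℕ)) else 0) • BMap.id _ + BMap.E A S M i j c 0 := by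
  refine BMap.phi_ext fun g f => ?_
  refine (Raw.Xop_Yop_single_of_eq_zero P.pair P.q P.s P.hA P.hS P.trace i j f.2 (.inr rfl)).trans ?_
  congr 1
  split_ifs
  · rfl
  · exact (zero_smul ℂ _).symm

/-- The commutator contracts with the image under E i j of vectors of the l-th copy, and projection
to the copy j ≠ l kills these. -/
lemma X_E (l : Fin k) (h : j ≠ l) : (P.X M l c m).comp (BMap.E A S M i j (c + 1) (m + 1)) =
    (BMap.E A S M i j c m).comp (P.X M l c m) := by
  refine BMap.phi_ext fun g f => ?_
  have h1 := Raw.Xop_DB P.q (fun t => RRep.single k S l (P.s t))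
    (RRep.single k S i ∘ₗ RRep.proj k S j) f.2.1
  refine h1.trans ?_
  have h2 : Xop P.q (fun t => (RRep.single k S i ∘ₗ RRep.proj k S j) (RRep.single k S l (P.s t))) f.1
      = 0 := by
    rw [Xop_apply]
    refine Finset.sum_eq_zero fun t _ => ?_
    have h3 : RRep.proj k S j (RRep.single k S l (P.s t)) = 0 :=
      Pi.single_eq_of_ne (M := fun _ : Fin k => S.carrier) h (P.s t)
    rw [LinearMap.comp_apply, h3, map_zero, ← dbL_apply f.2.1, map_zero, map_zero]
  rw [h2, add_zero]
  rfl

end DualPair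

lemma DB_comm_of_comp {A B M : Type*} [AddCommGroup A] [Module ℂ A] [AddCommGroup B] [Module ℂ B]
    [AddCommGroup M] [Module ℂ M] {δ τ : B →ₗ[ℂ] B} {a b : ℂ} (h1 : τ ∘ₗ δ = a • τ)
    (h2 : δ ∘ₗ τ = b • τ) {f : Raw A B M} (hf : f ∈ AM A B M) :
    DB δ (DB τ f) = DB τ (DB δ f) + (a - b) • DB τ f := by
  have h3 : ∀ c : ℂ, DB (c • τ) f = c • DB τ f := fun c => by
    change delta _ = c • delta _
    rw [← delta_smul]
    congr 1
    funext x
    rw [LinearMap.smul_apply, ← dbL_apply hf, map_smul, dbL_apply]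
  have := DB_comm δ τ hf
  rw [h1, h2, h3, h3, ← sub_smul] at this
  rw [← this]; abel

/-- D has weight i on the i-th copy of S, and E i j shifts D-weights by j - i. For i < j it is a
raising operator. -/
lemma BMap.D_E {k : ℕ} (i j : Fin k) (c m : ℕ) :
    (BMap.D A S M k c m).comp (BMap.E A S M i j c m) =
      (BMap.E A S M i j c m).comp (BMap.D A S M k c m) + ((j : ℂ) - (i : ℂ)) • BMap.E A S M i j c m := by
  refine BMap.phi_ext fun g f => ?_
  refine DB_comm_of_comp (a := j) (b := i) ?_ ?_ f.2.1
  · refine LinearMap.ext fun b => ?_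
    exact map_smul (RRep.single k S i) (j : ℂ) (b j)
  · refine LinearMap.ext fun b => funext fun l => ?_
    change (l : ℂ) • Pi.single (M := fun _ : Fin k => S.carrier) i (b j) l =
      (i : ℂ) • Pi.single (M := fun _ : Fin k => S.carrier) i (b j) l
    by_cases h : l = i
    · subst h; rfl
    · simp [h]

end LagGrass

end

/-! ### The highest weight argument -/

noncomputable section
namespace LagGrass

section abstract
variable {T : Type*} [AddCommGroup T] [Module ℂ T]

/-- T may be infinite-dimensional, but the annihilating polynomial splits over ℂ. If no root were an
eigenvalue, p(D) would be a nonzero multiple of a composition of injective maps. -/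
lemma exists_eigenvalue_root [Nontrivial T] (D : Module.End ℂ T) {p : Polynomial ℂ} (hp : p ≠ 0)
    (h : Polynomial.aeval D p = 0) : ∃ s ∈ p.roots, D.HasEigenvalue s := by
  by_contra! hn
  have hinj : ∀ (R : Multiset ℂ), (∀ s ∈ R, ¬ D.HasEigenvalue s) →
      Function.Injective (Polynomial.aeval D (R.map fun a => Polynomial.X - Polynomial.C a).prod) := by
    intro R
    induction R using Multiset.induction with
    | empty =>
      intro _
      rw [Multiset.map_zero, Multiset.prod_zero, map_one]
      exact Function.injective_id
    | cons a R ih =>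
      intro hR
      rw [Multiset.map_cons, Multiset.prod_cons, map_mul]
      have h1 : D.eigenspace a = ⊥ := not_not.1 (hR a (Multiset.mem_cons_self a R))
      have h2 : Function.Injective (Polynomial.aeval D (Polynomial.X - Polynomial.C a)) := by
        rw [← LinearMap.ker_eq_bot, ← h1, Module.End.eigenspace_def, map_sub, Polynomial.aeval_X,
          Polynomial.aeval_C, Algebra.algebraMap_eq_smul_one]
      exact fun x y hxy => ih (fun s hs => hR s (Multiset.mem_cons_of_mem hs)) (h2 hxy)
  have h2 := hinj p.roots hn
  have h3 := (IsAlgClosed.splits p).eq_prod_roots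
  rw [h3, map_mul, Polynomial.aeval_C] at h
  obtain ⟨x, hx⟩ := exists_ne (0 : T)
  have h4 := LinearMap.congr_fun h x
  rw [Module.End.mul_apply, Module.algebraMap_end_apply, LinearMap.zero_apply, smul_eq_zero] at h4
  rcases h4 with h4 | h4
  · exact hp (Polynomial.leadingCoeff_eq_zero.1 h4)
  · exact hx (h2 (h4.trans (map_zero _).symm))

/-- A nonzero module with an algebraic endomorphism has a generalized highest weight. -/
lemma exists_eigenvalue_max_re [Nontrivial T] (D : Module.End ℂ T) {p : Polynomial ℂ} (hp : p ≠ 0)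
    (h : Polynomial.aeval D p = 0) : ∃ s, D.HasEigenvalue s ∧
      ∀ s', D.HasEigenvalue s' → s'.re ≤ s.re := by
  have hroot : ∀ s, D.HasEigenvalue s → s ∈ p.roots := by
    intro s hs
    obtain ⟨v, hv⟩ := hs.exists_hasEigenvector
    rw [Polynomial.mem_roots hp]
    have := Module.End.aeval_apply_of_hasEigenvector (p := p) hv
    rw [h, LinearMap.zero_apply] at this
    exact (smul_eq_zero.1 this.symm).resolve_right hv.2
  obtain ⟨s, -, hs⟩ := exists_eigenvalue_root D hp h
  have hfin : {s | D.HasEigenvalue s}.Finite :=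
    (p.roots.toFinset.finite_toSet).subset fun s hs => by simpa using hroot s hs
  obtain ⟨s, hs, hmax⟩ := Set.exists_max_image _ Complex.re hfin ⟨s, hs⟩
  exact ⟨s, hs, hmax⟩

/-- Composition of the first lowering operators. -/
def chain {k : ℕ} (X : Fin k → T → T) : ℕ → T → T
  | 0, x => x
  | j + 1, x => if h : j < k then X ⟨j, h⟩ (chain X j x) else 0

variable {k : ℕ} {X Y : Fin k → Module.End ℂ T} {E : Fin k → Fin k → Module.End ℂ T}
  {N : Module.End ℂ T} {r b : ℂ}

/-- Three facts about v_j = X_{j-1} ⋯ X_0 u, carried along together. Each X lowers the degree by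
one. The operators E_li with i ≥ j commute with the X used so far. For i > j, anticommuting Y_i past
X_j leaves only E_ji, which passes to u and kills it because j < i; so Y_i v_j = 0 whenever i ≥ j.
-/
lemma chain_spec
    (hXY : ∀ i j x, X i (Y j x) + Y j (X i x) = (if i = j then r • x - N x else 0) + E i j x)
    (hXE : ∀ l i j x, j ≠ l → X l (E i j x) = E i j (X l x))
    (hNX : ∀ i x, N (X i x) = X i (N x) - X i x)
    {u : T} (hN : N u = b • u) (hY : ∀ i, Y i u = 0) (hE : ∀ l i, l < i → E l i u = 0)
    (j : ℕ) (hj : j ≤ k) :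
    N (chain (fun i => X i) j u) = (b - j) • chain (fun i => X i) j u ∧
    (∀ i l : Fin k, j ≤ (i : ℕ) → E l i (chain (fun i => X i) j u) =
      chain (fun i => X i) j (E l i u)) ∧
    (∀ i : Fin k, j ≤ (i : ℕ) → Y i (chain (fun i => X i) j u) = 0) := by
  have hzero : ∀ j, chain (fun i => (X i : T → T)) j 0 = 0 := by
    intro j
    induction j with
    | zero => rfl
    | succ j ih =>
      rw [chain]
      split_ifs
      · rw [ih, map_zero]
      · rfl
  induction j with
  | zero => exact ⟨by simpa [chain] using hN, fun i l _ => rfl, fun i _ => hY i⟩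
  | succ j ih =>
    obtain ⟨h1, h2, h3⟩ := ih (by omega)
    have hjk : j < k := by omega
    simp only [chain, hjk, dif_pos]
    refine ⟨?_, fun i l hi => ?_, fun i hi => ?_⟩
    · rw [hNX, h1, map_smul]
      push_cast
      module
    · rw [← hXE, h2 i l (by omega)]
      intro h
      subst h
      simp at hi
    · have hne : (⟨j, hjk⟩ : Fin k) ≠ i := by rintro rfl; simp at hi
      have h4 := hXY ⟨j, hjk⟩ i (chain (fun i => X i) j u)
      rw [h3 i (by omega), map_zero, zero_add, if_neg hne, zero_add, h2 i _ (by omega)] at h4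
      rw [h4, hE _ _ (Fin.lt_def.2 (by simpa using hi)), hzero]

/-- Since Y_j v_j = 0, the relation for i = j gives Y_j X_j v_j = (r - deg v_j) v_j + E_jj v_j, and
deg v_j = b - j; then E_jj is moved through the chain to u. -/
lemma chain_raise
    (hXY : ∀ i j x, X i (Y j x) + Y j (X i x) = (if i = j then r • x - N x else 0) + E i j x)
    (hXE : ∀ l i j x, j ≠ l → X l (E i j x) = E i j (X l x))
    (hNX : ∀ i x, N (X i x) = X i (N x) - X i x)
    {u : T} (hN : N u = b • u) (hY : ∀ i, Y i u = 0) (hE : ∀ l i, l < i → E l i u = 0)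
    (j : ℕ) (hj : j < k) :
    Y ⟨j, hj⟩ (chain (fun i => X i) (j + 1) u) =
      chain (fun i => X i) j ((r - b + j) • u + E ⟨j, hj⟩ ⟨j, hj⟩ u) := by
  obtain ⟨h1, h2, h3⟩ := chain_spec hXY hXE hNX hN hY hE j hj.le
  have hlin : ∀ (c : ℂ) x y, chain (fun i => (X i : T → T)) j (c • x + y) =
      c • chain (fun i => X i) j x + chain (fun i => X i) j y := by
    clear h1 h2 h3
    intro c x y
    induction j with
    | zero => rfl
    | succ j ih =>
      have : j < k := by omega
      simp only [chain, this, dif_pos]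
      rw [ih this, map_add, map_smul]
  have h4 := hXY ⟨j, hj⟩ ⟨j, hj⟩ (chain (fun i => X i) j u)
  rw [h3 _ le_rfl, map_zero, zero_add, if_pos rfl, h1, h2 _ _ le_rfl] at h4
  simp only [chain, hj, dif_pos]
  rw [h4, hlin, ← sub_smul]
  congr 2
  ring

/-- Vanishing of highest weight spaces for the lowering operators. -/
theorem eq_zero_of_chain
    (hXY : ∀ i j x, X i (Y j x) + Y j (X i x) = (if i = j then r • x - N x else 0) + E i j x)
    (hXE : ∀ l i j x, j ≠ l → X l (E i j x) = E i j (X l x))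
    (hNX : ∀ i x, N (X i x) = X i (N x) - X i x)
    (K : T → Prop) (hN : ∀ u, K u → N u = b • u) (hY : ∀ u, K u → ∀ i, Y i u = 0)
    (hE : ∀ u, K u → ∀ l i, l < i → E l i u = 0)
    (hb : ∀ (j : Fin k) v, K v → ∃ u, K u ∧ (r - b + (j : ℕ)) • u + E j j u = v)
    (hk : ∀ u, K u → chain (fun i => X i) k u = 0) {u : T} (hu : K u) : u = 0 := by
  -- Descending induction on j. At j = k the chain vanishes by assumption. Below, any v in K is of
  -- the form (r - b + j)u + E_jj u with u in K, and its chain of length j is Y_j applied to the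
  -- chain of u of length j + 1, which is already zero.
  have key : ∀ d j, j + d = k → ∀ u, K u → chain (fun i => (X i : T → T)) j u = 0 := by
    intro d
    induction d with
    | zero => rintro j rfl u hu; exact hk u hu
    | succ d ih =>
      intro j hj v hv
      have hjk : j < k := by omega
      obtain ⟨u, hu, rfl⟩ := hb ⟨j, hjk⟩ v hv
      have := chain_raise hXY hXE hNX (hN u hu) (hY u hu) (hE u hu) j hjk
      rw [← this, ih (j + 1) (by omega) u hu, map_zero]
  exact key k 0 (by simp) u hu

end abstract
end LagGrass

end

/-! ### Pieri vanishing on cohomology -/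

noncomputable section
namespace LagGrass
open Raw
variable {V : Type u} [AddCommGroup V] [Module ℂ V] {ω : LinearMap.BilinForm ℂ V} {n : ℕ}
variable [FiniteDimensional ℂ V] {W : LagGrass ω n}

section hmap
variable (F : Mod ω n) (l : List ℕ) (q : ℕ)

/-- Cohomology of iterated forms. -/
abbrev hcoh (M : RRep W) : Type u := coh F (RRep.iter l M) q

variable {M M' M'' : RRep W}

/-- The map induced on the cohomology of iterated forms. -/
def hmap : BMap M M' →ₗ[ℂ] hcoh F l q M →ₗ[ℂ] hcoh F l q M' :=
  coh.mapL F _ _ q ∘ₗ BMap.iterL M M' l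

lemma hmap_comp (b : BMap M' M'') (a : BMap M M') (x : hcoh F l q M) :
    hmap F l q (b.comp a) x = hmap F l q b (hmap F l q a x) := by
  change coh.map F q ((b.comp a).iter l) x = _
  rw [BMap.iter_comp, coh.map_comp]
  rfl

lemma hmap_id (x : hcoh F l q M) : hmap F l q (BMap.id M) x = x := by
  change coh.map F q ((BMap.id M).iter l) x = _
  rw [BMap.iter_id, coh.map_id]
  rfl

variable {F l q}

lemma hcoh_of_retract (a : BMap M M') (b : BMap M' M) (h : b.comp a = BMap.id M)
    (hM : Subsingleton (hcoh F l q M')) : Subsingleton (hcoh F l q M) :=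
  coh.subsingleton_of_retract (a.iter l) (b.iter l) (by rw [← BMap.iter_comp, h, BMap.iter_id]) hM

lemma hcoh_of_id_eq_zero (h : BMap.id M = 0) : Subsingleton (hcoh F l q M) :=
  subsingleton_of_forall_eq 0 fun x => by
    rw [← hmap_id F l q x, h, map_zero, LinearMap.zero_apply]

lemma hcoh_of_subsingleton [Subsingleton M] : Subsingleton (hcoh F l q M) :=
  hcoh_of_id_eq_zero (BMap.ext fun _ _ => Subsingleton.elim _ _)

/-- A polynomial in the operator induced on cohomology is induced by the same polynomial in the
operator on the representation. -/
lemma exists_aeval (a : BMap M M) (p : Polynomial ℂ) : ∃ b : BMap M M,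
    (∀ g, b.1 g = Polynomial.aeval (R := ℂ) (A := Module.End ℂ M) (a.1 g) p) ∧
      ∀ x, hmap F l q b x = Polynomial.aeval (R := ℂ) (A := Module.End ℂ (hcoh F l q M))
        (hmap F l q a) p x := by
  induction p using Polynomial.induction_on with
  | C c =>
    refine ⟨c • BMap.id M, fun g => ?_, fun x => ?_⟩
    · rw [Polynomial.aeval_C]; rfl
    · rw [Polynomial.aeval_C, map_smul, LinearMap.smul_apply, hmap_id]; rfl
  | add p p' h h' =>
    obtain ⟨b, hb, hb'⟩ := h
    obtain ⟨c, hc, hc'⟩ := h'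
    refine ⟨b + c, fun g => ?_, fun x => ?_⟩
    · rw [map_add, ← hb, ← hc]; rfl
    · rw [map_add, map_add, LinearMap.add_apply, LinearMap.add_apply, hb', hc']
  | monomial k c h =>
    obtain ⟨b, hb, hb'⟩ := h
    refine ⟨b.comp a, fun g => ?_, fun x => ?_⟩
    · rw [pow_succ, ← mul_assoc, map_mul, ← hb, Polynomial.aeval_X]; rfl
    · rw [pow_succ, ← mul_assoc, map_mul, Polynomial.aeval_X, hmap_comp, hb']; rfl

/-- Cayley–Hamilton on the finite-dimensional representation; no finiteness of cohomology is
involved. -/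
lemma exists_annihilator (f : M →ₗ[ℂ] M) (hf : Eqv f) : ∃ p : Polynomial ℂ, p ≠ 0 ∧
    Polynomial.aeval (R := ℂ) (A := Module.End ℂ (hcoh F l q M)) (hmap F l q (BMap.const f hf)) p = 0 := by
  obtain ⟨b, hb, hb'⟩ := exists_aeval (F := F) (l := l) (q := q) (BMap.const f hf) (LinearMap.charpoly f)
  refine ⟨LinearMap.charpoly f, (LinearMap.charpoly_monic f).ne_zero, LinearMap.ext fun x => ?_⟩
  rw [← hb']
  have : b = 0 := BMap.ext fun g m => by
    rw [hb]
    exact LinearMap.congr_fun (LinearMap.aeval_self_charpoly f) m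
  rw [this, map_zero]

lemma exists_inverse (f : M →ₗ[ℂ] M) (hf : Eqv f) (hi : Function.Injective f) :
    ∃ b : BMap M M, (BMap.const f hf).comp b = BMap.id M ∧ b.comp (BMap.const f hf) = BMap.id M := by
  let e := LinearEquiv.ofInjectiveEndo f hi
  have he : ∀ m, f (e.symm m) = m := fun m => e.apply_symm_apply m
  refine ⟨BMap.const (e.symm : M →ₗ[ℂ] M) fun p m => hi ?_, BMap.ext fun _ m => he m,
    BMap.ext fun _ m => e.symm_apply_apply m⟩
  exact (he _).trans ((hf _ _).trans (congrArg _ (he m))).symm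

end hmap

section pieri
variable (F : Mod ω n) (l : List ℕ) (q : ℕ) {A S M : RRep W} {r : ℕ} (P : DualPair A S r) (k : ℕ)

variable (A S M) in
/-- The graded module on which the Pieri operators act. -/
abbrev PieriModule : Type u := ∀ c m, hcoh F l q (RRep.phi A (RRep.piRep k S) M c m)

namespace PieriModule
variable {k}

variable (M) in
/-- The lowering operators. -/
def X (i : Fin k) : Module.End ℂ (PieriModule F l q A S M k) where
  toFun f c m := hmap F l q (P.X M i c m) (f (c + 1) (m + 1))
  map_add' f g := funext fun c => funext fun m => map_add _ _ _
  map_smul' a f := funext fun c => funext fun m =>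
    map_smul (hmap F l q (P.X M i c m)) a (f (c + 1) (m + 1))

variable (M) in
/-- The raising operators. -/
def Y (i : Fin k) : Module.End ℂ (PieriModule F l q A S M k) where
  -- Nothing maps into bidegrees with c = 0 or m = 0, so the component there is zero.
  toFun f c m := match c, m with
    | 0, _ => 0
    | _ + 1, 0 => 0
    | c + 1, m + 1 => hmap F l q (P.Y M i c m) (f c m)
  map_add' f g := funext fun c => funext fun m => by
    cases c with
    | zero => exact (add_zero _).symm
    | succ c => cases m with
      | zero => exact (add_zero _).symm
      | succ m => exact map_add _ _ _
  map_smul' a f := funext fun c => funext fun m => by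
    cases c with
    | zero => exact (smul_zero a).symm
    | succ c => cases m with
      | zero => exact (smul_zero a).symm
      | succ m => exact map_smul (hmap F l q (P.Y M i c m)) a (f c m)

variable (A S M) in
/-- The derivations. -/
def E (i j : Fin k) : Module.End ℂ (PieriModule F l q A S M k) where
  toFun f c m := hmap F l q (BMap.E A S M i j c m) (f c m)
  map_add' f g := funext fun c => funext fun m => map_add _ _ _
  map_smul' a f := funext fun c => funext fun m =>
    map_smul (hmap F l q (BMap.E A S M i j c m)) a (f c m)

variable (A S M k) in
/-- The degree operator. -/
def N : Module.End ℂ (PieriModule F l q A S M k) where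
  toFun f c m := (c : ℂ) • f c m
  map_add' f g := funext fun c => funext fun m => smul_add _ _ _
  map_smul' a f := funext fun c => funext fun m => smul_comm (c : ℂ) a (f c m)

lemma X_Y (i j : Fin k) (f : PieriModule F l q A S M k) :
    X F l q M P i (Y F l q M P j f) + Y F l q M P j (X F l q M P i f) =
      (if i = j then (r : ℂ) • f - N F l q A S M k f else 0) + E F l q A S M i j f := by
  have aux : ∀ c m : ℕ, ((if i = j then ((r : ℂ) - c) else 0) • f c m : hcoh F l q _) =
      (if i = j then (r : ℂ) • f - N F l q A S M k f else 0) c m := by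
    intro c m
    split_ifs
    · exact sub_smul _ _ _
    · exact zero_smul _ _
  funext c m
  rw [Pi.add_apply, Pi.add_apply, Pi.add_apply, Pi.add_apply, ← aux]
  cases c with
  | zero =>
    have h := congrArg (fun z => hmap F l q z (f 0 m)) (P.X_Y_zero_left (M := M) i j m)
    beta_reduce at h
    rw [hmap_comp, map_add, map_smul, LinearMap.add_apply, LinearMap.smul_apply, hmap_id] at h
    exact (add_zero _).trans h
  | succ c => cases m with
    | zero =>
      have h := congrArg (fun z => hmap F l q z (f (c + 1) 0)) (P.X_Y_zero_right (M := M) i j (c + 1))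
      beta_reduce at h
      rw [hmap_comp, map_add, map_smul, LinearMap.add_apply, LinearMap.smul_apply, hmap_id] at h
      exact (add_zero _).trans h
    | succ m =>
      have h := congrArg (fun z => hmap F l q z (f (c + 1) (m + 1))) (P.X_Y (M := M) i j c m)
      beta_reduce at h
      rw [map_add, LinearMap.add_apply, hmap_comp, hmap_comp, map_add, map_smul, LinearMap.add_apply,
        LinearMap.smul_apply, hmap_id] at h
      exact h

lemma X_E (i j t : Fin k) (h : j ≠ t) (f : PieriModule F l q A S M k) :
    X F l q M P t (E F l q A S M i j f) = E F l q A S M i j (X F l q M P t f) := by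
  funext c m
  have h := congrArg (fun z => hmap F l q z (f (c + 1) (m + 1))) (P.X_E (M := M) i j c m t h)
  beta_reduce at h
  rw [hmap_comp, hmap_comp] at h
  exact h

lemma N_X (i : Fin k) (f : PieriModule F l q A S M k) :
    N F l q A S M k (X F l q M P i f) = X F l q M P i (N F l q A S M k f) - X F l q M P i f := by
  funext c m
  change (c : ℂ) • hmap F l q (P.X M i c m) _ = hmap F l q (P.X M i c m) (((c + 1 : ℕ) : ℂ) • f _ _) -
    hmap F l q (P.X M i c m) _
  rw [map_smul]
  push_cast
  module

end PieriModule

variable {F l q k}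

lemma Phi.subsingleton_of_lt {A B M : RRep W} {c m : ℕ} (h : Module.finrank ℂ A < c) :
    Subsingleton (RRep.phi A B M c m) :=
  subsingleton_of_forall_eq 0 fun f => Subtype.ext (Phi.eq_zero_of_lt h f.2)

/-- E_jj is the derivation of the projection to the j-th copy and has nonnegative eigenvalues, so d
+ E_jj is invertible for d > 0. The inverse is again a map of representations and therefore acts on
cohomology. -/
lemma BMap.E_inverse (j : Fin k) (c m d : ℕ) (hd : 0 < d) : ∃ b : BMap (RRep.phi A (RRep.piRep k S) M c m)
    (RRep.phi A (RRep.piRep k S) M c m), ((d : ℂ) • BMap.id _ + BMap.E A S M j j c m).comp b = BMap.id _ ∧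
      b.comp ((d : ℂ) • BMap.id _ + BMap.E A S M j j c m) = BMap.id _ := by
  obtain ⟨b, h1, h2⟩ := exists_inverse (M := RRep.phi A (RRep.piRep k S) M c m)
    (((d : ℂ) • BMap.id _ + BMap.E A S M j j c m : BMap (RRep.phi A (RRep.piRep k S) M c m)
      (RRep.phi A (RRep.piRep k S) M c m)).1 1)
    (fun p f => (LinearMap.congr_fun
      (((d : ℂ) • BMap.id _ + BMap.E A S M j j c m : BMap (RRep.phi A (RRep.piRep k S) M c m)
      (RRep.phi A (RRep.piRep k S) M c m)).2.1 1 p) f).symm)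
    (by
      rw [← LinearMap.ker_eq_bot, LinearMap.ker_eq_bot']
      intro f hf
      have hf' := congrArg (Subtype.val (p := fun x => x ∈ Phi A (RRep.piRep k S) M c m)) hf
      refine Subtype.ext (Phi.eq_zero_of_smul_add_DB (e := RRep.single k S j ∘ₗ RRep.proj k S j)
        (fun b => ?_) d hd f.2 hf')
      have : RRep.proj k S j (RRep.single k S j (RRep.proj k S j b)) = RRep.proj k S j b :=
        Pi.single_eq_same (M := fun _ : Fin k => S.carrier) j _
      rw [LinearMap.comp_apply, LinearMap.comp_apply, this])
  exact ⟨b, h1, h2⟩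

-- A nonzero cohomology group in degree c would contain a highest weight class. It is annihilated by
-- the raising operators because degree c + 1 has no cohomology, and k lowering operators bring it
-- to degree c - k < r - k, where cohomology also vanishes; `eq_zero_of_chain` then gives zero.
set_option maxHeartbeats 800000 in
theorem pieri_step (P : DualPair A S r) {c : ℕ} (hcr : c < r)
    (hlow : ∀ c m, c + k < r → Subsingleton (hcoh F l q (RRep.phi A (RRep.piRep k S) M c m)))
    (hup : ∀ m, Subsingleton (hcoh F l q (RRep.phi A (RRep.piRep k S) M (c + 1) m))) (m : ℕ) :
    Subsingleton (hcoh F l q (RRep.phi A (RRep.piRep k S) M c m)) := by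
  by_contra hns
  rw [not_subsingleton_iff_nontrivial] at hns
  let D : Module.End ℂ (hcoh F l q (RRep.phi A (RRep.piRep k S) M c m)) :=
    hmap F l q (BMap.D A S M k c m)
  obtain ⟨p, hp0, hp⟩ := exists_annihilator (F := F) (l := l) (q := q)
    ((BMap.D A S M k c m).1 1) (fun p f => (LinearMap.congr_fun ((BMap.D A S M k c m).2.1 1 p) f).symm)
  obtain ⟨s, hs, hmax⟩ := exists_eigenvalue_max_re D hp0 hp
  have hDE : ∀ (i j : Fin k) x, D (hmap F l q (BMap.E A S M i j c m) x) =
      hmap F l q (BMap.E A S M i j c m) (D x) +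
        ((j : ℂ) - i) • hmap F l q (BMap.E A S M i j c m) x := by
    intro i j x
    have h := congrArg (fun z => hmap F l q z x) (BMap.D_E (A := A) (S := S) (M := M) i j c m)
    beta_reduce at h
    rw [map_add, map_smul, LinearMap.add_apply, hmap_comp, hmap_comp] at h
    exact h
  obtain ⟨x, hx⟩ := hs.exists_hasEigenvector
  have hx1 : D x = s • x := hx.apply_eq_smul
  -- Vectors concentrated in bidegree (c, m) whose component lies in the eigenspace of D for s. As s
  -- has maximal real part, these are highest weight vectors.
  let K : PieriModule F l q A S M k → Prop := fun u =>
    (∀ c' m', ¬ (c' = c ∧ m' = m) → u c' m' = 0) ∧ D (u c m) = s • u c m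
  let u₀ : PieriModule F l q A S M k := Pi.single c (Pi.single m x)
  have hu1 : u₀ c m = x := by
    change (Pi.single c (Pi.single m x) : PieriModule F l q A S M k) c m = x
    rw [Pi.single_eq_same, Pi.single_eq_same]
  have hu₀ : K u₀ := by
    refine ⟨fun c' m' h => ?_, by rw [hu1, hx1]⟩
    change (Pi.single c (Pi.single m x) : PieriModule F l q A S M k) c' m' = 0
    by_cases hc : c' = c
    · subst hc
      rw [Pi.single_eq_same, Pi.single_eq_of_ne fun h' => h ⟨rfl, h'⟩]
    · rw [Pi.single_eq_of_ne hc]; rfl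
  have hN : ∀ u, K u → PieriModule.N F l q A S M k u = (c : ℂ) • u := by
    intro u hu
    funext c' m'
    by_cases h : c' = c ∧ m' = m
    · obtain ⟨rfl, rfl⟩ := h; rfl
    · change (c' : ℂ) • u c' m' = (c : ℂ) • u c' m'
      rw [hu.1 _ _ h, smul_zero, smul_zero]
  have hY : ∀ u, K u → ∀ i, PieriModule.Y F l q M P i u = 0 := by
    intro u hu i
    funext c' m'
    cases c' with
    | zero => rfl
    | succ c' => cases m' with
      | zero => rfl
      | succ m' =>
        change hmap F l q (P.Y M i c' m') (u c' m') = 0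
        by_cases h : c' = c ∧ m' = m
        · obtain ⟨rfl, rfl⟩ := h; exact @Subsingleton.elim _ (hup _) _ _
        · rw [hu.1 _ _ h, map_zero]
  have hE : ∀ u, K u → ∀ i j, i < j → PieriModule.E F l q A S M i j u = 0 := by
    intro u hu i j hij
    funext c' m'
    change hmap F l q (BMap.E A S M i j c' m') (u c' m') = 0
    by_cases h : c' = c ∧ m' = m
    · obtain ⟨rfl, rfl⟩ := h
      by_contra hne
      have h1 := hDE i j (u c' m')
      rw [hu.2, map_smul, ← add_smul] at h1
      -- Otherwise E_ij u would be an eigenvector for s + j - i, whose real part exceeds that of s.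
      have h2 := hmax _ (Module.End.hasEigenvalue_of_hasEigenvector
        (Module.End.hasEigenvector_iff.2 ⟨Module.End.mem_eigenspace_iff.2 h1, hne⟩))
      simp only [Complex.add_re, Complex.sub_re, Complex.natCast_re, add_le_iff_nonpos_right,
        sub_nonpos, Nat.cast_le, Fin.val_fin_le] at h2
      exact absurd hij (not_lt.2 h2)
    · rw [hu.1 _ _ h, map_zero]
  have hb : ∀ (j : Fin k) v, K v → ∃ u, K u ∧
      ((r : ℂ) - c + (j : ℕ)) • u + PieriModule.E F l q A S M j j u = v := by
    intro j v hv
    -- The integer r - c + j is positive because c < r. The inverse of r - c + j + E_jj preserves K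
    -- since E_jj commutes with D.
    choose b hb1 hb2 using fun c' m' => BMap.E_inverse (A := A) (S := S) (M := M) j c' m' (r - c + j)
      (by omega)
    have hd : (((r - c + j : ℕ) : ℕ) : ℂ) = (r : ℂ) - c + (j : ℕ) := by
      rw [Nat.cast_add, Nat.cast_sub hcr.le]
    have h1 : ∀ c' m' y, ((r : ℂ) - c + (j : ℕ)) • hmap F l q (b c' m') y +
        hmap F l q (BMap.E A S M j j c' m') (hmap F l q (b c' m') y) = y := by
      intro c' m' y
      have h := congrArg (fun z => hmap F l q z y) (hb1 c' m')
      beta_reduce at h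
      rw [hmap_comp, hmap_id, map_add, map_smul, LinearMap.add_apply, LinearMap.smul_apply, hmap_id,
        hd] at h
      exact h
    have h2 : ∀ c' m' y, hmap F l q (b c' m') (((r : ℂ) - c + (j : ℕ)) • y +
        hmap F l q (BMap.E A S M j j c' m') y) = y := by
      intro c' m' y
      have h := congrArg (fun z => hmap F l q z y) (hb2 c' m')
      beta_reduce at h
      rw [hmap_comp, hmap_id, map_add, map_smul, LinearMap.add_apply, LinearMap.smul_apply, hmap_id,
        hd] at h
      exact h
    refine ⟨fun c' m' => hmap F l q (b c' m') (v c' m'), ⟨fun c' m' h => ?_, ?_⟩, ?_⟩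
    · change hmap F l q (b c' m') (v c' m') = 0
      rw [hv.1 _ _ h, map_zero]
    · change D (hmap F l q (b c m) (v c m)) = s • hmap F l q (b c m) (v c m)
      have h4 : s • hmap F l q (b c m) (v c m) = hmap F l q (b c m) (s • v c m) :=
        ((hmap F l q (b c m)).map_smul s _).symm
      rw [h4, ← h2 c m (D _)]
      refine congrArg (hmap F l q (b c m)) ?_
      have h3 := hDE j j (hmap F l q (b c m) (v c m))
      rw [sub_self, zero_smul, add_zero] at h3
      rw [← h3, ← D.map_smul, ← D.map_add, h1, hv.2]
    · funext c' m'
      exact h1 _ _ _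
  have hk : ∀ u, K u → chain (fun i => PieriModule.X F l q M P i) k u = 0 := by
    intro u hu
    have h1 := (chain_spec (PieriModule.X_Y F l q P) (fun t i j x h => PieriModule.X_E F l q P i j t h x)
      (PieriModule.N_X F l q P) (hN u hu) (hY u hu) (hE u hu) k le_rfl).1
    funext c' m'
    have h2 := congrFun (congrFun h1 c') m'
    change (c' : ℂ) • chain (fun i => PieriModule.X F l q M P i) k u c' m' =
      ((c : ℂ) - k) • chain (fun i => PieriModule.X F l q M P i) k u c' m' at h2
    -- The component of degree c' is an eigenvector of the degree operator for both c' and c - k, so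
    -- it is zero unless c' + k = c, and then `hlow` applies.
    rw [← sub_eq_zero, ← sub_smul, smul_eq_zero] at h2
    rcases h2 with h2 | h2
    · have h3 : c' + k = c := by
        have : ((c' + k : ℕ) : ℂ) = c := by push_cast; linear_combination h2
        exact_mod_cast this
      exact @Subsingleton.elim _ (hlow c' m' (by omega)) _ _
    · exact h2
  have := eq_zero_of_chain (PieriModule.X_Y F l q P) (fun t i j x h => PieriModule.X_E F l q P i j t h x)
      (PieriModule.N_X F l q P) K hN hY hE hb hk hu₀
  rw [this] at hu1
  exact hx.2 hu1.symm

/-- Vanishing in the extreme degrees implies vanishing in all degrees. -/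
theorem pieri_vanishing (P : DualPair A S r)
    (hlow : ∀ c m, c + k < r → Subsingleton (hcoh F l q (RRep.phi A (RRep.piRep k S) M c m)))
    (htop : ∀ m, Subsingleton (hcoh F l q (RRep.phi A (RRep.piRep k S) M r m))) (c m : ℕ) :
    Subsingleton (hcoh F l q (RRep.phi A (RRep.piRep k S) M c m)) := by
  -- Induction downwards from c = r. Beyond r the forms themselves vanish, because A has dimension
  -- at most r.
  have key : ∀ d c m, r ≤ c + d → Subsingleton (hcoh F l q (RRep.phi A (RRep.piRep k S) M c m)) := by
    intro d
    induction d with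
    | zero =>
      intro c m h
      rcases (show r = c ∨ r < c by omega) with rfl | h
      · exact htop m
      · have := Phi.subsingleton_of_lt (B := RRep.piRep k S) (M := M) (m := m) (P.finrank_le.trans_lt h)
        exact hcoh_of_subsingleton
    | succ d ih =>
      intro c m h
      by_cases h' : c < r
      · exact pieri_step P h' hlow (fun m => ih _ m (by omega)) m
      · exact ih c m (by omega)
  exact key r c m (by omega)

end pieri
end LagGrass

end

/-! ### Trivial factors -/

noncomputable section
namespace LagGrass
open Raw
variable {V : Type u} [AddCommGroup V] [Module ℂ V] {ω : LinearMap.BilinForm ℂ V} {n : ℕ}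
variable [FiniteDimensional ℂ V] {W : LagGrass ω n}

/-- A trivialization of the bundle of a representation, compatible with frames. -/
structure Triv (A : RRep W) where
  /-- the transformations -/
  t : (V ≃ₗ[ℂ] V) → A ≃ₗ[ℂ] A
  mul : ∀ g (p : stab W) a, t (g * p) a = t g (A.ρ p a)
  reg : ∀ (U : Opens (space ω n)) (φ : Frame W U), RegHom (fun x => (t (φ.g x)).toLinearMap)
  reg_inv : ∀ (U : Opens (space ω n)) (φ : Frame W U),
    RegHom (fun x => (t (φ.g x)).symm.toLinearMap)

/-- The tautological representation is trivialized. -/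
def Triv.v (W : LagGrass ω n) : Triv (RRep.vRep W) where
  t g := g
  mul _ _ _ := rfl
  reg _ φ := φ.reg
  reg_inv _ φ := φ.reg_inv

lemma RegHom.pi {U : Opens (space ω n)} {M : Type*} [AddCommGroup M] [Module ℂ M] {k : ℕ}
    {c : U → M →ₗ[ℂ] M} (hc : RegHom c) :
    RegHom fun x => (LinearMap.pi fun i => c x ∘ₗ LinearMap.proj i : (Fin k → M) →ₗ[ℂ] Fin k → M) := by
  intro f
  have e : (fun x => (LinearMap.pi fun i => c x ∘ₗ LinearMap.proj i : (Fin k → M) →ₗ[ℂ] Fin k → M) f) =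
      fun x => ∑ i, LinearMap.single ℂ (fun _ : Fin k => M) i (c x (f i)) := by
    funext x j
    simp [Finset.sum_apply, Pi.single_apply]
  exact e ▸ RegVec.sum _ fun i _ => (hc (f i)).map _

/-- Powers of trivialized representations. -/
def Triv.pi {A : RRep W} (τ : Triv A) (k : ℕ) : Triv (RRep.piRep k A) where
  t g := LinearEquiv.piCongrRight fun _ => τ.t g
  mul g p a := funext fun i => τ.mul g p (a i)
  reg U φ := RegHom.pi (τ.reg U φ)
  reg_inv U φ := RegHom.pi (τ.reg_inv U φ)

section triv
variable {A M N : RRep W} (τ : Triv A)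

lemma Triv.symm_mul (g : V ≃ₗ[ℂ] V) (p : stab W) (a : A) :
    (τ.t (g * p)).symm a = A.ρ p⁻¹ ((τ.t g).symm a) := by
  apply (τ.t (g * p)).injective
  rw [LinearEquiv.apply_symm_apply, τ.mul, RRep.ρ_inv_apply, LinearEquiv.apply_symm_apply]

/-- The map to the constant homomorphisms defined by a linear form. -/
def BMap.toHom (N : RRep W) (ℓ : A →ₗ[ℂ] ℂ) : BMap N (RRep.homRep A N) :=
  ⟨fun g => (LinearMap.smulRightₗ (ℓ ∘ₗ (τ.t g).toLinearMap) : N →ₗ[ℂ] A →ₗ[ℂ] N), fun g p => by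
    refine LinearMap.ext fun m => LinearMap.ext fun v => ?_
    change N.ρ p (ℓ (τ.t (g * p) (A.ρ p⁻¹ v)) • m) = ℓ (τ.t g v) • N.ρ p m
    rw [τ.mul, RRep.ρ_inv_apply, map_smul],
    fun U φ m => by
      have h := RegHom.regVec ((RegHom.const (U := U) ℓ).comp (τ.reg U φ))
      exact h.map (LinearMap.smulRightₗ.flip m : (A →ₗ[ℂ] ℂ) →ₗ[ℂ] A →ₗ[ℂ] N)⟩

/-- Evaluation at a constant section. -/
def BMap.ofHom (N : RRep W) (w : A) : BMap (RRep.homRep A N) N :=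
  ⟨fun g => (LinearMap.applyₗ ((τ.t g).symm w) : (A →ₗ[ℂ] N) →ₗ[ℂ] N), fun g p => by
    refine LinearMap.ext fun f => ?_
    change N.ρ p (DFunLike.coe (F := A →ₗ[ℂ] N) f ((τ.t (g * p)).symm w)) =
      N.ρ p (DFunLike.coe (F := A →ₗ[ℂ] N) f (A.ρ p⁻¹ ((τ.t g).symm w)))
    rw [τ.symm_mul],
    fun U φ f => (τ.reg_inv U φ w).map (f : A →ₗ[ℂ] N)⟩

variable {F : Mod ω n} {l : List ℕ} {q : ℕ}

lemma hcoh_of_sum {ι : Type*} (s : Finset ι) (a : ι → BMap M N) (b : ι → BMap N M)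
    (h : BMap.id M = ∑ i ∈ s, (b i).comp (a i)) (hN : Subsingleton (hcoh F l q N)) :
    Subsingleton (hcoh F l q M) :=
  subsingleton_of_forall_eq 0 fun x => by
    rw [← hmap_id F l q x, h, map_sum, LinearMap.sum_apply]
    refine Finset.sum_eq_zero fun i _ => ?_
    rw [hmap_comp, Subsingleton.elim (hmap F l q (a i) x) 0, map_zero]

lemma BMap.sum_apply {ι : Type*} (s : Finset ι) (a : ι → BMap M N) (g m) :
    (∑ i ∈ s, a i).1 g m = ∑ i ∈ s, (a i).1 g m := by
  rw [AddSubmonoidClass.coe_finsetSum, Finset.sum_apply, LinearMap.sum_apply]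

lemma sum_smulRight {A N ι : Type*} [AddCommGroup A] [Module ℂ A] [AddCommGroup N] [Module ℂ N]
    [Fintype ι] (b : Module.Basis ι ℂ A) (t : A ≃ₗ[ℂ] A) (f : A →ₗ[ℂ] N) :
    ∑ i, LinearMap.smulRightₗ (b.coord i ∘ₗ t.toLinearMap) (f (t.symm (b i))) = f := by
  refine LinearMap.ext fun v => ?_
  have h2 : ∑ i, b.coord i (t v) • b i = t v := b.sum_repr _
  have h3 : f v = f (t.symm (∑ i, b.coord i (t v) • b i)) := by
    rw [h2, LinearEquiv.symm_apply_apply]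
  rw [h3, LinearMap.sum_apply, map_sum, map_sum]
  simp

/-- When the bundle of A is trivial, Hom(A, N) is a sum of copies of N: a basis of A gives
evaluations at constant sections and inclusions by constant forms, and these decompose the identity.
-/
lemma hcoh_homRep (τ : Triv A) (hN : Subsingleton (hcoh F l q N)) : Subsingleton (hcoh F l q (RRep.homRep A N)) := by
  let b := Module.finBasis ℂ A
  refine hcoh_of_sum Finset.univ (fun i => BMap.ofHom τ N (b i)) (fun i => BMap.toHom τ N (b.coord i))
    (BMap.ext fun g f => ?_) hN
  rw [BMap.sum_apply]
  exact (sum_smulRight b (τ.t g) f).symm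

end triv

section ext
variable {A B B' C M : RRep W} {F : Mod ω n} {l : List ℕ} {q : ℕ}

/-- The derivative along a subrepresentation. -/
def BMap.dbHom (A M : RRep W) (ι : C →ₗ[ℂ] B) (hι : Eqv ι) (c m : ℕ) :
    BMap (RRep.phi A B M c (m + 1)) (RRep.homRep C (RRep.phi A B M c m)) :=
  BMap.const
    ({ toFun := fun f => curryB A B M c m f ∘ₗ ι
       map_add' := fun _ _ => rfl
       map_smul' := fun _ _ => rfl } : Phi A B M c (m + 1) →ₗ[ℂ] C →ₗ[ℂ] Phi A B M c m)
    fun p f => LinearMap.ext fun v => Subtype.ext <|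
      congrArg (fun z => rawAct A B M p (db z f.1)) (hι p⁻¹ v).symm

/-- Symmetrization along a quotient representation. -/
def BMap.deltaHom (A M : RRep W) (κ : B →ₗ[ℂ] C) (hκ : Eqv κ) (c m : ℕ) :
    BMap (RRep.homRep C (RRep.phi A B M c m)) (RRep.phi A B M c (m + 1)) :=
  BMap.const
    ({ toFun := fun g => ⟨delta fun b => (g (κ b)).1,
         AM.delta (g := (Phi A B M c m).subtype ∘ₗ g ∘ₗ κ) fun b => (g (κ b)).2.1,
         Deg.delta fun b => (g (κ b)).2.2⟩
       map_add' := fun g g' => Subtype.ext (delta_add _ _)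
       map_smul' := fun c g => Subtype.ext (delta_smul c _) } :
        (C →ₗ[ℂ] Phi A B M c m) →ₗ[ℂ] Phi A B M c (m + 1))
    fun p g => Subtype.ext <| Eq.symm <| pull_delta _ _ _ _ _ fun b => by
      change rawAct A B M p (DFunLike.coe (F := C →ₗ[ℂ] Phi A B M c m) g (C.ρ p⁻¹ (κ b))).1 = _
      rw [← hκ]
      rfl

variable {ι : C →ₗ[ℂ] B} {κ : B →ₗ[ℂ] C} {ι' : B' →ₗ[ℂ] B} {κ' : B →ₗ[ℂ] B'} (hι : Eqv ι) (hκ : Eqv κ)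
  (hι' : Eqv ι') (hκ' : Eqv κ')

lemma Eqv.id (M : RRep W) : Eqv (LinearMap.id : M →ₗ[ℂ] M) := fun _ _ => rfl

/-- The Euler operator of a direct sum decomposition. -/
def BMap.euler (A M : RRep W) (c m : ℕ) : BMap (RRep.phi A B M c m) (RRep.phi A B M c m) :=
  BMap.der A M (ι ∘ₗ κ) (RRep.Eqv.comp hι hκ) c m +
    (BMap.pull M LinearMap.id (Eqv.id A) κ' hκ' c m).comp (BMap.pull M LinearMap.id (Eqv.id A) ι' hι' c m)

/-- Here κ' followed by ι' is 1 - ικ, so the Euler operator is the derivation of the idempotent ικ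
plus the pullback along its complement; `eq_zero_of_DB_add_pull` applies. -/
lemma BMap.euler_inverse (h : κ ∘ₗ ι = LinearMap.id) (h' : ι ∘ₗ κ + ι' ∘ₗ κ' = LinearMap.id) (c m : ℕ) :
    ∃ b : BMap (RRep.phi A B M c m) (RRep.phi A B M c m),
      (BMap.euler hι hκ hι' hκ' A M c m).comp b = BMap.id _ ∧
      b.comp (BMap.euler hι hκ hι' hκ' A M c m) = BMap.id _ := by
  obtain ⟨b, h1, h2⟩ := exists_inverse (M := RRep.phi A B M c m)
    ((BMap.euler hι hκ hι' hκ' A M c m).1 1)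
    (fun p f => (LinearMap.congr_fun ((BMap.euler hι hκ hι' hκ' A M c m).2.1 1 p) f).symm)
    (by
      rw [← LinearMap.ker_eq_bot, LinearMap.ker_eq_bot']
      intro f hf
      have hf' := congrArg (Subtype.val (p := fun x => x ∈ Phi A B M c m)) hf
      refine Subtype.ext (Phi.eq_zero_of_DB_add_pull (e := ι ∘ₗ κ) (fun b => ?_) f.2 ?_)
      · exact congrArg ι (LinearMap.congr_fun h (κ b))
      · refine Eq.trans ?_ hf'
        refine congrArg (fun z => DB (ι ∘ₗ κ) f.1 + z) ?_
        refine Eq.trans ?_ (pull_pull LinearMap.id ι' LinearMap.id LinearMap.id κ' LinearMap.id f.1).symm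
        rw [← h', add_sub_cancel_left]
        rfl)
  exact ⟨b, h1, h2⟩

lemma BMap.der_succ (c m : ℕ) : BMap.der A M (ι ∘ₗ κ) (RRep.Eqv.comp hι hκ) c (m + 1) =
    (BMap.deltaHom A M κ hκ c m).comp (BMap.dbHom A M ι hι c m) := rfl

lemma BMap.der_zero {τ : B →ₗ[ℂ] B} (hτ : Eqv τ) (c : ℕ) : BMap.der A M τ hτ c 0 = 0 :=
  BMap.phi_ext fun _ f => Phi.DB_zero f.2 τ

/-- B is the sum of a trivial bundle C and of B'. The invertible Euler operator is a sum of two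
maps: one factors through Hom(C, forms of symmetric degree m - 1), without cohomology by induction
and triviality of C, the other through forms on B'. So its inverse exhibits every class as zero. For
m = 0 the first map is zero. -/
theorem hcoh_of_decomposition (hι : Eqv ι) (hκ : Eqv κ) (hι' : Eqv ι') (hκ' : Eqv κ') (τ : Triv C) (h : κ ∘ₗ ι = LinearMap.id)
    (h' : ι ∘ₗ κ + ι' ∘ₗ κ' = LinearMap.id) (c : ℕ)
    (hB : ∀ m, Subsingleton (hcoh F l q (RRep.phi A B' M c m))) (m : ℕ) :
    Subsingleton (hcoh F l q (RRep.phi A B M c m)) := by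
  induction m with
  | zero =>
    obtain ⟨b, -, hb⟩ := BMap.euler_inverse (A := A) (M := M) hι hκ hι' hκ' h h' c 0
    refine subsingleton_of_forall_eq 0 fun x => ?_
    rw [← hmap_id F l q x, ← hb, hmap_comp, BMap.euler, BMap.der_zero, zero_add, hmap_comp,
      @Subsingleton.elim _ (hB 0) (hmap F l q (BMap.pull M LinearMap.id (Eqv.id A) ι' hι' c 0) x) 0,
      map_zero, map_zero]
  | succ m ih =>
    obtain ⟨b, -, hb⟩ := BMap.euler_inverse (A := A) (M := M) hι hκ hι' hκ' h h' c (m + 1)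
    refine subsingleton_of_forall_eq 0 fun x => ?_
    rw [← hmap_id F l q x, ← hb, hmap_comp, BMap.euler, BMap.der_succ hι hκ, map_add, LinearMap.add_apply,
      hmap_comp, hmap_comp, @Subsingleton.elim _ (hcoh_homRep τ ih)
        (hmap F l q (BMap.dbHom A M ι hι c m) x) 0,
      @Subsingleton.elim _ (hB (m + 1)) (hmap F l q (BMap.pull M LinearMap.id (Eqv.id A) ι' hι' c (m + 1)) x) 0,
      map_zero, map_zero, add_zero, map_zero]

end ext

section retract
variable {A B M : RRep W} {F : Mod ω n} {l : List ℕ} {q : ℕ}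

/-- Contraction of all alternating variables. -/
def BMap.curryHom (A B M : RRep W) (c m : ℕ) :
    BMap (RRep.phi A B M (c + 1) m) (RRep.homRep A (RRep.phi A B M c m)) :=
  BMap.const (curryA A B M c m) fun p f => LinearMap.ext fun v => Subtype.ext rfl

/-- Alternation. -/
def BMap.epsHom (A B M : RRep W) (c m : ℕ) :
    BMap (RRep.homRep A (RRep.phi A B M c m)) (RRep.phi A B M (c + 1) m) :=
  BMap.const
    ({ toFun := fun g => ⟨eps fun b => (g b).1,
         AM.eps (g := (Phi A B M c m).subtype ∘ₗ g) fun b => (g b).2.1,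
         Deg.eps fun b => (g b).2.2⟩
       map_add' := fun g g' => Subtype.ext (eps_add _ _)
       map_smul' := fun c g => Subtype.ext (eps_smul c _) } :
        (A →ₗ[ℂ] Phi A B M c m) →ₗ[ℂ] Phi A B M (c + 1) m)
    fun p g => Subtype.ext <| Eq.symm <| pull_eps _ _ _ _ _ fun b => rfl

/-- Contraction followed by alternation is multiplication by c + 1, so forms of degree c + 1 are a
retract of Hom(A, forms of degree c). -/
lemma hcoh_phi_succ (τ : Triv A) {c m : ℕ} (h : Subsingleton (hcoh F l q (RRep.phi A B M c m))) :
    Subsingleton (hcoh F l q (RRep.phi A B M (c + 1) m)) := by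
  refine hcoh_of_retract (BMap.curryHom A B M c m) (((c + 1 : ℕ) : ℂ)⁻¹ • BMap.epsHom A B M c m)
    (BMap.phi_ext fun g f => ?_) (hcoh_homRep τ h)
  have h1 := Phi.DA_id f.2
  have h2 : ((c + 1 : ℕ) : ℂ)⁻¹ • DA LinearMap.id f.1 = f.1 := by
    rw [h1, smul_smul, inv_mul_cancel₀ (by exact_mod_cast Nat.succ_ne_zero c), one_smul]
  exact h2

end retract
end LagGrass

end

/-! ### Koszul complexes and dimension shifting -/

noncomputable section
namespace LagGrass
open Raw
variable {V : Type u} [AddCommGroup V] [Module ℂ V] {ω : LinearMap.BilinForm ℂ V} {n : ℕ}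
variable [FiniteDimensional ℂ V] {W : LagGrass ω n}

section ker
variable {M M' M'' : RRep W} {F : Mod ω n} {l : List ℕ} {q : ℕ}

lemma SES.ker {f : M →ₗ[ℂ] M'} (hf : Eqv f) (hs : Function.Surjective f) :
    ∃ a : BMap (RRep.kerRep f hf) M, SES a (BMap.const f hf) :=
  ⟨BMap.const (LinearMap.ker f).subtype fun _ _ => rfl, _, fun _ _ => rfl, f, hf, rfl, rfl,
    Subtype.val_injective, hs, fun x => by
      constructor
      · intro h; exact ⟨⟨x, h⟩, rfl⟩
      · rintro ⟨y, rfl⟩; exact y.2⟩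

lemma SES.ker_ker {f : M →ₗ[ℂ] M'} {g : M' →ₗ[ℂ] M''} (hf : Eqv f) (hg : Eqv g)
    (h : Function.Exact f g) :
    ∃ (a : BMap (RRep.kerRep f hf) M) (b : BMap M (RRep.kerRep g hg)), SES a b := by
  let f' : M →ₗ[ℂ] LinearMap.ker g := LinearMap.codRestrict (LinearMap.ker g) f fun m => (h _).2 ⟨m, rfl⟩
  refine ⟨BMap.const (LinearMap.ker f).subtype fun _ _ => rfl,
    BMap.const (M' := RRep.kerRep g hg) f' fun p m => Subtype.ext (hf p m), _, fun _ _ => rfl,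
    f', fun p m => Subtype.ext (hf p m), rfl, rfl, Subtype.val_injective, fun x => ?_, fun x => ?_⟩
  · obtain ⟨y, hy⟩ := (h x.1).1 x.2
    exact ⟨y, Subtype.ext hy⟩
  · constructor
    · intro h'; exact ⟨⟨x, congrArg Subtype.val h'⟩, rfl⟩
    · rintro ⟨y, rfl⟩; exact Subtype.ext y.2

/-- By exactness the kernel of g is the quotient of M by the kernel of f; vanishing is shifted one
degree up, to the kernel of f. -/
lemma hcoh_ker_of_exact (hfr : HasFrames W) {f : M →ₗ[ℂ] M'} {g : M' →ₗ[ℂ] M''} (hf : Eqv f)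
    (hg : Eqv g) (h : Function.Exact f g) (hM : Subsingleton (hcoh F l q M))
    (hk : Subsingleton (hcoh F l (q + 1) (RRep.kerRep f hf))) :
    Subsingleton (hcoh F l q (RRep.kerRep g hg)) := by
  obtain ⟨a, b, hab⟩ := SES.ker_ker hf hg h
  exact (hab.iter l).coh_right hfr hM hk

lemma hcoh_of_surjective (hfr : HasFrames W) {f : M →ₗ[ℂ] M'} (hf : Eqv f)
    (h : Function.Surjective f) (hM : Subsingleton (hcoh F l q M))
    (hk : Subsingleton (hcoh F l (q + 1) (RRep.kerRep f hf))) : Subsingleton (hcoh F l q M') := by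
  obtain ⟨a, ha⟩ := SES.ker hf h
  exact (ha.iter l).coh_right hfr hM hk

lemma hcoh_kerRep_of_injective {f : M →ₗ[ℂ] M'} (hf : Eqv f) (h : Function.Injective f) :
    Subsingleton (hcoh F l q (RRep.kerRep f hf)) := by
  have : Subsingleton (RRep.kerRep f hf) := subsingleton_of_forall_eq 0 fun x =>
    Subtype.ext (h ((show f x.1 = 0 from x.2).trans (map_zero f).symm))
  exact hcoh_of_subsingleton

end ker

namespace Phi
variable {A B M A' B' M' : Type*} [AddCommGroup A] [Module ℂ A] [AddCommGroup B] [Module ℂ B]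
  [AddCommGroup M] [Module ℂ M] [AddCommGroup A'] [Module ℂ A'] [AddCommGroup B'] [Module ℂ B']
  [AddCommGroup M'] [Module ℂ M']

variable (M) in
/-- The Koszul differential on forms. -/
def y (π : B →ₗ[ℂ] A) (c m : ℕ) : Phi A B M (c + 1) m →ₗ[ℂ] Phi A B M c (m + 1) :=
  (yop π).restrict fun _ hf => Phi.yop hf π

variable (M) in
/-- Pullback of forms. -/
def pl (α : A' →ₗ[ℂ] A) (β : B' →ₗ[ℂ] B) (c m : ℕ) : Phi A B M c m →ₗ[ℂ] Phi A' B' M c m :=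
  (Raw.pull α β LinearMap.id).restrict fun _ hf => Phi.pull hf _ _ _

lemma pull_id (f : Raw A B M) : Raw.pull LinearMap.id LinearMap.id LinearMap.id f = f := by
  funext l s
  change f (l.map _) (s.map _) = _
  rw [LinearMap.id_coe, LinearMap.id_coe, List.map_id, List.map_id]

/-- An injective endomorphism of the finite-dimensional space K is onto, so y is onto K already on
the image of x. This avoids decomposing into eigenspaces. -/
lemma exists_of_comp_injective {N N' : Type*} [AddCommGroup N] [Module ℂ N] [AddCommGroup N']
    [Module ℂ N'] [FiniteDimensional ℂ N] (y : N' →ₗ[ℂ] N) (x : N →ₗ[ℂ] N') (K : Submodule ℂ N)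
    (hy : ∀ g, y g ∈ K) (h : ∀ f ∈ K, y (x f) = 0 → f = 0) : ∀ f ∈ K, ∃ g, y g = f := by
  let T : K →ₗ[ℂ] K := LinearMap.codRestrict K (y ∘ₗ x ∘ₗ K.subtype) fun f => hy _
  have hT : Function.Injective T :=
    (injective_iff_map_eq_zero T).2 fun f hf => Subtype.ext (h f.1 f.2 (congrArg Subtype.val hf))
  intro f hf
  obtain ⟨g, hg⟩ := LinearMap.surjective_of_injective hT ⟨f, hf⟩
  exact ⟨x g.1, congrArg Subtype.val hg⟩

lemma exists_yop [FiniteDimensional ℂ A] [FiniteDimensional ℂ B]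
    [FiniteDimensional ℂ M] {π : B →ₗ[ℂ] A} (σ : A →ₗ[ℂ] B) {c m : ℕ}
    (K : Submodule ℂ (Phi A B M c (m + 1))) (hy : ∀ g, y M π c m g ∈ K)
    (h : ∀ f ∈ K, Raw.yop π (Raw.xop σ f.1) = 0 → f = 0) : ∀ f ∈ K, ∃ g, y M π c m g = f :=
  exists_of_comp_injective (y M π c m) ((Raw.xop σ).restrict fun _ hf => Phi.xop hf σ) K hy
    fun f hf h0 => h f hf (congrArg Subtype.val h0)

/-- On the kernel of y the composition yx equals the anticommutator, i.e. the sum of derivations in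
`xop_yop`; if that is injective, every cycle is a boundary. -/
lemma y_exact [FiniteDimensional ℂ A] [FiniteDimensional ℂ B]
    [FiniteDimensional ℂ M] {π : B →ₗ[ℂ] A} (σ : A →ₗ[ℂ] B) {c m : ℕ}
    (h : ∀ f ∈ Phi A B M (c + 1) (m + 1), Raw.DA (π ∘ₗ σ) f + Raw.DB (σ ∘ₗ π) f = 0 → f = 0) :
    Function.Exact (y M π (c + 1) m) (y M π c (m + 1)) := by
  intro f
  constructor
  · intro hf
    refine exists_yop σ (LinearMap.ker (y M π c (m + 1))) (fun g => ?_) (fun f hf h0 => ?_) f hf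
    · exact Subtype.ext (Raw.yop_yop π g.2.1)
    · refine Subtype.ext (h f.1 f.2 ?_)
      rw [← Raw.xop_yop π σ f.2.1, h0, show Raw.yop π f.1 = 0 from congrArg Subtype.val hf, map_zero,
        add_zero]
  · rintro ⟨g, rfl⟩
    exact Subtype.ext (Raw.yop_yop π g.2.1)

lemma yop_xop_zero {π : B →ₗ[ℂ] A} {σ : A →ₗ[ℂ] B} {m : ℕ} {f : Raw A B M} (hf : f ∈ Phi A B M 0 m) :
    Raw.yop π (Raw.xop σ f) = Raw.DB (σ ∘ₗ π) f := by
  have := Raw.xop_yop π σ hf.1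
  rw [Phi.yop_zero hf, map_zero, zero_add, Phi.DA_zero hf, zero_add] at this
  exact this

lemma y_injective {π : B →ₗ[ℂ] A} (hπ : Function.Surjective π) (c : ℕ) :
    Function.Injective (y M π c 0) := by
  rw [← LinearMap.ker_eq_bot, LinearMap.ker_eq_bot']
  intro f hf
  refine Subtype.ext (Phi.eq_zero_of_ia f.2 fun a => ?_)
  obtain ⟨b, rfl⟩ := hπ a
  have h := Raw.db_yop f.1 π b
  rw [show Raw.yop π f.1 = 0 from congrArg Subtype.val hf, Deg.db_zero f.2.2, map_zero, map_zero,
    add_zero] at h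
  exact h.symm

/-- Exactness at the end of the Koszul complex of a split surjection. -/
lemma y_pl_exact [FiniteDimensional ℂ A] [FiniteDimensional ℂ B]
    [FiniteDimensional ℂ M] {π : B →ₗ[ℂ] A} {σ : A →ₗ[ℂ] B}
    (hπσ : π ∘ₗ σ = LinearMap.id) {ι : B' →ₗ[ℂ] B} {μ : B →ₗ[ℂ] B'}
    (hι : π ∘ₗ ι = 0) (hμ : ι ∘ₗ μ = LinearMap.id - σ ∘ₗ π) (m : ℕ) :
    Function.Exact (y M π 0 m) (pl M (LinearMap.id : A →ₗ[ℂ] A) ι 0 (m + 1)) := by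
  have hz : ∀ g : Phi A B M 1 m, pl M (LinearMap.id : A →ₗ[ℂ] A) ι 0 (m + 1) (y M π 0 m g) = 0 := by
    intro g
    refine Subtype.ext ?_
    have h1 := Raw.pull_yop LinearMap.id ι LinearMap.id g.1 π (0 : B' →ₗ[ℂ] A) (by rw [hι]; rfl)
    refine h1.trans ?_
    have h2 : (fun b : B' => ia ((0 : B' →ₗ[ℂ] A) b) (Raw.pull LinearMap.id ι LinearMap.id g.1)) =
        fun _ => (0 : Raw A B' M) := funext fun b => by
      rw [LinearMap.zero_apply, ← iaL_apply (Phi.pull g.2 _ _ _).1, map_zero]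
    change delta _ = 0
    rw [h2]
    exact delta_zero
  intro f
  constructor
  · intro hf
    refine exists_yop σ (LinearMap.ker (pl M (LinearMap.id : A →ₗ[ℂ] A) ι 0 (m + 1))) hz
      (fun f hf h0 => ?_) f hf
    -- In alternating degree zero yx is the derivation of the idempotent σπ. Forms that restrict to
    -- zero on B' are also killed by the pullback along 1 - σπ = ιμ.
    refine Subtype.ext (Phi.eq_zero_of_DB_add_pull (e := σ ∘ₗ π) (fun b => ?_) f.2 ?_)
    · exact congrArg σ (LinearMap.congr_fun hπσ (π b))
    · rw [← yop_xop_zero f.2, h0, zero_add, ← hμ]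
      refine (pull_pull LinearMap.id ι LinearMap.id LinearMap.id μ LinearMap.id f.1).symm.trans ?_
      rw [show Raw.pull LinearMap.id ι LinearMap.id f.1 = 0 from congrArg Subtype.val hf, map_zero]
  · rintro ⟨g, rfl⟩
    exact hz g

lemma pl_surjective {ι : B' →ₗ[ℂ] B} (hι : Function.Injective ι) (c m : ℕ) :
    Function.Surjective (pl M (LinearMap.id : A →ₗ[ℂ] A) ι c m) := by
  obtain ⟨ν, hν⟩ := ι.exists_leftInverse_of_injective (LinearMap.ker_eq_bot.2 hι)
  intro f
  refine ⟨pl M LinearMap.id ν c m f, Subtype.ext ?_⟩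
  refine (pull_pull LinearMap.id ν LinearMap.id LinearMap.id ι LinearMap.id f.1).trans ?_
  rw [hν]
  exact pull_id f.1

lemma pl_injective_zero {ι : B' →ₗ[ℂ] B} :
    Function.Injective (pl M (LinearMap.id : A →ₗ[ℂ] A) ι 0 0) := by
  intro f g h
  apply evalNil_injective
  exact congrArg (fun z => z.1 [] []) h

end Phi

section eqv
variable {A B A' B' : RRep W} (M : RRep W)

lemma Phi.y_eqv {π : B →ₗ[ℂ] A} (hπ : Eqv π) (c m : ℕ) :
    Eqv (M := RRep.phi A B M (c + 1) m) (M' := RRep.phi A B M c (m + 1)) (Phi.y M π c m) :=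
  fun p f => Subtype.ext (pull_yop _ _ _ f.1 π π (hπ.symm_apply p⁻¹)).symm

lemma Phi.pl_eqv {α : A' →ₗ[ℂ] A} {β : B' →ₗ[ℂ] B} (hα : Eqv α) (hβ : Eqv β) (c m : ℕ) :
    Eqv (M := RRep.phi A B M c m) (M' := RRep.phi A' B' M c m) (Phi.pl M α β c m) :=
  fun p f => Subtype.ext <| by
    change Raw.pull α β LinearMap.id (rawAct A B M p f.1) =
      rawAct A' B' M p (Raw.pull α β LinearMap.id f.1)
    rw [rawAct, rawAct, pull_pull, pull_pull, hα.symm_apply, hβ.symm_apply]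
    rfl

end eqv

section lk
variable {A B B' M : RRep W} {F : Mod ω n} {l : List ℕ} {C : ℕ}

/-- The kernel in bidegree (c + 1, m + 1) is the quotient of the forms of bidegree (c + 2, m) by the
kernel there. Each step raises both the alternating degree and the cohomological degree by one, in
accordance with the bound c + C in `hΦ`. At m = 0 the differential is injective, since π is onto. -/
theorem koszul_vanishing (hfr : HasFrames W) {π : B →ₗ[ℂ] A} {σ : A →ₗ[ℂ] B} (hπ : Eqv π)
    (hπσ : π ∘ₗ σ = LinearMap.id)
    (hΦ : ∀ c m q, max 1 (c + C) ≤ q → Subsingleton (hcoh F l q (RRep.phi A B M c m))) (m : ℕ) :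
    ∀ c q, c + 2 + C ≤ q → Subsingleton (hcoh F l q
      (RRep.kerRep (M := RRep.phi A B M (c + 1) m) (M' := RRep.phi A B M c (m + 1)) (Phi.y M π c m)
        (Phi.y_eqv M hπ c m))) := by
  have hs : Function.Surjective π := fun a => ⟨σ a, LinearMap.congr_fun hπσ a⟩
  induction m with
  | zero => exact fun c q _ => hcoh_kerRep_of_injective _ (Phi.y_injective hs c)
  | succ m ih =>
    intro c q hq
    refine hcoh_ker_of_exact hfr (Phi.y_eqv M hπ (c + 1) m) (Phi.y_eqv M hπ c (m + 1))
      (Phi.y_exact σ fun f hf h => ?_) (hΦ _ _ _ (by omega)) (ih _ _ (by omega))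
    rw [hπσ, Phi.DA_id hf] at h
    exact Phi.eq_zero_of_smul_add_DB (e := σ ∘ₗ π)
      (fun b => congrArg σ (LinearMap.congr_fun hπσ (π b))) (c + 1) c.succ_pos hf h

/-- The kernel of the restriction from symmetric forms on B to those on B' = ker π is the image of
the last Koszul differential, so one more shift reduces it to `koszul_vanishing`. -/
theorem koszul_end_vanishing (hfr : HasFrames W) {π : B →ₗ[ℂ] A} {σ : A →ₗ[ℂ] B} (hπ : Eqv π)
    (hπσ : π ∘ₗ σ = LinearMap.id) {ι : B' →ₗ[ℂ] B} {μ : B →ₗ[ℂ] B'} (hι : Eqv ι)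
    (hπι : π ∘ₗ ι = 0) (hμ : ι ∘ₗ μ = LinearMap.id - σ ∘ₗ π)
    (hΦ : ∀ c m q, max 1 (c + C) ≤ q → Subsingleton (hcoh F l q (RRep.phi A B M c m))) (m q : ℕ)
    (hq : 1 + C ≤ q) : Subsingleton (hcoh F l q
      (RRep.kerRep (M := RRep.phi A B M 0 m) (M' := RRep.phi A B' M 0 m)
        (Phi.pl M LinearMap.id ι 0 m) (Phi.pl_eqv M (Eqv.id A) hι 0 m))) := by
  cases m with
  | zero => exact hcoh_kerRep_of_injective _ Phi.pl_injective_zero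
  | succ m =>
    exact hcoh_ker_of_exact hfr (Phi.y_eqv M hπ 0 m) (Phi.pl_eqv M (Eqv.id A) hι 0 (m + 1))
      (Phi.y_pl_exact hπσ hπι hμ m) (hΦ _ _ _ (by omega))
      (koszul_vanishing hfr hπ hπσ hΦ m 0 _ (by omega))

end lk

end LagGrass

end

/-! ### Forms as alternating forms with values in symmetric forms -/

noncomputable section
namespace LagGrass
open Raw

section generic
variable {A B M A' : Type*} [AddCommGroup A] [Module ℂ A] [AddCommGroup B] [Module ℂ B]
  [AddCommGroup M] [Module ℂ M] [AddCommGroup A'] [Module ℂ A']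

/-- Functions concentrated on empty lists. -/
def Raw.nil (x : M) : Raw A B M := fun l s =>
  match l, s with
  | [], [] => x
  | _, _ => 0

lemma Phi.nil_mem (x : M) : Raw.nil x ∈ Phi A B M 0 0 := by
  have hia : ∀ (x : M) a, ia a (Raw.nil x : Raw A B M) = 0 := fun x a => rfl
  have hdb : ∀ (x : M) a, db a (Raw.nil x : Raw A B M) = 0 := fun x a =>
    funext fun l => by cases l <;> rfl
  have h0 : ∀ l s, (Raw.nil (0 : M) : Raw A B M) l s = 0 := fun l s => by
    cases l <;> cases s <;> rfl
  constructor
  · refine AM.of_stable (fun f => ∃ x, f = Raw.nil x) ?_ ?_ ?_ ⟨x, rfl⟩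
    · rintro _ ⟨x, rfl⟩
      constructor <;> intros <;> simp only [hia, hdb, map_zero, add_zero, smul_zero]
    · rintro _ a ⟨x, rfl⟩
      exact ⟨0, (hia x a).trans (funext fun l => funext fun s => (h0 l s).symm)⟩
    · rintro _ a ⟨x, rfl⟩
      exact ⟨0, (hdb x a).trans (funext fun l => funext fun s => (h0 l s).symm)⟩
  · intro l s h
    cases l with
    | nil => cases s with
      | nil => exact absurd ⟨rfl, rfl⟩ h
      | cons => rfl
    | cons => rfl

/-- The slice of a function at a list of alternating variables. -/
def Raw.slice (l : List A) : Raw A B M →ₗ[ℂ] Raw A B M where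
  toFun f := fun l' s => match l' with
    | [] => f l s
    | _ :: _ => 0
  map_add' f g := funext fun l' => funext fun s => by
    cases l' with
    | nil => rfl
    | cons => exact (add_zero (0 : M)).symm
  map_smul' c f := funext fun l' => funext fun s => by
    cases l' with
    | nil => rfl
    | cons => exact (smul_zero c).symm

lemma Raw.db_slice (l : List A) (b : B) (f : Raw A B M) : db b (slice l f) = slice l (db b f) :=
  funext fun l' => by cases l' <;> rfl

lemma AM.slice {f : Raw A B M} (hf : f ∈ AM A B M) (l : List A) : Raw.slice l f ∈ AM A B M := by
  refine AM.of_stable (fun z => ∃ f ∈ AM A B M, z = Raw.slice l f) ?_ ?_ ?_ ⟨f, hf, rfl⟩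
  · rintro _ ⟨f, hf, rfl⟩
    have hia : ∀ a, ia a (Raw.slice l f) = 0 := fun a => rfl
    have h := AM.loc hf
    refine ⟨fun a a' => ?_, fun c a => ?_, fun a => ?_, fun b b' => ?_, fun c b => ?_, fun b b' => ?_⟩
    · simp only [hia, add_zero]
    · simp only [hia, smul_zero]
    · simp only [hia, map_zero]
    · simp only [db_slice, h.db_add, map_add]
    · simp only [db_slice, h.db_smul, map_smul]
    · simp only [db_slice, h.db_comm b b']
  · rintro _ a ⟨f, hf, rfl⟩
    exact ⟨0, zero_mem _, (show ia a (Raw.slice l f) = 0 from rfl).trans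
      (map_zero (Raw.slice (B := B) (M := M) l)).symm⟩
  · rintro _ b ⟨f, hf, rfl⟩
    exact ⟨db b f, AM.db hf b, db_slice l b f⟩

lemma Phi.slice {c m : ℕ} {f : Raw A B M} (hf : f ∈ Phi A B M c m) (l : List A) :
    Raw.slice l f ∈ Phi A B M 0 m := by
  refine ⟨AM.slice hf.1 l, fun l' s h => ?_⟩
  cases l' with
  | nil => exact hf.2 l s fun h' => h ⟨rfl, h'.2⟩
  | cons => rfl

lemma AM.of_slice (m : ℕ) {G : Raw A A' (Phi A B M 0 m)} {f : Raw A B M} (hf : f ∈ AM A B M)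
    (h : ∀ l, (G l []).1 = Raw.slice l f) (h' : ∀ l b s, G l (b :: s) = 0) :
    G ∈ AM A A' (Phi A B M 0 m) := by
  refine AM.of_stable (fun G => ∃ f ∈ AM A B M, (∀ l, (G l []).1 = Raw.slice l f) ∧
    ∀ l b s, G l (b :: s) = 0) ?_ ?_ ?_ ⟨f, hf, h, h'⟩
  · rintro G ⟨f, hf, h, h'⟩
    have hdb : ∀ b, db b G = 0 := fun b => funext fun l => funext fun s => h' l b s
    have h2 := AM.loc hf
    refine ⟨fun a a' => ?_, fun c a => ?_, fun a => ?_, fun b b' => ?_, fun c b => ?_, fun b b' => ?_⟩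
    · funext l s
      cases s with
      | nil =>
        refine Subtype.ext ((h _).trans ?_)
        change Raw.slice l (ia (a + a') f) = (G (a :: l) []).1 + (G (a' :: l) []).1
        rw [h2.ia_add, map_add, h, h]
        rfl
      | cons b s => exact (h' _ _ _).trans ((congrArg₂ (· + ·) (h' _ _ _) (h' _ _ _)).trans (add_zero _)).symm
    · funext l s
      cases s with
      | nil =>
        refine Subtype.ext ((h _).trans ?_)
        change Raw.slice l (ia (c • a) f) = c • (G (a :: l) []).1
        rw [h2.ia_smul, map_smul, h]
        rfl
      | cons b s => exact (h' _ _ _).trans ((congrArg (c • ·) (h' _ _ _)).trans (smul_zero _)).symm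
    · funext l s
      cases s with
      | nil =>
        refine Subtype.ext ((h _).trans ?_)
        change Raw.slice l (ia a (ia a f)) = 0
        rw [h2.ia_self, map_zero]
      | cons b s => exact h' _ _ _
    · simp only [hdb, add_zero]
    · simp only [hdb, smul_zero]
    · simp only [hdb, map_zero]
  · rintro G a ⟨f, hf, h, h'⟩
    exact ⟨ia a f, AM.ia hf a, fun l => h (a :: l), fun l b s => h' _ _ _⟩
  · rintro G b ⟨f, hf, h, h'⟩
    exact ⟨0, zero_mem _, fun l => by rw [map_zero]; exact congrArg Subtype.val (h' l b []),
      fun l b' s => h' _ _ _⟩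

variable (A B M A') in
/-- Alternating forms with values in symmetric forms. -/
def Phi.outer (c m : ℕ) : Phi A B M c m →ₗ[ℂ] Phi A A' (Phi A B M 0 m) c 0 where
  toFun f := ⟨fun l s => match s with
    | [] => ⟨Raw.slice l f.1, Phi.slice f.2 l⟩
    | _ :: _ => 0, AM.of_slice m f.2.1 (fun _ => rfl) (fun _ _ _ => rfl), fun l s h => by
      cases s with
      | nil =>
        refine Subtype.ext (funext fun l' => funext fun s' => ?_)
        cases l' with
        | nil => exact f.2.2 l s' fun h' => h ⟨h'.1, rfl⟩
        | cons => rfl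
      | cons => rfl⟩
  map_add' f g := Subtype.ext <| funext fun l => funext fun s => by
    cases s with
    | nil => exact Subtype.ext (map_add (Raw.slice l) f.1 g.1)
    | cons => exact (add_zero (0 : Phi A B M 0 m)).symm
  map_smul' c f := Subtype.ext <| funext fun l => funext fun s => by
    cases s with
    | nil => exact Subtype.ext (map_smul (Raw.slice l) c f.1)
    | cons => exact (smul_zero (A := Phi A B M 0 m) c).symm

lemma AM.of_values {m : ℕ} {G : Raw A A' (Phi A B M 0 m)} (hG : G ∈ AM A A' (Phi A B M 0 m)) :
    (fun l s => (G l []).1 [] s : Raw A B M) ∈ AM A B M := by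
  refine AM.of_stable (fun z => ∃ m, ∃ G ∈ AM A A' (Phi A B M 0 m),
    z = fun l s => (G l []).1 [] s) ?_ ?_ ?_ ⟨m, G, hG, rfl⟩
  · rintro _ ⟨m, G, hG, rfl⟩
    have h := AM.loc hG
    refine ⟨fun a a' => ?_, fun c a => ?_, fun a => ?_, fun b b' => ?_, fun c b => ?_, fun b b' => ?_⟩ <;>
      funext l s
    · exact congrArg (fun z => (z l []).1 [] s) (h.ia_add a a')
    · exact congrArg (fun z => (z l []).1 [] s) (h.ia_smul c a)
    · exact congrArg (fun z => (z l []).1 [] s) (h.ia_self a)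
    · exact congrArg (fun z => z [] s) ((AM.loc (G l []).2.1).db_add b b')
    · exact congrArg (fun z => z [] s) ((AM.loc (G l []).2.1).db_smul c b)
    · exact congrArg (fun z => z [] s) ((AM.loc (G l []).2.1).db_comm b b')
  · rintro _ a ⟨m, G, hG, rfl⟩
    exact ⟨m, ia a G, AM.ia hG a, rfl⟩
  · rintro _ b ⟨m, G, hG, rfl⟩
    cases m with
    | zero =>
      refine ⟨0, 0, zero_mem _, funext fun l => funext fun s => ?_⟩
      exact (G l []).2.2 [] (b :: s) (by simp)
    | succ m =>
      refine ⟨m, Raw.pull LinearMap.id LinearMap.id ((curryB A B M 0 m).flip b) G, AM.pull _ _ _ hG,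
        funext fun l => funext fun s => ?_⟩
      change (G l []).1 [] (b :: s) = (G (l.map _) []).1 [] (b :: s)
      rw [LinearMap.id_coe, List.map_id]

variable (A B M A') in
/-- The inverse of the description of forms as forms with values. -/
def Phi.unouter (c m : ℕ) : Phi A A' (Phi A B M 0 m) c 0 →ₗ[ℂ] Phi A B M c m where
  toFun G := ⟨fun l s => (G.1 l []).1 [] s, AM.of_values G.2.1, fun l s h => by
    by_cases hl : l.length = c
    · exact (G.1 l []).2.2 _ _ fun h' => h ⟨hl, h'.2⟩
    · change (G.1 l []).1 [] s = 0
      rw [G.2.2 l [] fun h' => hl h'.1]; rfl⟩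
  map_add' f g := rfl
  map_smul' c f := rfl

end generic

variable {V : Type u} [AddCommGroup V] [Module ℂ V] {ω : LinearMap.BilinForm ℂ V} {n : ℕ}
variable {W : LagGrass ω n}

section
variable (A B M : RRep W)

/-- Evaluation on empty lists. -/
def BMap.evalNil : BMap (RRep.phi A B M 0 0) M := BMap.const (LagGrass.evalNil A B M) fun _ _ => rfl

/-- Forms of degree zero. -/
def BMap.mkNil : BMap M (RRep.phi A B M 0 0) :=
  BMap.const
    ({ toFun := fun x => ⟨Raw.nil x, Phi.nil_mem x⟩
       map_add' := fun x y => evalNil_injective A B M rfl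
       map_smul' := fun c x => evalNil_injective A B M rfl } : M →ₗ[ℂ] Phi A B M 0 0)
    fun p x => evalNil_injective A B M rfl

lemma BMap.evalNil_mkNil : (BMap.evalNil A B M).comp (BMap.mkNil A B M) = BMap.id M := rfl

lemma BMap.mkNil_evalNil : (BMap.mkNil A B M).comp (BMap.evalNil A B M) = BMap.id _ :=
  BMap.ext fun _ _ => evalNil_injective A B M rfl

end

variable [FiniteDimensional ℂ V] {B M : RRep W} {F : Mod ω n} {l : List ℕ} {q : ℕ}

/-- Separating the two kinds of variables shows the forms of bidegree (c, m) as a retract of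
alternating c-forms with values in symmetric m-forms, so that ⋀^c Q* can be counted as one more
factor of the list. -/
lemma hcoh_of_alt {c m : ℕ}
    (h : Subsingleton (hcoh F l q (RRep.alt c (RRep.phi (RRep.qRep W) B M 0 m)))) :
    Subsingleton (hcoh F l q (RRep.phi (RRep.qRep W) B M c m)) := by
  refine hcoh_of_retract (BMap.const (Phi.outer (RRep.qRep W) B M (RRep.qRep W) c m) fun p f => ?_)
    (BMap.const (M := RRep.alt c (RRep.phi (RRep.qRep W) B M 0 m))
      (Phi.unouter (RRep.qRep W) B M (RRep.qRep W) c m) fun p f => rfl) ?_ h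
  · refine Subtype.ext (funext fun l => funext fun s => ?_)
    cases s with
    | nil =>
      refine Subtype.ext (funext fun l' => funext fun s' => ?_)
      cases l' with
      | nil => rfl
      | cons => exact (map_zero (M.ρ p)).symm
    | cons => exact (map_zero ((RRep.phi (RRep.qRep W) B M 0 m).ρ p)).symm
  · rfl

lemma iter_append (l : List ℕ) (c : ℕ) (M : RRep W) :
    RRep.iter (l ++ [c]) M = RRep.iter l (RRep.alt c M) := List.foldr_append ..

/-- Factors ⋀^0 Q* change nothing. They let a twist without exterior factors be treated as one with
N factors of total cost zero. -/
lemma coh_of_iter_zero (N : ℕ)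
    (h : Subsingleton (hcoh F (List.replicate N 0) q M)) : Subsingleton (coh F M q) := by
  induction N with
  | zero => exact h
  | succ N ih =>
    exact ih (coh.subsingleton_of_retract (BMap.mkNil (RRep.qRep W) (RRep.qRep W) _)
      (BMap.evalNil (RRep.qRep W) (RRep.qRep W) _) (BMap.evalNil_mkNil _ _ _) h)

end LagGrass

end

/-! ### Removing copies of the subbundle one at a time -/

noncomputable section
namespace LagGrass
open Raw
variable {V : Type u} [AddCommGroup V] [Module ℂ V] {ω : LinearMap.BilinForm ℂ V} {n : ℕ}
variable [FiniteDimensional ℂ V] {W : LagGrass ω n}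

/-- The pairing between the tautological subbundle and quotient bundle. -/
def sympPair (W : LagGrass ω n) : W.1 →ₗ[ℂ] (V ⧸ W.1) →ₗ[ℂ] ℂ where
  toFun s := W.1.liftQ (ω s.1) fun w hw => W.2.1 _ s.2 _ hw
  map_add' s s' := Submodule.linearMap_qext _ <| LinearMap.ext fun v =>
    LinearMap.congr_fun (map_add ω s.1 s'.1) v
  map_smul' c s := Submodule.linearMap_qext _ <| LinearMap.ext fun v =>
    LinearMap.congr_fun (map_smul ω c s.1) v

/-- Nondegeneracy makes the map from W to the dual of V/W injective; both have dimension n, so it is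
an isomorphism, and a basis of V/W with its dual basis in W serves. -/
lemma exists_dual_families (hV : Module.finrank ℂ V = 2 * n) (hnd : ω.Nondegenerate)
    (W : LagGrass ω n) : ∃ (s : Fin n → W.1) (q : Fin n → V ⧸ W.1),
      (∀ a, ∑ t, sympPair W (s t) a • q t = a) ∧ (∀ b, ∑ t, sympPair W b (q t) • s t = b) ∧
      ∑ t, sympPair W (s t) (q t) = (n : ℂ) := by
  have hW := W.2.2
  have hQ : Module.finrank ℂ (V ⧸ W.1) = n := by
    have := W.1.finrank_quotient_add_finrank
    omega
  have hinj : Function.Injective (sympPair W) := by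
    rw [injective_iff_map_eq_zero]
    intro s hs
    refine Subtype.ext (hnd.1 s.1 fun v => ?_)
    exact LinearMap.congr_fun hs (Submodule.Quotient.mk v)
  let e : W.1 ≃ₗ[ℂ] Module.Dual ℂ (V ⧸ W.1) := LinearEquiv.ofInjectiveOfFinrankEq (sympPair W) hinj
    (by rw [Subspace.dual_finrank_eq, hW, hQ])
  have he : ∀ s, e s = sympPair W s := fun s => rfl
  let q := Module.finBasisOfFinrankEq ℂ (V ⧸ W.1) hQ
  have hs : ∀ t, sympPair W (e.symm (q.coord t)) = q.coord t := fun t => e.apply_symm_apply _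
  refine ⟨fun t => e.symm (q.coord t), q, fun a => ?_, fun b => hinj ?_, ?_⟩
  · simp only [hs]
    exact q.sum_repr a
  · rw [map_sum]
    refine q.ext fun j => ?_
    rw [LinearMap.sum_apply]
    simp only [map_smul, hs, LinearMap.smul_apply, Module.Basis.coord_apply, Module.Basis.repr_self]
    simp [Finsupp.single_apply]
  · simp only [hs, Module.Basis.coord_apply, Module.Basis.repr_self]
    simp

/-- The dual families for the symplectic pairing. -/
def DualPair.symplectic (hV : Module.finrank ℂ V = 2 * n) (hnd : ω.Nondegenerate)
    (W : LagGrass ω n) : DualPair (RRep.qRep W) (RRep.sRep W) n where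
  pair := sympPair W
  inv p s a := by
    obtain ⟨v, rfl⟩ := W.1.mkQ_surjective a
    exact p.2.1 s.1 v
  s := (exists_dual_families hV hnd W).choose
  q := (exists_dual_families hV hnd W).choose_spec.choose
  hA := (exists_dual_families hV hnd W).choose_spec.choose_spec.1
  hS := (exists_dual_families hV hnd W).choose_spec.choose_spec.2.1
  trace := (exists_dual_families hV hnd W).choose_spec.choose_spec.2.2

variable (n) in
/-- Lists of degrees of the first `N` factors, with their costs. -/
inductive Admissible : ℕ → List ℕ → ℕ → Prop
  | nil : Admissible 0 [] 0
  -- The new factor is the (N + 1)-st, and b ≤ N is the case i_j < j of the sheaves ℒ with j = N +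
  -- 1.
  | low {N l C b} : Admissible N l C → b ≤ N → Admissible (N + 1) (l ++ [b]) (C + b)
  -- Here the new factor is 𝒪(-1) = ⋀^n Q*, the case i_j = j; its cost is j = N + 1 and not its
  -- degree n.
  | top {N l C} : Admissible N l C → Admissible (N + 1) (l ++ [n]) (C + (N + 1))

lemma Admissible.replicate (N : ℕ) : Admissible n N (List.replicate N 0) 0 := by
  induction N with
  | zero => exact .nil
  | succ N ih => rw [List.replicate_succ']; exact .low ih (Nat.zero_le N)

namespace RRep
variable (W) (k : ℕ)

/-- The product of a power of the subbundle with the trivial bundle. -/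
def sv : RRep W := prodRep (piRep k (sRep W)) (vRep W)

/-- The projection to the quotient bundle. -/
def svQ : sv W k →ₗ[ℂ] qRep W := W.1.mkQ ∘ₗ LinearMap.snd ℂ (Fin k → W.1) V

lemma svQ_eqv : Eqv (svQ W k) := fun _ _ => rfl

/-- The inclusion of a power of the subbundle. -/
def svS : piRep (k + 1) (sRep W) →ₗ[ℂ] sv W k :=
  LinearMap.prod (LinearMap.pi fun i : Fin k => LinearMap.proj (R := ℂ) (φ := fun _ => W.1) i.castSucc)
    (W.1.subtype ∘ₗ LinearMap.proj (R := ℂ) (φ := fun _ => W.1) (Fin.last k))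

lemma svS_eqv : Eqv (svS W k) := fun _ _ => rfl

lemma svS_injective : Function.Injective (svS W k) := fun s s' h => by
  refine funext fun i => ?_
  have h1 : ∀ j : Fin k, s j.castSucc = s' j.castSucc := fun j =>
    congrArg (fun z : (Fin k → W.1) × V => z.1 j) h
  have h2 : s (Fin.last k) = s' (Fin.last k) :=
    Subtype.ext (congrArg (fun z : (Fin k → W.1) × V => z.2) h)
  cases i using Fin.lastCases with
  | last => exact h2
  | cast j => exact h1 j

lemma exists_svS {z : sv W k} (h : svQ W k z = 0) : ∃ s, svS W k s = z := by
  have h1 : z.2 ∈ W.1 := (Submodule.Quotient.mk_eq_zero W.1).1 h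
  refine ⟨(Fin.snoc (α := fun _ => W.1) z.1 (⟨z.2, h1⟩ : W.1) : Fin (k + 1) → W.1), Prod.ext ?_ ?_⟩
  · funext i
    exact Fin.snoc_castSucc (α := fun _ => W.1) _ _ i
  · exact congrArg Subtype.val (Fin.snoc_last (α := fun _ => W.1) (⟨z.2, h1⟩ : W.1) z.1)

/-- Linear splittings of 0 → S^{k+1} → S^k ⊕ V → Q → 0, in which the last copy of S is included in
V. -/
lemma exists_sections : ∃ (σ : qRep W →ₗ[ℂ] sv W k) (μ : sv W k →ₗ[ℂ] piRep (k + 1) (sRep W)),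
    svQ W k ∘ₗ σ = LinearMap.id ∧ svS W k ∘ₗ μ = LinearMap.id - σ ∘ₗ svQ W k := by
  have hs : Function.Surjective (svQ W k) := fun a => by
    obtain ⟨v, rfl⟩ := W.1.mkQ_surjective a
    exact ⟨((0, v) : (Fin k → W.1) × V), rfl⟩
  obtain ⟨σ, hσ⟩ := (svQ W k).exists_rightInverse_of_surjective (LinearMap.range_eq_top.2 hs)
  obtain ⟨ν, hν⟩ := (svS W k).exists_leftInverse_of_injective
    (LinearMap.ker_eq_bot.2 (svS_injective W k))
  refine ⟨σ, ν ∘ₗ (LinearMap.id - σ ∘ₗ svQ W k), hσ, LinearMap.ext fun z => ?_⟩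
  obtain ⟨y, hy⟩ := exists_svS W k
    (z := (LinearMap.id - σ ∘ₗ svQ W k : sv W k →ₗ[ℂ] sv W k) z) (by
    rw [LinearMap.sub_apply, map_sub]
    exact sub_eq_zero.2 (LinearMap.congr_fun hσ (svQ W k z)).symm)
  rw [LinearMap.comp_apply, LinearMap.comp_apply, ← hy]
  exact congrArg (svS W k) (LinearMap.congr_fun hν y)

lemma svQ_svS : svQ W k ∘ₗ svS W k = 0 := LinearMap.ext fun s =>
  (Submodule.Quotient.mk_eq_zero W.1).2 (s (Fin.last k)).2

/-- The inclusions and projections of the two factors. -/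
def svInl : piRep k (sRep W) →ₗ[ℂ] sv W k := LinearMap.inl ℂ (Fin k → W.1) V
/-- The inclusion of the trivial factor. -/
def svInr : vRep W →ₗ[ℂ] sv W k := LinearMap.inr ℂ (Fin k → W.1) V
/-- The projection to the power of the subbundle. -/
def svFst : sv W k →ₗ[ℂ] piRep k (sRep W) := LinearMap.fst ℂ (Fin k → W.1) V
/-- The projection to the trivial factor. -/
def svSnd : sv W k →ₗ[ℂ] vRep W := LinearMap.snd ℂ (Fin k → W.1) V

lemma svInl_eqv : Eqv (svInl W k) := fun p _ => Prod.ext rfl (map_zero ((vRep W).ρ p)).symm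
lemma svInr_eqv : Eqv (svInr W k) := fun p _ => Prod.ext (map_zero ((piRep k (sRep W)).ρ p)).symm rfl
lemma svFst_eqv : Eqv (svFst W k) := fun _ _ => rfl
lemma svSnd_eqv : Eqv (svSnd W k) := fun _ _ => rfl

lemma svSnd_svInr : svSnd W k ∘ₗ svInr W k = LinearMap.id := rfl

lemma sv_decomposition : svInr W k ∘ₗ svSnd W k + svInl W k ∘ₗ svFst W k = LinearMap.id :=
  LinearMap.ext fun z => Prod.ext (zero_add (z.1 : Fin k → W.1)) (add_zero (z.2 : V))

end RRep

section induction
variable {F : Mod ω n} {M : RRep W}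

/-- For c ≤ N, and for c = n, the factor ⋀^c Q* extends the admissible list and the assumption for N
+ 1 applies. The remaining degrees are filled in by `pieri_vanishing`. -/
theorem hcoh_qRep_phi (P : DualPair (RRep.qRep W) (RRep.sRep W) n) {N k : ℕ} (hN : N + 1 + k = n)
    {l : List ℕ} {C : ℕ} (hl : Admissible n N l C)
    (h : ∀ l C, Admissible n (N + 1) l C → ∀ m q, max 1 C ≤ q →
      Subsingleton (hcoh F l q (RRep.phi (RRep.qRep W) (RRep.piRep k (RRep.sRep W)) M 0 m)))
    (c m q : ℕ) (hq : max 1 (c + C) ≤ q) :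
    Subsingleton (hcoh F l q (RRep.phi (RRep.qRep W) (RRep.piRep k (RRep.sRep W)) M c m)) := by
  have low : ∀ c m q, c ≤ N → max 1 (c + C) ≤ q →
      Subsingleton (hcoh F l q (RRep.phi (RRep.qRep W) (RRep.piRep k (RRep.sRep W)) M c m)) := by
    intro c m q hc hq
    apply hcoh_of_alt
    have := h _ _ (hl.low hc) m q (by omega)
    rwa [hcoh, iter_append] at this
  by_cases hc : c ≤ N
  · exact low c m q hc hq
  -- Now c ≥ N + 1, so q ≥ N + 1 + C. This fixed q is large enough both for all degrees c with c + k
  -- < n, i.e. c ≤ N, and for the top degree, whose cost is N + 1.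
  · refine pieri_vanishing P (fun c m h => low c m q (by omega) (by omega)) (fun m => ?_) c m
    apply hcoh_of_alt
    have := h _ _ hl.top m q (by omega)
    rwa [hcoh, iter_append] at this

theorem hcoh_sv_phi (P : DualPair (RRep.qRep W) (RRep.sRep W) n) {N k : ℕ} (hN : N + 1 + k = n)
    {l : List ℕ} {C : ℕ} (hl : Admissible n N l C)
    (h : ∀ l C, Admissible n (N + 1) l C → ∀ m q, max 1 C ≤ q →
      Subsingleton (hcoh F l q (RRep.phi (RRep.qRep W) (RRep.piRep k (RRep.sRep W)) M 0 m)))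
    (c m q : ℕ) (hq : max 1 (c + C) ≤ q) :
    Subsingleton (hcoh F l q (RRep.phi (RRep.qRep W) (RRep.sv W k) M c m)) :=
  hcoh_of_decomposition (RRep.svInr_eqv W k) (RRep.svSnd_eqv W k) (RRep.svInl_eqv W k)
    (RRep.svFst_eqv W k) (Triv.v W) (RRep.svSnd_svInr W k) (RRep.sv_decomposition W k) c
    (fun m => hcoh_qRep_phi P hN hl h c m q hq) m

/-- Induction on the number k of copies of S. The step resolves symmetric forms on S^{k+1} by those
on S^k ⊕ V with exterior powers of Q*. At k = 0 only symmetric degree zero survives and the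
vanishing is `hbase`. -/
theorem hcoh_power (hfr : HasFrames W) (P : DualPair (RRep.qRep W) (RRep.sRep W) n)
    (hbase : ∀ l C, Admissible n n l C → ∀ q, max 1 C ≤ q → Subsingleton (hcoh F l q M)) (k : ℕ) :
    ∀ N, N + k = n → ∀ l C, Admissible n N l C → ∀ m q, max 1 C ≤ q →
      Subsingleton (hcoh F l q (RRep.phi (RRep.qRep W) (RRep.piRep k (RRep.sRep W)) M 0 m)) := by
  induction k with
  | zero =>
    rintro N rfl l C hl m q hq
    cases m with
    | zero =>
      exact hcoh_of_retract (BMap.evalNil (RRep.qRep W) (RRep.piRep 0 (RRep.sRep W)) M)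
        (BMap.mkNil _ _ M) (BMap.mkNil_evalNil _ _ _) (hbase l C hl q hq)
    | succ m =>
      have : Subsingleton (RRep.phi (RRep.qRep W) (RRep.piRep 0 (RRep.sRep W)) M 0 (m + 1)) :=
        subsingleton_of_forall_eq 0 fun f => Subtype.ext <| Phi.eq_zero_of_db f.2 fun b => by
          rw [show b = 0 from funext fun i : Fin 0 => i.elim0, ← dbL_apply f.2.1, map_zero]
      exact hcoh_of_subsingleton
  | succ k ih =>
    intro N hN l C hl m q hq
    have h := ih (N + 1) (by omega)
    have hΦ := hcoh_sv_phi (M := M) P (by omega) hl h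
    obtain ⟨σ, μ, hσ, hμ⟩ := RRep.exists_sections W k
    refine hcoh_of_surjective hfr
      (M := RRep.phi (RRep.qRep W) (RRep.sv W k) M 0 m)
      (M' := RRep.phi (RRep.qRep W) (RRep.piRep (k + 1) (RRep.sRep W)) M 0 m) (Phi.pl_eqv M (Eqv.id (RRep.qRep W)) (RRep.svS_eqv W k) 0 m)
      (Phi.pl_surjective (RRep.svS_injective W k) 0 m) (hΦ 0 m q (by omega)) ?_
    exact koszul_end_vanishing hfr (RRep.svQ_eqv W k) hσ (RRep.svS_eqv W k) (RRep.svQ_svS W k) hμ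
      hΦ m (q + 1) (by omega)

/-- The kernel of the restriction has no H^1. To see this, N factors ⋀^0 Q* are inserted, which is
an admissible list of cost zero, so that the bound 1 + C equals 1. -/
theorem coh_pl_surjective (hfr : HasFrames W) (P : DualPair (RRep.qRep W) (RRep.sRep W) n)
    (hbase : ∀ l C, Admissible n n l C → ∀ q, max 1 C ≤ q → Subsingleton (hcoh F l q M)) {k : ℕ}
    (hk : k < n) (m : ℕ) : Function.Surjective (hmap F [] 0 (BMap.const
      (M := RRep.phi (RRep.qRep W) (RRep.sv W k) M 0 m)
      (M' := RRep.phi (RRep.qRep W) (RRep.piRep (k + 1) (RRep.sRep W)) M 0 m)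
      (Phi.pl M LinearMap.id (RRep.svS W k) 0 m) (Phi.pl_eqv M (Eqv.id (RRep.qRep W)) (RRep.svS_eqv W k) 0 m))) := by
  obtain ⟨N, hN⟩ : ∃ N, N + 1 + k = n := ⟨n - 1 - k, by omega⟩
  obtain ⟨a, ha⟩ := SES.ker (Phi.pl_eqv M (Eqv.id (RRep.qRep W)) (RRep.svS_eqv W k) 0 m)
    (Phi.pl_surjective (RRep.svS_injective W k) 0 m)
  refine ha.coh_surjective hfr (coh_of_iter_zero N ?_)
  have hΦ := hcoh_sv_phi (M := M) P (by omega) (Admissible.replicate N)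
    (hcoh_power hfr P hbase k (N + 1) hN)
  obtain ⟨σ, μ, hσ, hμ⟩ := RRep.exists_sections W k
  exact koszul_end_vanishing hfr (RRep.svQ_eqv W k) hσ (RRep.svS_eqv W k) (RRep.svQ_svS W k) hμ
      hΦ m 1 (by omega)

end induction

end LagGrass

end

/-! ### From symmetric powers of the subbundle to exterior powers of Q^n -/

noncomputable section
namespace LagGrass
open Raw

section generic
variable {A B M A' : Type*} [AddCommGroup A] [Module ℂ A] [AddCommGroup B] [Module ℂ B]
  [AddCommGroup M] [Module ℂ M] [AddCommGroup A'] [Module ℂ A']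

lemma Phi.pl_zero_pl_zero (m : ℕ) (f : Phi A B M 0 m) :
    Phi.pl M (0 : A →ₗ[ℂ] A') LinearMap.id 0 m (Phi.pl M (0 : A' →ₗ[ℂ] A) LinearMap.id 0 m f) = f := by
  refine Subtype.ext (funext fun l => funext fun s => ?_)
  change f.1 ((l.map _).map _) ((s.map _).map _) = _
  rw [LinearMap.id_coe, List.map_id, List.map_id]
  cases l with
  | nil => rfl
  | cons a l => exact (f.2.2 _ _ (by simp)).trans (f.2.2 _ _ (by simp)).symm

/-- Here π is a split inclusion, so the derivations exchange their roles: the symmetric one is the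
degree m + 1, and the alternating one comes from the idempotent πσ and has nonnegative eigenvalues.
-/
lemma Phi.y_exact_of_retraction [FiniteDimensional ℂ A] [FiniteDimensional ℂ B]
    [FiniteDimensional ℂ M] {π : B →ₗ[ℂ] A} {σ : A →ₗ[ℂ] B} (h : σ ∘ₗ π = LinearMap.id) (c m : ℕ) :
    Function.Exact (Phi.y M π (c + 1) m) (Phi.y M π c (m + 1)) := by
  refine Phi.y_exact σ fun f hf h0 => ?_
  rw [h, Phi.DB_id hf, add_comm] at h0
  exact Phi.eq_zero_of_smul_add_DA (e := π ∘ₗ σ)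
    (fun a => congrArg π (LinearMap.congr_fun h (σ a))) (m + 1) m.succ_pos hf h0

lemma Phi.y_surjective_of_retraction [FiniteDimensional ℂ A] [FiniteDimensional ℂ B]
    [FiniteDimensional ℂ M] {π : B →ₗ[ℂ] A} {σ : A →ₗ[ℂ] B} (h : σ ∘ₗ π = LinearMap.id) (m : ℕ) :
    Function.Surjective (Phi.y M π 0 m) := by
  intro f
  refine Phi.exists_yop σ ⊤ (fun _ => trivial) (fun f _ h0 => Subtype.ext ?_) f trivial
  rw [Phi.yop_xop_zero f.2, h, Phi.DB_id f.2] at h0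
  exact (smul_eq_zero.1 h0).resolve_left (by exact_mod_cast m.succ_ne_zero)

lemma Raw.pull_eq_self {κ : A →ₗ[ℂ] A} {f : Raw A B M} (hf : f ∈ AM A B M)
    (h : ∀ a, ia (κ a - a) f = 0) : Raw.pull κ LinearMap.id LinearMap.id f = f := by
  rw [← sub_eq_zero]
  refine eq_zero_of_stable (fun z => ∃ f ∈ AM A B M, (∀ a, ia (κ a - a) f = 0) ∧
    z = Raw.pull κ LinearMap.id LinearMap.id f - f) ?_ ?_ ?_ ⟨f, hf, h, rfl⟩
  · rintro _ ⟨f, hf, h, rfl⟩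
    exact sub_self (f [] [])
  · rintro _ a ⟨f, hf, h, rfl⟩
    refine ⟨ia a f, AM.ia hf a, fun a' => ?_, ?_⟩
    · rw [AM.ia_anticomm hf, h, map_zero, neg_zero]
    · have := h a
      rw [← iaL_apply hf, map_sub, sub_eq_zero, iaL_apply, iaL_apply] at this
      rw [map_sub, ia_pull, this]
  · rintro _ b ⟨f, hf, h, rfl⟩
    refine ⟨db b f, AM.db hf b, fun a' => ?_, ?_⟩
    · rw [ia_db, h, map_zero]
    · rw [map_sub, db_pull]; rfl

/-- In symmetric degree zero the Koszul differential records the contractions with π b. If they all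
vanish, the form descends to the quotient of A by the image of π. -/
lemma Phi.exists_pl_of_y_eq_zero {π : B →ₗ[ℂ] A} {ρ : A →ₗ[ℂ] A'} (hρ : Function.Surjective ρ)
    (hπρ : ∀ a, ρ a = 0 → ∃ b, π b = a) (c : ℕ) {f : Phi A B M (c + 1) 0} (hf : Phi.y M π c 0 f = 0) :
    ∃ g : Phi A' B M (c + 1) 0, Phi.pl M ρ LinearMap.id (c + 1) 0 g = f := by
  obtain ⟨τ, hτ⟩ := ρ.exists_rightInverse_of_surjective (LinearMap.range_eq_top.2 hρ)
  have h1 : ∀ b, ia (π b) f.1 = 0 := fun b => by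
    have h := Raw.db_yop f.1 π b
    rw [show Raw.yop π f.1 = 0 from congrArg Subtype.val hf, Deg.db_zero f.2.2, map_zero, map_zero,
      add_zero] at h
    exact h.symm
  refine ⟨Phi.pl M τ LinearMap.id (c + 1) 0 f, Subtype.ext ?_⟩
  refine (pull_pull τ LinearMap.id LinearMap.id ρ LinearMap.id LinearMap.id f.1).trans ?_
  refine Raw.pull_eq_self f.2.1 fun a => ?_
  obtain ⟨b, hb⟩ := hπρ ((τ ∘ₗ ρ) a - a) (by
    rw [map_sub]
    exact sub_eq_zero.2 (LinearMap.congr_fun hτ (ρ a)))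
  rw [← hb, h1]

lemma Phi.y_pl_eq_zero {π : B →ₗ[ℂ] A} {ρ : A →ₗ[ℂ] A'} (h : ρ ∘ₗ π = 0) (c : ℕ)
    (g : Phi A' B M (c + 1) 0) : Phi.y M π c 0 (Phi.pl M ρ LinearMap.id (c + 1) 0 g) = 0 := by
  refine Subtype.ext ?_
  have h2 : (fun b : B => ia (π b) (Raw.pull ρ LinearMap.id LinearMap.id g.1)) =
        fun _ => (0 : Raw A B M) := funext fun b => by
    rw [ia_pull, show ρ (π b) = 0 from LinearMap.congr_fun h b, ← iaL_apply g.2.1, map_zero, map_zero]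
  change delta (fun b : B => ia (π b) (Raw.pull ρ LinearMap.id LinearMap.id g.1)) = 0
  rw [h2]
  exact delta_zero

/-- The derivation of σπ is yx on forms of alternating degree zero, and y commutes with pullback
along compatible maps; hence the restriction of the derivation is in the image of y. -/
lemma Phi.yop_pull_xop {C B' A'' : Type*} [AddCommGroup C] [Module ℂ C] [AddCommGroup B']
    [Module ℂ B'] [AddCommGroup A''] [Module ℂ A''] {m : ℕ} {f : Raw A B M} (hf : f ∈ Phi A B M 0 m)
    (π : B →ₗ[ℂ] C) (σ : C →ₗ[ℂ] B) (α : A'' →ₗ[ℂ] C) (β : B' →ₗ[ℂ] B) (ι : B' →ₗ[ℂ] A'')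
    (h : π ∘ₗ β = α ∘ₗ ι) :
    Raw.pull (0 : A'' →ₗ[ℂ] A) LinearMap.id LinearMap.id
      (Raw.pull LinearMap.id β LinearMap.id (Raw.DB (σ ∘ₗ π) f)) =
    Raw.yop ι (Raw.pull α β LinearMap.id (Raw.xop σ
      (Raw.pull (0 : C →ₗ[ℂ] A) LinearMap.id LinearMap.id f))) := by
  rw [← Raw.pull_yop α β LinearMap.id _ π ι h, Phi.yop_xop_zero (Phi.pull hf _ _ _),
    ← Raw.pull_DB 0 LinearMap.id LinearMap.id f (σ ∘ₗ π) (σ ∘ₗ π) rfl, pull_pull, pull_pull]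
  rfl

lemma Phi.pull_pull_zero {B' B'' A'' A₂ : Type*} [AddCommGroup B'] [Module ℂ B'] [AddCommGroup B'']
    [Module ℂ B''] [AddCommGroup A''] [Module ℂ A''] [AddCommGroup A₂] [Module ℂ A₂] (f : Raw A B M)
    (φ : B' →ₗ[ℂ] B) (β : B'' →ₗ[ℂ] B') (α : A'' →ₗ[ℂ] A₂) :
    Raw.pull (0 : A'' →ₗ[ℂ] A) LinearMap.id LinearMap.id
      (Raw.pull LinearMap.id β LinearMap.id (Raw.pull LinearMap.id φ LinearMap.id f)) =
    Raw.pull α (φ ∘ₗ β) LinearMap.id (Raw.pull (0 : A₂ →ₗ[ℂ] A) LinearMap.id LinearMap.id f) := by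
  rw [pull_pull, pull_pull, pull_pull]
  rfl

lemma Phi.pl_injective {ρ : A →ₗ[ℂ] A'} (hρ : Function.Surjective ρ) (c m : ℕ) :
    Function.Injective (Phi.pl (B := B) M ρ LinearMap.id c m) := by
  obtain ⟨τ, hτ⟩ := ρ.exists_rightInverse_of_surjective (LinearMap.range_eq_top.2 hρ)
  refine Function.LeftInverse.injective (g := Phi.pl M τ LinearMap.id c m) fun f => Subtype.ext ?_
  refine (pull_pull ρ LinearMap.id LinearMap.id τ LinearMap.id LinearMap.id f.1).trans ?_
  rw [hτ]
  exact Phi.pull_id f.1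

end generic

variable {V : Type u} [AddCommGroup V] [Module ℂ V] {ω : LinearMap.BilinForm ℂ V} {n : ℕ}
variable [FiniteDimensional ℂ V] {W : LagGrass ω n}

namespace RRep
variable (W) (k : ℕ)

/-- Powers of the trivial bundle. -/
def vPow : RRep W := piRep k (vRep W)
/-- Powers of the subbundle. -/
def sPow : RRep W := piRep k (sRep W)
/-- Powers of the quotient bundle. -/
def qPow : RRep W := piRep k (qRep W)

/-- The inclusion of the power of the subbundle. -/
def sIncl : sPow W k →ₗ[ℂ] vPow W k :=
  LinearMap.pi fun i => W.1.subtype ∘ₗ LinearMap.proj (R := ℂ) (φ := fun _ : Fin k => W.1) i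
lemma sIncl_eqv : Eqv (sIncl W k) := fun _ _ => rfl

/-- The projection to the power of the quotient bundle. -/
def qProj : vPow W k →ₗ[ℂ] qPow W k :=
  LinearMap.pi fun i => W.1.mkQ ∘ₗ LinearMap.proj (R := ℂ) (φ := fun _ : Fin k => V) i
lemma qProj_eqv : Eqv (qProj W k) := fun _ _ => rfl

lemma qProj_surjective : Function.Surjective (qProj W k) := fun a => by
  choose v hv using fun i => W.1.mkQ_surjective (a i)
  exact ⟨v, funext hv⟩

lemma qProj_sIncl : qProj W k ∘ₗ sIncl W k = 0 := LinearMap.ext fun s => funext fun i =>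
  (Submodule.Quotient.mk_eq_zero W.1).2 (s i).2

lemma exists_sIncl {a : vPow W k} (h : qProj W k a = 0) : ∃ b, sIncl W k b = a :=
  ⟨fun i => ⟨a i, (Submodule.Quotient.mk_eq_zero W.1).1 (congrFun h i)⟩, rfl⟩

lemma exists_sIncl_retraction : ∃ σ : vPow W k →ₗ[ℂ] sPow W k, σ ∘ₗ sIncl W k = LinearMap.id :=
  (sIncl W k).exists_leftInverse_of_injective (LinearMap.ker_eq_bot.2 fun s s' h =>
    funext fun i => Subtype.ext (congrFun h i))

/-- The projection to the last factor. -/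
def vLast : vPow W (k + 1) →ₗ[ℂ] vRep W :=
  LinearMap.proj (R := ℂ) (φ := fun _ : Fin (k + 1) => V) (Fin.last k)
lemma vLast_eqv : Eqv (vLast W k) := fun _ _ => rfl
/-- The projection to the first factors. -/
def vInit : vPow W (k + 1) →ₗ[ℂ] vPow W k :=
  LinearMap.pi fun i => LinearMap.proj (R := ℂ) (φ := fun _ : Fin (k + 1) => V) i.castSucc
lemma vInit_eqv : Eqv (vInit W k) := fun _ _ => rfl

lemma zero_eqv (A B : RRep W) : Eqv (0 : A →ₗ[ℂ] B) := fun p _ => (map_zero (B.ρ p)).symm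

end RRep

variable {F : Mod ω n} {M : RRep W}

variable (M) in
/-- The Koszul differential of the subbundle. -/
def BMap.yS (k c m : ℕ) : BMap (RRep.phi (RRep.vPow W k) (RRep.sPow W k) M (c + 1) m)
    (RRep.phi (RRep.vPow W k) (RRep.sPow W k) M c (m + 1)) :=
  BMap.const (Phi.y M (RRep.sIncl W k) c m) (Phi.y_eqv M (RRep.sIncl_eqv W k) c m)

/-- Pullback of forms. -/
def BMap.pl {A B A' B' : RRep W} (M : RRep W) {α : A' →ₗ[ℂ] A} {β : B' →ₗ[ℂ] B} (hα : Eqv α)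
    (hβ : Eqv β) (c m : ℕ) : BMap (RRep.phi A B M c m) (RRep.phi A' B' M c m) :=
  BMap.const (Phi.pl M α β c m) (Phi.pl_eqv M hα hβ c m)

/-- Induction on k. A class on S^{k+1} lifts to S^k ⊕ V by `coh_pl_surjective`, and the Euler
operator splits the lift into a derivative along V, which is visibly a boundary, and a part coming
from S^k, which is a boundary by induction. -/
theorem yS_surjective (hfr : HasFrames W) (P : DualPair (RRep.qRep W) (RRep.sRep W) n)
    (hbase : ∀ l C, Admissible n n l C → ∀ q, max 1 C ≤ q → Subsingleton (hcoh F l q M)) (m k : ℕ)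
    (hk : k ≤ n) : Function.Surjective (hmap F [] 0 (BMap.yS (W := W) M k 0 m)) := by
  induction k with
  | zero =>
    have : Subsingleton (RRep.phi (RRep.vPow W 0) (RRep.sPow W 0) M 0 (m + 1)) :=
      subsingleton_of_forall_eq 0 fun f => Subtype.ext <| Phi.eq_zero_of_db f.2 fun b => by
        rw [show b = 0 from funext fun i : Fin 0 => i.elim0, ← dbL_apply f.2.1, map_zero]
    exact fun x => ⟨0, @Subsingleton.elim _ hcoh_of_subsingleton _ _⟩
  | succ k ih =>
    intro x
    let qR := RRep.qRep W
    -- Forms of alternating degree zero do not involve the alternating space. Pullback along the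
    -- zero map identifies those over Q with those over V^{k+1}, and `ofV` is the inverse
    -- identification.
    let toV : BMap (RRep.phi qR (RRep.sPow W (k + 1)) M 0 (m + 1))
        (RRep.phi (RRep.vPow W (k + 1)) (RRep.sPow W (k + 1)) M 0 (m + 1)) :=
      BMap.pl M (RRep.zero_eqv W _ _) (Eqv.id _) 0 (m + 1)
    let ofV : BMap (RRep.phi (RRep.vPow W (k + 1)) (RRep.sPow W (k + 1)) M 0 (m + 1))
        (RRep.phi qR (RRep.sPow W (k + 1)) M 0 (m + 1)) :=
      BMap.pl M (RRep.zero_eqv W _ _) (Eqv.id _) 0 (m + 1)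
    have htoV : toV.comp ofV = BMap.id _ := BMap.ext fun g f => Phi.pl_zero_pl_zero (m + 1) f
    obtain ⟨z, hz⟩ := coh_pl_surjective hfr P hbase (show k < n by omega) (m + 1) (hmap F [] 0 ofV x)
    obtain ⟨b, hb, -⟩ := BMap.euler_inverse (A := qR) (M := M) (RRep.svInr_eqv W k)
      (RRep.svSnd_eqv W k) (RRep.svInl_eqv W k) (RRep.svFst_eqv W k) (RRep.svSnd_svInr W k)
      (RRep.sv_decomposition W k) 0 (m + 1)
    let lam : BMap (RRep.phi qR (RRep.sv W k) M 0 (m + 1)) (RRep.phi qR (RRep.sPow W (k + 1)) M 0 (m + 1)) :=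
      BMap.pl M (Eqv.id qR) (RRep.svS_eqv W k) 0 (m + 1)
    have hx : x = hmap F [] 0 toV (hmap F [] 0 lam z) := by
      rw [show hmap F [] 0 lam z = hmap F [] 0 ofV x from hz, ← hmap_comp, htoV, hmap_id]
    let toV' : BMap (RRep.phi qR (RRep.sv W k) M 0 (m + 1))
        (RRep.phi (RRep.vRep W) (RRep.sv W k) M 0 (m + 1)) :=
      BMap.pl M (RRep.zero_eqv W _ _) (Eqv.id _) 0 (m + 1)
    let D₁ : BMap (RRep.phi qR (RRep.sv W k) M 0 (m + 1))
        (RRep.phi (RRep.vPow W (k + 1)) (RRep.sPow W (k + 1)) M 1 m) :=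
      (BMap.pl M (RRep.vLast_eqv W k) (RRep.svS_eqv W k) 1 m).comp
        ((BMap.x M (RRep.svInr W k) (RRep.svInr_eqv W k) 0 m).comp toV')
    -- The derivative part of the restriction factors through the Koszul differential, by way of D₁.
    have h1 : toV.comp (lam.comp (BMap.der qR M (RRep.svInr W k ∘ₗ RRep.svSnd W k)
        (RRep.Eqv.comp (RRep.svInr_eqv W k) (RRep.svSnd_eqv W k)) 0 (m + 1))) =
        (BMap.yS M (k + 1) 0 m).comp D₁ := by
      refine BMap.phi_ext fun g f => ?_
      exact Phi.yop_pull_xop f.2 (RRep.svSnd W k) (RRep.svInr W k) (RRep.vLast W k) (RRep.svS W k)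
        (RRep.sIncl W (k + 1)) rfl
    let toVk : BMap (RRep.phi qR (RRep.sPow W k) M 0 (m + 1))
        (RRep.phi (RRep.vPow W k) (RRep.sPow W k) M 0 (m + 1)) :=
      BMap.pl M (RRep.zero_eqv W _ _) (Eqv.id _) 0 (m + 1)
    let E₁ : BMap (RRep.phi (RRep.vPow W k) (RRep.sPow W k) M 1 m)
        (RRep.phi (RRep.vPow W (k + 1)) (RRep.sPow W (k + 1)) M 1 m) :=
      BMap.pl M (RRep.vInit_eqv W k) (RRep.Eqv.comp (RRep.svFst_eqv W k) (RRep.svS_eqv W k)) 1 m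
    let E₀ : BMap (RRep.phi (RRep.vPow W k) (RRep.sPow W k) M 0 (m + 1))
        (RRep.phi (RRep.vPow W (k + 1)) (RRep.sPow W (k + 1)) M 0 (m + 1)) :=
      BMap.pl M (RRep.vInit_eqv W k) (RRep.Eqv.comp (RRep.svFst_eqv W k) (RRep.svS_eqv W k)) 0 (m + 1)
    -- The part pulled back from S^k is the image under E₀ of a form on S^k; together with `h3` this
    -- transports the preimage given by induction.
    have h2 : toV.comp (lam.comp (BMap.pull M LinearMap.id (Eqv.id qR) (RRep.svFst W k)
        (RRep.svFst_eqv W k) 0 (m + 1))) = E₀.comp toVk := by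
      refine BMap.phi_ext fun g f => ?_
      exact Phi.pull_pull_zero f.1 (RRep.svFst W k) (RRep.svS W k) (RRep.vInit W k)
    have h3 : E₀.comp (BMap.yS M k 0 m) = (BMap.yS M (k + 1) 0 m).comp E₁ := by
      refine BMap.phi_ext fun g f => ?_
      exact pull_yop (RRep.vInit W k) (RRep.svFst W k ∘ₗ RRep.svS W k) LinearMap.id f.1
        (RRep.sIncl W k) (RRep.sIncl W (k + 1)) rfl
    have hz' : z = hmap F [] 0 (BMap.euler (RRep.svInr_eqv W k)
      (RRep.svSnd_eqv W k) (RRep.svInl_eqv W k) (RRep.svFst_eqv W k) qR M 0 (m + 1)) (hmap F [] 0 b z) := by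
      rw [← hmap_comp, hb, hmap_id]
    generalize hmap F [] 0 b z = z₁ at hz'
    let inlM : BMap (RRep.phi qR (RRep.sv W k) M 0 (m + 1)) (RRep.phi qR (RRep.sPow W k) M 0 (m + 1)) :=
      BMap.pull M LinearMap.id (Eqv.id qR) (RRep.svInl W k) (RRep.svInl_eqv W k) 0 (m + 1)
    let fstM : BMap (RRep.phi qR (RRep.sPow W k) M 0 (m + 1)) (RRep.phi qR (RRep.sv W k) M 0 (m + 1)) :=
      BMap.pull M LinearMap.id (Eqv.id qR) (RRep.svFst W k) (RRep.svFst_eqv W k) 0 (m + 1)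
    let derM : BMap (RRep.phi qR (RRep.sv W k) M 0 (m + 1)) (RRep.phi qR (RRep.sv W k) M 0 (m + 1)) :=
      BMap.der qR M (RRep.svInr W k ∘ₗ RRep.svSnd W k)
        (RRep.Eqv.comp (RRep.svInr_eqv W k) (RRep.svSnd_eqv W k)) 0 (m + 1)
    have heuler : BMap.euler (RRep.svInr_eqv W k) (RRep.svSnd_eqv W k) (RRep.svInl_eqv W k)
        (RRep.svFst_eqv W k) qR M 0 (m + 1) = derM + fstM.comp inlM := rfl
    rw [heuler] at hz'
    obtain ⟨v, hv⟩ := ih (by omega) (hmap F [] 0 toVk (hmap F [] 0 inlM z₁))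
    refine ⟨hmap F [] 0 D₁ z₁ + hmap F [] 0 E₁ v, ?_⟩
    have e₁ : hmap F [] 0 (BMap.yS M (k + 1) 0 m) (hmap F [] 0 D₁ z₁) =
        hmap F [] 0 toV (hmap F [] 0 lam (hmap F [] 0 derM z₁)) :=
      (hmap_comp F [] 0 (BMap.yS M (k + 1) 0 m) D₁ z₁).symm.trans
        ((congrArg (fun t => hmap F [] 0 t z₁) h1.symm).trans
          ((hmap_comp F [] 0 toV (lam.comp derM) z₁).trans
            (congrArg _ (hmap_comp F [] 0 lam derM z₁))))
    have e₂ : hmap F [] 0 (BMap.yS M (k + 1) 0 m) (hmap F [] 0 E₁ v) =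
        hmap F [] 0 toV (hmap F [] 0 lam (hmap F [] 0 (fstM.comp inlM) z₁)) := by
      refine (hmap_comp F [] 0 (BMap.yS M (k + 1) 0 m) E₁ v).symm.trans
        ((congrArg (fun t => hmap F [] 0 t v) h3.symm).trans
          ((hmap_comp F [] 0 E₀ (BMap.yS M k 0 m) v).trans ?_))
      refine (congrArg (hmap F [] 0 E₀) hv).trans ?_
      refine (hmap_comp F [] 0 E₀ toVk _).symm.trans
        ((congrArg (fun t => hmap F [] 0 t (hmap F [] 0 inlM z₁)) h2.symm).trans
          ((hmap_comp F [] 0 toV (lam.comp fstM) _).trans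
            (congrArg _ ((hmap_comp F [] 0 lam fstM _).trans
              (congrArg _ (hmap_comp F [] 0 fstM inlM z₁).symm)))))
    rw [map_add, e₁, e₂, hx, hz', map_add, LinearMap.add_apply, map_add, map_add]

/-- V^n is a trivial bundle, so its exterior powers may be stripped off; degree zero is `hcoh_power`
with all n copies of S and no exterior factors. -/
lemma hcoh_vPow_phi (hfr : HasFrames W) (P : DualPair (RRep.qRep W) (RRep.sRep W) n)
    (hbase : ∀ l C, Admissible n n l C → ∀ q, max 1 C ≤ q → Subsingleton (hcoh F l q M))
    (c m q : ℕ) (hq : 1 ≤ q) :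
    Subsingleton (hcoh F [] q (RRep.phi (RRep.vPow W n) (RRep.sPow W n) M c m)) := by
  induction c with
  | zero =>
    have h := hcoh_power hfr P hbase n 0 (zero_add n) [] 0 .nil m q (by omega)
    refine hcoh_of_retract (BMap.pl M (RRep.zero_eqv W _ _) (Eqv.id (RRep.sPow W n)) 0 m)
      (BMap.pl M (RRep.zero_eqv W _ _) (Eqv.id (RRep.sPow W n)) 0 m)
      (BMap.ext fun g f => ?_) h
    exact Phi.pl_zero_pl_zero m f
  | succ c ih => exact hcoh_phi_succ ((Triv.v W).pi n) ih

/-- Dimension shifting along the Koszul complex of S^n in V^n. At its end, for c = 0, H^1 of the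
kernel vanishes because the last map is onto on H^0; this is where `yS_surjective` enters. -/
theorem hcoh_ker_yS (hfr : HasFrames W) (P : DualPair (RRep.qRep W) (RRep.sRep W) n)
    (hbase : ∀ l C, Admissible n n l C → ∀ q, max 1 C ≤ q → Subsingleton (hcoh F l q M)) (c : ℕ) :
    ∀ m q, c ≤ q → Subsingleton (hcoh F [] (q + 1) (RRep.kerRep
      (M := RRep.phi (RRep.vPow W n) (RRep.sPow W n) M (c + 1) m)
      (M' := RRep.phi (RRep.vPow W n) (RRep.sPow W n) M c (m + 1)) (Phi.y M (RRep.sIncl W n) c m)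
      (Phi.y_eqv M (RRep.sIncl_eqv W n) c m))) := by
  obtain ⟨σ, hσ⟩ := RRep.exists_sIncl_retraction W n
  induction c with
  | zero =>
    intro m q _
    obtain ⟨a, ha⟩ := SES.ker (Phi.y_eqv M (RRep.sIncl_eqv W n) 0 m)
      (Phi.y_surjective_of_retraction hσ m)
    have h2 := hcoh_vPow_phi hfr P hbase 1 m (q + 1) (by omega)
    refine ha.coh_left_of_surjective hfr ?_ h2
    cases q with
    | zero => exact yS_surjective hfr P hbase m n le_rfl
    | succ q =>
      exact fun x => ⟨0, @Subsingleton.elim _ (hcoh_vPow_phi hfr P hbase 0 (m + 1) (q + 1) (by omega)) _ _⟩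
  | succ c ih =>
    intro m q hq
    obtain ⟨q, rfl⟩ : ∃ q', q = q' + 1 := ⟨q - 1, by omega⟩
    obtain ⟨a, b, hab⟩ := SES.ker_ker (Phi.y_eqv M (RRep.sIncl_eqv W n) (c + 1) m)
      (Phi.y_eqv M (RRep.sIncl_eqv W n) c (m + 1)) (Phi.y_exact_of_retraction hσ c m)
    exact hab.coh_left hfr (ih (m + 1) q (by omega))
      (hcoh_vPow_phi hfr P hbase (c + 2) m (q + 2) (by omega))

lemma hcoh_of_bijective {M M' : RRep W} {l : List ℕ} {q : ℕ} {f : M →ₗ[ℂ] M'} (hf : Eqv f)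
    (h : Function.Bijective f) (hM : Subsingleton (hcoh F l q M')) : Subsingleton (hcoh F l q M) := by
  let e := LinearEquiv.ofBijective f h
  have he : ∀ m, f (e.symm m) = m := fun m => e.apply_symm_apply m
  refine hcoh_of_retract (BMap.const f hf) (BMap.const (e.symm : M' →ₗ[ℂ] M) fun p m => h.1 ?_)
    (BMap.ext fun _ m => e.symm_apply_apply m) hM
  exact (he _).trans ((hf _ _).trans (congrArg _ (he m))).symm

/-- Vanishing for the terms of the Koszul complex. -/
theorem hcoh_qPow (hfr : HasFrames W) (P : DualPair (RRep.qRep W) (RRep.sRep W) n)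
    (hbase : ∀ l C, Admissible n n l C → ∀ q, max 1 C ≤ q → Subsingleton (hcoh F l q M)) (c q : ℕ)
    (hq : c ≤ q) :
    Subsingleton (coh F (RRep.phi (RRep.qPow W n) (RRep.sPow W n) M (c + 1) 0) (q + 1)) := by
  -- Forms on V^n killed by contraction with S^n are forms on Q^n, so ⋀^{c+1}(Q^n)* is the first
  -- kernel of the Koszul complex.
  let f : Phi (RRep.qPow W n) (RRep.sPow W n) M (c + 1) 0 →ₗ[ℂ]
      LinearMap.ker (Phi.y M (RRep.sIncl W n) c 0) :=
    LinearMap.codRestrict _ (Phi.pl M (RRep.qProj W n) LinearMap.id (c + 1) 0) fun g =>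
      Phi.y_pl_eq_zero (RRep.qProj_sIncl W n) c g
  have hf : Eqv (M := RRep.phi (RRep.qPow W n) (RRep.sPow W n) M (c + 1) 0)
      (M' := RRep.kerRep
      (M := RRep.phi (RRep.vPow W n) (RRep.sPow W n) M (c + 1) 0)
      (M' := RRep.phi (RRep.vPow W n) (RRep.sPow W n) M c 1) (Phi.y M (RRep.sIncl W n) c 0)
      (Phi.y_eqv M (RRep.sIncl_eqv W n) c 0)) f := fun p g => Subtype.ext <|
    Phi.pl_eqv M (RRep.qProj_eqv W n) (Eqv.id (RRep.sPow W n)) (c + 1) 0 p g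
  refine hcoh_of_bijective (l := []) hf ⟨fun g g' h => ?_, fun z => ?_⟩
    (hcoh_ker_yS hfr P hbase c 0 q hq)
  · exact Phi.pl_injective (RRep.qProj_surjective W n) (c + 1) 0 (congrArg Subtype.val h)
  · obtain ⟨g, hg⟩ := Phi.exists_pl_of_y_eq_zero (RRep.qProj_surjective W n)
      (fun a h => RRep.exists_sIncl W n h) c z.2
    exact ⟨g, Subtype.ext hg⟩

end LagGrass

end

/-! ### Alternating maps as functions of lists -/

noncomputable section
namespace LagGrass
open Raw

section ofAlt
variable {A B M : Type*} [AddCommGroup A] [Module ℂ A] [AddCommGroup B] [Module ℂ B]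
  [AddCommGroup M] [Module ℂ M]

/-- An alternating map as a function of lists. -/
def Raw.altList : ∀ c : ℕ, (A [⋀^Fin c]→ₗ[ℂ] M) → List A → M
  | 0, η, [] => η ![]
  | 0, _, _ :: _ => 0
  | _ + 1, _, [] => 0
  | c + 1, η, a :: l => Raw.altList c (η.curryLeft a) l

lemma Raw.altList_length (c : ℕ) (η : A [⋀^Fin c]→ₗ[ℂ] M) (l : List A) (h : l.length ≠ c) :
    Raw.altList c η l = 0 := by
  induction c generalizing l with
  | zero => cases l with
    | nil => simp at h
    | cons a l => rfl
  | succ c ih => cases l with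
    | nil => rfl
    | cons a l => exact ih _ l (by simpa using h)

lemma Raw.altList_add (c : ℕ) (η η' : A [⋀^Fin c]→ₗ[ℂ] M) (l : List A) :
    Raw.altList c (η + η') l = Raw.altList c η l + Raw.altList c η' l := by
  induction c generalizing l with
  | zero => cases l with
    | nil => rfl
    | cons a l => exact (add_zero _).symm
  | succ c ih => cases l with
    | nil => exact (add_zero _).symm
    | cons a l => exact ih (η.curryLeft a) (η'.curryLeft a) l

lemma Raw.altList_smul (c : ℕ) (r : ℂ) (η : A [⋀^Fin c]→ₗ[ℂ] M) (l : List A) :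
    Raw.altList c (r • η) l = r • Raw.altList c η l := by
  induction c generalizing l with
  | zero => cases l with
    | nil => rfl
    | cons a l => exact (smul_zero _).symm
  | succ c ih => cases l with
    | nil => exact (smul_zero _).symm
    | cons a l => exact ih (η.curryLeft a) l

lemma Raw.altList_ofFn (c : ℕ) (η : A [⋀^Fin c]→ₗ[ℂ] M) (v : Fin c → A) :
    Raw.altList c η (List.ofFn v) = η v := by
  induction c with
  | zero => exact congrArg η (Subsingleton.elim _ _)
  | succ c ih =>
    rw [List.ofFn_succ]
    refine (ih (η.curryLeft (v 0)) _).trans ?_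
    rw [AlternatingMap.curryLeft_apply_apply]
    congr 1
    exact Fin.cons_self_tail v

/-- An alternating map as a function of two lists. -/
def Raw.ofAlt (B : Type*) (c : ℕ) (η : A [⋀^Fin c]→ₗ[ℂ] M) : Raw A B M
  | l, [] => Raw.altList c η l
  | _, _ :: _ => 0

lemma Raw.ia_ofAlt (c : ℕ) (η : A [⋀^Fin (c + 1)]→ₗ[ℂ] M) (a : A) :
    ia a (Raw.ofAlt B (c + 1) η) = Raw.ofAlt B c (η.curryLeft a) := by
  funext l s
  cases s <;> rfl

lemma Raw.ia_ofAlt_zero (η : A [⋀^Fin 0]→ₗ[ℂ] M) (a : A) : ia a (Raw.ofAlt B 0 η) = 0 := by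
  funext l s
  cases s <;> rfl

lemma Raw.db_ofAlt (c : ℕ) (η : A [⋀^Fin c]→ₗ[ℂ] M) (b : B) : db b (Raw.ofAlt B c η) = 0 := rfl

lemma Raw.ofAlt_add (c : ℕ) (η η' : A [⋀^Fin c]→ₗ[ℂ] M) :
    Raw.ofAlt B c (η + η') = Raw.ofAlt B c η + Raw.ofAlt B c η' := by
  funext l s
  cases s with
  | nil => exact Raw.altList_add c η η' l
  | cons b s => exact (add_zero _).symm

lemma Raw.ofAlt_smul (c : ℕ) (r : ℂ) (η : A [⋀^Fin c]→ₗ[ℂ] M) :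
    Raw.ofAlt B c (r • η) = r • Raw.ofAlt B c η := by
  funext l s
  cases s with
  | nil => exact Raw.altList_smul c r η l
  | cons b s => exact (smul_zero _).symm

lemma Raw.ofAlt_mem (c : ℕ) (η : A [⋀^Fin c]→ₗ[ℂ] M) : Raw.ofAlt B c η ∈ Phi A B M c 0 := by
  refine ⟨AM.of_stable (fun f => f = 0 ∨ ∃ c, ∃ η : A [⋀^Fin c]→ₗ[ℂ] M, f = Raw.ofAlt B c η)
    ?_ ?_ ?_ (.inr ⟨c, η, rfl⟩), fun l s h => ?_⟩
  · rintro f (rfl | ⟨c, η, rfl⟩)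
    · exact Loc.zero
    · cases c with
      | zero => exact ⟨fun a a' => by simp [Raw.ia_ofAlt_zero], fun r a => by simp [Raw.ia_ofAlt_zero],
          fun a => by simp [Raw.ia_ofAlt_zero], fun a a' => by simp [Raw.db_ofAlt],
          fun r a => by simp [Raw.db_ofAlt], fun a a' => by simp [Raw.db_ofAlt]⟩
      | succ c =>
        refine ⟨fun a a' => ?_, fun r a => ?_, fun a => ?_, fun a a' => by simp [Raw.db_ofAlt],
          fun r a => by simp [Raw.db_ofAlt], fun a a' => by simp [Raw.db_ofAlt]⟩
        · rw [Raw.ia_ofAlt, map_add, Raw.ofAlt_add, Raw.ia_ofAlt, Raw.ia_ofAlt]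
        · rw [Raw.ia_ofAlt, map_smul, Raw.ofAlt_smul, Raw.ia_ofAlt]
        · rw [Raw.ia_ofAlt]
          cases c with
          | zero => exact Raw.ia_ofAlt_zero _ a
          | succ c =>
            rw [Raw.ia_ofAlt, AlternatingMap.curryLeft_same]
            simpa using Raw.ofAlt_smul (B := B) c 0 (0 : A [⋀^Fin c]→ₗ[ℂ] M)
  · rintro f a (rfl | ⟨c, η, rfl⟩)
    · exact .inl (map_zero _)
    · cases c with
      | zero => exact .inl (Raw.ia_ofAlt_zero _ a)
      | succ c => exact .inr ⟨c, _, Raw.ia_ofAlt c η a⟩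
  · rintro f b (rfl | ⟨c, η, rfl⟩)
    · exact .inl (map_zero _)
    · exact .inl (Raw.db_ofAlt c η b)
  · cases s with
    | nil => exact Raw.altList_length c η l (by simpa using h)
    | cons b s => rfl

/-- An alternating map as a form. -/
def Phi.ofAlt (c : ℕ) : (A [⋀^Fin c]→ₗ[ℂ] M) →ₗ[ℂ] Phi A B M c 0 where
  toFun η := ⟨Raw.ofAlt B c η, Raw.ofAlt_mem c η⟩
  map_add' η η' := Subtype.ext (Raw.ofAlt_add c η η')
  map_smul' r η := Subtype.ext (Raw.ofAlt_smul c r η)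

lemma Phi.ofAlt_ofFn (c : ℕ) (η : A [⋀^Fin c]→ₗ[ℂ] M) (v : Fin c → A) :
    (Phi.ofAlt (B := B) c η).1 (List.ofFn v) [] = η v := Raw.altList_ofFn c η v

lemma Phi.ext_ofFn {c : ℕ} {f g : Phi A B M c 0}
    (h : ∀ v : Fin c → A, f.1 (List.ofFn v) [] = g.1 (List.ofFn v) []) : f = g := by
  refine Subtype.ext (funext fun l => funext fun s => ?_)
  by_cases hl : l.length = c ∧ s.length = 0
  · obtain ⟨rfl, hs⟩ := hl
    have := h l.get
    rw [List.ofFn_get] at this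
    rw [List.length_eq_zero_iff.1 hs, this]
  · rw [f.2.2 l s hl, g.2.2 l s hl]

/-- A form as an alternating map. -/
def Phi.toAlt (c : ℕ) : Phi A B M c 0 →ₗ[ℂ] A [⋀^Fin c]→ₗ[ℂ] M where
  toFun f := AM.toAlt f.2.1 c []
  map_add' _ _ := rfl
  map_smul' _ _ := rfl

lemma Phi.toAlt_apply (c : ℕ) (f : Phi A B M c 0) (v : Fin c → A) :
    Phi.toAlt c f v = f.1 (List.ofFn v) [] := rfl

/-- The product of a scalar form and a vector. -/
def Phi.smulRight (c : ℕ) : Phi A B ℂ c 0 →ₗ[ℂ] M →ₗ[ℂ] Phi A B M c 0 :=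
  LinearMap.mk₂ ℂ (fun e m => Phi.mapVal c 0 (LinearMap.toSpanSingleton ℂ M m) e)
    (fun e e' m => (Phi.mapVal c 0 (LinearMap.toSpanSingleton ℂ M m)).map_add e e')
    (fun r e m => (Phi.mapVal c 0 (LinearMap.toSpanSingleton ℂ M m)).map_smul r e)
    (fun _ _ _ => Subtype.ext (funext fun _ => funext fun _ => smul_add _ _ _))
    (fun _ _ _ => Subtype.ext (funext fun _ => funext fun _ => smul_comm _ _ _))

lemma Phi.smulRight_apply (c : ℕ) (e : Phi A B ℂ c 0) (m : M) (l : List A) (s : List B) :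
    (Phi.smulRight c e m).1 l s = e.1 l s • m :=
  Phi.mapVal_apply c 0 (LinearMap.toSpanSingleton ℂ M m) e l s

/-- Forms with values in a space are sums of products of scalar forms and vectors. -/
def Phi.ofCoord {ι : Type*} [Fintype ι] (c : ℕ) (e : ι → Phi A B ℂ c 0) :
    (ι → M) →ₗ[ℂ] Phi A B M c 0 :=
  ∑ j, Phi.smulRight c (e j) ∘ₗ LinearMap.proj (R := ℂ) (φ := fun _ : ι => M) j

lemma Phi.ofCoord_apply {ι : Type*} [Fintype ι] (c : ℕ) (e : ι → Phi A B ℂ c 0) (m : ι → M) :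
    Phi.ofCoord c e m = ∑ j, Phi.smulRight c (e j) (m j) := by
  simp [Phi.ofCoord]

lemma Phi.mapVal_smulRight (c : ℕ) (e : Phi A B ℂ c 0) (m : M) (γ : M →ₗ[ℂ] ℂ) :
    Phi.mapVal c 0 γ (Phi.smulRight c e m) = γ m • e := by
  refine Subtype.ext (funext fun l => funext fun s => ?_)
  rw [Phi.mapVal_apply, Phi.smulRight_apply, map_smul, smul_eq_mul, mul_comm]
  rfl

lemma Phi.ofCoord_bijective {ι : Type*} [Fintype ι] [FiniteDimensional ℂ M] (c : ℕ)
    (b : Module.Basis ι ℂ (Phi A B ℂ c 0)) :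
    Function.Bijective (Phi.ofCoord (M := M) c b) := by
  constructor
  · rw [injective_iff_map_eq_zero]
    intro m hm
    funext j
    rw [Pi.zero_apply, ← Module.forall_dual_apply_eq_zero_iff ℂ]
    intro γ
    have h := congrArg (Phi.mapVal c 0 γ) hm
    rw [Phi.ofCoord_apply, map_sum, map_zero] at h
    simp only [Phi.mapVal_smulRight] at h
    exact Fintype.linearIndependent_iff.1 b.linearIndependent _ h j
  · intro f
    let μ := Module.finBasis ℂ M
    have hf : f = ∑ k, Phi.smulRight c (Phi.mapVal c 0 (μ.coord k) f) (μ k) := by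
      refine Subtype.ext (funext fun l => funext fun s => ?_)
      have : (∑ k, Phi.smulRight c (Phi.mapVal c 0 (μ.coord k) f) (μ k)).1 l s =
          ∑ k, (Phi.smulRight c (Phi.mapVal c 0 (μ.coord k) f) (μ k)).1 l s := by
        simp [Finset.sum_apply]
      rw [this]
      simp only [Phi.smulRight_apply, Phi.mapVal_apply]
      exact (μ.sum_repr (f.1 l s)).symm
    refine ⟨fun j => ∑ k, b.coord j (Phi.mapVal c 0 (μ.coord k) f) • μ k, ?_⟩
    rw [Phi.ofCoord_apply]
    conv_rhs => rw [hf]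
    simp only [map_sum, map_smul]
    rw [Finset.sum_comm]
    refine Finset.sum_congr rfl fun k _ => ?_
    conv_rhs => rw [← b.sum_repr (Phi.mapVal c 0 (μ.coord k) f)]
    simp only [map_sum, map_smul, LinearMap.sum_apply, LinearMap.smul_apply,
      Module.Basis.coord_apply]

end ofAlt
end LagGrass

end

/-! ### Regular forms in a frame -/

noncomputable section
namespace LagGrass
open Raw
variable {V : Type u} [AddCommGroup V] [Module ℂ V] {ω : LinearMap.BilinForm ℂ V} {n : ℕ}
variable [FiniteDimensional ℂ V] {W : LagGrass ω n}

section
variable {U : Opens (space ω n)} 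

lemma regular_multilinear {c : ℕ} (μ : U → MultilinearMap ℂ (fun _ : Fin c => V) ℂ)
    (hμ : ∀ v : Fin c → V, (regular ω n).pred (fun x => μ x v)) {v : U → Fin c → V}
    (hv : ∀ i, RegVec (fun x => v x i)) : (regular ω n).pred (fun x => μ x (v x)) := by
  classical
  let b := Module.finBasis ℂ V
  have e : (fun x => μ x (v x)) = fun x =>
      ∑ r : Fin c → Fin (Module.finrank ℂ V), (∏ i, b.coord (r i) (v x i)) * μ x (fun i => b (r i)) := by
    funext x
    have h : v x = fun i => ∑ j, b.coord j (v x i) • b j := funext fun i => (b.sum_repr (v x i)).symm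
    conv_lhs => rw [h]
    rw [MultilinearMap.map_sum]
    refine Finset.sum_congr rfl fun r _ => ?_
    rw [MultilinearMap.map_smul_univ, smul_eq_mul]
  rw [e]
  exact regular_sum _ fun r _ => regular_mul (regular_prod _ fun i _ => hv i _) (hμ _)

lemma RegVec.phi {A B M : Type*} [AddCommGroup A] [Module ℂ A] [AddCommGroup B] [Module ℂ B]
    [AddCommGroup M] [Module ℂ M] [FiniteDimensional ℂ A] [FiniteDimensional ℂ B] {c m : ℕ}
    {f : U → Phi A B M c m} (h : ∀ l s, RegVec (fun x => (f x).1 l s)) : RegVec f := by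
  induction c with
  | zero =>
    induction m with
    | zero => exact RegVec.of_injective (evalNil_injective A B M) (h [] [])
    | succ m ih =>
      refine RegVec.of_injective (curryB_injective A B M 0 m) (RegHom.regVec fun b => ?_)
      exact ih fun l s => h l (b :: s)
  | succ c ih =>
    refine RegVec.of_injective (curryA_injective A B M c m) (RegHom.regVec fun b => ?_)
    exact ih fun l s => h (b :: l) s

lemma RegVec.phi_ofFn {A B M : Type*} [AddCommGroup A] [Module ℂ A] [AddCommGroup B] [Module ℂ B]
    [AddCommGroup M] [Module ℂ M] [FiniteDimensional ℂ A] [FiniteDimensional ℂ B] {c : ℕ}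
    {f : U → Phi A B M c 0} (h : ∀ v : Fin c → A, RegVec (fun x => (f x).1 (List.ofFn v) [])) :
    RegVec f := by
  refine RegVec.phi fun l s => ?_
  by_cases hl : l.length = c ∧ s.length = 0
  · have := h (fun i => l.get (i.cast hl.1.symm))
    have e : List.ofFn (fun i => l.get (i.cast hl.1.symm)) = l := by
      obtain ⟨rfl, -⟩ := hl
      exact List.ofFn_get l
    rwa [e, ← List.length_eq_zero_iff.1 hl.2] at this
  · have e : (fun x => (f x).1 l s) = fun _ => 0 := funext fun x => (f x).2.2 l s hl
    rw [e]
    exact RegVec.const 0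

lemma Frame.g_mem (φ : Frame W U) (x : U) {v : V} (hv : v ∈ W.1) :
    φ.g x v ∈ (x : LagGrass ω n).1 := by
  rw [← φ.map]
  exact Submodule.mem_map_of_mem hv

lemma Frame.g_symm_mem (φ : Frame W U) (x : U) {v : V} (hv : v ∈ (x : LagGrass ω n).1) :
    (φ.g x)⁻¹ v ∈ W.1 := by
  rw [← φ.map] at hv
  obtain ⟨w, hw, rfl⟩ := hv
  rwa [show (φ.g x)⁻¹ ((φ.g x : V →ₗ[ℂ] V) w) = w from (φ.g x).symm_apply_apply w]

/-- The isomorphism of fibres of the quotient bundle defined by a frame. -/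
def Frame.q (φ : Frame W U) (x : U) : (V ⧸ W.1) →ₗ[ℂ] V ⧸ (x : LagGrass ω n).1 :=
  W.1.mapQ _ (φ.g x : V →ₗ[ℂ] V) fun _ hv => φ.g_mem x hv

/-- Its inverse. -/
def Frame.qinv (φ : Frame W U) (x : U) : (V ⧸ (x : LagGrass ω n).1) →ₗ[ℂ] V ⧸ W.1 :=
  Submodule.mapQ _ W.1 ((φ.g x)⁻¹ : V ≃ₗ[ℂ] V).toLinearMap fun _ hv => φ.g_symm_mem x hv

lemma Frame.q_qinv (φ : Frame W U) (x : U) (v) : φ.q x (φ.qinv x v) = v := by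
  obtain ⟨v, rfl⟩ := Submodule.Quotient.mk_surjective _ v
  exact congrArg Submodule.Quotient.mk ((φ.g x).apply_symm_apply v)

lemma Frame.qinv_q (φ : Frame W U) (x : U) (v) : φ.qinv x (φ.q x v) = v := by
  obtain ⟨v, rfl⟩ := Submodule.Quotient.mk_surjective _ v
  exact congrArg Submodule.Quotient.mk ((φ.g x).symm_apply_apply v)

variable {c : ℕ}

/-- A form on `U` in a frame. -/
def Frame.form (φ : Frame W U) (η : forms (ω := ω) (n := n) c U) (x : U) :
    Phi (V ⧸ W.1) (V ⧸ W.1) ℂ c 0 :=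
  Phi.ofAlt c ((η.1 x).compLinearMap (φ.q x))

lemma Frame.form_ofFn (φ : Frame W U) (η : forms (ω := ω) (n := n) c U) (x : U)
    (v : Fin c → V ⧸ W.1) : (φ.form η x).1 (List.ofFn v) [] = η.1 x (fun i => φ.q x (v i)) :=
  Phi.ofAlt_ofFn c _ v

lemma Frame.form_reg (φ : Frame W U) (η : forms (ω := ω) (n := n) c U) : RegVec (φ.form η) := by
  refine RegVec.phi_ofFn fun v => ?_
  choose w hw using fun i => Submodule.Quotient.mk_surjective W.1 (v i)
  have e : (fun x => (φ.form η x).1 (List.ofFn v) []) = fun x =>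
      ((η.1 x).toMultilinearMap.compLinearMap fun _ => (x : LagGrass ω n).1.mkQ)
        (fun i => φ.g x (w i)) := by
    funext x
    rw [φ.form_ofFn]
    refine congrArg (η.1 x) (funext fun i => ?_)
    rw [← hw i]
    rfl
  rw [e]
  refine fun l => ?_
  have h := regular_multilinear
    (fun x : U => (η.1 x).toMultilinearMap.compLinearMap fun _ => (x : LagGrass ω n).1.mkQ)
    (fun v => η.2 v) (v := fun x i => φ.g x (w i)) (fun i => φ.reg (w i))
  have hl : ∀ z : ℂ, l z = z * l 1 := fun z => by
    conv_lhs => rw [← mul_one z, ← smul_eq_mul, map_smul, smul_eq_mul]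
  rw [show (fun x : U => l (((η.1 x).toMultilinearMap.compLinearMap fun _ =>
    (x : LagGrass ω n).1.mkQ) (fun i => φ.g x (w i)))) = fun x => _ * l 1 from funext fun x => hl _]
  exact regular_mul h (regular_const U _)

/-- A constant form in a frame, as a form on `U`. -/
def Frame.unform (φ : Frame W U) (e : Phi (V ⧸ W.1) (V ⧸ W.1) ℂ c 0) :
    forms (ω := ω) (n := n) c U :=
  ⟨fun x => (Phi.toAlt c e).compLinearMap (φ.qinv x), fun v =>
    regular_multilinear (U := U)
      (fun _ => (Phi.toAlt c e).toMultilinearMap.compLinearMap fun _ => W.1.mkQ)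
      (fun _ => regular_const U _) (v := fun x i => (φ.g x)⁻¹ (v i)) (fun i => φ.reg_inv (v i))⟩

lemma Frame.form_unform (φ : Frame W U) (e : Phi (V ⧸ W.1) (V ⧸ W.1) ℂ c 0) (x : U) :
    φ.form (φ.unform e) x = e := by
  refine Phi.ext_ofFn fun v => ?_
  rw [φ.form_ofFn]
  change Phi.toAlt c e (fun i => φ.qinv x (φ.q x (v i))) = _
  simp only [φ.qinv_q]
  rfl

instance : Module (regularFunctions U) (forms (ω := ω) (n := n) c U) :=
  Submodule.module (forms (ω := ω) (n := n) c U)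

instance : SMul (regularFunctions U) (forms (ω := ω) (n := n) c U) :=
  (Submodule.module (forms (ω := ω) (n := n) c U)).toDistribMulAction.toMulAction.toSMul

/-- A frame identifies all fibres of Q with V/W, so a basis of forms at W is a basis of the module
of forms over the regular functions. -/
lemma Frame.eq_sum_unform {ι : Type*} [Fintype ι] (φ : Frame W U)
    (b : Module.Basis ι ℂ (Phi (V ⧸ W.1) (V ⧸ W.1) ℂ c 0)) (η : forms (ω := ω) (n := n) c U) :
    η = ∑ j, ((⟨fun x => b.coord j (φ.form η x), φ.form_reg η _⟩ : regularFunctions U) •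
      φ.unform (b j) : forms (ω := ω) (n := n) c U) := by
  refine Subtype.ext (funext fun x => AlternatingMap.ext fun v => ?_)
  have h : (η.1 x) v = Phi.toAlt c (φ.form η x) (fun i => φ.qinv x (v i)) := by
    rw [Phi.toAlt_apply, φ.form_ofFn]
    simp only [φ.q_qinv]
  let ev : forms (ω := ω) (n := n) c U →+ ℂ :=
    { toFun := fun η => η.1 x v, map_zero' := rfl, map_add' := fun _ _ => rfl }
  let ev' : Phi (V ⧸ W.1) (V ⧸ W.1) ℂ c 0 →ₗ[ℂ] ℂ :=
    { toFun := fun e => Phi.toAlt c e (fun i => φ.qinv x (v i)), map_add' := fun _ _ => rfl,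
      map_smul' := fun _ _ => rfl }
  have h' : ev' (φ.form η x) = ∑ j, b.coord j (φ.form η x) • ev' (b j) := by
    conv_lhs => rw [← b.sum_repr (φ.form η x)]
    simp only [map_sum, map_smul, Module.Basis.coord_apply]
  refine h.trans (h'.trans (Eq.trans ?_ (map_sum ev _ _).symm))
  exact Finset.sum_congr rfl fun _ _ => rfl

end
end LagGrass

end

/-! ### Tensor products with exterior powers of Q* as twists -/

noncomputable section
namespace LagGrass
open Raw
variable {V : Type u} [AddCommGroup V] [Module ℂ V] {ω : LinearMap.BilinForm ℂ V} {n : ℕ}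

lemma Presheaf.W_of_bijective {X : TopCat.{u}} {A B : (Opens X)ᵒᵖ ⥤ AddCommGrpCat.{u}} (f : A ⟶ B)
    (h : ∀ x : X, ∃ U₀ : Opens X, x ∈ U₀ ∧ ∀ U ≤ U₀, Function.Bijective (f.app (op U))) :
    (Opens.grothendieckTopology X).W f := by
  have h1 : Presheaf.IsLocallyInjective (Opens.grothendieckTopology X) f := by
    refine ⟨fun {U} a b hab x hx => ?_⟩
    obtain ⟨U₀, hx₀, hU⟩ := h x
    refine ⟨U.unop ⊓ U₀, homOfLE inf_le_left, (hU _ inf_le_right).1 ?_, ⟨hx, hx₀⟩⟩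
    have e (c) := ConcreteCategory.congr_hom
      (f.naturality (homOfLE (inf_le_left : U.unop ⊓ U₀ ≤ U.unop)).op) c
    refine (e a).trans (Eq.trans ?_ (e b).symm)
    exact congrArg (fun c => B.map (homOfLE (inf_le_left : U.unop ⊓ U₀ ≤ U.unop)).op c) hab
  have h2 : Presheaf.IsLocallySurjective (Opens.grothendieckTopology X) f := by
    refine ⟨fun {U} t x hx => ?_⟩
    obtain ⟨U₀, hx₀, hU⟩ := h x
    refine ⟨U ⊓ U₀, homOfLE inf_le_left, (hU _ inf_le_right).2 _, ⟨hx, hx₀⟩⟩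
  exact (Opens.grothendieckTopology X).W_of_isLocallyBijective f

/-- A locally bijective map becomes an isomorphism after sheafification, and Q is its own
sheafification. -/
lemma nonempty_sheafification_iso (P : PresheafOfModules (ringSheaf ω n).obj) (Q : Mod ω n)
    (f : P.presheaf ⟶ Q.val.presheaf)
    (hf : ∀ (U : (Opens (space ω n))ᵒᵖ) (r : (ringSheaf ω n).obj.obj U) (m : P.obj U),
      f.app U (r • m) = r • (show Q.val.obj U from f.app U m))
    (h : ∀ x : space ω n, ∃ U₀ : Opens (space ω n), x ∈ U₀ ∧ ∀ U ≤ U₀,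
      Function.Bijective (f.app (op U))) :
    Nonempty ((PresheafOfModules.sheafification (𝟙 (ringSheaf ω n).obj)).obj P ≅ Q) := by
  let g : P ⟶ (PresheafOfModules.restrictScalars (𝟙 (ringSheaf ω n).obj)).obj
      ((SheafOfModules.forget _).obj Q) := PresheafOfModules.homMk f hf
  have hg : (Opens.grothendieckTopology (space ω n)).W ((PresheafOfModules.toPresheaf _).map g) :=
    Presheaf.W_of_bijective f h
  have hi : IsIso ((PresheafOfModules.sheafification (𝟙 (ringSheaf ω n).obj)).map g) := by
    have := PresheafOfModules.inverseImage_W_toPresheaf_eq_inverseImage_isomorphisms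
      (𝟙 (ringSheaf ω n).obj)
    have h' : ((Opens.grothendieckTopology (space ω n)).W.inverseImage
      (PresheafOfModules.toPresheaf _)) g := hg
    rw [this] at h'
    exact h'
  exact ⟨asIso ((PresheafOfModules.sheafification (𝟙 (ringSheaf ω n).obj)).map g) ≪≫
    asIso ((PresheafOfModules.sheafificationAdjunction (𝟙 (ringSheaf ω n).obj)).counit.app Q)⟩

lemma nonempty_iso_of_bijective (P Q : Mod ω n) (f : ∀ U, Sec P U →+ Sec Q U)
    (hr : ∀ U U' (l : U' ≤ U) (s : Sec P U), f _ (Sec.res l s) = Sec.res l (f _ s))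
    (hf : ∀ U (r : regularFunctions U) (s : Sec P U), f U (r • s) = r • f U s)
    (h : ∀ x : space ω n, ∃ U₀ : Opens (space ω n), x ∈ U₀ ∧ ∀ U ≤ U₀,
      Function.Bijective (f U)) : Nonempty (P ≅ Q) := by
  let f' : P.val.presheaf ⟶ Q.val.presheaf := (abHom f hr).hom
  have hf' : ∀ (U : (Opens (space ω n))ᵒᵖ) (r : (ringSheaf ω n).obj.obj U) (m : P.val.obj U),
      f'.app U (r • m) = r • (show Q.val.obj U from f'.app U m) := fun U r m => hf U.unop r m
  obtain ⟨e⟩ := nonempty_sheafification_iso P.val Q f' hf' h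
  -- P is also its own sheafification; comparing the two isomorphisms gives P ≅ Q.
  obtain ⟨e'⟩ := nonempty_sheafification_iso P.val P (𝟙 _) (fun _ _ _ => rfl)
    fun x => ⟨⊤, trivial, fun U _ => Function.bijective_id⟩
  exact ⟨e'.symm ≪≫ e⟩

lemma tensor_iso (A : Mod ω n) {B C : Mod ω n} (e : B ≅ C) : Nonempty (tensor A B ≅ tensor A C) :=
  ⟨(PresheafOfModules.sheafification (𝟙 (ringSheaf ω n).obj)).mapIso
    ((MonoidalCategory.tensorLeft (C := PresheafOfModules (structurePresheaf ω n ⋙ forget₂ _ _))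
      A.val).mapIso ((SheafOfModules.forget _).mapIso e))⟩

variable [FiniteDimensional ℂ V] {W : LagGrass ω n}

section
variable {U : Opens (space ω n)} {c : ℕ} {M : RRep W} {F : Mod ω n}

/-- Restriction of forms. -/
def formRes {U' : Opens (space ω n)} (h : U' ≤ U) (η : forms (ω := ω) (n := n) c U) :
    forms (ω := ω) (n := n) c U' :=
  ⟨fun x => η.1 ⟨x.1, h x.2⟩, fun v => regular_res h (η.2 v)⟩

variable (M) in
/-- Multiplication by a form, in a frame. -/
def Frame.wedge (φ : Frame W U) (η : forms (ω := ω) (n := n) c U) : RHom U M (RRep.alt c M) :=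
  ⟨fun x => Phi.smulRight c (φ.form η x), fun m =>
    (φ.form_reg η).map ((Phi.smulRight (A := V ⧸ W.1) (B := V ⧸ W.1) c).flip m)⟩

lemma Frame.wedge_trans (φ' φ : Frame W U) (η : forms (ω := ω) (n := n) c U) :
    (φ'.wedge M η).comp (M.fam (φ'.trans φ)) =
      ((RRep.alt c M).fam (φ'.trans φ)).comp (φ.wedge M η) := by
  refine Subtype.ext (funext fun x => LinearMap.ext fun m => ?_)
  refine Phi.ext_ofFn (A := V ⧸ W.1) (B := V ⧸ W.1) (M := M) fun v => ?_
  refine (Phi.smulRight_apply c _ _ _ _).trans ?_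
  refine Eq.trans ?_ (congrArg (M.ρ ((φ'.trans φ).p x)) (Phi.smulRight_apply c _ _ _ _)).symm
  rw [map_smul]
  congr 1
  rw [φ'.form_ofFn]
  refine Eq.trans ?_ ((congrArg (fun l => (φ.form η x).1 l []) (List.map_ofFn (f := v) (g := (RRep.qRep W).ρ _))).trans
    (φ.form_ofFn η x _)).symm
  refine congrArg (η.1 x) (funext fun i => ?_)
  obtain ⟨w, hw⟩ := Submodule.Quotient.mk_surjective W.1 (v i)
  change _ = φ.q x ((RRep.qRep W).ρ _ (v i))
  rw [← hw]
  refine congrArg (Submodule.Quotient.mk (p := (x : LagGrass ω n).1)) ?_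
  change φ'.g x w = φ.g x ((φ.g x)⁻¹ (φ'.g x w))
  exact ((φ.g x).apply_symm_apply _).symm

/-- The product of a form and a section of a twist. -/
def tensorSec (η : forms (ω := ω) (n := n) c U) (s : secF F M U) : secF F (RRep.alt c M) U :=
  ⟨fun U' h φ => (φ.wedge M (formRes h η)).act (s.1 U' h φ),
    fun U' h φ U'' h' => by
      refine (congrArg _ (s.2.1 U' h φ U'' h')).trans ?_
      exact (VSec.res_act h' (φ.wedge M (formRes h η)) _).symm,
    fun U' h φ φ' => by
      refine (congrArg _ (s.2.2 U' h φ φ')).trans ?_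
      beta_reduce
      rw [RHom.act_act, RHom.act_act, Frame.wedge_trans]⟩

lemma tensorSec_val (η : forms (ω := ω) (n := n) c U) (s : secF F M U) (U' h φ) :
    (tensorSec η s).1 U' h φ = (φ.wedge M (formRes h η)).act (s.1 U' h φ) := rfl

lemma Frame.form_add (φ : Frame W U) (η η' : forms (ω := ω) (n := n) c U) (x : U) :
    φ.form (η + η') x = φ.form η x + φ.form η' x := Phi.ext_ofFn fun v => by
  refine (φ.form_ofFn (η + η') x v).trans ?_
  exact (congrArg₂ (· + ·) (φ.form_ofFn η x v) (φ.form_ofFn η' x v)).symm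

lemma Frame.form_smul (φ : Frame W U) (r : regularFunctions U) (η : forms (ω := ω) (n := n) c U)
    (x : U) : φ.form (r • η) x = r.1 x • φ.form η x := Phi.ext_ofFn fun v => by
  refine (φ.form_ofFn (r • η) x v).trans ?_
  exact (congrArg (r.1 x * ·) (φ.form_ofFn η x v)).symm

/-- The product of forms and sections of a twist as a bilinear map. -/
def tensorBilin (F : Mod ω n) (M : RRep W) (c : ℕ) (U : Opens (space ω n)) :
    forms (ω := ω) (n := n) c U →ₗ[regularFunctions U] secF F M U →ₗ[regularFunctions U]
      secF F (RRep.alt c M) U :=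
  LinearMap.mk₂ _ tensorSec
    (fun η η' s => secF.ext_frame fun U' h φ => by
      have : φ.wedge M (formRes h (η + η')) = φ.wedge M (formRes h η) + φ.wedge M (formRes h η') :=
        Subtype.ext (funext fun x => (congrArg (Phi.smulRight c)
          (φ.form_add (formRes h η) (formRes h η') x)).trans (map_add _ _ _))
      rw [tensorSec_val, this, RHom.act_add_left]
      rfl)
    (fun r η s => secF.ext_frame fun U' h φ => by
      have : φ.wedge M (formRes h (r • η)) = RHom.fsmul (rres h r) (φ.wedge M (formRes h η)) :=
        Subtype.ext (funext fun x => (congrArg (Phi.smulRight c)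
          (φ.form_smul (rres h r) (formRes h η) x)).trans (map_smul _ _ _))
      rw [tensorSec_val, this, RHom.act_fsmul_left]
      rfl)
    (fun η s t => secF.ext_frame fun U' h φ => map_add _ _ _)
    (fun r η s => secF.ext_frame fun U' h φ => by
      rw [tensorSec_val, secF.smul_val, secF.smul_val, RHom.act_smul]
      rfl)

section
variable {ι : Type*} [Fintype ι] {M N : Type*} [AddCommGroup M] [Module ℂ M] [AddCommGroup N]
  [Module ℂ N] [FiniteDimensional ℂ M] [FiniteDimensional ℂ N]

lemma RHom.act_sum_left (s : Finset ι) (c : ι → RHom U M N)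
    (v : Fin (Module.finrank ℂ M) → Sec F U) :
    (∑ i ∈ s, c i).act v = ∑ i ∈ s, (c i).act v := by
  classical
  induction s using Finset.induction_on with
  | empty => simpa using RHom.act_zero_left v
  | insert a s ha ih => rw [Finset.sum_insert ha, Finset.sum_insert ha, RHom.act_add_left, ih]

lemma RHom.sum_act_bijective (f : ι → M →ₗ[ℂ] N)
    (hf : Function.Bijective (fun m : ι → M => ∑ j, f j (m j))) :
    Function.Bijective (fun s : ι → Fin (Module.finrank ℂ M) → Sec F U =>
      ∑ j, (RHom.const U (f j)).act (s j)) := by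
  classical
  let f' : (ι → M) →ₗ[ℂ] N := ∑ j, f j ∘ₗ LinearMap.proj (R := ℂ) (φ := fun _ : ι => M) j
  have hf' (m) : f' m = ∑ j, f j (m j) := by simp [f']
  let e : (ι → M) ≃ₗ[ℂ] N := LinearEquiv.ofBijective f' (by
    rwa [show (f' : (ι → M) → N) = fun m => ∑ j, f j (m j) from funext hf'])
  have he (m : ι → M) : e m = ∑ j, f j (m j) := hf' m
  let pr (j : ι) : N →ₗ[ℂ] M :=
    LinearMap.proj (R := ℂ) (φ := fun _ : ι => M) j ∘ₗ (e.symm : N →ₗ[ℂ] (ι → M))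
  have hpr (i j : ι) : pr i ∘ₗ f j = if i = j then LinearMap.id else 0 := by
    refine LinearMap.ext fun m => ?_
    have h1 : f j m = e (Pi.single j m) := by
      rw [he, Finset.sum_eq_single j]
      · rw [Pi.single_eq_same]
      · intro i _ hi
        rw [Pi.single_eq_of_ne hi, map_zero]
      · exact fun h => absurd (Finset.mem_univ j) h
    change e.symm (f j m) i = _
    rw [h1, e.symm_apply_apply]
    split_ifs with h
    · subst h; simp
    · simp [h]
  have hsum : ∑ j, f j ∘ₗ pr j = LinearMap.id := by
    refine LinearMap.ext fun y => ?_
    rw [LinearMap.sum_apply]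
    exact (he (e.symm y)).symm.trans (e.apply_symm_apply y)
  constructor
  · intro s t hst
    funext i
    have key (s : ι → Fin (Module.finrank ℂ M) → Sec F U) : s i =
        (RHom.const U (pr i)).act (∑ j, (RHom.const U (f j)).act (s j)) := by
      rw [map_sum, Finset.sum_eq_single i]
      · rw [RHom.act_act]
        change _ = (RHom.const U (pr i ∘ₗ f i)).act (s i)
        rw [hpr, if_pos rfl, RHom.act_const_id]
      · intro j _ hj
        rw [RHom.act_act]
        change (RHom.const U (pr i ∘ₗ f j)).act (s j) = 0
        rw [hpr, if_neg hj.symm]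
        exact RHom.act_zero_left _
      · exact fun h => absurd (Finset.mem_univ i) h
    rw [key s, key t]
    exact congrArg _ hst
  · intro t
    refine ⟨fun j => (RHom.const U (pr j)).act t, ?_⟩
    simp only [RHom.act_act]
    rw [← RHom.act_sum_left]
    refine Eq.trans ?_ (RHom.act_const_id t)
    rw [← hsum]
    refine congrArg (fun c : RHom U N N => c.act t) (Subtype.ext ?_)
    rw [AddSubmonoidClass.coe_finsetSum]
    funext x
    rw [Finset.sum_apply]
    rfl

end

lemma Frame.wedge_unform (φ : Frame W U) (e : Phi (V ⧸ W.1) (V ⧸ W.1) ℂ c 0) :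
    φ.wedge M (φ.unform e) = RHom.const U (Phi.smulRight (M := M) c e) :=
  Subtype.ext (funext fun x => congrArg (Phi.smulRight (M := M) c) (φ.form_unform e x))

/-- The decomposition of forms on a framed open subset. -/
lemma tensorSec_sum_bijective {ι : Type*} [Fintype ι] (φ : Frame W U)
    (b : Module.Basis ι ℂ (Phi (V ⧸ W.1) (V ⧸ W.1) ℂ c 0)) :
    Function.Bijective (fun s : ι → secF F M U => ∑ j, tensorSec (φ.unform (b j)) (s j)) := by
  have hval (s : ι → secF F M U) : secF.frameEquiv φ (∑ j, tensorSec (φ.unform (b j)) (s j)) =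
      ∑ j, (RHom.const U (Phi.smulRight (M := M) c (b j))).act (secF.frameEquiv φ (s j)) := by
    refine (map_sum (secF.frameEquiv (F := F) (M := RRep.alt c M) φ).toAddMonoidHom _ _).trans (Finset.sum_congr rfl fun j _ => ?_)
    exact congrArg (fun r : RHom U M (RRep.alt c M) => r.act ((s j).1 U le_rfl φ))
      (φ.wedge_unform (b j))
  have hbij := RHom.sum_act_bijective (F := F) (U := U) (fun j => Phi.smulRight (M := M) c (b j)) (by
    have := Phi.ofCoord_bijective (M := M) c b
    rwa [show (Phi.ofCoord (M := M) c b : (ι → M) → _) = _ from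
      funext (Phi.ofCoord_apply (M := M) c b)] at this)
  rw [← (secF.frameEquiv (F := F) (M := RRep.alt c M) φ).bijective.of_comp_iff']
  have := hbij.comp (Equiv.piCongrRight fun _ : ι => (secF.frameEquiv (F := F) (M := M) φ).toEquiv).bijective
  have e : secF.frameEquiv (F := F) (M := RRep.alt c M) φ ∘
      (fun s : ι → secF F M U => ∑ j, tensorSec (φ.unform (b j)) (s j)) = _ := funext hval
  rw [e]
  exact this

open TensorProduct in
-- Over a framed open set the constant forms b_j generate the module of forms, so every tensor is ∑
-- b_j ⊗ s_j. The product map takes it to ∑ b_j s_j, and this is bijective in (s_j); hence so is the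
-- product map.
lemma tensorBilin_bijective (φ : Frame W U) :
    Function.Bijective (TensorProduct.lift (tensorBilin F M c U)) := by
  let b := Module.finBasis ℂ (Phi (V ⧸ W.1) (V ⧸ W.1) ℂ c 0)
  have hb := tensorSec_sum_bijective (F := F) (M := M) φ b
  let T : (Fin (Module.finrank ℂ (Phi (V ⧸ W.1) (V ⧸ W.1) ℂ c 0)) → secF F M U) →
      forms (ω := ω) (n := n) c U ⊗[regularFunctions U] secF F M U :=
    fun s => ∑ j, φ.unform (b j) ⊗ₜ s j
  have hT (s) : TensorProduct.lift (tensorBilin F M c U) (T s) =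
      ∑ j, tensorSec (φ.unform (b j)) (s j) := by
    rw [map_sum]
    exact Finset.sum_congr rfl fun j _ => TensorProduct.lift.tmul _ _
  have hsurj : Function.Surjective T := by
    intro t
    induction t using TensorProduct.induction_on with
    | zero => exact ⟨0, Finset.sum_eq_zero fun j _ => TensorProduct.tmul_zero _ _⟩
    | tmul η s =>
      refine ⟨fun j => (⟨fun x => b.coord j (φ.form η x), φ.form_reg η _⟩ : regularFunctions U) • s, ?_⟩
      conv_rhs => rw [φ.eq_sum_unform b η, TensorProduct.sum_tmul]
      refine Finset.sum_congr rfl fun j _ => ?_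
      exact (((TensorProduct.mk (regularFunctions U) (forms (ω := ω) (n := n) c U) (secF F M U)
        (φ.unform (b j))).map_smul _ s).trans (LinearMap.map_smul₂ (TensorProduct.mk
          (regularFunctions U) (forms (ω := ω) (n := n) c U) (secF F M U)) _ _ s).symm)
    | add t t' h h' =>
      obtain ⟨s, rfl⟩ := h
      obtain ⟨s', rfl⟩ := h'
      refine ⟨s + s', ?_⟩
      refine Eq.trans (Finset.sum_congr rfl fun j _ => TensorProduct.tmul_add _ _ _) ?_
      exact Finset.sum_add_distrib
  constructor
  · intro t t' h
    obtain ⟨s, rfl⟩ := hsurj t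
    obtain ⟨s', rfl⟩ := hsurj t'
    rw [hT, hT] at h
    rw [hb.1 h]
  · intro t
    obtain ⟨s, hs⟩ := hb.2 t
    exact ⟨T s, (hT s).trans hs⟩

/-- Multiplication is a map from the presheaf tensor product to the twist; it is bijective on small
framed open sets, so it induces an isomorphism from the sheafification. -/
lemma tensor_tw (hfr : HasFrames W) (F : Mod ω n) (M : RRep W) (c : ℕ) :
    Nonempty (tensor (formSheaf ω n c) (tw F M) ≅ tw F (RRep.alt c M)) := by
  let P : PresheafOfModules (ringSheaf ω n).obj :=
    PresheafOfModules.Monoidal.tensorObj (R := structurePresheaf ω n) (formSheaf ω n c).val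
      (tw F M).val
  let g (U : Opens (space ω n)) := TensorProduct.lift (tensorBilin F M c U)
  let f : P.presheaf ⟶ (tw F (RRep.alt c M)).val.presheaf :=
    { app := fun U => AddCommGrpCat.ofHom (g U.unop).toAddMonoidHom
      naturality := fun U U' i => by
        ext t
        have key : ∀ t : TensorProduct (regularFunctions U.unop) (forms (ω := ω) (n := n) c U.unop)
            (secF F M U.unop), g U'.unop (P.presheaf.map i t) = secF.res i.unop.le (g U.unop t) := by
          intro t
          induction t using TensorProduct.induction_on with
          | zero =>
            refine (congrArg (g U'.unop) (map_zero (P.presheaf.map i).hom)).trans ?_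
            exact (map_zero (g U'.unop)).trans ((congrArg (secF.res i.unop.le)
              (map_zero (g U.unop))).trans (map_zero _)).symm
          | tmul η s => rfl
          | add t t' h h' =>
            refine (congrArg (g U'.unop) (map_add (P.presheaf.map i).hom t t')).trans ?_
            refine (map_add (g U'.unop) _ _).trans ((congrArg₂ (· + ·) h h').trans ?_)
            exact ((congrArg (secF.res i.unop.le) (map_add (g U.unop) t t')).trans
              (map_add _ _ _)).symm
        exact key t }
  refine nonempty_sheafification_iso P (tw F (RRep.alt c M)) f
    (fun U r m => (g U.unop).map_smul r m) fun x => ?_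
  obtain ⟨U₀, hx, ⟨φ⟩⟩ := hfr x
  exact ⟨U₀, hx, fun U hU => tensorBilin_bijective (φ.res hU)⟩

end
end LagGrass

end

/-! ### The vanishing hypothesis in terms of twists -/

noncomputable section
namespace LagGrass
open Raw
variable {V : Type u} [AddCommGroup V] [Module ℂ V] {ω : LinearMap.BilinForm ℂ V} {n : ℕ}
variable [FiniteDimensional ℂ V] {W : LagGrass ω n}

section base
variable {F : Mod ω n} {U : Opens (space ω n)}

/-- The only coordinate of the unit of the trivial representation. -/
def trivCoord (U : Opens (space ω n)) (i : Fin (Module.finrank ℂ (RRep.triv W))) :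
    regularFunctions U :=
  ⟨fun _ => (Module.finBasis ℂ (RRep.triv W)).coord i (ULift.up 1), regular_const U _⟩

lemma finrank_triv : Module.finrank ℂ (RRep.triv W) = 1 := by
  have : Module.finrank ℂ (ULift.{u} ℂ) = 1 := by
    rw [(ULift.moduleEquiv (R := ℂ) (M := ℂ)).finrank_eq, Module.finrank_self]
  exact this

/-- The chosen basis of the trivial line need not be 1, so the coordinate of 1 is only some nonzero
constant. -/
lemma trivCoord_inverse (U : Opens (space ω n)) (i : Fin (Module.finrank ℂ (RRep.triv W))) :
    ∃ r : regularFunctions U, r * trivCoord U i = 1 := by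
  have h1 : (Module.finBasis ℂ (RRep.triv W)).coord i (ULift.up 1) ≠ 0 := by
    intro h
    have h2 : (ULift.up 1 : ULift.{u} ℂ) = 0 := by
      refine (Module.finBasis ℂ (RRep.triv W)).ext_elem fun j => ?_
      have hj : j = i := by
        apply Fin.ext
        have := finrank_triv (W := W)
        omega
      rw [hj]
      exact h.trans (map_zero ((Module.finBasis ℂ (RRep.triv W)).coord i)).symm
    exact one_ne_zero (congrArg ULift.down h2)
  exact ⟨⟨fun _ => ((Module.finBasis ℂ (RRep.triv W)).coord i (ULift.up 1))⁻¹, regular_const U _⟩,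
    Subtype.ext (funext fun _ => inv_mul_cancel₀ h1)⟩

/-- Sections as sections of the trivial twist. -/
def toTriv (U : Opens (space ω n)) : Sec F U →+ secF F (RRep.triv W) U where
  toFun s := ⟨fun U' h φ i => trivCoord U' i • Sec.res h s,
    fun U' h φ U'' h' => funext fun i => by
      change _ = Sec.res h' _
      rw [Sec.res_smul, Sec.res_res]
      rfl,
    fun U' h φ φ' => (RHom.act_const_id (M := RRep.triv W) _).symm⟩
  map_zero' := secF.ext_frame fun U' h φ => funext fun i => by
    change trivCoord U' i • Sec.res h 0 = 0
    rw [map_zero, smul_zero]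
  map_add' s t := secF.ext_frame fun U' h φ => funext fun i => by
    change trivCoord U' i • Sec.res h (s + t) = trivCoord U' i • Sec.res h s + trivCoord U' i • Sec.res h t
    rw [map_add, smul_add]

lemma toTriv_bijective (φ : Frame W U) :
    Function.Bijective (toTriv (F := F) (W := W) U) := by
  let i : Fin (Module.finrank ℂ (RRep.triv W)) := ⟨0, by rw [finrank_triv]; exact one_pos⟩
  have hi (j : Fin (Module.finrank ℂ (RRep.triv W))) : j = i := by
    apply Fin.ext
    have := finrank_triv (W := W)
    omega
  obtain ⟨r, hr⟩ := trivCoord_inverse (W := W) U i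
  have hval (s : Sec F U) : (toTriv (F := F) (W := W) U s).1 U le_rfl φ i = trivCoord U i • s :=
    congrArg (trivCoord U i • ·) (Sec.res_refl s)
  constructor
  · intro s t h
    have h1 := congrArg (fun z : secF F (RRep.triv W) U => r • z.1 U le_rfl φ i) h
    simp only [hval, smul_smul, hr, one_smul] at h1
    exact h1
  · intro t
    refine ⟨r • t.1 U le_rfl φ i, secF.eq_of_frame φ (funext fun j => ?_)⟩
    rw [hi j, hval, smul_smul, mul_comm, hr, one_smul]

lemma tw_triv (hfr : HasFrames W) (F : Mod ω n) : Nonempty (F ≅ tw F (RRep.triv W)) := by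
  refine nonempty_iso_of_bijective F (tw F (RRep.triv W)) (fun U => toTriv U) (fun U U' l s => ?_)
    (fun U r s => ?_) fun x => ?_
  · refine secF.ext_frame fun U'' h φ => funext fun i => ?_
    exact congrArg (trivCoord U'' i • ·) (Sec.res_res l h s)
  · refine secF.ext_frame fun U'' h φ => funext fun i => ?_
    change trivCoord U'' i • Sec.res h (r • s) = rres h r • (trivCoord U'' i • Sec.res h s)
    rw [Sec.res_smul, smul_smul, smul_smul, mul_comm]
  · obtain ⟨U₀, hx, ⟨φ⟩⟩ := hfr x
    exact ⟨U₀, hx, fun U hU => toTriv_bijective (φ.res hU)⟩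

end base

lemma foldr_tensor_iso (hfr : HasFrames W) (F : Mod ω n) (l : List ℕ) :
    Nonempty ((l.map (formSheaf ω n)).foldr tensor F ≅ tw F (RRep.iter l (RRep.triv W))) := by
  induction l with
  | nil => exact tw_triv hfr F
  | cons c l ih =>
    obtain ⟨e⟩ := ih
    obtain ⟨e₁⟩ := tensor_iso (formSheaf ω n c) e
    obtain ⟨e₂⟩ := tensor_tw hfr F (RRep.iter l (RRep.triv W)) c
    exact ⟨e₁ ≪≫ e₂⟩

/-- Translation of admissible lists into the indices i_j ≤ j of the hypothesis: the entry n stands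
for i_j = j, and the total cost becomes ∑ i_j. -/
lemma Admissible.exists_index {N C : ℕ} {l : List ℕ} (h : Admissible n N l C) :
    ∃ I : Fin N → ℕ, (l = List.ofFn fun k => if I k < k + 1 then I k else n) ∧
      (∀ k, I k ≤ k + 1) ∧ ∑ k, I k = C := by
  induction h with
  | nil => exact ⟨Fin.elim0, rfl, fun k => k.elim0, rfl⟩
  | @low N l C b h hb ih =>
    obtain ⟨I, rfl, hI, rfl⟩ := ih
    refine ⟨Fin.snoc I b, ?_, fun k => ?_, ?_⟩
    · rw [List.ofFn_succ', List.concat_eq_append]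
      simp only [Fin.snoc_castSucc, Fin.val_castSucc, Fin.snoc_last, Fin.val_last]
      rw [if_pos (by omega)]
    · induction k using Fin.lastCases with
      | last => simp only [Fin.snoc_last, Fin.val_last]; omega
      | cast k => simpa using hI k
    · rw [Fin.sum_univ_castSucc]
      simp
  | @top N l C h ih =>
    obtain ⟨I, rfl, hI, rfl⟩ := ih
    refine ⟨Fin.snoc I (N + 1), ?_, fun k => ?_, ?_⟩
    · rw [List.ofFn_succ', List.concat_eq_append]
      simp
    · induction k using Fin.lastCases with
      | last => simp
      | cast k => simpa using hI k
    · rw [Fin.sum_univ_castSucc]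
      simp

lemma twist_eq (F : Mod ω n) (I : Fin n → ℕ) (hI : ∀ k, I k ≤ k + 1) :
    twist I F = ((List.ofFn fun k => if I k < k + 1 then I k else n).map (formSheaf ω n)).foldr
      tensor F := by
  rw [twist, List.map_ofFn]
  congr 2
  funext k
  rw [calL]
  split_ifs with h h'
  · exact congrArg (formSheaf ω n) (if_pos h).symm
  · exact congrArg (formSheaf ω n) (if_neg h).symm
  · exact absurd (hI k) (by omega)

lemma H_subsingleton_of_iso {A B : Mod ω n} (e : A ≅ B) (q : ℕ) (h : Subsingleton (H q A)) :
    Subsingleton (H q B) :=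
  @Equiv.subsingleton _ _ ((((Sheaf.functorH _ q).mapIso
    ((SheafOfModules.toSheaf (ringSheaf ω n)).mapIso e)).symm.addCommGroupIsoToAddEquiv).toEquiv) h

/-- The hypothesis of the theorem in terms of twists by representations. -/
theorem hcoh_of_twist (hfr : HasFrames W) (F : Mod ω n)
    (hvan : ∀ (i : Fin n → ℕ) (q : ℕ),
      ((∑ k, i k ≤ q ∧ 0 < ∑ k, i k) ∨ (∑ k, i k < q ∧ ∑ k, i k = 0)) →
        Subsingleton (H q (twist i F)))
    (l : List ℕ) (C : ℕ) (hl : Admissible n n l C) (q : ℕ) (hq : max 1 C ≤ q) :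
    Subsingleton (hcoh F l q (RRep.triv W)) := by
  obtain ⟨I, rfl, hI, rfl⟩ := hl.exists_index
  -- For C > 0 the bound reads q ≥ C, and for C = 0 it reads q ≥ 1; these are the two cases of the
  -- hypothesis.
  have h := hvan I q (by omega)
  rw [twist_eq F I hI] at h
  obtain ⟨e⟩ := foldr_tensor_iso hfr F (List.ofFn fun k => if I k < k + 1 then I k else n)
  exact H_subsingleton_of_iso e q h

end LagGrass

end

/-! ### Local existence of symplectic frames -/

noncomputable section
namespace LagGrass
variable {V : Type u} [AddCommGroup V] [Module ℂ V] {ω : LinearMap.BilinForm ℂ V} {n : ℕ}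
variable [FiniteDimensional ℂ V]

/-- Otherwise L^⊥ ⊆ L + A. A vector of A ∩ L^⊥ is then orthogonal to L and to A, hence to L^⊥, so it
lies in L ∩ A = 0. -/
lemma exists_extension_vector (hV : Module.finrank ℂ V = 2 * n) (hω : ω.IsAlt)
    (hnd : ω.Nondegenerate) (A : LagGrass ω n) {L : Submodule ℂ V}
    (hL : ∀ v ∈ L, ∀ w ∈ L, ω v w = 0) (hk : Module.finrank ℂ L < n) (hd : Disjoint L A.1) :
    ∃ v, (∀ w ∈ L, ω w v = 0) ∧ v ∉ L ⊔ A.1 := by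
  by_contra! h
  have hle : ω.orthogonal L ≤ L ⊔ A.1 := fun v hv => h v hv
  have hdis : Disjoint A.1 (ω.orthogonal L) := by
    rw [Submodule.disjoint_def]
    intro a ha haL
    have h1 : a ∈ ω.orthogonal (ω.orthogonal L) := by
      intro w hw
      obtain ⟨l, hl, a', ha', rfl⟩ := Submodule.mem_sup.1 (hle hw)
      change ω (l + a') a = 0
      rw [map_add, LinearMap.add_apply, haL l hl, A.2.1 a' ha' a ha, add_zero]
    rw [LinearMap.BilinForm.orthogonal_orthogonal hnd hω.isRefl] at h1
    exact Submodule.disjoint_def.1 hd a h1 ha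
  -- The dimensions n and 2n - dim L of disjoint subspaces add up to more than 2n, since dim L < n.
  have h2 := Submodule.finrank_add_finrank_le_of_disjoint hdis
  rw [LinearMap.BilinForm.finrank_orthogonal hnd, A.2.2] at h2
  omega

lemma disjoint_sup_span {L A : Submodule ℂ V} (hd : Disjoint L A) {v : V} (hv : v ∉ L ⊔ A) :
    Disjoint (L ⊔ ℂ ∙ v) A := by
  rw [Submodule.disjoint_def]
  intro a ha haA
  obtain ⟨l, hl, y, hy, rfl⟩ := Submodule.mem_sup.1 ha
  obtain ⟨c, rfl⟩ := Submodule.mem_span_singleton.1 hy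
  by_cases hc : c = 0
  · subst hc
    rw [zero_smul, add_zero] at haA ⊢
    exact Submodule.disjoint_def.1 hd l hl haA
  · refine absurd ?_ hv
    have : v = c⁻¹ • ((l + c • v) - l) := by
      rw [add_sub_cancel_left, smul_smul, inv_mul_cancel₀ hc, one_smul]
    rw [this]
    exact Submodule.smul_mem _ _ (Submodule.sub_mem _ (Submodule.mem_sup_right haA)
      (Submodule.mem_sup_left hl))

lemma RegVec.congr_fun {U : Opens (space ω n)} {M : Type*} [AddCommGroup M] [Module ℂ M]
    {f g : U → M} (hf : RegVec f) (h : ∀ x, f x = g x) : RegVec g := (funext h : f = g) ▸ hf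

/-- An isotropic subspace disjoint from A and B is enlarged one vector at a time until it is
Lagrangian. -/
lemma exists_common_complement (hV : Module.finrank ℂ V = 2 * n) (hω : ω.IsAlt)
    (hnd : ω.Nondegenerate) (A B : LagGrass ω n) : ∃ L : Submodule ℂ V,
      (∀ v ∈ L, ∀ w ∈ L, ω v w = 0) ∧ Module.finrank ℂ L = n ∧ Disjoint L A.1 ∧ Disjoint L B.1 := by
  suffices H : ∀ k ≤ n, ∃ L : Submodule ℂ V, (∀ v ∈ L, ∀ w ∈ L, ω v w = 0) ∧
      Module.finrank ℂ L = k ∧ Disjoint L A.1 ∧ Disjoint L B.1 from H n le_rfl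
  intro k
  induction k with
  | zero => exact fun _ => ⟨⊥, by simp, by simp, disjoint_bot_left, disjoint_bot_left⟩
  | succ k ih =>
    intro hk
    obtain ⟨L, hL, hLk, hA, hB⟩ := ih (by omega)
    obtain ⟨v, hvL, hvA, hvB⟩ : ∃ v, (∀ w ∈ L, ω w v = 0) ∧ v ∉ L ⊔ A.1 ∧ v ∉ L ⊔ B.1 := by
      obtain ⟨a, haL, ha⟩ := exists_extension_vector hV hω hnd A hL (by omega) hA
      obtain ⟨b, hbL, hb⟩ := exists_extension_vector hV hω hnd B hL (by omega) hB
      -- One vector must avoid two proper subspaces of L^⊥: if neither a nor b does, a + b does.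
      by_cases h1 : a ∈ L ⊔ B.1
      · by_cases h2 : b ∈ L ⊔ A.1
        · refine ⟨a + b, fun w hw => by rw [map_add, haL w hw, hbL w hw, add_zero], fun h => ha ?_,
            fun h => hb ?_⟩
          · simpa using Submodule.sub_mem _ h h2
          · simpa using Submodule.sub_mem _ h h1
        · exact ⟨b, hbL, h2, hb⟩
      · exact ⟨a, haL, ha, h1⟩
    have hvL' : v ∉ L := fun h => hvA (Submodule.mem_sup_left h)
    have hv0 : v ≠ 0 := fun h => hvL' (h ▸ L.zero_mem)
    refine ⟨L ⊔ ℂ ∙ v, ?_, ?_, disjoint_sup_span hA hvA, disjoint_sup_span hB hvB⟩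
    · intro x hx y hy
      obtain ⟨l, hl, z, hz, rfl⟩ := Submodule.mem_sup.1 hx
      obtain ⟨c, rfl⟩ := Submodule.mem_span_singleton.1 hz
      obtain ⟨l', hl', z', hz', rfl⟩ := Submodule.mem_sup.1 hy
      obtain ⟨c', rfl⟩ := Submodule.mem_span_singleton.1 hz'
      have h1 : ω v l' = 0 := hω.isRefl _ _ (hvL l' hl')
      simp [hL l hl l' hl', hvL l hl, h1, hω v]
    · have h := Submodule.finrank_sup_add_finrank_inf_eq L (ℂ ∙ v)
      have h0 : L ⊓ ℂ ∙ v = ⊥ :=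
        disjoint_iff.1 ((Submodule.disjoint_span_singleton' hv0).2 hvL')
      rw [h0, finrank_bot, finrank_span_singleton hv0, hLk] at h
      exact h

lemma isCompl_of_disjoint (hV : Module.finrank ℂ V = 2 * n) (x : LagGrass ω n) {L : Submodule ℂ V}
    (hn : Module.finrank ℂ L = n) (hd : Disjoint L x.1) : IsCompl x.1 L :=
  (Submodule.isCompl_iff_disjoint _ _ (by rw [x.2.2, hn]; omega)).2 hd.symm

section chart
variable {L : Submodule ℂ V}

variable (ω n L) in
/-- The open subset of points that are complements of `L`. -/
def chart : Set (LagGrass ω n) := {x | IsCompl x.1 L}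

/-- The alternating forms whose quotients are the entries of projections. -/
def chartForm (e : Module.Basis (Fin (n + 1)) ℂ (ℂ × (V ⧸ L))) (l : Module.Dual ℂ V) :
    V [⋀^Fin (n + 1)]→ₗ[ℂ] ℂ := e.det.compLinearMap (l.prod L.mkQ)

/-- The form that vanishes where a subspace is not a complement. -/
def chartDenom (e : Module.Basis (Fin (n + 1)) ℂ (ℂ × (V ⧸ L))) (l : Module.Dual ℂ V) :
    V [⋀^Fin n]→ₗ[ℂ] ℂ := (e.det.curryLeft (1, 0)).compLinearMap (l.prod L.mkQ)

/-- The linear polynomial in Plücker coordinates defined by an alternating form. -/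
def pluckerPoly (f : V [⋀^Fin n]→ₗ[ℂ] ℂ) : MvPolynomial (Module.Dual ℂ (⋀[ℂ]^n V)) ℂ :=
  MvPolynomial.X (exteriorPower.alternatingMapLinearEquiv f)

lemma pluckerEval_pluckerPoly (f : V [⋀^Fin n]→ₗ[ℂ] ℂ) (x : LagGrass ω n)
    (b : Module.Basis (Fin n) ℂ x.1) :
    pluckerEval x b (pluckerPoly f) = f (fun k => (b k : V)) := by
  rw [pluckerEval, pluckerPoly, MvPolynomial.eval_X]
  exact exteriorPower.alternatingMapLinearEquiv_apply_ιMulti f _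

lemma coe_eq_sum_repr (x : LagGrass ω n) (b : Module.Basis (Fin n) ℂ x.1) (v : x.1) :
    (v : V) = ∑ k, b.repr v k • (b k : V) := by
  have := congrArg x.1.subtype (b.sum_repr v)
  rw [map_sum] at this
  exact this.symm

/-- The determinant tests whether a basis of x stays independent modulo L. The extra coordinate in ℂ
× (V ⧸ L) is occupied by the vector (1, 0), so l has no influence here; it matters for the
numerators. -/
lemma chartDenom_ne_zero_iff (hn : Module.finrank ℂ L = n) (hV : Module.finrank ℂ V = 2 * n)
    (e : Module.Basis (Fin (n + 1)) ℂ (ℂ × (V ⧸ L))) (l : Module.Dual ℂ V) (x : LagGrass ω n)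
    (b : Module.Basis (Fin n) ℂ x.1) :
    chartDenom e l (fun k => (b k : V)) ≠ 0 ↔ IsCompl x.1 L := by
  have hdet : chartDenom e l (fun k => (b k : V)) =
      e.det (Fin.cons (1, 0) fun k => ((l (b k), L.mkQ (b k)) : ℂ × (V ⧸ L))) := rfl
  have hbx := coe_eq_sum_repr x b
  have hcard : Fintype.card (Fin (n + 1)) = Module.finrank ℂ (ℂ × (V ⧸ L)) := by
    rw [Module.finrank_eq_card_basis e]
  have hli : IsUnit (e.det (Fin.cons (1, 0) fun k => ((l (b k), L.mkQ (b k)) : ℂ × (V ⧸ L)))) ↔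
      LinearIndependent ℂ (Fin.cons (1, 0) fun k => ((l (b k), L.mkQ (b k)) : ℂ × (V ⧸ L)) :
        Fin (n + 1) → ℂ × (V ⧸ L)) := by
    rw [← Module.Basis.is_basis_iff_det]
    exact ⟨fun h => h.1, fun h => ⟨h, h.span_eq_top_of_card_eq_finrank' hcard⟩⟩
  rw [hdet, ← isUnit_iff_ne_zero, hli, Fintype.linearIndependent_iff]
  have hsum : ∀ g : Fin (n + 1) → ℂ, ∑ i, g i • (Fin.cons (1, 0)
      (fun k => ((l (b k), L.mkQ (b k)) : ℂ × (V ⧸ L))) : Fin (n + 1) → ℂ × (V ⧸ L)) i =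
      (g 0 + l (∑ k, g (Fin.succ k) • (b k : V)), L.mkQ (∑ k, g (Fin.succ k) • (b k : V))) := by
    intro g
    rw [Fin.sum_univ_succ]
    ext
    · simp [Prod.fst_sum]
    · simp [Prod.snd_sum]
  simp only [hsum]
  constructor
  · intro h
    refine isCompl_of_disjoint hV x hn (Submodule.disjoint_def.2 fun v hvL hvx => ?_)
    have h1 := h (Fin.cons (- l v) (b.repr ⟨v, hvx⟩)) (by
      simp only [Fin.cons_zero, Fin.cons_succ]
      rw [← hbx ⟨v, hvx⟩]
      ext
      · simp
      · simpa using hvL)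
    refine (hbx ⟨v, hvx⟩).trans (Finset.sum_eq_zero fun k _ => ?_)
    have := h1 k.succ
    rw [Fin.cons_succ] at this
    rw [this, zero_smul]
  · intro h g hg
    have h2 := congrArg Prod.snd hg
    have h1 := congrArg Prod.fst hg
    simp only [Prod.fst_zero, Prod.snd_zero] at h1 h2
    have hm : ∑ k, g (Fin.succ k) • (b k : V) ∈ x.1 :=
      Submodule.sum_mem _ fun k _ => Submodule.smul_mem _ _ (b k).2
    have hz : ∑ k, g (Fin.succ k) • (b k : V) = 0 :=
      Submodule.disjoint_def.1 h.disjoint _ hm ((Submodule.Quotient.mk_eq_zero L).1 h2)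
    rw [hz, map_zero, add_zero] at h1
    have hk : ∀ k : Fin n, g k.succ = 0 := by
      refine Fintype.linearIndependent_iff.1 b.linearIndependent (fun k => g k.succ) ?_
      refine Subtype.ext ?_
      simpa using hz
    intro i
    induction i using Fin.cases with
    | zero => exact h1
    | succ i => exact hk i

lemma exists_basis (x : LagGrass ω n) : Nonempty (Module.Basis (Fin n) ℂ x.1) :=
  ⟨Module.finBasisOfFinrankEq ℂ x.1 x.2.2⟩

/-- An auxiliary basis. -/
lemma exists_chart_basis (hn : Module.finrank ℂ L = n) (hV : Module.finrank ℂ V = 2 * n) :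
    Nonempty (Module.Basis (Fin (n + 1)) ℂ (ℂ × (V ⧸ L))) := by
  have h := L.finrank_quotient_add_finrank
  exact ⟨Module.finBasisOfFinrankEq ℂ _ (by
    rw [Module.finrank_prod, Module.finrank_self]; omega)⟩

lemma isOpen_chart (hn : Module.finrank ℂ L = n) (hV : Module.finrank ℂ V = 2 * n) :
    IsOpen (chart ω n L) := by
  obtain ⟨e⟩ := exists_chart_basis hn hV
  refine TopologicalSpace.isOpen_generateFrom_of_mem
    ⟨1, pluckerPoly (chartDenom e 0), MvPolynomial.isHomogeneous_X _ _, Set.ext fun x => ?_⟩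
  obtain ⟨b⟩ := exists_basis x
  refine ⟨fun h b => ?_, fun h => ?_⟩
  · rw [pluckerEval_pluckerPoly, chartDenom_ne_zero_iff hn hV]
    exact h
  · have := h b
    rwa [pluckerEval_pluckerPoly, chartDenom_ne_zero_iff hn hV] at this

/-- Cramer's rule. The determinant with first argument v depends on v only modulo x, so v may be
replaced by v - π v in L, whose image is a multiple of (1, 0). -/
lemma chartForm_eq (e : Module.Basis (Fin (n + 1)) ℂ (ℂ × (V ⧸ L))) (l : Module.Dual ℂ V)
    (x : LagGrass ω n) (hx : IsCompl x.1 L) (b : Module.Basis (Fin n) ℂ x.1) (v : V) :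
    (chartForm e l).curryLeft v (fun k => (b k : V)) =
      (l v - l (x.1.projection L hx v)) * chartDenom e l (fun k => (b k : V)) := by
  set π := x.1.projection L hx
  have hπ : π v ∈ x.1 := Submodule.projection_apply_mem hx v
  have hL : v - π v ∈ L := by
    rw [← Submodule.projection_apply_eq_zero_iff hx, map_sub]
    rw [Submodule.projection_apply_of_mem_left hx hπ, sub_self]
  have h0 : (chartForm e l).curryLeft (π v) (fun k => (b k : V)) = 0 := by
    let T : V →ₗ[ℂ] ℂ :=
      { toFun := fun v => (chartForm e l).curryLeft v (fun k => (b k : V))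
        map_add' := fun v w => by rw [map_add, AlternatingMap.add_apply]
        map_smul' := fun c v => by rw [map_smul, AlternatingMap.smul_apply]; rfl }
    change T (π v) = 0
    rw [show π v = _ from coe_eq_sum_repr x b ⟨π v, hπ⟩, map_sum]
    refine Finset.sum_eq_zero fun k _ => ?_
    rw [map_smul, smul_eq_mul, mul_eq_zero]
    refine .inr ((chartForm e l).map_eq_zero_of_eq _ (i := 0) (j := k.succ) ?_
      (Fin.succ_ne_zero k).symm)
    rfl
  have h1 : (chartForm e l).curryLeft v (fun k => (b k : V)) =
      (chartForm e l).curryLeft (v - π v) (fun k => (b k : V)) := by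
    rw [map_sub, AlternatingMap.sub_apply, h0, sub_zero]
  rw [h1]
  have h2 : (l.prod L.mkQ) (v - π v) = (l v - l (π v)) • ((1, 0) : ℂ × (V ⧸ L)) := by
    ext
    · simp
    · simpa using (Submodule.Quotient.mk_eq_zero L).2 hL
  have h3 : (chartForm e l).curryLeft (v - π v) (fun k => (b k : V)) =
      e.det.curryLeft ((l.prod L.mkQ) (v - π v)) (fun k => (l.prod L.mkQ) (b k : V)) := by
    change e.det _ = e.det _
    congr 1
    funext i
    induction i using Fin.cases <;> rfl
  rw [h3, h2, map_smul]
  rfl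

variable (hn : Module.finrank ℂ L = n) (hV : Module.finrank ℂ V = 2 * n)

/-- The open subset of points that are complements of `L`, as an open subset. -/
def chartOpens : Opens (space ω n) := ⟨chart ω n L, isOpen_chart hn hV⟩

lemma projection_regular : RegHom (fun x : chartOpens (ω := ω) hn hV => x.1.1.projection L x.2) := by
  intro v l
  obtain ⟨e⟩ := exists_chart_basis hn hV
  -- By `chartForm_eq` this is a quotient of two linear forms in the Plücker coordinates with
  -- nonvanishing denominator.
  have h : (regular ω n).pred (fun x : chartOpens (ω := ω) hn hV =>
      l v - l (x.1.1.projection L x.2 v)) :=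
    TopCat.PrelocalPredicate.sheafifyOf ⟨1, pluckerPoly ((chartForm e l).curryLeft v),
      pluckerPoly (chartDenom e l), MvPolynomial.isHomogeneous_X _ _,
      MvPolynomial.isHomogeneous_X _ _, fun x b => by
        have h0 : chartDenom e l (fun k => (b k : V)) ≠ 0 :=
          (chartDenom_ne_zero_iff hn hV e l x.1 b).2 x.2
        rw [pluckerEval_pluckerPoly, pluckerEval_pluckerPoly, chartForm_eq e l x.1 x.2 b v]
        exact ⟨h0, (mul_div_cancel_right₀ _ h0).symm⟩⟩
  have h' := regular_add (regular_const _ (l v)) (regular_neg h)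
  simpa using h'

lemma shear_apply {A B L : Submodule ℂ V} (hA : IsCompl A L) (hB : IsCompl B L) (v : V) :
    A.projection L hA v - B.projection L hB v ∈ L ∧
      A.projection L hA (B.projection L hB v) = A.projection L hA v ∧ 
      A.projection L hA (A.projection L hA v) = A.projection L hA v := by
  have h {C : Submodule ℂ V} (hC : IsCompl C L) (v : V) : v - C.projection L hC v ∈ L := by
    rw [← Submodule.projection_apply_eq_zero_iff hC, map_sub,
      Submodule.projection_apply_of_mem_left hC (Submodule.projection_apply_mem hC v), sub_self]
  refine ⟨?_, ?_, ?_⟩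
  · have := L.sub_mem (h hB v) (h hA v)
    rwa [sub_sub_sub_cancel_left] at this
  · have := (Submodule.projection_apply_eq_zero_iff hA).2 (h hB v)
    rw [map_sub, sub_eq_zero] at this
    exact this.symm
  · exact Submodule.projection_apply_of_mem_left hA (Submodule.projection_apply_mem hA v)

/-- The transformation that fixes `L` and takes one complement of `L` to another. -/
def shear {A B L : Submodule ℂ V} (hA : IsCompl A L) (hB : IsCompl B L) : V ≃ₗ[ℂ] V :=
  LinearEquiv.ofLinear (LinearMap.id + A.projection L hA - B.projection L hB)
    (LinearMap.id + B.projection L hB - A.projection L hA)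
    (by
      ext v
      have h1 := shear_apply hA hB v
      have h2 := shear_apply hB hA v
      simp only [LinearMap.comp_apply, LinearMap.sub_apply, LinearMap.add_apply, LinearMap.id_apply,
        map_sub, map_add, h1.2.1, h1.2.2, h2.2.1, h2.2.2]
      abel)
    (by
      ext v
      have h1 := shear_apply hA hB v
      have h2 := shear_apply hB hA v
      simp only [LinearMap.comp_apply, LinearMap.sub_apply, LinearMap.add_apply, LinearMap.id_apply,
        map_sub, map_add, h1.2.1, h1.2.2, h2.2.1, h2.2.2]
      abel)

/-- The shear takes v = b + l to a + l, with b in y, a in x, and both l and a - b in L. As x, y and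
L are isotropic, ω changes by ω(a - b, l') + ω(l, a' - b') = 0. -/
lemma shear_mem_symp (hω : ω.IsAlt) {L : Submodule ℂ V} (hL : ∀ v ∈ L, ∀ w ∈ L, ω v w = 0)
    (x y : LagGrass ω n) (hx : IsCompl x.1 L) (hy : IsCompl y.1 L) : shear hx hy ∈ symp ω := by
  intro v w
  have key : ∀ v, ∃ a ∈ x.1, ∃ b ∈ y.1, ∃ l ∈ L, v = b + l ∧ a - b ∈ L ∧ shear hx hy v = a + l := by
    intro v
    have h1 := (shear_apply hx hy v).1
    refine ⟨_, Submodule.projection_apply_mem hx v, _, Submodule.projection_apply_mem hy v,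
      v - y.1.projection L hy v, ?_, by abel, h1, ?_⟩
    · rw [← Submodule.projection_apply_eq_zero_iff hy, map_sub, (shear_apply hy hy v).2.2, sub_self]
    · change v + x.1.projection L hx v - y.1.projection L hy v = _
      abel
  obtain ⟨a, ha, b, hb, l, hl, hv, hab, hs⟩ := key v
  obtain ⟨a', ha', b', hb', l', hl', hw, hab', hs'⟩ := key w
  rw [hs, hs', hv, hw]
  have e1 := hL _ hab l' hl'
  have e2 := hL l hl _ hab'
  have e5 := hL _ hab _ hab'
  simp only [map_sub, map_add, LinearMap.sub_apply, LinearMap.add_apply] at e1 e2 e5 ⊢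
  have e3 := x.2.1 a ha a' ha'
  have e4 := y.2.1 b hb b' hb'
  rw [e3, e4]
  linear_combination e1 + e2

lemma shear_map {L : Submodule ℂ V} (x y : LagGrass ω n)
    (hx : IsCompl x.1 L) (hy : IsCompl y.1 L) :
    y.1.map (shear hx hy : V →ₗ[ℂ] V) = x.1 := by
  refine Submodule.eq_of_le_of_finrank_eq ?_ ?_
  · rintro _ ⟨v, hv, rfl⟩
    change v + x.1.projection L hx v - y.1.projection L hy v ∈ x.1
    rw [Submodule.projection_apply_of_mem_left hy hv, add_sub_cancel_left]
    exact Submodule.projection_apply_mem hx v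
  · exact (LinearEquiv.finrank_map_eq (shear hx hy) y.1).trans (y.2.2.trans x.2.2.symm)

end chart

/-- Symplectic frames exist locally. -/
theorem hasFrames (hV : Module.finrank ℂ V = 2 * n) (hω : ω.IsAlt) (hnd : ω.Nondegenerate)
    (W : LagGrass ω n) : HasFrames W := by
  intro x
  obtain ⟨L, hL, hn, hLW, hLx⟩ := exists_common_complement hV hω hnd W x
  have hW := isCompl_of_disjoint hV W hn hLW
  have hreg := projection_regular (ω := ω) hn hV
  refine ⟨chartOpens hn hV, isCompl_of_disjoint hV x hn hLx,
    ⟨⟨fun x => shear x.2 hW, fun x => shear_mem_symp hω hL x.1 W x.2 hW,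
      fun x => shear_map x.1 W x.2 hW, fun v => ?_, fun v => ?_⟩⟩⟩
  · exact (RegVec.const (v - W.1.projection L hW v)).add (hreg v) |>.congr_fun fun x => by
      change _ = v + x.1.1.projection L x.2 v - W.1.projection L hW v
      abel
  · exact (RegVec.const (v + W.1.projection L hW v)).add ((hreg v).map (-LinearMap.id)) |>.congr_fun
      fun x => by
        change _ = v + W.1.projection L hW v - x.1.1.projection L x.2 v
        rw [LinearMap.neg_apply, LinearMap.id_apply]
        abel

end LagGrass

end

/-! ### Sheaves supported at a point and complexes exact off it -/

noncomputable section
namespace LagGrass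

section supported
variable {X : TopCat.{u}} {x₀ : X}

/-- Sheaves that vanish off a point. -/
def SupportedAt (x₀ : X) (G : AbSheaf X) : Prop :=
  ∀ U : Opens X, x₀ ∉ U → Subsingleton (G.obj.obj (op U))

lemma Sheaf.section_eq_of_locally {G : AbSheaf X} {U : Opens X} {s t : G.obj.obj (op U)}
    (h : ∀ x ∈ U, ∃ (W : Opens X) (hW : W ≤ U), x ∈ W ∧
      G.obj.map (homOfLE hW).op s = G.obj.map (homOfLE hW).op t) : s = t := by
  choose W hW hx he using h
  refine TopCat.Sheaf.eq_of_locally_eq' G (fun x : U => W x.1 x.2) U (fun x => homOfLE (hW _ _)) ?_ s t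
    fun x => he _ _
  exact fun x hxU => Opens.mem_iSup.2 ⟨⟨x, hxU⟩, hx x hxU⟩

/-- A section over U' extends by zero off the closed point x₀; if x₀ is not in U' the section is
already zero. -/
lemma SupportedAt.isFlasque (hx₀ : IsClosed ({x₀} : Set X)) {G : AbSheaf X}
    (hG : SupportedAt x₀ G) : TopCat.Sheaf.IsFlasque G := by
  refine ⟨fun {U U'} i => (AddCommGrpCat.epi_iff_surjective _).2 fun s => ?_⟩
  by_cases h : x₀ ∈ U'.unop
  · let O : Bool → Opens X := fun b => if b then U'.unop else U.unop ⊓ ⟨{x₀}ᶜ, hx₀.isOpen_compl⟩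
    have hO : ∀ b, O b ≤ U.unop := by
      rintro (_ | _)
      · exact inf_le_left
      · exact i.unop.le
    have hcov : U.unop ≤ iSup O := by
      intro x hx
      by_cases hxx : x = x₀
      · exact Opens.mem_iSup.2 ⟨true, hxx ▸ h⟩
      · exact Opens.mem_iSup.2 ⟨false, hx, hxx⟩
    have hsub : Subsingleton (G.obj.obj (op (O true ⊓ O false))) := hG _ fun h' => h'.2.2 rfl
    have hsub' : Subsingleton (G.obj.obj (op (O false ⊓ O true))) := hG _ fun h' => h'.1.2 rfl
    obtain ⟨t, ht, -⟩ := TopCat.Sheaf.existsUnique_gluing' (C := AddCommGrpCat.{u}) G O U.unop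
      (fun b => homOfLE (hO b)) hcov (fun b => match b with
        | true => s
        | false => 0) (by
          rintro (_ | _) (_ | _)
          · rfl
          · exact Subsingleton.elim (α := G.obj.obj (op (O false ⊓ O true))) _ _
          · exact Subsingleton.elim (α := G.obj.obj (op (O true ⊓ O false))) _ _
          · rfl)
    exact ⟨t, ht true⟩
  · exact ⟨0, @Subsingleton.elim _ (hG _ h) _ _⟩

lemma SupportedAt.eq_zero_of_germ (hx₀ : IsClosed ({x₀} : Set X)) {G : AbSheaf X}
    (hG : SupportedAt x₀ G) {U : Opens X} (h : x₀ ∈ U)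
    (s : G.obj.obj (op U)) (hs : TopCat.Presheaf.germ G.obj U x₀ h s = 0) : s = 0 := by
  obtain ⟨W, hW, i, i', e⟩ := TopCat.Presheaf.germ_eq G.obj x₀ h h s 0 (hs.trans (map_zero _).symm)
  refine Sheaf.section_eq_of_locally fun x hx => ?_
  by_cases hxx : x = x₀
  · exact ⟨W, i.le, hxx ▸ hW, e⟩
  · exact ⟨U ⊓ ⟨{x₀}ᶜ, hx₀.isOpen_compl⟩, inf_le_left, ⟨hx, hxx⟩,
      @Subsingleton.elim _ (hG (U ⊓ ⟨{x₀}ᶜ, hx₀.isOpen_compl⟩) fun h' => h'.2 rfl) _ _⟩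

lemma SupportedAt.cokernel {A B : AbSheaf X} (f : A ⟶ B) [Mono f]
    (h : ∀ (U : Opens X) (t : B.obj.obj (op U)) (x : X), x ∈ U → x ≠ x₀ →
      ∃ (W : Opens X) (hW : W ≤ U), x ∈ W ∧ ∃ s, f.hom.app (op W) s = B.obj.map (homOfLE hW).op t) :
    SupportedAt x₀ (Limits.cokernel f) := by
  intro U hU
  refine subsingleton_of_forall_eq 0 fun t => Sheaf.section_eq_of_locally fun x hx => ?_
  obtain ⟨W, hW, hxW, s, hs⟩ := Sheaf.locally_of_epi (Limits.cokernel.π f) U t x hx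
  obtain ⟨W', hW', hxW', a, ha⟩ := h W s x hxW fun e => hU (e ▸ hx)
  refine ⟨W', hW'.trans hW, hxW', ?_⟩
  have h1 : (Limits.cokernel.π f).hom.app (op W') (B.obj.map (homOfLE hW').op s) =
      (Limits.cokernel f).obj.map (homOfLE (hW'.trans hW)).op t := by
    refine (ConcreteCategory.congr_hom ((Limits.cokernel.π f).hom.naturality (homOfLE hW').op) s).trans ?_
    refine (congrArg ((Limits.cokernel f).obj.map (homOfLE hW').op) hs).trans ?_
    exact (ConcreteCategory.congr_hom ((Limits.cokernel f).obj.map_comp (homOfLE hW).op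
      (homOfLE hW').op) t).symm
  rw [map_zero, ← h1, ← ha]
  exact congrArg (fun g : A ⟶ Limits.cokernel f => g.hom.app (op W') a) (Limits.cokernel.condition f)

/-- The skyscraper of an injective hull of the stalk is injective by adjunction, and a section of G
is determined by its germ at x₀. -/
lemma SupportedAt.exists_injective (hx₀ : IsClosed ({x₀} : Set X)) {G : AbSheaf X}
    (hG : SupportedAt x₀ G) :
    ∃ (I : AbSheaf X) (f : G ⟶ I), Injective I ∧ Mono f ∧ SupportedAt x₀ I := by
  classical
  let adj := stalkSkyscraperSheafAdjunction (X := X) x₀ (C := AddCommGrpCat.{u})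
  let L := TopCat.Sheaf.forget AddCommGrpCat.{u} X ⋙ TopCat.Presheaf.stalkFunctor AddCommGrpCat.{u} x₀
  let D := Injective.under (L.obj G)
  let j : L.obj G ⟶ D := Injective.ι _
  have hinj : Injective ((skyscraperSheafFunctor x₀).obj D) := Injective.injective_of_adjoint adj D
  let f : G ⟶ (skyscraperSheafFunctor x₀).obj D := adj.homEquiv G D j
  refine ⟨_, f, hinj, Sheaf.mono_of_sections f fun U => ?_, fun U hU => ?_⟩
  · rw [injective_iff_map_eq_zero]
    intro s hs
    by_cases h : x₀ ∈ U
    · refine hG.eq_zero_of_germ hx₀ h s ?_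
      have h1 : L.map f ≫ adj.counit.app D = j := by
        exact (adj.homEquiv_counit (X := G) (Y := D) (g := f)).symm.trans
          ((adj.homEquiv G D).symm_apply_apply j)
      refine (AddCommGrpCat.mono_iff_injective j).1 inferInstance ?_
      have h2 : L.map f (TopCat.Presheaf.germ G.obj U x₀ h s) = 0 := by
        refine (TopCat.Presheaf.stalkFunctor_map_germ_apply U x₀ h f.hom s).trans ?_
        rw [hs, map_zero]
        rfl
      refine (ConcreteCategory.congr_hom h1.symm _).trans ?_
      refine (congrArg (adj.counit.app D) h2).trans ?_
      refine (map_zero (adj.counit.app D).hom).trans ?_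
      exact (map_zero j.hom).symm
    · exact @Subsingleton.elim _ (hG _ h) _ _
  · have ht := isTerminalSkyscraperSheafObjObjOfNotMem (p₀ := x₀) (A := D) (U := op U) hU
    exact AddCommGrpCat.subsingleton_of_isZero (Limits.IsZero.of_iso (Limits.isZero_zero _)
      (ht.uniqueUpToIso Limits.HasZeroObject.zeroIsTerminal))

/-- Dimension shifting along the embedding into an injective sheaf with the same support. H^1
vanishes because G is flasque, so global sections lift from the cokernel. -/
theorem SupportedAt.subsingleton_H (hx₀ : IsClosed ({x₀} : Set X)) (q : ℕ) :
    ∀ {G : AbSheaf X}, SupportedAt x₀ G → Subsingleton (Sheaf.H.{u} G (q + 1)) := by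
  induction q with
  | zero =>
    intro G hG
    obtain ⟨I, f, hI, hf, hIs⟩ := hG.exists_injective hx₀
    let S := ShortComplex.mk f (Limits.cokernel.π f) (Limits.cokernel.condition f)
    have hS : S.ShortExact := { exact := ShortComplex.exact_cokernel f }
    refine H_left_of_surjective hS 0 (fun y => ?_) inferInstance
    have : TopCat.Sheaf.IsFlasque S.X₁ := hG.isFlasque hx₀
    obtain ⟨t, ht⟩ := (AddCommGrpCat.epi_iff_surjective _).1
      (TopCat.Sheaf.IsFlasque.epi_of_shortExact (U := ⊤) hS)
      (Sheaf.H.equiv₀ S.X₃ Limits.isTerminalTop y)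
    refine ⟨(Sheaf.H.equiv₀ S.X₂ Limits.isTerminalTop).symm t,
      (Sheaf.H.equiv₀ S.X₃ Limits.isTerminalTop).injective ?_⟩
    rw [← Sheaf.H.equiv₀_naturality, AddEquiv.apply_symm_apply]
    exact ht
  | succ q ih =>
    intro G hG
    obtain ⟨I, f, hI, hf, hIs⟩ := hG.exists_injective hx₀
    let S := ShortComplex.mk f (Limits.cokernel.π f) (Limits.cokernel.condition f)
    have hS : S.ShortExact := { exact := ShortComplex.exact_cokernel f }
    refine H_left hS (q + 1) (ih (SupportedAt.cokernel f fun U t x hx hne => ?_)) inferInstance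
    have hsub : Subsingleton (I.obj.obj (op (U ⊓ ⟨{x₀}ᶜ, hx₀.isOpen_compl⟩))) := hIs _ fun h' => h'.2 rfl
    exact ⟨U ⊓ ⟨{x₀}ᶜ, hx₀.isOpen_compl⟩, inf_le_left, ⟨hx, hne⟩, 0, Subsingleton.elim _ _⟩

/-- The image of the last differential of a complex that is exact off a point, with vanishing
cohomology of its terms. -/
theorem subsingleton_H_of_exact_off (hx₀ : IsClosed ({x₀} : Set X)) (T : ℕ → AbSheaf X)
    (d : ∀ p, T (p + 1) ⟶ T p) (hd : ∀ p, d (p + 1) ≫ d p = 0)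
    (hexact : ∀ (p : ℕ) (U : Opens X) (t : (T (p + 1)).obj.obj (op U)), (d p).hom.app (op U) t = 0 →
      ∀ x ∈ U, x ≠ x₀ → ∃ (W : Opens X) (hW : W ≤ U), x ∈ W ∧
        ∃ s, (d (p + 1)).hom.app (op W) s = (T (p + 1)).obj.map (homOfLE hW).op t)
    {N : ℕ} (hN : ∀ p, N ≤ p → Limits.IsZero (T p))
    (hT : ∀ p q, p + 1 ≤ q → Subsingleton (Sheaf.H.{u} (T (p + 1)) q)) (k : ℕ) :
    ∀ p, N ≤ p + k → ∀ (Y : AbSheaf X) (j : T (p + 1) ⟶ Y) (m : Y ⟶ T p), Epi j → Mono m →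
      j ≫ m = d p → ∀ q, p + 1 ≤ q → Subsingleton (Sheaf.H.{u} Y q) := by
  induction k with
  | zero =>
    intro p hp Y j m hj hm hjm q hq
    exact Sheaf.subsingleton_H_of_isZero (Limits.IsZero.of_mono m (hN p hp)) q
  | succ k ih =>
    intro p hp Y j m hj hm hjm q hq
    have hl : d (p + 1) ≫ j = 0 := by
      rw [← cancel_mono m, Category.assoc, hjm, hd, Limits.zero_comp]
    let l := Limits.kernel.lift j (d (p + 1)) hl
    -- i includes the boundaries, the image of d (p + 1), in the cycles, the kernel of j. Its
    -- cokernel is the homology sheaf, supported at x₀ and thus without higher cohomology, so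
    -- vanishing passes from boundaries to cycles.
    let i := Abelian.image.ι l
    have h1 := ih (p + 1) (by omega) (Abelian.image l) (Abelian.factorThruImage l)
      (i ≫ Limits.kernel.ι j) inferInstance inferInstance (by
        rw [← Category.assoc, Abelian.image.fac, Limits.kernel.lift_ι]) (q + 1) (by omega)
    let S := ShortComplex.mk i (Limits.cokernel.π i) (Limits.cokernel.condition i)
    have hS : S.ShortExact := { exact := ShortComplex.exact_cokernel i }
    have h2 : Subsingleton (Sheaf.H.{u} (Limits.cokernel i) (q + 1)) := by
      refine SupportedAt.subsingleton_H hx₀ q (SupportedAt.cokernel i fun U z x hx hne => ?_)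
      let z' : (T (p + 1)).obj.obj (op U) := (Limits.kernel.ι j).hom.app (op U) z
      have hz : (d p).hom.app (op U) z' = 0 := by
        have e : Limits.kernel.ι j ≫ d p = 0 := by
          rw [← hjm, ← Category.assoc, Limits.kernel.condition, Limits.zero_comp]
        exact congrArg (fun g : Limits.kernel j ⟶ T p => g.hom.app (op U) z) e
      obtain ⟨W, hW, hxW, s, hs⟩ := hexact p U z' hz x hx hne
      refine ⟨W, hW, hxW, (Abelian.factorThruImage l).hom.app (op W) s,
        Sheaf.injective_of_mono (Limits.kernel.ι j) W ?_⟩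
      have e1 : Abelian.factorThruImage l ≫ i ≫ Limits.kernel.ι j = d (p + 1) := by
        rw [← Category.assoc, Abelian.image.fac, Limits.kernel.lift_ι]
      refine (congrArg (fun g : T (p + 2) ⟶ T (p + 1) => g.hom.app (op W) s) e1).trans (hs.trans ?_)
      exact (ConcreteCategory.congr_hom ((Limits.kernel.ι j).hom.naturality (homOfLE hW).op) z).symm
    have h3 : Subsingleton (Sheaf.H.{u} (Limits.kernel j) (q + 1)) := H_middle hS (q + 1) h1 h2
    let S' := ShortComplex.mk (Limits.kernel.ι j) j (Limits.kernel.condition j)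
    have hS' : S'.ShortExact := { exact := ShortComplex.exact_kernel j }
    -- Y is the quotient of T (p + 1) by the cycles: H^{q+1} of the cycles and H^q of the term both
    -- vanish.
    exact H_right hS' q (hT p q hq) h3

end supported
end LagGrass

end

/-! ### Contraction with a section and its local homotopy -/

noncomputable section
namespace LagGrass
open Raw
variable {V : Type u} [AddCommGroup V] [Module ℂ V] {ω : LinearMap.BilinForm ℂ V} {n : ℕ}
variable [FiniteDimensional ℂ V]

/-- A regular function is invertible near any point where it does not vanish. -/
lemma exists_regular_inverse {U : Opens (space ω n)} (f : regularFunctions U) {x : space ω n}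
    (hx : x ∈ U) (h : f.1 ⟨x, hx⟩ ≠ 0) : ∃ (U' : Opens (space ω n)) (hU : U' ≤ U), x ∈ U' ∧
      ∃ r : regularFunctions U', r * rres hU f = 1 := by
  obtain ⟨O, hxO, i, d, P, Q, hP, hQ, hPQ⟩ := f.2 ⟨x, hx⟩
  have hopen : IsOpen (nonvanishing (ω := ω) (n := n) P) :=
    TopologicalSpace.isOpen_generateFrom_of_mem ⟨d, P, hP, rfl⟩
  let N : Opens (space ω n) := O ⊓ ⟨_, hopen⟩
  have hle : N ≤ U := inf_le_left.trans i.le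
  have hne : ∀ y : N, f.1 ⟨y.1, hle y.2⟩ ≠ 0 := fun y h0 => by
    obtain ⟨b⟩ := exists_basis (y : LagGrass ω n)
    have h1 := hPQ ⟨y.1, y.2.1⟩ b
    have h2 := h1.2.symm.trans h0
    rw [div_eq_zero_iff] at h2
    exact h2.elim (y.2.2 b) h1.1
  have hreg : (regular ω n).pred (fun y : N => (f.1 ⟨y.1, hle y.2⟩)⁻¹) := by
    refine TopCat.PrelocalPredicate.sheafifyOf (P := fractionPrelocal ω n)
      ⟨d, Q, P, hQ, hP, fun y b => ⟨y.2.2 b, ?_⟩⟩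
    refine (congrArg _ (hPQ ⟨y.1, y.2.1⟩ b).2).trans ?_
    rw [inv_div]
  refine ⟨N, hle, ⟨hxO, fun b hb => h ?_⟩, ⟨_, hreg⟩,
    Subtype.ext (funext fun y => inv_mul_cancel₀ (hne y))⟩
  refine ((hPQ ⟨x, hxO⟩ b).2).trans ?_
  rw [hb, zero_div]

section wedge
variable {A B M : Type*} [AddCommGroup A] [Module ℂ A] [AddCommGroup B] [Module ℂ B]
  [AddCommGroup M] [Module ℂ M]

/-- Exterior multiplication by a linear form. -/
def Phi.wedge (l : A →ₗ[ℂ] ℂ) (c m : ℕ) : Phi A B M c m →ₗ[ℂ] Phi A B M (c + 1) m where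
  toFun f := ⟨eps (fun a => l a • f.1),
    AM.eps (g := l.smulRight f.1) fun _ => Submodule.smul_mem _ _ f.2.1,
    Deg.eps fun _ => Submodule.smul_mem _ _ f.2.2⟩
  map_add' f g := Subtype.ext (by
    change eps (fun a => l a • (f.1 + g.1)) = _
    simp only [smul_add, eps_add]
    rfl)
  map_smul' r f := Subtype.ext (by
    change eps (fun a => l a • (r • f.1)) = _
    simp only [smul_comm _ r, eps_smul]
    rfl)

/-- Contraction is an antiderivation: applied to l ∧ f it gives l(a) f minus l ∧ (contraction of f).
Where l(a) is invertible this contracts the Koszul complex. -/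
lemma Phi.contract_wedge (l : A →ₗ[ℂ] ℂ) (c m : ℕ) (a : A) (f : Phi A B M (c + 1) m) :
    curryA A B M (c + 1) m (Phi.wedge l (c + 1) m f) a +
      Phi.wedge l c m (curryA A B M c m f a) = l a • f := by
  refine Subtype.ext ?_
  change ia a (eps fun a' => l a' • f.1) + eps (fun a' => l a' • ia a f.1) = l a • f.1
  rw [ia_eps]
  simp only [map_smul]
  abel

lemma Phi.contract_smul_wedge {l : A →ₗ[ℂ] ℂ} (c m : ℕ) {a : A} {r : ℂ} (hr : r * l a = 1)
    (f : Phi A B M (c + 1) m) :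
    curryA A B M (c + 1) m (r • Phi.wedge l (c + 1) m f) a +
      r • Phi.wedge l c m (curryA A B M c m f a) = f := by
  rw [map_smul, LinearMap.smul_apply, ← smul_add, Phi.contract_wedge, smul_smul, hr, one_smul]

lemma Phi.contract_smul_wedge_zero {l : A →ₗ[ℂ] ℂ} (m : ℕ) {a : A} {r : ℂ} (hr : r * l a = 1)
    (f : Phi A B M 0 m) : curryA A B M 0 m (r • Phi.wedge l 0 m f) a = f := by
  rw [map_smul, LinearMap.smul_apply]
  refine Subtype.ext ?_
  change r • ia a (eps fun a' => l a' • f.1) = f.1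
  rw [ia_eps]
  simp only [map_smul, Deg.ia_zero f.2.2, smul_zero, eps_zero, sub_zero, smul_smul, hr, one_smul]

lemma curryA_regVec {U : Opens (space ω n)} [FiniteDimensional ℂ A] {a : U → A} (ha : RegVec a)
    (c m : ℕ) (f : Phi A B M (c + 1) m) : RegVec fun x => curryA A B M c m f (a x) :=
  RegHom.apply (RegHom.const (curryA A B M c m f)) ha

end wedge

variable {W : LagGrass ω n}

section contraction
variable {A B M : RRep W}

/-- Contraction with a section of a homogeneous bundle. -/
def BMap.contract (B M : RRep W) (a : (V ≃ₗ[ℂ] V) → A) (ha : ∀ g (p : stab W), A.ρ p (a (g * p)) = a g)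
    (hreg : ∀ (U : Opens (space ω n)) (φ : Frame W U), RegVec fun x => a (φ.g x)) (c m : ℕ) :
    BMap (RRep.phi A B M (c + 1) m) (RRep.phi A B M c m) :=
  ⟨fun g => (curryA A B M c m).flip (a g), fun g p => LinearMap.ext fun f => Subtype.ext <|
      funext fun l => funext fun s => by
    refine congrArg (fun z => M.ρ p (Subtype.val (p := fun x => x ∈ Phi A B M (c + 1) m) f
      (z :: l.map (A.ρ p⁻¹)) (s.map (B.ρ p⁻¹)))) ?_
    rw [← ha g p, RRep.ρ_apply_inv],
    fun U φ f => curryA_regVec (hreg U φ) c m f⟩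

variable {a : (V ≃ₗ[ℂ] V) → A} {ha : ∀ g (p : stab W), A.ρ p (a (g * p)) = a g}
  {hreg : ∀ (U : Opens (space ω n)) (φ : Frame W U), RegVec fun x => a (φ.g x)}

lemma BMap.contract_contract (c m : ℕ) :
    (BMap.contract B M a ha hreg c m).comp (BMap.contract B M a ha hreg (c + 1) m) = 0 :=
  BMap.ext fun g f => Subtype.ext (a1 := (((BMap.contract B M a ha hreg c m).comp
      (BMap.contract B M a ha hreg (c + 1) m)).1 g f : Phi A B M c m)) (a2 := (0 : Phi A B M c m))
    ((AM.loc (Subtype.prop (p := fun x => x ∈ Phi A B M (c + 2) m) f).1).ia_self (a g))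

/-- In the frame φ the operator r · (l ∧ -) is a homotopy from the identity to zero, so the preimage
of a cycle is its image under this operator. -/
lemma exists_contract_eq {F : Mod ω n} {c m : ℕ} {U : Opens (space ω n)}
    (φ : Frame W U) (t : secF F (RRep.phi A B M (c + 1) m) U)
    (ht : tw.mapSec (BMap.contract B M a ha hreg c m) U t = 0) (l : A →ₗ[ℂ] ℂ)
    (r : regularFunctions U) (hr : ∀ x, r.1 x * l (a (φ.g x)) = 1) :
    ∃ s, tw.mapSec (BMap.contract B M a ha hreg (c + 1) m) U s = t := by
  let e (c : ℕ) := (BMap.contract B M a ha hreg c m).fam φ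
  let w (c : ℕ) : RHom U (RRep.phi A B M c m) (RRep.phi A B M (c + 1) m) :=
    RHom.fsmul r (RHom.const U (Phi.wedge l c m))
  have hw : (e (c + 1)).comp (w (c + 1)) + (w c).comp (e c) = RHom.const U LinearMap.id := by
    refine Subtype.ext (funext fun x => LinearMap.ext fun f => ?_)
    exact Phi.contract_smul_wedge c m (hr x) f
  have ht' : (e c).act (t.1 U le_rfl φ) = 0 :=
    congrArg (fun z : secF F (RRep.phi A B M c m) U => z.1 U le_rfl φ) ht
  refine ⟨secF.ofFrame φ ((w (c + 1)).act (t.1 U le_rfl φ)), secF.eq_of_frame φ ?_⟩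
  refine (congrArg (e (c + 1)).act (secF.ofFrame_val φ _)).trans ?_
  have h := congrArg (fun z : RHom U _ _ => z.act (t.1 U le_rfl φ)) hw
  beta_reduce at h
  rw [RHom.act_add_left, RHom.act_const_id, ← RHom.act_act, ← RHom.act_act, ht', map_zero,
    add_zero] at h
  exact h

lemma exists_contract_eq_zero {F : Mod ω n} {m : ℕ} {U : Opens (space ω n)}
    (φ : Frame W U) (t : secF F (RRep.phi A B M 0 m) U) (l : A →ₗ[ℂ] ℂ)
    (r : regularFunctions U) (hr : ∀ x, r.1 x * l (a (φ.g x)) = 1) :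
    ∃ s, tw.mapSec (BMap.contract B M a ha hreg 0 m) U s = t := by
  let e := (BMap.contract B M a ha hreg 0 m).fam φ
  let w : RHom U (RRep.phi A B M 0 m) (RRep.phi A B M 1 m) :=
    RHom.fsmul r (RHom.const U (Phi.wedge l 0 m))
  have hw : e.comp w = RHom.const U LinearMap.id :=
    Subtype.ext (funext fun x => LinearMap.ext fun f => Phi.contract_smul_wedge_zero m (hr x) f)
  refine ⟨secF.ofFrame φ (w.act (t.1 U le_rfl φ)), secF.eq_of_frame φ ?_⟩
  refine (congrArg e.act (secF.ofFrame_val φ _)).trans ?_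
  rw [RHom.act_act, hw, RHom.act_const_id]

lemma subsingleton_secF_of_lt {F : Mod ω n} (hfr : HasFrames W) {c m : ℕ}
    (hc : Module.finrank ℂ A < c) (U : Opens (space ω n)) :
    Subsingleton (secF F (RRep.phi A B M c m) U) := by
  have h0 : Subsingleton (RRep.phi A B M c m) := subsingleton_of_forall_eq 0 fun f =>
    Subtype.ext (Phi.eq_zero_of_lt hc (Subtype.prop (p := fun x => x ∈ Phi A B M c m) f))
  have hd : Module.finrank ℂ (RRep.phi A B M c m) = 0 := Module.finrank_zero_of_subsingleton
  refine ⟨fun s t => secF.ext_frame fun U' h φ => funext fun i => ?_⟩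
  exact (Fin.cast hd i).elim0

end contraction
end LagGrass

end

/-! ### The Koszul complex of the tautological section -/

noncomputable section
namespace LagGrass
open Raw
variable {V : Type u} [AddCommGroup V] [Module ℂ V] {ω : LinearMap.BilinForm ℂ V} {n : ℕ}
variable [FiniteDimensional ℂ V] {W : LagGrass ω n}

lemma RegVec.pi {U : Opens (space ω n)} {ι M : Type*} [Fintype ι] [AddCommGroup M] [Module ℂ M]
    {f : U → ι → M} (h : ∀ i, RegVec fun x => f x i) : RegVec f := by
  classical
  refine (RegVec.sum Finset.univ fun i _ => (h i).map (LinearMap.single ℂ (fun _ : ι => M) i)).congr_fun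
    fun x => funext fun j => ?_
  simp [Finset.sum_apply, Pi.single_apply]

section tautological
variable (w : Module.Basis (Fin n) ℂ W.1)

/-- The images in the quotient bundle of a basis of the fixed subspace `W`; they vanish together
only at `W`. -/
def tautSec (g : V ≃ₗ[ℂ] V) : RRep.qPow W n := fun i => W.1.mkQ (g⁻¹ (w i : V))

lemma tautSec_equivariant (g : V ≃ₗ[ℂ] V) (p : stab W) :
    (RRep.qPow W n).ρ p (tautSec w (g * p)) = tautSec w g := funext fun i => by
  refine congrArg W.1.mkQ (?_ : (p : V ≃ₗ[ℂ] V) ((g * p)⁻¹ (w i : V)) = _)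
  rw [mul_inv_rev]
  exact (p : V ≃ₗ[ℂ] V).apply_symm_apply _

lemma tautSec_regular (U : Opens (space ω n)) (φ : Frame W U) : RegVec fun x => tautSec w (φ.g x) :=
  RegVec.pi (M := V ⧸ W.1) fun i => (φ.reg_inv (w i : V)).map W.1.mkQ

/-- g⁻¹ w_i lies in W exactly when w_i lies in gW, the subspace x. All of them vanish exactly when W
⊆ x, and the dimensions agree. -/
lemma tautSec_eq_zero_iff {U : Opens (space ω n)} (φ : Frame W U) (x : U) :
    tautSec w (φ.g x) = 0 ↔ x.1 = W := by
  have h1 : ∀ v, (φ.g x)⁻¹ v ∈ W.1 ↔ v ∈ (x : LagGrass ω n).1 := fun v => by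
    rw [← φ.map x]
    refine ⟨fun h => ⟨_, h, (φ.g x).apply_symm_apply v⟩, ?_⟩
    rintro ⟨y, hy, rfl⟩
    have : (φ.g x)⁻¹ (φ.g x y) = y := (φ.g x).symm_apply_apply y
    exact this.symm ▸ hy
  have h2 : tautSec w (φ.g x) = 0 ↔ ∀ i, (w i : V) ∈ (x : LagGrass ω n).1 := by
    refine funext_iff.trans (forall_congr' fun i => ?_)
    exact (Submodule.Quotient.mk_eq_zero W.1).trans (h1 _)
  rw [h2]
  refine ⟨fun h => Subtype.ext (Submodule.eq_of_le_of_finrank_eq ?_ ?_).symm, fun h i => ?_⟩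
  · intro v hv
    have h3 := coe_eq_sum_repr W w ⟨v, hv⟩
    rw [show v = _ from h3]
    exact sum_mem fun k _ => Submodule.smul_mem _ _ (h k)
  · rw [W.2.2, (x : LagGrass ω n).2.2]
  · rw [h]
    exact (w i).2

lemma exists_tautSec_unit (hfr : HasFrames W) {U : Opens (space ω n)} {x : space ω n} (hx : x ∈ U)
    (hne : x ≠ W) : ∃ U' ≤ U, x ∈ U' ∧ ∃ (φ : Frame W U') (l : RRep.qPow W n →ₗ[ℂ] ℂ)
      (r : regularFunctions U'), ∀ y, r.1 y * l (tautSec w (φ.g y)) = 1 := by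
  obtain ⟨O, hxO, ⟨φ⟩⟩ := hfr x
  have h0 : tautSec w (φ.g ⟨x, hxO⟩) ≠ 0 := fun h => hne ((tautSec_eq_zero_iff w φ ⟨x, hxO⟩).1 h)
  obtain ⟨l, hl⟩ : ∃ l : Module.Dual ℂ (RRep.qPow W n), l (tautSec w (φ.g ⟨x, hxO⟩)) ≠ 0 := by
    by_contra! h
    exact h0 ((Module.forall_dual_apply_eq_zero_iff ℂ _).1 h)
  let f : regularFunctions O := ⟨fun y => l (tautSec w (φ.g y)), tautSec_regular w O φ l⟩
  obtain ⟨U', hU', hxU', r, hr⟩ := exists_regular_inverse f hxO hl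
  refine ⟨U' ⊓ U, inf_le_right, ⟨hxU', hx⟩, φ.res (inf_le_left.trans hU'), l, rres inf_le_left r,
    fun y => ?_⟩
  exact congrFun (congrArg Subtype.val hr) ⟨y.1, y.2.1⟩

/-- Away from W some coordinate of the tautological section is invertible on a neighbourhood, which
therefore misses W. -/
lemma isClosed_point (hfr : HasFrames W) : IsClosed ({W} : Set (space ω n)) := by
  obtain ⟨w⟩ := exists_basis W
  refine ⟨isOpen_iff_forall_mem_open.2 fun x hx => ?_⟩
  obtain ⟨U', -, hxU', φ, l, r, hr⟩ := exists_tautSec_unit w hfr (U := ⊤) trivial hx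
  refine ⟨U', fun y hy hyW => ?_, U'.2, hxU'⟩
  have := hr ⟨y, hy⟩
  rw [(tautSec_eq_zero_iff w φ ⟨y, hy⟩).2 hyW, map_zero, mul_zero] at this
  exact zero_ne_one this

/-- The terms of the Koszul complex of the tautological section. -/
def RRep.koszul (W : LagGrass ω n) (p : ℕ) : RRep W :=
  RRep.phi (RRep.qPow W n) (RRep.sPow W n) (RRep.triv W) p 0

/-- The differential of the Koszul complex of the tautological section. -/
def BMap.koszul (p : ℕ) : BMap (RRep.koszul W (p + 1)) (RRep.koszul W p) :=
  BMap.contract (RRep.sPow W n) (RRep.triv W) (tautSec w) (tautSec_equivariant w)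
    (tautSec_regular w) p 0

lemma BMap.koszul_koszul (p : ℕ) : (BMap.koszul w p).comp (BMap.koszul w (p + 1)) = 0 :=
  BMap.contract_contract p 0

lemma koszul_exact_off (hfr : HasFrames W) (F : Mod ω n) (p : ℕ) (U : Opens (space ω n))
    (t : secF F (RRep.koszul W (p + 1)) U) (ht : tw.mapSec (BMap.koszul w p) U t = 0)
    (x : space ω n) (hx : x ∈ U) (hne : x ≠ W) : ∃ (U' : Opens (space ω n)) (hU : U' ≤ U), x ∈ U' ∧
      ∃ s, tw.mapSec (BMap.koszul w (p + 1)) U' s = secF.res hU t := by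
  obtain ⟨U', hU, hxU', φ, l, r, hr⟩ := exists_tautSec_unit w hfr hx hne
  refine ⟨U', hU, hxU', exists_contract_eq φ _ ?_ l r hr⟩
  exact congrArg (secF.res hU) ht

lemma koszul_surjective_off (hfr : HasFrames W) (F : Mod ω n) (U : Opens (space ω n))
    (t : secF F (RRep.koszul W 0) U)
    (x : space ω n) (hx : x ∈ U) (hne : x ≠ W) : ∃ (U' : Opens (space ω n)) (hU : U' ≤ U), x ∈ U' ∧
      ∃ s, tw.mapSec (BMap.koszul w 0) U' s = secF.res hU t := by
  obtain ⟨U', hU, hxU', φ, l, r, hr⟩ := exists_tautSec_unit w hfr hx hne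
  exact ⟨U', hU, hxU', exists_contract_eq_zero φ _ l r hr⟩

variable {F : Mod ω n}

lemma subsingleton_H_koszul_image (hfr : HasFrames W)
    (hT : ∀ p q, p + 1 ≤ q → Subsingleton (coh F (RRep.koszul W (p + 1)) q)) :
    Subsingleton (Sheaf.H.{u} (Abelian.image (tw.map F (BMap.koszul w 0))) 1) := by
  refine subsingleton_H_of_exact_off (isClosed_point hfr) (fun p => ab (tw F (RRep.koszul W p)))
    (fun p => tw.map F (BMap.koszul w p))
    (fun p => tw.map_zero_of_comp _ _ (BMap.koszul_koszul w p))
    (fun p U t ht x hx hne => koszul_exact_off w hfr F p U t ht x hx hne)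
    -- Above the rank of Q^n the exterior powers vanish and the descending induction starts.
    (N := Module.finrank ℂ (RRep.qPow W n) + 1) (fun p hp => ?_) hT
    (Module.finrank ℂ (RRep.qPow W n) + 1) 0 (by omega) _ (Abelian.factorThruImage _)
    (Abelian.image.ι _) inferInstance inferInstance (Abelian.image.fac _) 1 le_rfl
  rw [Limits.IsZero.iff_id_eq_zero]
  refine Sheaf.hom_ext_apply fun U s => ?_
  have := subsingleton_secF_of_lt (F := F) (B := RRep.sPow W n) (M := RRep.triv W) (m := 0) hfr
    (show Module.finrank ℂ (RRep.qPow W n) < p from hp) U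
  exact @Subsingleton.elim _ this _ _

/-- The cokernel of the last differential is supported at W, hence flasque, so the class of t over U
extends to a global section of it; that one lifts, since the image has no H^1. Near W the difference
then lifts to the preceding term. -/
lemma exists_global_koszul (hfr : HasFrames W)
    (hT : ∀ p q, p + 1 ≤ q → Subsingleton (coh F (RRep.koszul W (p + 1)) q))
    {U : Opens (space ω n)} (hW : W ∈ U) (t : secF F (RRep.koszul W 0) U) :
    ∃ (s : secF F (RRep.koszul W 0) ⊤) (U' : Opens (space ω n)) (hU : U' ≤ U), W ∈ U' ∧
      ∃ y, tw.mapSec (BMap.koszul w 0) U' y = secF.res hU t - secF.res le_top s := by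
  let d := tw.map F (BMap.koszul w 0)
  let m := Abelian.image.ι d
  let π := Limits.cokernel.π m
  let S := ShortComplex.mk m π (Limits.cokernel.condition m)
  have hS : S.ShortExact := { exact := ShortComplex.exact_cokernel m }
  have hsurj := sections_top_surjective π
    (H_surjective hS 0 (subsingleton_H_koszul_image w hfr hT))
  have hfac (O : Opens (space ω n)) (y : secF F (RRep.koszul W 1) O) :
      m.hom.app (op O) ((Abelian.factorThruImage d).hom.app (op O) y) =
        tw.mapSec (BMap.koszul w 0) O y :=
    congrArg (fun g : ab (tw F (RRep.koszul W 1)) ⟶ ab (tw F (RRep.koszul W 0)) =>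
      g.hom.app (op O) y) (Abelian.image.fac d)
  have hsupp : SupportedAt (W : space ω n) (Limits.cokernel m) :=
    SupportedAt.cokernel m fun O t x hx hne => by
      obtain ⟨O', hO, hxO, y, hy⟩ := koszul_surjective_off w hfr F O t x hx hne
      exact ⟨O', hO, hxO, _, (hfac O' y).trans hy⟩
  have hfl := hsupp.isFlasque (isClosed_point hfr)
  obtain ⟨z, hz⟩ := (AddCommGrpCat.epi_iff_surjective _).1
    (hfl.epi (homOfLE (le_top : U ≤ ⊤)).op) (π.hom.app (op U) t)
  obtain ⟨s, hs⟩ := hsurj z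
  have h0 : π.hom.app (op U) (t - secF.res le_top s) = 0 := by
    refine (map_sub (π.hom.app (op U)).hom t (secF.res le_top s)).trans ?_
    refine sub_eq_zero.2 (hz.symm.trans ?_)
    rw [← hs]
    exact (ConcreteCategory.congr_hom (π.hom.naturality (homOfLE (le_top : U ≤ ⊤)).op) s).symm
  obtain ⟨b, hb⟩ := TopCat.Sheaf.sections_exact_of_left_exact (U := U) hS.exact hS.mono_f _ h0
  obtain ⟨U', hU, hWU', y, hy⟩ := Sheaf.locally_of_epi (Abelian.factorThruImage d) U b W hW
  refine ⟨s, U', hU, hWU', y, (hfac U' y).symm.trans ((congrArg _ hy).trans ?_)⟩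
  refine (ConcreteCategory.congr_hom (m.hom.naturality (homOfLE hU).op) b).trans ?_
  exact congrArg (secF.res hU) hb

end tautological
end LagGrass

end

/-! ### Epimorphisms from free sheaves and local spans -/

noncomputable section
namespace LagGrass

section generating
universe v' u'
variable {C : Type u'} [Category.{v'} C] {J : GrothendieckTopology C} {R : Sheaf J RingCat.{u}}
  [HasWeakSheafify J AddCommGrpCat.{u}] [J.WEqualsLocallyBijective AddCommGrpCat.{u}]
  {M : SheafOfModules.{u} R}

/-- The submodule spanned by global sections. -/
def sectionsSpan {I : Type u} (s : I → M.sections) (X : Cᵒᵖ) : Submodule (R.obj.obj X) (M.val.obj X) :=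
  Submodule.span _ (Set.range fun i => (s i).1 X)

lemma map_mem_sectionsSpan {I : Type u} (s : I → M.sections) {X Y : Cᵒᵖ} (f : X ⟶ Y) {t : M.val.obj X}
    (ht : t ∈ sectionsSpan s X) : M.val.presheaf.map f t ∈ sectionsSpan s Y := by
  induction ht using Submodule.span_induction with
  | mem x hx =>
    obtain ⟨i, rfl⟩ := hx
    exact Submodule.subset_span ⟨i, ((s i).2 f).symm⟩
  | zero => exact (map_zero (M.val.presheaf.map f).hom).symm ▸ zero_mem _
  | add x y _ _ hx hy => exact (map_add (M.val.presheaf.map f).hom x y).symm ▸ add_mem hx hy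
  | smul r x _ hx =>
    exact (PresheafOfModules.map_smul M.val f r x).symm ▸ Submodule.smul_mem _ _ hx

/-- The quotient by the submodules spanned by global sections, as a presheaf of groups. -/
def spanQuotientAb {I : Type u} (s : I → M.sections) : Cᵒᵖ ⥤ Ab.{u} where
  obj X := AddCommGrpCat.of (M.val.obj X ⧸ sectionsSpan s X)
  map {X Y} f := AddCommGrpCat.ofHom (QuotientAddGroup.map (sectionsSpan s X).toAddSubgroup
    (sectionsSpan s Y).toAddSubgroup (M.val.presheaf.map f).hom fun _ h => map_mem_sectionsSpan s f h)
  map_id X := by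
    ext x
    obtain ⟨x, rfl⟩ := QuotientAddGroup.mk_surjective x
    exact congrArg (QuotientAddGroup.mk (s := (sectionsSpan s X).toAddSubgroup))
      (ConcreteCategory.congr_hom (M.val.presheaf.map_id X) x)
  map_comp {X Y Z} f g := by
    ext x
    obtain ⟨x, rfl⟩ := QuotientAddGroup.mk_surjective x
    exact congrArg (QuotientAddGroup.mk (s := (sectionsSpan s Z).toAddSubgroup))
      (ConcreteCategory.congr_hom (M.val.presheaf.map_comp f g) x)

instance {I : Type u} (s : I → M.sections) (X : Cᵒᵖ) :
    Module (R.obj.obj X) ((spanQuotientAb s).obj X) :=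
  inferInstanceAs (Module (R.obj.obj X) (M.val.obj X ⧸ sectionsSpan s X))

/-- The quotient by the submodules spanned by global sections. -/
def spanQuotient {I : Type u} (s : I → M.sections) : PresheafOfModules R.obj :=
  PresheafOfModules.ofPresheaf (spanQuotientAb s) fun {X Y} f r x => by
    obtain ⟨x, rfl⟩ := QuotientAddGroup.mk_surjective x
    exact congrArg (QuotientAddGroup.mk (s := (sectionsSpan s Y).toAddSubgroup))
      (PresheafOfModules.map_smul M.val f r x)

/-- The projection to the quotient. -/
def spanQuotientMk {I : Type u} (s : I → M.sections) : M.val ⟶ spanQuotient s :=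
  PresheafOfModules.homMk
    { app := fun X => AddCommGrpCat.ofHom (QuotientAddGroup.mk' (sectionsSpan s X).toAddSubgroup)
      naturality := fun _ _ _ => rfl } fun _ _ _ => rfl

/-- The map from M to the sheafified quotient by the spans kills the generators, hence is zero
because they define an epimorphism. A section that dies in the sheafification dies locally in the
quotient presheaf. -/
lemma GeneratingSections.locally_mem_span (σ : M.GeneratingSections) (X : C) (t : M.val.obj (op X)) :
    ∃ S ∈ J X, ∀ ⦃Y : C⦄ (f : Y ⟶ X), S f →
      M.val.presheaf.map f.op t ∈ sectionsSpan σ.s (op Y) := by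
  let Q := spanQuotient σ.s
  let a := (PresheafOfModules.sheafification (𝟙 R.obj)).obj Q
  let η : Q ⟶ a.val := PresheafOfModules.sheafificationHomEquiv (𝟙 R.obj) (𝟙 a)
  let g : M ⟶ a := ⟨spanQuotientMk σ.s ≫ η⟩
  have hη : (PresheafOfModules.toPresheaf R.obj).map η = toSheafify J Q.presheaf := by
    refine (PresheafOfModules.toPresheaf_map_sheafificationHomEquiv_def (𝟙 R.obj) (𝟙 a)).trans ?_
    exact Category.comp_id _
  have hg : g = 0 := by
    rw [← cancel_epi σ.π, SheafOfModules.freeHomEquiv_symm_comp, Limits.comp_zero]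
    refine (Equiv.symm_apply_eq _).2 (funext fun i => ?_)
    refine Subtype.ext (funext fun Y => ?_)
    have h0 : (spanQuotientMk σ.s).app Y ((σ.s i).1 Y) = 0 :=
      (QuotientAddGroup.eq_zero_iff _).2 (Submodule.subset_span ⟨i, rfl⟩)
    refine (congrArg (η.app Y) h0).trans ?_
    exact map_zero (η.app Y).hom
  have h1 : (toSheafify J Q.presheaf).app (op X) ((spanQuotientMk σ.s).app (op X) t) =
      (toSheafify J Q.presheaf).app (op X) 0 := by
    rw [← hη]
    refine Eq.trans ?_ (map_zero (η.app (op X)).hom).symm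
    exact congrArg (fun g : M ⟶ a => g.val.app (op X) t) hg
  refine ⟨_, Presheaf.equalizerSieve_mem J (toSheafify J Q.presheaf) _ _ h1, fun Y f hf => ?_⟩
  have h2 : (Q.presheaf.map f.op) ((spanQuotientMk σ.s).app (op X) t) = (Q.presheaf.map f.op) 0 := hf
  rw [map_zero] at h2
  exact (QuotientAddGroup.eq_zero_iff _).1 h2

lemma epi_of_locally_mem_span {I : Type u} (s : I → M.sections)
    (h : ∀ (X : C) (t : M.val.obj (op X)), ∃ S ∈ J X, ∀ ⦃Y : C⦄ (f : Y ⟶ X), S f →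
      M.val.presheaf.map f.op t ∈ sectionsSpan s (op Y)) : Epi (M.freeHomEquiv.symm s) := by
  refine Preadditive.epi_of_cancel_zero _ fun {N} g hg => ?_
  rw [SheafOfModules.freeHomEquiv_symm_comp, Equiv.symm_apply_eq] at hg
  have h0 : ∀ (X : Cᵒᵖ) (t : M.val.obj X), t ∈ sectionsSpan s X → g.val.app X t = 0 := by
    intro X t ht
    induction ht using Submodule.span_induction with
    | mem x hx =>
      obtain ⟨i, rfl⟩ := hx
      refine (congrFun (congrArg Subtype.val (congrFun hg i)) X).trans ?_
      rfl
    | zero => exact map_zero (g.val.app X).hom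
    | add x y _ _ hx hy => exact (map_add (g.val.app X).hom x y).trans (by rw [hx, hy, add_zero])
    | smul r x _ hx => exact (map_smul (g.val.app X).hom r x).trans (by rw [hx, smul_zero])
  apply SheafOfModules.hom_ext
  ext X t
  obtain ⟨S, hS, hSt⟩ := h X.unop t
  refine N.isSheaf.isSeparated _ S hS _ _ fun Y f hf => ?_
  refine ((PresheafOfModules.naturality_apply g.val f.op t).symm.trans (h0 _ _ (hSt f hf))).trans ?_
  exact (map_zero (N.val.presheaf.map f.op).hom).symm

end generating
end LagGrass

end

/-! ### Generation near a point and Nakayama's lemma -/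

noncomputable section
namespace LagGrass
variable {V : Type u} [AddCommGroup V] [Module ℂ V] {ω : LinearMap.BilinForm ℂ V} {n : ℕ}
variable {F : Mod ω n}

/-- A family of sections generates the sheaf over an open subset. -/
def Generates {ι : Type*} {U : Opens (space ω n)} (t : ι → Sec F U) : Prop :=
  ∀ (O : Opens (space ω n)) (hO : O ≤ U) (z : Sec F O), ∀ x ∈ O, ∃ (O' : Opens (space ω n))
    (h : O' ≤ O), x ∈ O' ∧ Sec.res h z ∈ Submodule.span (regularFunctions O')
      (Set.range fun i => Sec.res (h.trans hO) (t i))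

lemma generates_of_generatingSections {U : Opens (space ω n)} (g : (F.over U).GeneratingSections) :
    Generates (F := F) (U := U) fun j => (g.s j).1 (op (Over.mk (𝟙 U))) := by
  intro O hO z y hy
  obtain ⟨S, hS, hSz⟩ := GeneratingSections.locally_mem_span g (Over.mk (homOfLE hO)) z
  rw [GrothendieckTopology.mem_over_iff] at hS
  obtain ⟨O', f, hf, hyO'⟩ := hS y hy
  refine ⟨O', f.le, hyO', ?_⟩
  have h1 := hSz _ ((Sieve.overEquiv_iff S f).1 hf)
  have h2 : (fun j => (g.s j).1 (op (Over.mk (f ≫ homOfLE hO)))) = fun j =>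
      Sec.res (F := F) (f.le.trans hO) ((g.s j).1 (op (Over.mk (𝟙 (U))))) :=
    funext fun j => ((g.s j).2 (Over.homMk (U := Over.mk (f ≫ homOfLE hO))
      (V := Over.mk (𝟙 (U))) (f ≫ homOfLE hO)).op).symm
  rw [← h2]
  have h3 : ∀ a : (F.over (U)).val.obj (op (Over.mk (f ≫ homOfLE hO))),
      a ∈ sectionsSpan g.s (op (Over.mk (f ≫ homOfLE hO))) →
      (show Sec F O' from a) ∈ Submodule.span (regularFunctions O')
        (Set.range fun j => (show Sec F O' from (g.s j).1 (op (Over.mk (f ≫ homOfLE hO))))) := by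
    intro a ha
    induction ha using Submodule.span_induction with
    | mem a ha =>
      obtain ⟨j, rfl⟩ := ha
      exact Submodule.subset_span ⟨j, rfl⟩
    | zero => exact zero_mem _
    | add a b _ _ ha hb => exact add_mem ha hb
    | smul r a _ ha => exact Submodule.smul_mem _ (show regularFunctions O' from r) ha
  exact h3 _ h1

lemma exists_generates (hF : F.IsFiniteType) (x : space ω n) : ∃ (U : Opens (space ω n)) (_ : x ∈ U)
    (ι : Type u) (_ : Finite ι) (t : ι → Sec F U), Generates t := by
  obtain ⟨σ, hσ⟩ := SheafOfModules.IsFiniteType.exists_localGeneratorsData F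
  obtain ⟨U₀, f₀, h₀, hx₀⟩ := σ.coversTop ⊤ x trivial
  obtain ⟨i, ⟨e⟩⟩ := (Sieve.mem_ofObjects_iff ..).1 h₀
  let g := σ.generators i
  have hfin : Finite g.I := (hσ.isFiniteType i).finite
  refine ⟨σ.X i, e.le hx₀, g.I, hfin, fun j => (g.s j).1 (op (Over.mk (𝟙 (σ.X i)))), generates_of_generatingSections g⟩

/-- A sheaf with a family of global sections that generates it near every point is globally
generated. -/
lemma isGloballyGenerated_of_generates (h : ∀ x : space ω n, ∃ (U : Opens (space ω n)), x ∈ U ∧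
    Generates (fun s : Sec F ⊤ => Sec.res (le_top : U ≤ ⊤) s)) : IsGloballyGenerated F := by
  let sec (s : Sec F ⊤) : F.sections := ⟨fun U => Sec.res (le_top : U.unop ≤ ⊤) s, fun {U U'} f =>
    Sec.res_res _ _ _⟩
  refine ⟨⟨Sec F ⊤, sec, epi_of_locally_mem_span sec fun U (t : Sec F U) => ?_⟩⟩
  have key : ∀ x ∈ U, ∃ (O : Opens (space ω n)) (hO : O ≤ U), x ∈ O ∧
      Sec.res hO t ∈ Submodule.span (regularFunctions O) (Set.range fun s => Sec.res le_top s) := by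
    intro x hx
    obtain ⟨O, hxO, hO⟩ := h x
    obtain ⟨O', h', hxO', hm⟩ := hO (O ⊓ U) inf_le_left (Sec.res inf_le_right t) x ⟨hxO, hx⟩
    rw [Sec.res_res] at hm
    simp only [Sec.res_res] at hm
    exact ⟨O', h'.trans inf_le_right, hxO', hm⟩
  choose! O hO hxO hm using key
  refine ⟨Sieve.generate (Presieve.ofArrows (fun x : U => O x.1) fun x => homOfLE (hO x.1 x.2)),
    fun x hx => ⟨O x, homOfLE (hO x hx),
      ⟨_, 𝟙 _, _, Presieve.ofArrows.mk (⟨x, hx⟩ : U), Category.id_comp _⟩, hxO x hx⟩, ?_⟩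
  rintro Y f ⟨_, g, _, ⟨x⟩, rfl⟩
  have h1 := map_mem_sectionsSpan sec g.op (hm x.1 x.2)
  have h2 := ConcreteCategory.congr_hom (F.val.presheaf.map_comp (homOfLE (hO x.1 x.2)).op g.op) t
  exact h2.symm ▸ h1

section nakayama
variable [FiniteDimensional ℂ V] {U : Opens (space ω n)} {ι : Type u} [Fintype ι]

/-- Nakayama's lemma for a generating family that is congruent to another family modulo functions
that vanish at a point. -/
lemma exists_generates_of_congr {t s : ι → Sec F U} (ht : Generates t) {x : space ω n} (hx : x ∈ U)
    (m : ι → ι → regularFunctions U) (hm : ∀ i j, (m i j).1 ⟨x, hx⟩ = 0)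
    (h : ∀ i, t i - s i = ∑ j, m i j • t j) :
    ∃ (U' : Opens (space ω n)) (hU : U' ≤ U), x ∈ U' ∧ Generates fun i => Sec.res hU (s i) := by
  classical
  -- s = A t, and A is the identity matrix at x. Its determinant is invertible near x, and the
  -- adjugate expresses t through s.
  let A : Matrix ι ι (regularFunctions U) := 1 - Matrix.of m
  have hA : ∀ i, s i = ∑ j, A i j • t j := fun i => by
    have h1 := h i
    simp only [A, Matrix.sub_apply, Matrix.of_apply, sub_smul, Finset.sum_sub_distrib, ← h1,
      Matrix.one_apply, ite_smul, one_smul, zero_smul, Finset.sum_ite_eq, Finset.mem_univ, if_true]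
    abel
  let ev : regularFunctions U →+* ℂ := (Pi.evalRingHom (fun _ : U => ℂ) ⟨x, hx⟩).comp
    (regularFunctions U).subtype
  have hdet : ev A.det ≠ 0 := by
    have : ev.mapMatrix A = 1 := by
      rw [map_sub, map_one, sub_eq_self]
      ext i j
      exact hm i j
    rw [RingHom.map_det, this, Matrix.det_one]
    exact one_ne_zero
  obtain ⟨U', hU, hxU', r, hr⟩ := exists_regular_inverse A.det hx hdet
  obtain ⟨B, hB⟩ : ∃ B : ι → ι → regularFunctions U, ∀ i, A.det • t i = ∑ j, B i j • s j := by
    refine ⟨fun i j => A.adjugate i j, fun i => ?_⟩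
    simp only [hA, Finset.smul_sum, smul_smul]
    rw [Finset.sum_comm]
    simp only [← Finset.sum_smul]
    have h1 : ∀ k, ∑ j, A.adjugate i j * A j k = (A.det • (1 : Matrix ι ι (regularFunctions U))) i k :=
      fun k => by rw [← Matrix.adjugate_mul, Matrix.mul_apply]
    simp only [h1, Matrix.smul_apply, Matrix.one_apply, smul_eq_mul, mul_ite, mul_one, mul_zero,
      ite_smul, zero_smul, Finset.sum_ite_eq, Finset.mem_univ, if_true]
  refine ⟨U', hU, hxU', fun O hO z y hy => ?_⟩
  obtain ⟨O', hO', hyO', hz⟩ := ht O (hO.trans hU) z y hy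
  refine ⟨O', hO', hyO', Submodule.span_le.2 ?_ hz⟩
  rintro _ ⟨i, rfl⟩
  have hle : O' ≤ U' := hO'.trans hO
  have e : Sec.res (hle.trans hU) (t i) =
      rres hle r • ∑ j, rres (hle.trans hU) (B i j) • Sec.res (hle.trans hU) (s j) := by
    have h1 := congrArg (Sec.res (hle.trans hU)) (hB i)
    rw [Sec.res_smul, map_sum] at h1
    rw [← (h1.trans (Finset.sum_congr rfl fun j _ => Sec.res_smul _ _ _)), smul_smul]
    have h2 : rres hle r * rres (hle.trans hU) A.det = 1 := by
      have := congrArg (rres hle) hr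
      rwa [map_mul, map_one] at this
    rw [h2, one_smul]
  refine (congrArg (· ∈ _) e).mpr (Submodule.smul_mem _ _ (sum_mem fun j _ => Submodule.smul_mem _ _ ?_))
  refine Submodule.subset_span ⟨j, Sec.res_res _ _ _⟩

end nakayama
end LagGrass

end

/-! ### Global generation near the base point -/

noncomputable section
namespace LagGrass
open Raw
variable {V : Type u} [AddCommGroup V] [Module ℂ V] {ω : LinearMap.BilinForm ℂ V} {n : ℕ}
variable {F : Mod ω n}

/-- The ideal of the regular functions that vanish at a point. -/
def idealAt {U : Opens (space ω n)} (x : U) : Ideal (regularFunctions U) :=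
  RingHom.ker ((Pi.evalRingHom (fun _ : U => ℂ) x).comp (regularFunctions U).subtype)

lemma mem_idealAt {U : Opens (space ω n)} {x : U} {f : regularFunctions U} :
    f ∈ idealAt x ↔ f.1 x = 0 := Iff.rfl

lemma Generates.res {ι : Type*} {U U' : Opens (space ω n)} {t : ι → Sec F U} (ht : Generates t)
    (h : U' ≤ U) : Generates fun i => Sec.res h (t i) := by
  intro O hO z x hx
  obtain ⟨O', hO', hxO', hz⟩ := ht O (hO.trans h) z x hx
  refine ⟨O', hO', hxO', ?_⟩
  simp only [Sec.res_res]
  exact hz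

lemma Generates.of_range {ι κ : Type*} {U : Opens (space ω n)} {t : ι → Sec F U} {s : κ → Sec F U}
    (ht : Generates t) (h : ∀ i, ∃ k, s k = t i) : Generates s := by
  intro O hO z x hx
  obtain ⟨O', hO', hxO', hz⟩ := ht O hO z x hx
  refine ⟨O', hO', hxO', Submodule.span_mono ?_ hz⟩
  rintro _ ⟨i, rfl⟩
  obtain ⟨k, hk⟩ := h i
  exact ⟨k, congrArg (Sec.res _) hk⟩

/-- After shrinking, every section is a combination of the generators, so a product of a function
vanishing at x and a section has coefficients vanishing at x. -/
lemma Generates.exists_coeff {ι : Type u} [Fintype ι] {U O : Opens (space ω n)} {t : ι → Sec F U}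
    (ht : Generates t) (hO : O ≤ U) {x : space ω n} (hx : x ∈ O) {z : Sec F O}
    (hz : z ∈ idealAt ⟨x, hx⟩ • (⊤ : Submodule (regularFunctions O) (Sec F O))) :
    ∃ (O' : Opens (space ω n)) (h : O' ≤ O) (hx' : x ∈ O') (m : ι → regularFunctions O'),
      (∀ j, (m j).1 ⟨x, hx'⟩ = 0) ∧
        Sec.res h z = ∑ j, m j • Sec.res (h.trans hO) (t j) := by
  induction hz using Submodule.smul_induction_on' with
  | smul r hr y hy =>
    obtain ⟨O', hO', hxO', hy'⟩ := ht O hO y x hx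
    obtain ⟨c, hc⟩ := (Submodule.mem_span_range_iff_exists_fun _).1 hy'
    refine ⟨O', hO', hxO', fun j => rres hO' r * c j, fun j => ?_, ?_⟩
    · have h0 : r.1 ⟨x, hx⟩ = 0 := hr
      change r.1 ⟨x, hx⟩ * (c j).1 ⟨x, hxO'⟩ = 0
      rw [h0, zero_mul]
    · rw [Sec.res_smul, ← hc, Finset.smul_sum]
      exact Finset.sum_congr rfl fun j _ => (mul_smul _ _ _).symm
  | add y _ z _ hy hz =>
    obtain ⟨O₁, h₁, hx₁, m₁, hm₁, e₁⟩ := hy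
    obtain ⟨O₂, h₂, hx₂, m₂, hm₂, e₂⟩ := hz
    refine ⟨O₁ ⊓ O₂, inf_le_left.trans h₁, ⟨hx₁, hx₂⟩,
      fun j => rres inf_le_left (m₁ j) + rres inf_le_right (m₂ j), fun j => ?_, ?_⟩
    · change (m₁ j).1 ⟨x, hx₁⟩ + (m₂ j).1 ⟨x, hx₂⟩ = 0
      rw [hm₁, hm₂, add_zero]
    · have e₁' := congrArg (Sec.res (inf_le_left : O₁ ⊓ O₂ ≤ O₁)) e₁
      have e₂' := congrArg (Sec.res (inf_le_right : O₁ ⊓ O₂ ≤ O₂)) e₂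
      rw [Sec.res_res, map_sum] at e₁' e₂'
      rw [map_add, e₁', e₂', ← Finset.sum_add_distrib]
      refine Finset.sum_congr rfl fun j _ => ?_
      rw [Sec.res_smul, Sec.res_smul, Sec.res_res, Sec.res_res, add_smul]

variable [FiniteDimensional ℂ V] {W : LagGrass ω n}

/-- A map of twists that vanishes at a point. -/
lemma mapSec_mem_ideal_smul {M M' : RRep W} (a : BMap M M') {U : Opens (space ω n)} (φ : Frame W U)
    (x : U) (h : a.1 (φ.g x) = 0) (y : secF F M U) :
    tw.mapSec a U y ∈ idealAt x • (⊤ : Submodule (regularFunctions U) (secF F M' U)) := by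
  classical
  let v := y.1 U le_rfl φ
  let z (i : Fin (Module.finrank ℂ M')) (j : Fin (Module.finrank ℂ M)) : secF F M' U :=
    secF.ofFrame φ (Pi.single i (v j))
  have e : tw.mapSec a U y = ∑ i, ∑ j, (a.fam φ).mat i j • z i j := by
    refine secF.eq_of_frame φ (funext fun k => ?_)
    let E : secF F M' U →+ Sec F U :=
      (Pi.evalAddMonoidHom (fun _ => Sec F U) k).comp (secF.frameEquiv φ).toAddMonoidHom
    have hE (i j) : E ((a.fam φ).mat i j • z i j) =
        (a.fam φ).mat i j • (Pi.single i (v j) : VSec F M' U) k :=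
      congrArg (fun s : VSec F M' U => (a.fam φ).mat i j • s k) (secF.ofFrame_val φ _)
    change ∑ j, (a.fam φ).mat k j • v j = E (∑ i, ∑ j, (a.fam φ).mat i j • z i j)
    simp only [map_sum, hE]
    rw [Finset.sum_eq_single k]
    · simp only [Pi.single_eq_same]
    · exact fun i _ hi => Finset.sum_eq_zero fun j _ => by
        rw [Pi.single_eq_of_ne hi.symm, smul_zero]
    · exact fun h => absurd (Finset.mem_univ k) h
  rw [e]
  refine sum_mem fun i _ => sum_mem fun j _ => Submodule.smul_mem_smul (mem_idealAt.2 ?_) trivial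
  change (Module.finBasis ℂ M').coord i (a.1 (φ.g x) _) = 0
  rw [h, LinearMap.zero_apply, map_zero]

/-- Sections of a twist by a map of representations, as a linear map. -/
def tw.mapSecₗ {M M' : RRep W} (a : BMap M M') (U : Opens (space ω n)) :
    secF F M U →ₗ[regularFunctions U] secF F M' U :=
  { tw.mapSec a U with map_smul' := fun r s => secF.ext_frame fun _ _ _ => RHom.act_smul _ _ _ }

/-- The Koszul term of degree zero is the twist by zero-forms with trivial values, i.e. F itself. A
surjection linear over the regular functions is all that is used. -/
lemma exists_koszul_augmentation (hfr : HasFrames W) (F : Mod ω n) :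
    ∃ χ : ∀ U, secF F (RRep.koszul W 0) U →ₗ[regularFunctions U] Sec F U,
      (∀ U U' (h : U' ≤ U) s, χ U' (secF.res h s) = Sec.res h (χ U s)) ∧
      ∀ U, Function.Surjective (χ U) := by
  obtain ⟨e⟩ := tw_triv hfr F
  let ev := BMap.evalNil (RRep.qPow W n) (RRep.sPow W n) (RRep.triv W)
  let einv (U : Opens (space ω n)) : secF F (RRep.triv W) U →ₗ[regularFunctions U] Sec F U :=
    (e.inv.val.app (op U)).hom
  refine ⟨fun U => einv U ∘ₗ tw.mapSecₗ ev U, fun U U' h s => ?_, fun U t => ?_⟩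
  · exact PresheafOfModules.naturality_apply e.inv.val (homOfLE h).op
      (show (tw F (RRep.triv W)).val.obj (op U) from tw.mapSec ev U s)
  · let t' : secF F (RRep.triv W) U := e.hom.val.app (op U) t
    refine ⟨tw.mapSec (BMap.mkNil _ _ _) U t', ?_⟩
    have h1 : tw.mapSec ev U (tw.mapSec (BMap.mkNil _ _ _) U t') = t' := by
      rw [← tw.mapSec_comp, BMap.evalNil_mkNil, tw.mapSec_id]
    refine (congrArg (einv U) h1).trans ?_
    exact congrArg (fun g : F ⟶ F => g.val.app (op U) t) e.hom_inv_id

/-- Global generation near the base point of the Koszul complex. -/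
theorem exists_generates_global (hfr : HasFrames W) (hF : F.IsFiniteType)
    (hT : ∀ p q, p + 1 ≤ q → Subsingleton (coh F (RRep.koszul W (p + 1)) q)) :
    ∃ U : Opens (space ω n), (W : space ω n) ∈ U ∧
      Generates (fun s : Sec F ⊤ => Sec.res (le_top : U ≤ ⊤) s) := by
  obtain ⟨w⟩ := exists_basis W
  obtain ⟨U, hWU, ι, hι, t, ht⟩ := exists_generates hF W
  have := Fintype.ofFinite ι
  obtain ⟨O, hWO, ⟨φ⟩⟩ := hfr W
  obtain ⟨χ, hχ, hsurj⟩ := exists_koszul_augmentation hfr F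
  have key : ∀ i, ∃ (s : Sec F ⊤) (O' : Opens (space ω n)) (h : O' ≤ U) (hx : (W : space ω n) ∈ O')
      (m : ι → regularFunctions O'), (∀ j, (m j).1 ⟨W, hx⟩ = 0) ∧
        Sec.res h (t i) - Sec.res le_top s = ∑ j, m j • Sec.res h (t j) := by
    intro i
    obtain ⟨T, hT'⟩ := hsurj U (t i)
    obtain ⟨s, U', hU', hWU', y, hy⟩ := exists_global_koszul w hfr hT hWU T
    -- The differential is contraction with the tautological section, which vanishes at W; so its
    -- matrix in a frame has entries in the ideal of W.
    have h0 : (BMap.koszul w 0).1 ((φ.res inf_le_right : Frame W (U' ⊓ O)).g ⟨W, ⟨hWU', hWO⟩⟩) = 0 := by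
      refine LinearMap.ext fun f => ?_
      refine (congrArg (curryA (RRep.qPow W n) (RRep.sPow W n) (RRep.triv W) 0 0 f)
        ((tautSec_eq_zero_iff w _ _).2 rfl)).trans ?_
      exact map_zero _
    have h1 := mapSec_mem_ideal_smul (BMap.koszul w 0) (φ.res inf_le_right) ⟨W, ⟨hWU', hWO⟩⟩ h0
      (secF.res inf_le_left y)
    have h2 := Submodule.mem_map_of_mem (f := χ (U' ⊓ O)) h1
    rw [Submodule.map_smul''] at h2
    obtain ⟨O', hO', hWO', m, hm, e⟩ := ht.exists_coeff (inf_le_left.trans hU') _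
      (Submodule.smul_mono le_rfl le_top h2)
    refine ⟨χ ⊤ s, O', hO'.trans (inf_le_left.trans hU'), hWO', m, hm, Eq.trans ?_ e⟩
    have h3 : tw.mapSec (BMap.koszul w 0) (U' ⊓ O) (secF.res inf_le_left y) =
        secF.res (inf_le_left.trans hU') T - secF.res le_top s := by
      refine (congrArg (secF.res (inf_le_left : U' ⊓ O ≤ U')) hy).trans ?_
      exact map_sub _ _ _
    rw [h3, map_sub, hχ, hχ, map_sub, Sec.res_res, Sec.res_res, hT']
  choose s O' hO' hWO' m hm e using key
  -- There are finitely many generators, so their neighbourhoods have an open intersection.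
  let N : Opens (space ω n) := ⟨⋂ i, O' i, isOpen_iInter_of_finite fun i => (O' i).2⟩ ⊓ U
  have hN : ∀ i, N ≤ O' i := fun i => inf_le_left.trans (Set.iInter_subset (fun i => (O' i : Set (space ω n))) i)
  have hWN : (W : space ω n) ∈ N := ⟨Set.mem_iInter.2 hWO', hWU⟩
  obtain ⟨U', hU', hWU', hg⟩ := exists_generates_of_congr (ht.res (inf_le_right : N ≤ U))
    (s := fun i => Sec.res le_top (s i)) hWN (fun i j => rres (hN i) (m i j)) (fun i j => hm i j)
    fun i => by
      have h1 := congrArg (Sec.res (hN i)) (e i)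
      rw [map_sub, map_sum, Sec.res_res, Sec.res_res] at h1
      refine h1.trans (Finset.sum_congr rfl fun j _ => ?_)
      rw [Sec.res_smul, Sec.res_res]
  exact ⟨U', hWU', hg.of_range fun i => ⟨s i, (Sec.res_res _ _ _).symm⟩⟩

end LagGrass

end

theorem mainTheorem7 {V : Type u} [AddCommGroup V] [Module ℂ V] [FiniteDimensional ℂ V] (n : ℕ)
    (hV : Module.finrank ℂ V = 2 * n) (ω : LinearMap.BilinForm ℂ V) (hω : ω.IsAlt)
    (hnd : ω.Nondegenerate) (F : LagGrass.Mod ω n) (hF : LagGrass.IsCoherent F)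
    (hvan : ∀ (i : Fin n → ℕ) (q : ℕ),
      ((∑ k, i k ≤ q ∧ 0 < ∑ k, i k) ∨ (∑ k, i k < q ∧ ∑ k, i k = 0)) →
        Subsingleton (LagGrass.H q (LagGrass.twist i F))) :
    LagGrass.IsGloballyGenerated F := by
  refine LagGrass.isGloballyGenerated_of_generates fun W => ?_
  have hfr := LagGrass.hasFrames hV hω hnd W
  refine LagGrass.exists_generates_global hfr hF.1 fun p q hq => ?_
  -- q ≥ p + 1 is positive, and the shifted form of the vanishing asks only for p ≤ q'.
  obtain ⟨q, rfl⟩ : ∃ q', q = q' + 1 := ⟨q - 1, by omega⟩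
  exact LagGrass.hcoh_qPow hfr (LagGrass.DualPair.symplectic hV hnd W)
    (LagGrass.hcoh_of_twist hfr F hvan) p q (by omega)
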